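/- Units: $c=\mathcal G=1$, $\kappa=8\pi$. Let $0<\sigma<1$, $0<r_{min}<r_{max}$, $t_0<t_{end}$. **Fluid.** A perfect fluid with energy density $\rho>0$, pressure $p=\sigma\rho$ and velocity $|v|<1$ has the state $u=(u^0,u^1)=(T^{00}_M,T^{01}_M)$ with $$T^{00}_M=\frac{1+\sigma v^2}{1-v^2}\rho,\quad T^{01}_M=\frac{(1+\sigma)v}{1-v^2}\rho,\quad T^{11}_M=\frac{v^2+\sigma}{1-v^2}\rho .$$ States of this form are called physical; they determine $\rho$, $v$ and $T^{11}_M$. Write $\mathbf A=(A,B)$ for the metric $ds^2=-B\,dt^2+A^{-1}dr^2+r^2d\Omega^2$, with $T^{00}=T^{00}_M/B$, $T^{01}=\sqrt{A/B}\,T^{01}_M$, $T^{11}=A\,T^{11}_M$, $T^{22}=\sigma\rho/r^2$. Put $f(\mathbf A,u)=\sqrt{AB}\,(T^{01}_M,T^{11}_M)$, $$g^0=-\tfrac2x\sqrt{AB}\,T^{01}_M,\qquad g^1=-\tfrac12\sqrt{AB}\Big\{\tfrac4xT^{11}_M+\tfrac{1/A-1}{x}(T^{00}_M-T^{11}_M)+\tfrac{2\kappa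 x}{A}\big(T^{00}_MT^{11}_M-(T^{01}_M)^2\big)-4xT^{22}\Big\},$$ $$h^0=\tfrac{1-A}{x}-\kappa xT^{00}_M,\qquad h^1=\tfrac BA\Big\{\tfrac{1-A}{x}+\kappa xT^{11}_M\Big\},\qquad G=g-h\cdot\nabla_{\mathbf A}f .$$ **The method.** Let $n\ge2$, $\Delta x=(r_{max}-r_{min})/(n-1)$, $x_i=r_{min}+(i-1)\Delta x$, $x_{i\pm}=x_i\pm\Delta x/2$. Given are boundary data $M_{r_{min}}(t)$, $B_{r_{min}}(t)$, Lipschitz on $[t_0,t_{end}]$, initial profiles $u_0$ and $\mathbf A_0=(A_0,B_0)$ on $[r_{min},r_{max}]$ with $\mathbf A_0$ Lipschitz, and ghost data $u_{0,j}$, $u_{n+1,j}$, $\mathbf A_{n+1,j}$, $\mathbf A_{1,0}$. The method produces times $t_j$, states $u_{ij}$ on $[x_{i-},x_{i+})$ and metric values $\mathbf A_{ij}$ on the Riemann cells $R_{ij}=[x_{i-1},x_i)\times[t_j,t_{j+1})$, $1\le i\le n+1$, as follows. * $u_{i0}=u_0(x_i)$ for $1\le i\le n$, and $\mathbf A_{i0}=\mathbf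 A_0(x_{i-})$ for $2\le i\le n$. * $t_{j+1}=t_j+\Delta t_j$ with $\Delta t_j=\min_{1\le i\le n+1}\Delta x/(2\sqrt{A_{ij}B_{ij}})$. * $u^{RP}_{ij}$ is the solution in $R_{ij}$ of the Riemann problem for $u_t+f(\mathbf A_{ij},u)_x=0$ with the states $u_{i-1,j}$ and $u_{ij}$ to the left and right of $x_{i-}$: a 1-wave followed by a 2-wave, each a rarefaction wave or a Lax-admissible shock. Let $u^*_{ij}$ be its zero-speed state. Let $\hat u(\tau,u_*)=\hat u(\tau,u_*;\mathbf A,x)$ solve $\hat u_\tau=G(\mathbf A,\hat u,x)$, $\hat u(0)=u_*$. * On $R_{ij}$: $u_{\Delta x}(t,x)=\hat u\big(t-t_j,u^{RP}_{ij}(t,x);\mathbf A_{ij},x\big)$ and $\mathbf A_{\Delta x}=\mathbf A_{ij}$. * For $1\le i\le n$, $\bar u_{ij}$ is the mean of $u_{ij}-\frac{2\Delta t_j}{\Delta x}\{f(\mathbf A_{ij},u_{ij})-f(\mathbf A_{ij},u^*_{ij})\}$ and $u_{ij}-\frac{2\Delta t_j}{\Delta x}\{f(\mathbf A_{i+1,j},u^*_{i+1,j})-f(\mathbf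 A_{i+1,j},u_{ij})\}$, and $u_{i,j+1}=\bar u_{ij}+\Delta t_j\,G\big(\bar{\mathbf A},\hat u(\xi-t_j,\bar u_{ij};\bar{\mathbf A},x_i),x_i\big)$ with $\bar{\mathbf A}=\frac12(\mathbf A_{ij}+\mathbf A_{i+1,j})$ and some $\xi\in[t_j,t_{j+1}]$. * For $1\le i\le n$, with all quantities at level $j+1$ and $\tilde u_k=\frac12(u_{k-1}+u_k)$: $A_i=1-2M_i/x_{i-}$, $M_i=M_{r_{min}}(t_{j+1})+\sum_{1\le k<i}\frac\kappa2\tilde u^0_kx_{k-}^2\Delta x$, and $B_i=B_{r_{min}}(t_{j+1})\exp\sum_{1\le k<i}\big\{\frac{1/A_k-1}{x_{k-}}+\frac{\kappa x_{k-}}{A_k}T^{11}_M(\tilde u_k)\big\}\Delta x$. **Theorem.** Let $(u_{\Delta x},\mathbf A_{\Delta x})$ be approximate solutions generated in this way for a sequence of meshes with $\Delta x\to0$, with the same boundary data and initial profiles. Assume: 1. they exist up to $t_{end}$, with bounds independent of $\Delta x$: for all $t_j<t_{end}$ the states $u_{ij}$ ($0\le i\le n+1$) lie in one fixed compact set of physical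 states, and $C^{-1}\le A_{ij},B_{ij}\le C$ ($1\le i\le n+1$) with one constant $C>0$; 2. $u_{\Delta x}\to u$ and $\mathbf A_{\Delta x}\to\mathbf A$ almost everywhere on $[t_0,t_{end}]\times[r_{min},r_{max}]$, and $u_{\Delta x}(t_0,\cdot)\to u_0$ almost everywhere on $[r_{min},r_{max}]$; 3. there is a constant $V$, independent of $j$ and $\Delta x$, with $T.V._{[r_{min},r_{max}]}\{u_{\Delta x}(t_j,\cdot)\}<V$ for all $t_j<t_{end}$. Then, after a change of $\mathbf A$ on a null set, $A$ and $B$ are positive and Lipschitz on $[t_0,t_{end}]\times[r_{min},r_{max}]$, $u$ is measurable, essentially bounded and almost everywhere physical, and: (i) $(u,\mathbf A)$ is a weak solution of $u_t+f(\mathbf A,u)_x=g(\mathbf A,u,x)$, $\mathbf A'=h(\mathbf A,u,x)$ with $u(t_0,\cdot)=u_0$: the second equation holds almost everywhere, and for all $\varphi\in C_c^\infty(\mathbb R^2)$ with support in $\{t<t_{end}\}$ $$\int_{t_0}^{t_{end}}\!\!\int_{r_{min}}^{r_{max}}\{u\varphi_t+f\varphi_x+g\varphi\}\,dx\,dt+\int_{r_{min}}^{r_{max}}u_0\,\varphi(t_0,\cdot)\,dx+\int_{t_0}^{t_{end}}f\varphi\,dt\Big|_{x=r_{min}^+}-\int_{t_0}^{t_{end}}f\varphi\,dt\Big|_{x=r_{max}^-}=0,$$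 where the difference of the two boundary integrals is the limit as $\delta\downarrow0$ of the difference of the corresponding means over boundary layers of width $\delta$. (ii) If, moreover, the boundary mass evolves by the Einstein equations, that is, $\dot M_{r_{min}}=-\frac\kappa2r^2\sqrt{AB}\,T^{01}_M$ at $r=r_{min}$ (integrated over any time interval in $[t_0,t_{end}]$, the boundary flux being the limit of its means over layers of width $\delta\downarrow0$), then $(u,\mathbf A)$ is a weak solution of the Einstein equations $G_{ij}=\kappa T_{ij}$: almost everywhere $$\frac{AB}{r^2}\Big\{-r\frac{A'}{A}+\frac1A-1\Big\}=\kappa B^2T^{00},\qquad\frac{\dot A}{rA}=\kappa\frac BAT^{01},\qquad\frac1{r^2}\Big\{r\frac{B'}{B}-\Big(\frac1A-1\Big)\Big\}=\frac{\kappa}{A^2}T^{11},$$ and in the sense of distributions on $(t_0,t_{end})\times(r_{min},r_{max})$ $$\frac{A^2}{rB}\Big\{\frac{\ddot A}{A^2}+B''-\Phi\Big\}=2\kappa rA\,T^{22},$$ $$\Phi=\frac{2\dot A^2}{A^3}+\frac{\dot A\dot B}{2A^2B}-\frac1{2A}\Big(\frac{\dot A}{A}\Big)^2-\frac{B'}{r}-\frac{BA'}{rA}+\frac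 B2\Big(\frac{B'}{B}\Big)^2-\frac B2\frac{B'}{B}\frac{A'}{A}.$$ -/

import Mathlib

open MeasureTheory Filter Topology Set
open scoped ContDiff

noncomputable section

namespace LocallyInertial

/-! ### Fluid states

Units are chosen so that the speed of light and Newton's constant are `1`; the equation of state is
`p = σ ρ`.  A state is the pair `u = (u.1, u.2)` of Minkowski energy and momentum densities
`(T⁰⁰_M, T⁰¹_M)`. -/

/-- Einstein's coupling constant `κ = 8πG/c⁴` in units `G = c = 1`. -/
def kappa : ℝ := 8 * Real.pi

/-- The conserved quantities `(T⁰⁰_M, T⁰¹_M)` of a fluid with energy density `ρ`, velocity `v`. -/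
def conserved (σ ρ v : ℝ) : ℝ × ℝ :=
  ((1 + σ * v ^ 2) / (1 - v ^ 2) * ρ, (1 + σ) * v / (1 - v ^ 2) * ρ)

/-- The physical states: those with `ρ > 0` and `|v| < 1`. -/
def physical (σ : ℝ) : Set (ℝ × ℝ) :=
  {u | ∃ ρ v : ℝ, 0 < ρ ∧ |v| < 1 ∧ u = conserved σ ρ v}

/-- The fluid velocity as a function of the conserved quantities (written without a division by
`u.2`, so that it is also correct for a fluid at rest). -/
def vel (σ : ℝ) (u : ℝ × ℝ) : ℝ :=
  2 * u.2 / ((1 + σ) * u.1 + Real.sqrt ((1 + σ) ^ 2 * u.1 ^ 2 - 4 * σ * u.2 ^ 2))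

/-- The energy density as a function of the conserved quantities. -/
def dens (σ : ℝ) (u : ℝ × ℝ) : ℝ :=
  u.1 * (1 - vel σ u ^ 2) / (1 + σ * vel σ u ^ 2)

theorem vel_conserved {σ ρ v : ℝ} (hσ : 0 < σ) (hσ1 : σ < 1) (hρ : 0 < ρ) (hv : |v| < 1) :
    vel σ (conserved σ ρ v) = v := by
  have hv2 : v ^ 2 < 1 := (sq_lt_one_iff_abs_lt_one v).2 hv
  have h1 : 0 < 1 - v ^ 2 := by linarith
  have h2 : 0 < 1 - σ * v ^ 2 := by nlinarith [sq_nonneg v]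
  have hs : (1 + σ) ^ 2 * ((1 + σ * v ^ 2) / (1 - v ^ 2) * ρ) ^ 2
      - 4 * σ * ((1 + σ) * v / (1 - v ^ 2) * ρ) ^ 2
      = ((1 + σ) * (1 - σ * v ^ 2) / (1 - v ^ 2) * ρ) ^ 2 := by
    field_simp
    ring
  have hpos : 0 ≤ (1 + σ) * (1 - σ * v ^ 2) / (1 - v ^ 2) * ρ := by positivity
  have hσ' : 1 + σ ≠ 0 := by positivity
  simp only [vel, conserved]
  rw [hs, Real.sqrt_sq hpos]
  field_simp
  ring

theorem dens_conserved {σ ρ v : ℝ} (hσ : 0 < σ) (hσ1 : σ < 1) (hρ : 0 < ρ) (hv : |v| < 1) :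
    dens σ (conserved σ ρ v) = ρ := by
  have hv2 : v ^ 2 < 1 := (sq_lt_one_iff_abs_lt_one v).2 hv
  have h1 : 1 - v ^ 2 ≠ 0 := by linarith
  have h2 : 1 + σ * v ^ 2 ≠ 0 := by positivity
  rw [dens, vel_conserved hσ hσ1 hρ hv]
  simp only [conserved]
  field_simp

/-- The Minkowski radial stress `T¹¹_M`. -/
def stress (σ : ℝ) (u : ℝ × ℝ) : ℝ :=
  (vel σ u ^ 2 + σ) / (1 - vel σ u ^ 2) * dens σ u

/-- The special-relativistic flux `F(u) = (T⁰¹_M, T¹¹_M)`. -/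
def minkFlux (σ : ℝ) (u : ℝ × ℝ) : ℝ × ℝ := (u.2, stress σ u)

/-- The flux `f(A, B, u) = √(AB) (T⁰¹_M, T¹¹_M)`. -/
def flux (σ A B : ℝ) (u : ℝ × ℝ) : ℝ × ℝ := Real.sqrt (A * B) • minkFlux σ u

/-- The component `T²²` of the stress-energy tensor at radius `x`. -/
def stress22 (σ : ℝ) (u : ℝ × ℝ) (x : ℝ) : ℝ := σ * dens σ u / x ^ 2

/-- The source `g(A, B, u, x)` of the balance laws. -/
def source (σ A B : ℝ) (u : ℝ × ℝ) (x : ℝ) : ℝ × ℝ :=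
  (-(2 / x) * Real.sqrt (A * B) * u.2,
   -(1 / 2) * Real.sqrt (A * B) *
    (4 / x * stress σ u + (1 / A - 1) / x * (u.1 - stress σ u)
      + 2 * kappa * x / A * (u.1 * stress σ u - u.2 ^ 2) - 4 * x * stress22 σ u x))

/-- The right-hand side of `A' = h⁰(A, B, u, x)`. -/
def metricRhsA (A : ℝ) (u : ℝ × ℝ) (x : ℝ) : ℝ := (1 - A) / x - kappa * x * u.1

/-- The right-hand side of `B' = h¹(A, B, u, x)`. -/
def metricRhsB (σ A B : ℝ) (u : ℝ × ℝ) (x : ℝ) : ℝ :=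
  B / A * ((1 - A) / x + kappa * x * stress σ u)

/-- The source `G = g - A' · ∇_A f` of the ODE step, with `A' = h`; here `∂f/∂A = f / (2A)` and
`∂f/∂B = f / (2B)`. -/
def odeSource (σ A B : ℝ) (u : ℝ × ℝ) (x : ℝ) : ℝ × ℝ :=
  source σ A B u x
    - (metricRhsA A u x / (2 * A) + metricRhsB σ A B u x / (2 * B)) • flux σ A B u

/-- The closed form of the source of the ODE step in the fluid variables. -/
theorem odeSource_conserved {σ ρ v A B x : ℝ} (hσ : 0 < σ) (hσ1 : σ < 1) (hρ : 0 < ρ)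
    (hv : |v| < 1) (hA : 0 < A) (hB : 0 < B) (hx : 0 < x) :
    odeSource σ A B (conserved σ ρ v) x =
      (-(1 / 2) * Real.sqrt (A * B) * ((1 + σ) / (1 - v ^ 2)) * v * (ρ / x) *
          (2 * (1 / A + 1) - kappa / A * (1 - σ) * ρ * x ^ 2),
       -(1 / 2) * Real.sqrt (A * B) * ((1 + σ) / (1 - v ^ 2)) * (ρ / x) *
          (4 * v ^ 2 + (1 / A - 1) * (1 + v ^ 2) + kappa / A * (σ - v ^ 2) * ρ * x ^ 2)) := by
  have hv2 : v ^ 2 < 1 := (sq_lt_one_iff_abs_lt_one v).2 hv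
  have h1 : 1 - v ^ 2 ≠ 0 := by linarith
  have hA' := hA.ne'
  have hB' := hB.ne'
  have hx' := hx.ne'
  simp only [odeSource, source, metricRhsA, metricRhsB, flux, minkFlux, stress22, stress,
    vel_conserved hσ hσ1 hρ hv, dens_conserved hσ hσ1 hρ hv]
  simp only [conserved, Prod.smul_mk, smul_eq_mul]
  refine Prod.ext ?_ ?_
  · simp only [Prod.fst_sub]
    field_simp
    ring
  · simp only [Prod.snd_sub]
    field_simp
    ring

/-! ### The Riemann problem -/

/-- The characteristic speed `λ₁` in Minkowski spacetime. -/
def charSpeed₁ (σ : ℝ) (u : ℝ × ℝ) : ℝ :=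
  (vel σ u - Real.sqrt σ) / (1 - Real.sqrt σ * vel σ u)

/-- The characteristic speed `λ₂` in Minkowski spacetime. -/
def charSpeed₂ (σ : ℝ) (u : ℝ × ℝ) : ℝ :=
  (vel σ u + Real.sqrt σ) / (1 + Real.sqrt σ * vel σ u)

/-- The Riemann invariant `r`, constant across 2-rarefaction waves. -/
def invariantR (σ : ℝ) (u : ℝ × ℝ) : ℝ :=
  1 / 2 * Real.log ((1 + vel σ u) / (1 - vel σ u))
    - Real.sqrt σ / (1 + σ) * Real.log (dens σ u)

/-- The Riemann invariant `s`, constant across 1-rarefaction waves. -/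
def invariantS (σ : ℝ) (u : ℝ × ℝ) : ℝ :=
  1 / 2 * Real.log ((1 + vel σ u) / (1 - vel σ u))
    + Real.sqrt σ / (1 + σ) * Real.log (dens σ u)

/-- In the self-similar profile `w` (a function of `ξ = x/t`) for `u_t + c F(u)_x = 0`, the interval
`[a, b]` carries an elementary wave from `uL` to `uR` of the family with characteristic speed
`c * lam`: either a shock of speed `a = b` that satisfies the Rankine-Hugoniot relation and the Lax
entropy condition, or a (possibly trivial) rarefaction fan across which `inv` is constant. -/
def IsElementaryWave (σ c : ℝ) (lam inv : ℝ × ℝ → ℝ) (uL uR : ℝ × ℝ) (a b : ℝ)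
    (w : ℝ → ℝ × ℝ) : Prop :=
  (a = b ∧ c • (minkFlux σ uR - minkFlux σ uL) = a • (uR - uL) ∧
      c * lam uR < a ∧ a < c * lam uL ∧ (w a = uL ∨ w a = uR)) ∨
  (a = c * lam uL ∧ b = c * lam uR ∧ a ≤ b ∧ inv uR = inv uL ∧
      ∀ ξ ∈ Icc a b, w ξ ∈ physical σ ∧ c * lam (w ξ) = ξ ∧ inv (w ξ) = inv uL)

/-- `w` is the self-similar profile of the solution `u(t, x) = w(x/t)` of the Riemann problem for
`u_t + c F(u)_x = 0` with left state `uL` and right state `uR`: a 1-wave from `uL` to a middle state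
`uM`, followed by a 2-wave from `uM` to `uR`. -/
def IsRiemannSolution (σ c : ℝ) (uL uR : ℝ × ℝ) (w : ℝ → ℝ × ℝ) : Prop :=
  ∃ (uM : ℝ × ℝ) (a₁ b₁ a₂ b₂ : ℝ), uM ∈ physical σ ∧ b₁ ≤ a₂ ∧
    IsElementaryWave σ c (charSpeed₁ σ) (invariantS σ) uL uM a₁ b₁ w ∧
    IsElementaryWave σ c (charSpeed₂ σ) (invariantR σ) uM uR a₂ b₂ w ∧
    (∀ ξ < a₁, w ξ = uL) ∧ (∀ ξ, b₁ < ξ → ξ < a₂ → w ξ = uM) ∧ (∀ ξ > b₂, w ξ = uR)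

/-- The value of the Riemann solution with profile `w` at elapsed time `τ ≥ 0` and at the signed
distance `y` from the initial discontinuity. -/
def riemannValue (uL uR : ℝ × ℝ) (w : ℝ → ℝ × ℝ) (τ y : ℝ) : ℝ × ℝ :=
  if τ = 0 then (if y < 0 then uL else uR) else w (y / τ)

/-! ### The locally inertial Godunov method -/

/-- `u₁ = û(τ, u₀)`: the solution of `û_t = G(A, B, û, x)`, `û(0) = u₀`, exists as a physical state
on `[0, τ]` and takes the value `u₁` at time `τ`. -/
def IsODEStep (σ A B x τ : ℝ) (u₀ u₁ : ℝ × ℝ) : Prop :=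
  ∃ y : ℝ → ℝ × ℝ, y 0 = u₀ ∧ y τ = u₁ ∧
    ∀ s ∈ Icc 0 τ, y s ∈ physical σ ∧ HasDerivWithinAt y (odeSource σ A B (y s) x) (Icc 0 τ) s

/-- The mesh width `Δx` for `n` gridpoints on `[rmin, rmax]`. -/
def meshWidth (rmin rmax : ℝ) (n : ℕ) : ℝ := (rmax - rmin) / ((n : ℝ) - 1)

/-- The gridpoint `x_i = rmin + (i - 1) Δx`; the ghost points are `i = 0` and `i = n + 1`. -/
def gridPoint (rmin rmax : ℝ) (n i : ℕ) : ℝ := rmin + ((i : ℝ) - 1) * meshWidth rmin rmax n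

/-- The half gridpoint `x_{i-} = x_i - Δx/2`. -/
def halfPoint (rmin rmax : ℝ) (n i : ℕ) : ℝ :=
  gridPoint rmin rmax n i - meshWidth rmin rmax n / 2

/-- The time step `min_i Δx / (2 √(A_i B_i))` over the Riemann cells `i = 1, …, n + 1`. -/
def timeStep (Δx : ℝ) (n : ℕ) (A B : ℕ → ℝ) : ℝ :=
  (Finset.Icc 1 (n + 1)).inf' ⟨1, by simp⟩ fun i => Δx / (2 * Real.sqrt (A i * B i))

/-- The Godunov step on a cell with centre state `uC`: the mean of the averages over its left half,
with metric `(A, B)` and zero-speed state `uStarL`, and over its right half, with metric `(A', B')`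
and zero-speed state `uStarR`. -/
def godunovAverage (σ Δt Δx A B A' B' : ℝ) (uStarL uC uStarR : ℝ × ℝ) : ℝ × ℝ :=
  (1 / 2 : ℝ) •
    ((uC - (2 * Δt / Δx) • (flux σ A B uC - flux σ A B uStarL)) +
     (uC - (2 * Δt / Δx) • (flux σ A' B' uStarR - flux σ A' B' uC)))

/-- The average of the states on both sides of `x_{k-}`. -/
def midState (u : ℕ → ℝ × ℝ) (k : ℕ) : ℝ × ℝ := (1 / 2 : ℝ) • (u (k - 1) + u k)

/-- The discrete mass `M_i = M_{rmin} + ∑_{k<i} (κ/2) u⁰(x_{k-}) x_{k-}² Δx`. -/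
def discreteMass (rmin rmax : ℝ) (n : ℕ) (M : ℝ) (u : ℕ → ℝ × ℝ) (i : ℕ) : ℝ :=
  M + ∑ k ∈ Finset.Ico 1 i,
    kappa / 2 * ((midState u k).1 * halfPoint rmin rmax n k ^ 2 * meshWidth rmin rmax n)

/-- The exponent `τ` in the update `B_i = B_{rmin} e^τ`. -/
def discreteExponent (σ rmin rmax : ℝ) (n : ℕ) (u : ℕ → ℝ × ℝ) (A : ℕ → ℝ) (i : ℕ) : ℝ :=
  ∑ k ∈ Finset.Ico 1 i,
    (((A k)⁻¹ - 1) / halfPoint rmin rmax n k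
      + kappa * halfPoint rmin rmax n k / A k * stress σ (midState u k)) * meshWidth rmin rmax n

/-- An approximate solution generated on `[t0, tend)` by the locally inertial Godunov method with
`n` gridpoints.  The parameters are: the mass `Mb t` and the metric coefficient `Bb t` imposed at
`r = rmin` at time `t`, and the initial profiles `u₀`, `A₀`, `B₀` on `[rmin, rmax]`.  The first
index of `u`, `A`, `B`, `w` is the spatial one and the second the temporal one.  The ghost states
`u 0 j`, `u (n + 1) j`, the metric values `A (n + 1) j`, `B (n + 1) j` in the last Riemann cell
(which lies outside `[rmin, rmax]`) and the initial metric values in the first one are free data. -/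
structure GodunovApproximation (σ rmin rmax t0 tend : ℝ) (Mb Bb : ℝ → ℝ) (u₀ : ℝ → ℝ × ℝ)
    (A₀ B₀ : ℝ → ℝ) (n : ℕ) where
  /-- the time levels `t_j` -/
  t : ℕ → ℝ
  /-- the states `u_{ij}` on the Godunov cells `[x_{i-}, x_{i+})` -/
  u : ℕ → ℕ → ℝ × ℝ
  /-- the values `A_{ij}` on the Riemann cells `R_{ij} = [x_{i-1}, x_i) × [t_j, t_{j+1})` -/
  A : ℕ → ℕ → ℝ
  /-- the values `B_{ij}` on the Riemann cells -/
  B : ℕ → ℕ → ℝ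
  /-- the profile of the Riemann solution in `R_{ij}` -/
  w : ℕ → ℕ → ℝ → ℝ × ℝ
  /-- the approximate solution `u_{Δx}(t, x)` -/
  uApp : ℝ → ℝ → ℝ × ℝ
  /-- the approximate metric coefficient `A_{Δx}(t, x)` -/
  AApp : ℝ → ℝ → ℝ
  /-- the approximate metric coefficient `B_{Δx}(t, x)` -/
  BApp : ℝ → ℝ → ℝ
  two_le : 2 ≤ n
  time_zero : t 0 = t0
  time_succ : ∀ j, t j < tend →
    t (j + 1) = t j + timeStep (meshWidth rmin rmax n) n (fun i => A i j) (fun i => B i j)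
  reaches_end : ∃ J, tend ≤ t J
  init_state : ∀ i ∈ Finset.Icc 1 n, u i 0 = u₀ (gridPoint rmin rmax n i)
  init_metric : ∀ i ∈ Finset.Icc 2 n,
    A i 0 = A₀ (halfPoint rmin rmax n i) ∧ B i 0 = B₀ (halfPoint rmin rmax n i)
  state_physical : ∀ j, t j < tend → ∀ i ≤ n + 1, u i j ∈ physical σ
  metric_pos : ∀ j, t j < tend → ∀ i ∈ Finset.Icc 1 (n + 1), 0 < A i j ∧ 0 < B i j
  /-- Riemann problem step: in `R_{ij}` the coordinate speed of light is `√(A_{ij} B_{ij})` -/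
  riemann_step : ∀ j, t j < tend → ∀ i ∈ Finset.Icc 1 (n + 1),
    IsRiemannSolution σ (Real.sqrt (A i j * B i j)) (u (i - 1) j) (u i j) (w i j)
  /-- `u_{Δx}` is the Riemann solution evolved by the ODE step, and `(A_{Δx}, B_{Δx})` is constant
  in each Riemann cell -/
  approx : ∀ j, t j < tend → ∀ i ∈ Finset.Icc 1 (n + 1), ∀ τ x : ℝ,
    t j ≤ τ → τ < t (j + 1) → τ < tend →
    gridPoint rmin rmax n (i - 1) ≤ x → x < gridPoint rmin rmax n i →
    rmin ≤ x → x ≤ rmax →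
    IsODEStep σ (A i j) (B i j) x (τ - t j)
      (riemannValue (u (i - 1) j) (u i j) (w i j) (τ - t j) (x - halfPoint rmin rmax n i))
      (uApp τ x) ∧ AApp τ x = A i j ∧ BApp τ x = B i j
  /-- Godunov step followed by the ODE step, whose time integral is evaluated by a one-point rule
  with some node `ξ` in `[t_j, t_{j+1}]` -/
  state_update : ∀ j, t (j + 1) < tend → ∀ i ∈ Finset.Icc 1 n, ∀ uBar : ℝ × ℝ,
    uBar = godunovAverage σ (t (j + 1) - t j) (meshWidth rmin rmax n)
        (A i j) (B i j) (A (i + 1) j) (B (i + 1) j) (w i j 0) (u i j) (w (i + 1) j 0) →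
    ∃ ξ ∈ Icc (t j) (t (j + 1)), ∃ q : ℝ × ℝ,
      IsODEStep σ ((A i j + A (i + 1) j) / 2) ((B i j + B (i + 1) j) / 2)
        (gridPoint rmin rmax n i) (ξ - t j) uBar q ∧
      u i (j + 1) = uBar + (t (j + 1) - t j) •
        odeSource σ ((A i j + A (i + 1) j) / 2) ((B i j + B (i + 1) j) / 2) q
          (gridPoint rmin rmax n i)
  metric_update : ∀ j, t (j + 1) < tend → ∀ i ∈ Finset.Icc 1 n,
    A i (j + 1) = 1 - 2 * discreteMass rmin rmax n (Mb (t (j + 1))) (fun k => u k (j + 1)) i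
        / halfPoint rmin rmax n i ∧
    B i (j + 1) = Bb (t (j + 1)) *
      Real.exp (discreteExponent σ rmin rmax n (fun k => u k (j + 1)) (fun k => A k (j + 1)) i)

/-! ### Weak solutions -/

/-- The region `[t0, tend] × [rmin, rmax]`. -/
def region (rmin rmax t0 tend : ℝ) : Set (ℝ × ℝ) := Icc t0 tend ×ˢ Icc rmin rmax

/-- The class in which weak solutions are sought: a bounded measurable fluid and a Lipschitz metric
`ds² = -B dt² + A⁻¹ dr² + r² dΩ²`. -/
structure IsBoundedFluidLipschitzMetric (σ rmin rmax t0 tend : ℝ) (u : ℝ → ℝ → ℝ × ℝ)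
    (A B : ℝ → ℝ → ℝ) : Prop where
  measurable : AEStronglyMeasurable (fun p : ℝ × ℝ => u p.1 p.2)
    (volume.restrict (region rmin rmax t0 tend))
  bounded : ∃ C : ℝ, ∀ᵐ p ∂(volume.restrict (region rmin rmax t0 tend)), ‖u p.1 p.2‖ ≤ C
  physical : ∀ᵐ p ∂(volume.restrict (region rmin rmax t0 tend)), u p.1 p.2 ∈ physical σ
  lipschitzA : ∃ L, LipschitzOnWith L (fun p : ℝ × ℝ => A p.1 p.2) (region rmin rmax t0 tend)
  lipschitzB : ∃ L, LipschitzOnWith L (fun p : ℝ × ℝ => B p.1 p.2) (region rmin rmax t0 tend)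
  pos : ∀ p ∈ region rmin rmax t0 tend, 0 < A p.1 p.2 ∧ 0 < B p.1 p.2

/-- The interior and initial part of the weak form of `u_t + f(A, B, u)_x = g(A, B, u, x)`,
`u(t0, ·) = u₀`, tested against `φ`. -/
def weakInterior (σ rmin rmax t0 tend : ℝ) (u₀ : ℝ → ℝ × ℝ) (u : ℝ → ℝ → ℝ × ℝ)
    (A B : ℝ → ℝ → ℝ) (φ : ℝ × ℝ → ℝ) : ℝ × ℝ :=
  (∫ p in region rmin rmax t0 tend,
      (deriv (fun s => φ (s, p.2)) p.1 • u p.1 p.2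
        + deriv (fun y => φ (p.1, y)) p.2 • flux σ (A p.1 p.2) (B p.1 p.2) (u p.1 p.2)
        + φ p • source σ (A p.1 p.2) (B p.1 p.2) (u p.1 p.2) p.2))
    + ∫ x in Icc rmin rmax, φ (t0, x) • u₀ x

/-- The boundary part of the weak form: `∫ f φ dt` at `rmin` minus `∫ f φ dt` at `rmax`.  As `u` is
defined only almost everywhere, each boundary integral is replaced by the mean over a layer of width
`δ` (and `δ ↓ 0` is taken in the definition of a weak solution). -/
def weakBoundary (σ rmin rmax t0 tend : ℝ) (u : ℝ → ℝ → ℝ × ℝ) (A B : ℝ → ℝ → ℝ)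
    (φ : ℝ × ℝ → ℝ) (δ : ℝ) : ℝ × ℝ :=
  δ⁻¹ • (∫ p in Icc t0 tend ×ˢ Icc rmin (rmin + δ),
      φ p • flux σ (A p.1 p.2) (B p.1 p.2) (u p.1 p.2))
    - δ⁻¹ • ∫ p in Icc t0 tend ×ˢ Icc (rmax - δ) rmax,
      φ p • flux σ (A p.1 p.2) (B p.1 p.2) (u p.1 p.2)

/-- `(u, A, B)` is a weak solution of `u_t + f(A, B, u)_x = g(A, B, u, x)`,
`(A, B)' = h(A, B, u, x)` with initial data `u(t0, ·) = u₀`.  The test functions may be nonzero at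
`t = t0` and at `x = rmin`, `x = rmax`; for those that vanish near `x = rmin` and `x = rmax` the
boundary part is eventually zero and the condition says that the interior part vanishes. -/
structure IsWeakSystemSolution (σ rmin rmax t0 tend : ℝ) (u₀ : ℝ → ℝ × ℝ) (u : ℝ → ℝ → ℝ × ℝ)
    (A B : ℝ → ℝ → ℝ) : Prop
    extends IsBoundedFluidLipschitzMetric σ rmin rmax t0 tend u A B where
  balance : ∀ φ : ℝ × ℝ → ℝ, ContDiff ℝ ∞ φ → HasCompactSupport φ →
    tsupport φ ⊆ {p | p.1 < tend} →
    Tendsto (fun δ : ℝ => weakInterior σ rmin rmax t0 tend u₀ u A B φ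
      + weakBoundary σ rmin rmax t0 tend u A B φ δ) (𝓝[>] 0) (𝓝 0)
  metricA : ∀ᵐ p ∂(volume.restrict (region rmin rmax t0 tend)),
    deriv (fun x => A p.1 x) p.2 = metricRhsA (A p.1 p.2) (u p.1 p.2) p.2
  metricB : ∀ᵐ p ∂(volume.restrict (region rmin rmax t0 tend)),
    deriv (fun x => B p.1 x) p.2 = metricRhsB σ (A p.1 p.2) (B p.1 p.2) (u p.1 p.2) p.2

/-- The quantity `Φ` in the second-order Einstein equation, as a function of the values of the metric
coefficients and of their first derivatives (`At = ∂A/∂t`, `Ar = ∂A/∂r`, …) at radius `r`. -/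
def einsteinPhi (r A B At Ar Bt Br : ℝ) : ℝ :=
  2 * At ^ 2 / A ^ 3 + At * Bt / (2 * A ^ 2 * B) - 1 / (2 * A) * (At / A) ^ 2
    - Br / r - B * Ar / (r * A) + B / 2 * (Br / B) ^ 2 - B / 2 * (Br / B) * (Ar / A)

/-- `(u, A, B)` is a weak solution of the Einstein equations `G = κ T` for the metric
`ds² = -B dt² + A⁻¹ dr² + r² dΩ²` and the perfect fluid with `p = σ ρ`, where
`T⁰⁰ = T⁰⁰_M / B`, `T⁰¹ = √(A/B) T⁰¹_M`, `T¹¹ = A T¹¹_M`, `T²² = σ ρ / r²`.  The three first-order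
equations hold almost everywhere and the second-order one
`(A²/(rB)) (A_tt/A² + B_rr - Φ) = 2 κ r A T²²` holds in the sense of distributions. -/
structure IsWeakEinsteinSolution (σ rmin rmax t0 tend : ℝ) (u : ℝ → ℝ → ℝ × ℝ)
    (A B : ℝ → ℝ → ℝ) : Prop
    extends IsBoundedFluidLipschitzMetric σ rmin rmax t0 tend u A B where
  einstein00 : ∀ᵐ p ∂(volume.restrict (region rmin rmax t0 tend)),
    A p.1 p.2 * B p.1 p.2 / p.2 ^ 2 *
        (-p.2 * (deriv (fun r => A p.1 r) p.2 / A p.1 p.2) + 1 / A p.1 p.2 - 1)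
      = kappa * B p.1 p.2 ^ 2 * ((u p.1 p.2).1 / B p.1 p.2)
  einstein01 : ∀ᵐ p ∂(volume.restrict (region rmin rmax t0 tend)),
    deriv (fun s => A s p.2) p.1 / (p.2 * A p.1 p.2)
      = kappa * (B p.1 p.2 / A p.1 p.2) *
        (Real.sqrt (A p.1 p.2 / B p.1 p.2) * (u p.1 p.2).2)
  einstein11 : ∀ᵐ p ∂(volume.restrict (region rmin rmax t0 tend)),
    1 / p.2 ^ 2 *
        (p.2 * (deriv (fun r => B p.1 r) p.2 / B p.1 p.2) - (1 / A p.1 p.2 - 1))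
      = kappa / A p.1 p.2 ^ 2 * (A p.1 p.2 * stress σ (u p.1 p.2))
  einstein22 : ∀ φ : ℝ × ℝ → ℝ, ContDiff ℝ ∞ φ → HasCompactSupport φ →
    tsupport φ ⊆ Ioo t0 tend ×ˢ Ioo rmin rmax →
    ∫ p in region rmin rmax t0 tend,
      (-(deriv (fun s => A s p.2) p.1
            * deriv (fun s => φ (s, p.2) / (p.2 * B s p.2)) p.1)
        - deriv (fun r => B p.1 r) p.2
            * deriv (fun r => A p.1 r ^ 2 / (r * B p.1 r) * φ (p.1, r)) p.2
        - A p.1 p.2 ^ 2 / (p.2 * B p.1 p.2)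
            * einsteinPhi p.2 (A p.1 p.2) (B p.1 p.2)
                (deriv (fun s => A s p.2) p.1) (deriv (fun r => A p.1 r) p.2)
                (deriv (fun s => B s p.2) p.1) (deriv (fun r => B p.1 r) p.2) * φ p
        - 2 * kappa * p.2 * A p.1 p.2 * stress22 σ (u p.1 p.2) p.2 * φ p) = 0

/-- The mass `Mb` imposed at `rmin` evolves by the Einstein equation
`∂M/∂t = -(κ/2) r² √(AB) T⁰¹_M` at `r = rmin`, in integrated form; the boundary value of the energy
flux is the limit of its means over layers of width `δ`. -/
def BoundaryMassConsistent (rmin t0 tend : ℝ) (Mb : ℝ → ℝ) (u : ℝ → ℝ → ℝ × ℝ)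
    (A B : ℝ → ℝ → ℝ) : Prop :=
  ∀ s₁ s₂ : ℝ, t0 ≤ s₁ → s₁ ≤ s₂ → s₂ ≤ tend →
    Tendsto (fun δ : ℝ => -(kappa / 2) * rmin ^ 2 *
        (δ⁻¹ * ∫ p in Icc s₁ s₂ ×ˢ Icc rmin (rmin + δ),
          Real.sqrt (A p.1 p.2 * B p.1 p.2) * (u p.1 p.2).2))
      (𝓝[>] 0) (𝓝 (Mb s₂ - Mb s₁))

end LocallyInertial

end

namespace LocallyInertial

/-! ### Fluid states -/

/-! The argument is of Lax-Wendroff type. On each mesh the state update is an exact discrete balance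
law: a difference of numerical fluxes taken at the zero-speed states, plus `(c' - c) • minkFlux`,
where `c` and `c'` are the values of `√(AB)` in the two Riemann cells that meet at a gridpoint, plus
the source `G` times the mesh width. The metric update is a quadrature of `A' = h`, so `(c' - c) /
Δx` tends to the derivative of `√(AB)` in the direction `h`. The jump term therefore tends to `h ·
∇_A f`, which is exactly what `G = g - h · ∇_A f` lacks, and `g` remains. Summation by parts and
dominated convergence give the weak form (`discrete_weak_form`, `weakInterior_eq_zero`).

Two facts make the limits legitimate. In the coordinates rapidity and logarithmic density, a Riemann
solution deviates from its data by a bounded multiple of the jump and stays in a compact set of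
physical states (`exists_riemann_bound`). The variation bound makes the integral of the jumps
`O(Δx)`. Along a subsequence with summable mesh widths the jumps vanish almost everywhere, so all
auxiliary states (zero-speed states, averages, states inside the ODE step) have the same limit `u`.

The metric is Lipschitz although the fluid is not. In one time step the states change by `O(1)` in
the sum over all cells; the metric weights this sum by `Δx`, which is comparable with the time step
(`exists_metricEstimates`). The discrete formulas for mass and exponent become integral formulas for
`A` and `B` (`ae_metric_eq`), and differentiating them gives `A' = h⁰` and `B' = h¹`.

The weak form is proved for test functions that are merely Lipschitz and vanish at both radii.
Multiplying a smooth test function by a piecewise linear cutoff then produces the boundary terms as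
means over layers (`balance`).

Two of the first-order Einstein equations are the metric equations rewritten. For the equation with
`∂A/∂t`, let `M = (1 - A) r / 2`. The energy balance and the equation for `∂M/∂r` show that the
defect `∂M/∂t + (κ/2) r² √(AB) T⁰¹_M` does not depend on `r`; consistency of the boundary mass says
that its boundary value at `rmin` is zero, so it vanishes (`ae_massDefect_eq_zero`). The
second-order equation is the momentum balance tested against `κ √(A/B) φ`, up to a spatial
divergence (`einstein22_algebra`). -/

theorem discriminant_bound {σ : ℝ} (hσ : 0 < σ) {u : ℝ × ℝ} (hu : |u.2| < u.1) :
    ((1 - σ) * u.1) ^ 2 < (1 + σ) ^ 2 * u.1 ^ 2 - 4 * σ * u.2 ^ 2 := by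
  have h : u.2 ^ 2 < u.1 ^ 2 := sq_lt_sq' (by linarith [(abs_lt.1 hu).1]) (abs_lt.1 hu).2
  nlinarith

/-- This presents the physical states as an open convex cone, from which convexity and the
smoothness of `vel` follow. For the converse, `vel σ u` is the root in `(-1, 1)` of the quadratic
equation that expresses `u.2 / u.1` by the velocity. -/
theorem physical_iff {σ : ℝ} (hσ : 0 < σ) (hσ1 : σ < 1) {u : ℝ × ℝ} :
    u ∈ physical σ ↔ |u.2| < u.1 := by
  constructor
  · rintro ⟨ρ, v, hρ, hv, rfl⟩
    have hv2 : v ^ 2 < 1 := (sq_lt_one_iff_abs_lt_one v).2 hv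
    have h1 : 0 < 1 - v ^ 2 := by linarith
    have hv' := abs_lt.1 hv
    simp only [conserved]
    rw [abs_lt]
    constructor
    · rw [← sub_pos]
      have : (1 + σ) * v / (1 - v ^ 2) * ρ - -((1 + σ * v ^ 2) / (1 - v ^ 2) * ρ)
        = (1 + v) * (1 + σ * v) / (1 - v ^ 2) * ρ := by field_simp; ring
      rw [this]
      have : 0 < 1 + v := by linarith
      have : 0 < 1 + σ * v := by nlinarith
      positivity
    · rw [← sub_pos]
      have : (1 + σ * v ^ 2) / (1 - v ^ 2) * ρ - (1 + σ) * v / (1 - v ^ 2) * ρ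
        = (1 - v) * (1 - σ * v) / (1 - v ^ 2) * ρ := by field_simp; ring
      rw [this]
      have : 0 < 1 - v := by linarith
      have : 0 < 1 - σ * v := by nlinarith
      positivity
  · intro hu
    have hu0 : 0 < u.1 := lt_of_le_of_lt (abs_nonneg _) hu
    have hD := discriminant_bound hσ hu
    set D := Real.sqrt ((1 + σ) ^ 2 * u.1 ^ 2 - 4 * σ * u.2 ^ 2) with hDdef
    have hD2 : D ^ 2 = (1 + σ) ^ 2 * u.1 ^ 2 - 4 * σ * u.2 ^ 2 :=
      Real.sq_sqrt (le_trans (sq_nonneg _) hD.le)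
    -- This makes the denominator of `vel` larger than `2 * u.1`, hence larger than `2 * |u.2|`.
    have hDlt : (1 - σ) * u.1 < D := Real.lt_sqrt_of_sq_lt hD
    have hden : 0 < (1 + σ) * u.1 + D := by nlinarith
    have hvdef : vel σ u = 2 * u.2 / ((1 + σ) * u.1 + D) := rfl
    have hv : |vel σ u| < 1 := by
      rw [hvdef, abs_div, abs_mul, abs_of_pos hden, div_lt_one hden]
      norm_num
      nlinarith
    have hv2 : vel σ u ^ 2 < 1 := (sq_lt_one_iff_abs_lt_one _).2 hv
    have h1 : 0 < 1 - vel σ u ^ 2 := by linarith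
    have h2 : 0 < 1 + σ * vel σ u ^ 2 := by positivity
    have hquad : u.2 * (1 + σ * vel σ u ^ 2) = (1 + σ) * u.1 * vel σ u := by
      rw [hvdef]
      field_simp
      linear_combination u.2 * hD2
    refine ⟨dens σ u, vel σ u, by rw [dens]; positivity, hv, ?_⟩
    refine Prod.ext ?_ ?_
    · simp only [conserved, dens]
      field_simp
    · simp only [conserved, dens]
      field_simp
      linarith

theorem convex_physical {σ : ℝ} (hσ : 0 < σ) (hσ1 : σ < 1) : Convex ℝ (physical σ) := by
  intro u hu v hv a b ha hb hab
  rw [physical_iff hσ hσ1] at *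
  simp only [Prod.fst_add, Prod.smul_fst, Prod.snd_add, Prod.smul_snd, smul_eq_mul]
  have h1 : |a * u.2 + b * v.2| ≤ a * |u.2| + b * |v.2| := by
    refine (abs_add_le _ _).trans ?_
    rw [abs_mul, abs_mul, abs_of_nonneg ha, abs_of_nonneg hb]
  rcases ha.eq_or_lt with rfl | ha'
  · have : b = 1 := by linarith
    subst this; simp; exact hv
  · nlinarith

theorem abs_vel_lt_one {σ : ℝ} (hσ : 0 < σ) (hσ1 : σ < 1) {u : ℝ × ℝ} (hu : u ∈ physical σ) :
    |vel σ u| < 1 := by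
  obtain ⟨ρ, v, hρ, hv, rfl⟩ := hu
  rwa [vel_conserved hσ hσ1 hρ hv]

theorem dens_pos {σ : ℝ} (hσ : 0 < σ) (hσ1 : σ < 1) {u : ℝ × ℝ} (hu : u ∈ physical σ) :
    0 < dens σ u := by
  obtain ⟨ρ, v, hρ, hv, rfl⟩ := hu
  rwa [dens_conserved hσ hσ1 hρ hv]

theorem conserved_dens_vel {σ : ℝ} (hσ : 0 < σ) (hσ1 : σ < 1) {u : ℝ × ℝ} (hu : u ∈ physical σ) :
    conserved σ (dens σ u) (vel σ u) = u := by
  obtain ⟨ρ, v, hρ, hv, rfl⟩ := hu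
  rw [dens_conserved hσ hσ1 hρ hv, vel_conserved hσ hσ1 hρ hv]

theorem contDiffAt_vel {σ : ℝ} (hσ : 0 < σ) (hσ1 : σ < 1) {u : ℝ × ℝ} (hu : u ∈ physical σ) :
    ContDiffAt ℝ 1 (vel σ) u := by
  rw [physical_iff hσ hσ1] at hu
  have hu0 : 0 < u.1 := lt_of_le_of_lt (abs_nonneg _) hu
  have hD := discriminant_bound hσ hu
  have hpos : 0 < (1 + σ) ^ 2 * u.1 ^ 2 - 4 * σ * u.2 ^ 2 := lt_of_le_of_lt (sq_nonneg _) hD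
  unfold vel
  refine ContDiffAt.div (by fun_prop) (ContDiffAt.add (by fun_prop)
    (ContDiffAt.sqrt (by fun_prop) hpos.ne')) ?_
  have := Real.sqrt_nonneg ((1 + σ) ^ 2 * u.1 ^ 2 - 4 * σ * u.2 ^ 2)
  positivity

theorem contDiffAt_dens {σ : ℝ} (hσ : 0 < σ) (hσ1 : σ < 1) {u : ℝ × ℝ} (hu : u ∈ physical σ) :
    ContDiffAt ℝ 1 (dens σ) u := by
  have hv := contDiffAt_vel hσ hσ1 hu
  unfold dens
  refine ContDiffAt.div (by fun_prop) (by fun_prop) ?_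
  positivity

theorem one_sub_vel_sq_pos {σ : ℝ} (hσ : 0 < σ) (hσ1 : σ < 1) {u : ℝ × ℝ} (hu : u ∈ physical σ) :
    0 < 1 - vel σ u ^ 2 := by
  linarith [(sq_lt_one_iff_abs_lt_one _).2 (abs_vel_lt_one hσ hσ1 hu)]

theorem contDiffAt_stress {σ : ℝ} (hσ : 0 < σ) (hσ1 : σ < 1) {u : ℝ × ℝ} (hu : u ∈ physical σ) :
    ContDiffAt ℝ 1 (stress σ) u := by
  have hv := contDiffAt_vel hσ hσ1 hu
  have hd := contDiffAt_dens hσ hσ1 hu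
  unfold stress
  exact ContDiffAt.mul (ContDiffAt.div (by fun_prop) (by fun_prop)
    (one_sub_vel_sq_pos hσ hσ1 hu).ne') hd

/-- Convexity of `K` is not needed: a locally Lipschitz function on a compact set is Lipschitz,
since well-separated points are handled by boundedness. -/
theorem exists_lipschitzOnWith_of_contDiffAt {E F : Type*} [NormedAddCommGroup E]
    [NormedSpace ℝ E] [NormedAddCommGroup F] [NormedSpace ℝ F] {f : E → F} {K : Set E}
    (hK : IsCompact K) (hf : ∀ u ∈ K, ContDiffAt ℝ 1 f u) : ∃ L, LipschitzOnWith L f K := by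
  refine LocallyLipschitzOn.exists_lipschitzOnWith_of_compact hK fun u hu => ?_
  obtain ⟨L, t, ht, hL⟩ := (hf u hu).exists_lipschitzOnWith
  exact ⟨L, t, mem_nhdsWithin_of_mem_nhds ht, hL⟩

theorem exists_lipschitzOnWith_stress {σ : ℝ} (hσ : 0 < σ) (hσ1 : σ < 1) {K : Set (ℝ × ℝ)}
    (hK : IsCompact K) (hKp : K ⊆ physical σ) : ∃ L, LipschitzOnWith L (stress σ) K :=
  exists_lipschitzOnWith_of_contDiffAt hK fun _ hu => contDiffAt_stress hσ hσ1 (hKp hu)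

/-- The difference `T⁰⁰_M - T¹¹_M` equals `(1 - σ) ρ`. The bounds do not degenerate as `|v|` tends
to `1`, so a bound on the state alone controls fluxes and sources. -/
theorem stress_mem {σ : ℝ} (hσ : 0 < σ) (hσ1 : σ < 1) {u : ℝ × ℝ} (hu : u ∈ physical σ) :
    0 ≤ stress σ u ∧ stress σ u ≤ u.1 := by
  obtain ⟨ρ, v, hρ, hv, rfl⟩ := hu
  have hv2 : v ^ 2 < 1 := (sq_lt_one_iff_abs_lt_one v).2 hv
  have h1 : 0 < 1 - v ^ 2 := by linarith
  rw [stress, vel_conserved hσ hσ1 hρ hv, dens_conserved hσ hσ1 hρ hv]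
  simp only [conserved]
  refine ⟨by positivity, ?_⟩
  refine mul_le_mul_of_nonneg_right (div_le_div_of_nonneg_right ?_ h1.le) hρ.le
  nlinarith [mul_pos (sub_pos.2 hσ1) h1]

theorem dens_le {σ : ℝ} (hσ : 0 < σ) (hσ1 : σ < 1) {u : ℝ × ℝ} (hu : u ∈ physical σ) :
    dens σ u ≤ u.1 := by
  obtain ⟨ρ, v, hρ, hv, rfl⟩ := hu
  have hv2 : v ^ 2 < 1 := (sq_lt_one_iff_abs_lt_one v).2 hv
  have h1 : 0 < 1 - v ^ 2 := by linarith
  rw [dens_conserved hσ hσ1 hρ hv]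
  simp only [conserved]
  have : 1 ≤ (1 + σ * v ^ 2) / (1 - v ^ 2) := by
    rw [le_div_iff₀ h1]; nlinarith [sq_nonneg v, mul_nonneg hσ.le (sq_nonneg v)]
  nlinarith

theorem norm_minkFlux_le {σ : ℝ} (hσ : 0 < σ) (hσ1 : σ < 1) {u : ℝ × ℝ} (hu : u ∈ physical σ) :
    ‖minkFlux σ u‖ ≤ ‖u‖ := by
  have h1 := stress_mem hσ hσ1 hu
  have h2 := norm_fst_le u
  have h3 := norm_snd_le u
  simp only [minkFlux]
  rw [Prod.norm_def]
  refine max_le h3 ?_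
  simp only [Real.norm_eq_abs] at *
  rw [abs_of_nonneg h1.1]
  exact h1.2.trans ((le_abs_self _).trans h2)

theorem continuousAt_minkFlux {σ : ℝ} (hσ : 0 < σ) (hσ1 : σ < 1) {u : ℝ × ℝ}
    (hu : u ∈ physical σ) : ContinuousAt (minkFlux σ) u :=
  continuousAt_snd.prodMk (contDiffAt_stress hσ hσ1 hu).continuousAt

theorem kappa_pos : 0 < kappa := by unfold kappa; positivity

theorem sqrt_mul_le {A B C : ℝ} (hA : 0 ≤ A) (hA' : A ≤ C) (hB' : B ≤ C) :
    Real.sqrt (A * B) ≤ C := by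
  have hC : 0 ≤ C := hA.trans hA'
  rw [Real.sqrt_le_left hC]
  nlinarith

/-- On bounded sets of physical states the source of the ODE step is bounded, also near the
boundary of the set of physical states. -/
theorem exists_odeSource_bound {σ : ℝ} (hσ : 0 < σ) (hσ1 : σ < 1) {rmin : ℝ} (hrmin : 0 < rmin)
    (rmax : ℝ) {C : ℝ} (hC : 0 < C) (R : ℝ) :
    ∃ G : ℝ, 0 < G ∧ ∀ A ∈ Icc C⁻¹ C, ∀ B ∈ Icc C⁻¹ C, ∀ x ∈ Icc rmin rmax, ∀ u ∈ physical σ,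
      ‖u‖ ≤ R → ‖odeSource σ A B u x‖ ≤ G := by
  -- Stress and density are treated as independent variables in `[-R, R]`. The source is then
  -- continuous on a compact box, whereas the bounded physical states do not form a compact set.
  have hcont : ContinuousOn (fun p : ℝ × ℝ × ℝ × ℝ × ℝ × ℝ × ℝ =>
      ((-(2 / p.2.2.1) * Real.sqrt (p.1 * p.2.1) * p.2.2.2.1,
   -(1 / 2) * Real.sqrt (p.1 * p.2.1) *
    (4 / p.2.2.1 * p.2.2.2.2.1 + (1 / p.1 - 1) / p.2.2.1 * (p.2.2.2.2.2.1 - p.2.2.2.2.1)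
      + 2 * kappa * p.2.2.1 / p.1 * (p.2.2.2.2.2.1 * p.2.2.2.2.1 - p.2.2.2.1 ^ 2)
      - 4 * p.2.2.1 * (σ * p.2.2.2.2.2.2 / p.2.2.1 ^ 2))) : ℝ × ℝ)
      - (((1 - p.1) / p.2.2.1 - kappa * p.2.2.1 * p.2.2.2.2.2.1) / (2 * p.1)
        + (p.2.1 / p.1 * ((1 - p.1) / p.2.2.1 + kappa * p.2.2.1 * p.2.2.2.2.1)) / (2 * p.2.1))
        • (Real.sqrt (p.1 * p.2.1) • ((p.2.2.2.1, p.2.2.2.2.1) : ℝ × ℝ)))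
      (Icc C⁻¹ C ×ˢ Icc C⁻¹ C ×ˢ Icc rmin rmax ×ˢ Icc (-R) R ×ˢ Icc (-R) R ×ˢ Icc (-R) R
        ×ˢ Icc (-R) R) := by
    have hC' : 0 < C⁻¹ := inv_pos.2 hC
    have h1 : ∀ p ∈ (Icc C⁻¹ C ×ˢ Icc C⁻¹ C ×ˢ Icc rmin rmax ×ˢ Icc (-R) R ×ˢ Icc (-R) R ×ˢ
        Icc (-R) R ×ˢ Icc (-R) R : Set (ℝ × ℝ × ℝ × ℝ × ℝ × ℝ × ℝ)), p.1 ≠ 0 :=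
      fun p hp => (hC'.trans_le hp.1.1).ne'
    have h2 : ∀ p ∈ (Icc C⁻¹ C ×ˢ Icc C⁻¹ C ×ˢ Icc rmin rmax ×ˢ Icc (-R) R ×ˢ Icc (-R) R ×ˢ
        Icc (-R) R ×ˢ Icc (-R) R : Set (ℝ × ℝ × ℝ × ℝ × ℝ × ℝ × ℝ)), p.2.1 ≠ 0 :=
      fun p hp => (hC'.trans_le hp.2.1.1).ne'
    have h3 : ∀ p ∈ (Icc C⁻¹ C ×ˢ Icc C⁻¹ C ×ˢ Icc rmin rmax ×ˢ Icc (-R) R ×ˢ Icc (-R) R ×ˢ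
        Icc (-R) R ×ˢ Icc (-R) R : Set (ℝ × ℝ × ℝ × ℝ × ℝ × ℝ × ℝ)), p.2.2.1 ≠ 0 :=
      fun p hp => (hrmin.trans_le hp.2.2.1.1).ne'
    have h4 : ∀ p ∈ (Icc C⁻¹ C ×ˢ Icc C⁻¹ C ×ˢ Icc rmin rmax ×ˢ Icc (-R) R ×ˢ Icc (-R) R ×ˢ
        Icc (-R) R ×ˢ Icc (-R) R : Set (ℝ × ℝ × ℝ × ℝ × ℝ × ℝ × ℝ)), p.2.2.1 ^ 2 ≠ 0 :=
      fun p hp => pow_ne_zero _ (h3 p hp)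
    have h5 : ∀ p ∈ (Icc C⁻¹ C ×ˢ Icc C⁻¹ C ×ˢ Icc rmin rmax ×ˢ Icc (-R) R ×ˢ Icc (-R) R ×ˢ
        Icc (-R) R ×ˢ Icc (-R) R : Set (ℝ × ℝ × ℝ × ℝ × ℝ × ℝ × ℝ)), 2 * p.1 ≠ 0 :=
      fun p hp => mul_ne_zero two_ne_zero (h1 p hp)
    have h6 : ∀ p ∈ (Icc C⁻¹ C ×ˢ Icc C⁻¹ C ×ˢ Icc rmin rmax ×ˢ Icc (-R) R ×ˢ Icc (-R) R ×ˢ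
        Icc (-R) R ×ˢ Icc (-R) R : Set (ℝ × ℝ × ℝ × ℝ × ℝ × ℝ × ℝ)), 2 * p.2.1 ≠ 0 :=
      fun p hp => mul_ne_zero two_ne_zero (h2 p hp)
    fun_prop (disch := assumption)
  have hcomp : IsCompact (Icc C⁻¹ C ×ˢ Icc C⁻¹ C ×ˢ Icc rmin rmax ×ˢ Icc (-R) R ×ˢ Icc (-R) R ×ˢ
        Icc (-R) R ×ˢ Icc (-R) R : Set (ℝ × ℝ × ℝ × ℝ × ℝ × ℝ × ℝ)) := by
    repeat' apply IsCompact.prod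
    all_goals exact isCompact_Icc
  obtain ⟨G, hG⟩ := hcomp.exists_bound_of_continuousOn hcont
  refine ⟨max G 1, by positivity, fun A hA B hB x hx u hu hR => ?_⟩
  have hs := stress_mem hσ hσ1 hu
  have hd := dens_le hσ hσ1 hu
  have hd0 := dens_pos hσ hσ1 hu
  have h1 : |u.1| ≤ R := (norm_fst_le u).trans hR
  have h2 : |u.2| ≤ R := (norm_snd_le u).trans hR
  have h1' := abs_le.1 h1
  have h2' := abs_le.1 h2
  refine le_trans ?_ (le_max_left G 1)
  exact hG (A, B, x, u.2, stress σ u, u.1, dens σ u) ⟨hA, hB, hx, h2', ⟨by linarith, by linarith⟩,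
    h1', ⟨by linarith, by linarith⟩⟩

/-- The ODE step moves a bounded state by at most a constant times the elapsed time. -/
theorem exists_odeStep_bound {σ : ℝ} (hσ : 0 < σ) (hσ1 : σ < 1) {rmin : ℝ} (hrmin : 0 < rmin)
    (rmax : ℝ) {C : ℝ} (hC : 0 < C) (R : ℝ) :
    ∃ G : ℝ, 0 < G ∧ ∀ A ∈ Icc C⁻¹ C, ∀ B ∈ Icc C⁻¹ C, ∀ x ∈ Icc rmin rmax, ∀ τ, 0 ≤ τ →
      G * τ ≤ 1 → ∀ u₀ u₁ : ℝ × ℝ, ‖u₀‖ ≤ R → IsODEStep σ A B x τ u₀ u₁ →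
      u₁ ∈ physical σ ∧ ‖u₁ - u₀‖ ≤ G * τ ∧ ‖odeSource σ A B u₁ x‖ ≤ G := by
  obtain ⟨G, hG0, hG⟩ := exists_odeSource_bound hσ hσ1 hrmin rmax hC (R + 1)
  refine ⟨G + 1, by positivity, fun A hA B hB x hx τ hτ hτ1 u₀ u₁ hu₀ ⟨y, hy0, hyτ, hy⟩ => ?_⟩
  -- Barrier argument: where `‖y s - u₀‖ = (G + 1) * s`, this number is at most `1`, so `y s` lies
  -- in the ball of radius `R + 1` and moves with speed at most `G < G + 1`. The barrier cannot be
  -- crossed.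
  have key : ∀ ⦃s⦄, s ∈ Icc 0 τ → ‖y s - u₀‖ ≤ (G + 1) * s := by
    refine image_norm_le_of_norm_deriv_right_lt_deriv_boundary
      (f' := fun s => odeSource σ A B (y s) x) (B' := fun _ => G + 1) ?_ ?_ ?_ ?_ ?_
    · intro s hs
      exact ((hy s hs).2.continuousWithinAt).sub continuousWithinAt_const
    · intro s hs
      have := ((hy s (Ico_subset_Icc_self hs)).2.sub_const u₀)
      exact this.mono_of_mem_nhdsWithin (Icc_mem_nhdsGE_of_mem hs)
    · simp [hy0]
    · intro s
      simpa using (hasDerivAt_id s).const_mul (G + 1)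
    · intro s hs hn
      have hs' := Ico_subset_Icc_self hs
      have hb : ‖y s‖ ≤ R + 1 := by
        have h1 : ‖y s‖ ≤ ‖y s - u₀‖ + ‖u₀‖ := by simpa using norm_add_le (y s - u₀) u₀
        have h2 : (G + 1) * s ≤ (G + 1) * τ := by gcongr; exact hs'.2
        linarith
      linarith [hG A hA B hB x hx (y s) (hy s hs').1 hb]
  have hτm : τ ∈ Icc 0 τ := ⟨hτ, le_rfl⟩
  have h1 := key hτm
  have h2 := (hy τ hτm).1
  rw [hyτ] at h1 h2
  refine ⟨h2, h1, ?_⟩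
  have hb : ‖u₁‖ ≤ R + 1 := by
    have h1 : ‖u₁‖ ≤ ‖u₁ - u₀‖ + ‖u₀‖ := by simpa using norm_add_le (u₁ - u₀) u₀
    linarith
  linarith [hG A hA B hB x hx u₁ h2 hb]

/-! ### Estimates for the Riemann problem -/

/-- The rapidity of a fluid state. -/
noncomputable def rapidity (σ : ℝ) (u : ℝ × ℝ) : ℝ :=
  1 / 2 * Real.log ((1 + vel σ u) / (1 - vel σ u))

/-- The rescaled logarithm of the energy density of a fluid state. -/
noncomputable def logDens (σ : ℝ) (u : ℝ × ℝ) : ℝ :=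
  Real.sqrt σ / (1 + σ) * Real.log (dens σ u)

/-- The rapidity and the logarithmic density as coordinates on the set of physical states. -/
noncomputable def waveCoord (σ : ℝ) (u : ℝ × ℝ) : ℝ × ℝ := (rapidity σ u, logDens σ u)

/-- The fluid state with given rapidity and logarithmic density. -/
noncomputable def ofWaveCoord (σ : ℝ) (z : ℝ × ℝ) : ℝ × ℝ :=
  conserved σ (Real.exp (z.2 / (Real.sqrt σ / (1 + σ))))
    ((Real.exp (2 * z.1) - 1) / (Real.exp (2 * z.1) + 1))

theorem one_add_vel_pos {σ : ℝ} (hσ : 0 < σ) (hσ1 : σ < 1) {u : ℝ × ℝ} (hu : u ∈ physical σ) :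
    0 < 1 + vel σ u := by linarith [(abs_lt.1 (abs_vel_lt_one hσ hσ1 hu)).1]

theorem one_sub_vel_pos {σ : ℝ} (hσ : 0 < σ) (hσ1 : σ < 1) {u : ℝ × ℝ} (hu : u ∈ physical σ) :
    0 < 1 - vel σ u := by linarith [(abs_lt.1 (abs_vel_lt_one hσ hσ1 hu)).2]

theorem exp_two_mul_rapidity {σ : ℝ} (hσ : 0 < σ) (hσ1 : σ < 1) {u : ℝ × ℝ}
    (hu : u ∈ physical σ) : Real.exp (2 * rapidity σ u) = (1 + vel σ u) / (1 - vel σ u) := by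
  have h1 := one_add_vel_pos hσ hσ1 hu
  have h2 := one_sub_vel_pos hσ hσ1 hu
  rw [rapidity, ← mul_assoc]
  norm_num
  rw [Real.exp_log (by positivity)]

theorem exp_logDens {σ : ℝ} (hσ : 0 < σ) (hσ1 : σ < 1) {u : ℝ × ℝ} (hu : u ∈ physical σ) :
    Real.exp (logDens σ u / (Real.sqrt σ / (1 + σ))) = dens σ u := by
  have h : Real.sqrt σ / (1 + σ) ≠ 0 := by have := Real.sqrt_pos.2 hσ; positivity
  rw [logDens, mul_div_cancel_left₀ _ h, Real.exp_log (dens_pos hσ hσ1 hu)]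

/-- The velocity is the hyperbolic tangent of the rapidity. As the inverse map is smooth on the
whole plane, bounded wave coordinates confine a state to a compact set of physical states. -/
theorem ofWaveCoord_waveCoord {σ : ℝ} (hσ : 0 < σ) (hσ1 : σ < 1) {u : ℝ × ℝ}
    (hu : u ∈ physical σ) : ofWaveCoord σ (waveCoord σ u) = u := by
  have h2 := one_sub_vel_pos hσ hσ1 hu
  have h : (Real.exp (2 * rapidity σ u) - 1) / (Real.exp (2 * rapidity σ u) + 1) = vel σ u := by
    rw [exp_two_mul_rapidity hσ hσ1 hu]
    field_simp
    ring
  simp only [ofWaveCoord, waveCoord]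
  rw [h, exp_logDens hσ hσ1 hu, conserved_dens_vel hσ hσ1 hu]

theorem abs_exp_ratio_lt_one (t : ℝ) : |(Real.exp t - 1) / (Real.exp t + 1)| < 1 := by
  have h := Real.exp_pos t
  rw [abs_lt, lt_div_iff₀ (by linarith), div_lt_one (by linarith)]
  constructor <;> linarith

theorem ofWaveCoord_physical (σ : ℝ) (z : ℝ × ℝ) : ofWaveCoord σ z ∈ physical σ :=
  ⟨_, _, Real.exp_pos _, abs_exp_ratio_lt_one _, rfl⟩

theorem contDiff_ofWaveCoord (σ : ℝ) : ContDiff ℝ 1 (ofWaveCoord σ) := by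
  have hv : ContDiff ℝ 1
      (fun z : ℝ × ℝ => (Real.exp (2 * z.1) - 1) / (Real.exp (2 * z.1) + 1)) :=
    ContDiff.div (by fun_prop) (by fun_prop) fun z => by positivity
  have hne : ∀ z : ℝ × ℝ,
      1 - ((Real.exp (2 * z.1) - 1) / (Real.exp (2 * z.1) + 1)) ^ 2 ≠ 0 := fun z => by
    have := (sq_lt_one_iff_abs_lt_one _).2 (abs_exp_ratio_lt_one (2 * z.1))
    exact (sub_pos.2 this).ne'
  unfold ofWaveCoord conserved
  refine ContDiff.prodMk (ContDiff.mul (ContDiff.div (by fun_prop) (by fun_prop) hne) ?_)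
    (ContDiff.mul (ContDiff.div (by fun_prop) (by fun_prop) hne) ?_) <;>
  exact Real.contDiff_exp.comp (contDiff_snd.div_const _)

theorem contDiffAt_waveCoord {σ : ℝ} (hσ : 0 < σ) (hσ1 : σ < 1) {u : ℝ × ℝ}
    (hu : u ∈ physical σ) : ContDiffAt ℝ 1 (waveCoord σ) u := by
  have h1 := one_add_vel_pos hσ hσ1 hu
  have h2 := one_sub_vel_pos hσ hσ1 hu
  have h3 := dens_pos hσ hσ1 hu
  have hv := contDiffAt_vel hσ hσ1 hu
  have hd := contDiffAt_dens hσ hσ1 hu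
  unfold waveCoord rapidity logDens
  refine ContDiffAt.prodMk (contDiffAt_const.mul (ContDiffAt.log (ContDiffAt.div (by fun_prop)
    (by fun_prop) h2.ne') (by positivity))) (contDiffAt_const.mul (hd.log h3.ne'))

theorem rapidity_lt_iff {σ : ℝ} (hσ : 0 < σ) (hσ1 : σ < 1) {u v : ℝ × ℝ}
    (hu : u ∈ physical σ) (hv : v ∈ physical σ) :
    rapidity σ u < rapidity σ v ↔ vel σ u < vel σ v := by
  have h2 := one_sub_vel_pos hσ hσ1 hu
  have h2' := one_sub_vel_pos hσ hσ1 hv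
  have : rapidity σ u < rapidity σ v ↔ 2 * rapidity σ u < 2 * rapidity σ v := by
    constructor <;> intro h <;> linarith
  rw [this, ← Real.exp_lt_exp, exp_two_mul_rapidity hσ hσ1 hu, exp_two_mul_rapidity hσ hσ1 hv,
    div_lt_div_iff₀ h2 h2']
  constructor <;> intro h <;> linarith

theorem sqrt_lt_one {σ : ℝ} (hσ1 : σ < 1) : Real.sqrt σ < 1 := by
  rw [Real.sqrt_lt' one_pos]; simpa using hσ1

theorem charSpeed_denominators {σ : ℝ} (hσ : 0 < σ) (hσ1 : σ < 1) {u : ℝ × ℝ}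
    (hu : u ∈ physical σ) : 0 < 1 - Real.sqrt σ * vel σ u ∧ 0 < 1 + Real.sqrt σ * vel σ u := by
  have h1 := one_add_vel_pos hσ hσ1 hu
  have h2 := one_sub_vel_pos hσ hσ1 hu
  have h3 := Real.sqrt_nonneg σ
  have h4 := sqrt_lt_one hσ1
  constructor <;> nlinarith

/-- The characteristic speed is the relativistic sum of the fluid velocity and the sound speed, and
this operation is increasing because the sound speed is below `1`. The Lax conditions and the
ordering inside rarefaction fans thus become statements on the rapidity. -/
theorem charSpeed₁_lt_iff {σ : ℝ} (hσ : 0 < σ) (hσ1 : σ < 1) {u v : ℝ × ℝ}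
    (hu : u ∈ physical σ) (hv : v ∈ physical σ) :
    charSpeed₁ σ u < charSpeed₁ σ v ↔ rapidity σ u < rapidity σ v := by
  have h1 := (charSpeed_denominators hσ hσ1 hu).1
  have h2 := (charSpeed_denominators hσ hσ1 hv).1
  have h3 := Real.sq_sqrt hσ.le
  rw [rapidity_lt_iff hσ hσ1 hu hv, charSpeed₁, charSpeed₁, div_lt_div_iff₀ h1 h2]
  have key : (vel σ v - √σ) * (1 - √σ * vel σ u) - (vel σ u - √σ) * (1 - √σ * vel σ v)
      = (1 - σ) * (vel σ v - vel σ u) := by linear_combination (vel σ u - vel σ v) * h3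
  constructor <;> intro h
  · have : 0 < (1 - σ) * (vel σ v - vel σ u) := by rw [← key]; linarith
    linarith [(pos_iff_pos_of_mul_pos this).1 (by linarith)]
  · have : 0 < (1 - σ) * (vel σ v - vel σ u) := mul_pos (by linarith) (by linarith)
    linarith

theorem charSpeed₂_lt_iff {σ : ℝ} (hσ : 0 < σ) (hσ1 : σ < 1) {u v : ℝ × ℝ}
    (hu : u ∈ physical σ) (hv : v ∈ physical σ) :
    charSpeed₂ σ u < charSpeed₂ σ v ↔ rapidity σ u < rapidity σ v := by
  have h1 := (charSpeed_denominators hσ hσ1 hu).2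
  have h2 := (charSpeed_denominators hσ hσ1 hv).2
  have h3 := Real.sq_sqrt hσ.le
  rw [rapidity_lt_iff hσ hσ1 hu hv, charSpeed₂, charSpeed₂, div_lt_div_iff₀ h1 h2]
  have key : (vel σ v + √σ) * (1 + √σ * vel σ u) - (vel σ u + √σ) * (1 + √σ * vel σ v)
      = (1 - σ) * (vel σ v - vel σ u) := by linear_combination (vel σ u - vel σ v) * h3
  constructor <;> intro h
  · have : 0 < (1 - σ) * (vel σ v - vel σ u) := by rw [← key]; linarith
    linarith [(pos_iff_pos_of_mul_pos this).1 (by linarith)]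
  · have : 0 < (1 - σ) * (vel σ v - vel σ u) := mul_pos (by linarith) (by linarith)
    linarith

/-- For a 1-shock this confines the shock speed to `(-1, 1)` and places it below the fluid velocity
on the left, which decides the sign of the density jump. -/
theorem charSpeed₁_bounds {σ : ℝ} (hσ : 0 < σ) (hσ1 : σ < 1) {u : ℝ × ℝ}
    (hu : u ∈ physical σ) : -1 < charSpeed₁ σ u ∧ charSpeed₁ σ u < vel σ u := by
  have h1 := (charSpeed_denominators hσ hσ1 hu).1
  have h2 := one_add_vel_pos hσ hσ1 hu
  have h3 := one_sub_vel_pos hσ hσ1 hu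
  have h4 := sqrt_lt_one hσ1
  have h5 := Real.sqrt_pos.2 hσ
  rw [charSpeed₁, lt_div_iff₀ h1, div_lt_iff₀ h1]
  constructor
  · nlinarith
  · have := mul_pos h5 (mul_pos h2 h3)
    nlinarith

theorem charSpeed₂_bounds {σ : ℝ} (hσ : 0 < σ) (hσ1 : σ < 1) {u : ℝ × ℝ}
    (hu : u ∈ physical σ) : vel σ u < charSpeed₂ σ u ∧ charSpeed₂ σ u < 1 := by
  have h1 := (charSpeed_denominators hσ hσ1 hu).2
  have h2 := one_add_vel_pos hσ hσ1 hu
  have h3 := one_sub_vel_pos hσ hσ1 hu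
  have h4 := sqrt_lt_one hσ1
  have h5 := Real.sqrt_pos.2 hσ
  rw [charSpeed₂, div_lt_iff₀ h1, lt_div_iff₀ h1]
  constructor
  · have := mul_pos h5 (mul_pos h2 h3)
    nlinarith
  · nlinarith

/-- A boost multiplies the null components of the stress tensor by `e^{±2θ}`, with `θ` the rapidity,
and leaves the mixed component invariant. In these components the Rankine-Hugoniot relation splits
into two equations with factors `1 - s` and `1 + s`. -/
theorem lightcone_components {σ : ℝ} (hσ : 0 < σ) (hσ1 : σ < 1) {u : ℝ × ℝ}
    (hu : u ∈ physical σ) :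
    u.1 + stress σ u + 2 * u.2
        = (1 + σ) * (dens σ u * ((1 + vel σ u) / (1 - vel σ u))) ∧
      u.1 + stress σ u - 2 * u.2
        = (1 + σ) * (dens σ u / ((1 + vel σ u) / (1 - vel σ u))) ∧
      u.1 - stress σ u = (1 - σ) * dens σ u := by
  obtain ⟨ρ, v, hρ, hv, rfl⟩ := hu
  have hv' := abs_lt.1 hv
  have h1 : 1 - v ≠ 0 := by linarith
  have h2 : 1 + v ≠ 0 := by linarith
  have h3 : 1 - v ^ 2 = (1 - v) * (1 + v) := by ring
  simp only [stress, vel_conserved hσ hσ1 hρ hv, dens_conserved hσ hσ1 hρ hv]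
  simp only [conserved, h3]
  refine ⟨?_, ?_, ?_⟩ <;> field_simp <;> ring

/-- The Rankine-Hugoniot relation in light-cone components. -/
theorem rankineHugoniot_lightcone {σ : ℝ} (hσ : 0 < σ) (hσ1 : σ < 1) {uL uR : ℝ × ℝ} {s : ℝ}
    (hL : uL ∈ physical σ) (hR : uR ∈ physical σ)
    (h : minkFlux σ uR - minkFlux σ uL = s • (uR - uL)) :
    (1 + σ) * (dens σ uR * ((1 + vel σ uR) / (1 - vel σ uR))
        - dens σ uL * ((1 + vel σ uL) / (1 - vel σ uL))) * (1 - s)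
      = (1 - σ) * (dens σ uR - dens σ uL) * (1 + s) ∧
    (1 + σ) * (dens σ uR / ((1 + vel σ uR) / (1 - vel σ uR))
        - dens σ uL / ((1 + vel σ uL) / (1 - vel σ uL))) * (1 + s)
      = (1 - σ) * (dens σ uR - dens σ uL) * (1 - s) := by
  obtain ⟨a1, a2, a3⟩ := lightcone_components hσ hσ1 hL
  obtain ⟨b1, b2, b3⟩ := lightcone_components hσ hσ1 hR
  have h1 : uR.2 - uL.2 = s * (uR.1 - uL.1) := congrArg Prod.fst h
  have h2 : stress σ uR - stress σ uL = s * (uR.2 - uL.2) := congrArg Prod.snd h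
  constructor
  · linear_combination (a1 - b1) * (1 - s) - (a3 - b3) * (1 + s) + 2 * h1 + 2 * h2
  · linear_combination (a2 - b2) * (1 + s) - (a3 - b3) * (1 - s) - 2 * h1 + 2 * h2

/-- The jumps of the rapidity and of the logarithmic density across a shock. -/
theorem shock_sinh_sq {σ : ℝ} (hσ : 0 < σ) (hσ1 : σ < 1) {uL uR : ℝ × ℝ} {s : ℝ}
    (hL : uL ∈ physical σ) (hR : uR ∈ physical σ) (hs : -1 < s) (hs' : s < 1)
    (h : minkFlux σ uR - minkFlux σ uL = s • (uR - uL)) :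
    Real.sinh (rapidity σ uR - rapidity σ uL) ^ 2
      = (2 * (Real.sqrt σ / (1 + σ)) * Real.sinh ((logDens σ uR - logDens σ uL)
          / (2 * (Real.sqrt σ / (1 + σ))))) ^ 2 := by
  obtain ⟨h1, h2⟩ := rankineHugoniot_lightcone hσ hσ1 hL hR h
  set a := Real.sqrt σ / (1 + σ) with ha
  have hs0 := Real.sqrt_pos.2 hσ
  have ha0 : 0 < a := by positivity
  have ha2 : a ^ 2 * (1 + σ) ^ 2 = σ := by
    rw [ha, div_pow, Real.sq_sqrt hσ.le]; field_simp
  rw [← exp_two_mul_rapidity hσ hσ1 hL, ← exp_two_mul_rapidity hσ hσ1 hR,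
    ← exp_logDens hσ hσ1 hL, ← exp_logDens hσ hσ1 hR, ← ha] at h1 h2
  have e1 : ∀ y : ℝ, Real.exp (y / a) = Real.exp (y / (2 * a)) ^ 2 := fun y => by
    rw [← Real.exp_nat_mul]; congr 1; push_cast; field_simp
  have e2 : ∀ y : ℝ, Real.exp (2 * y) = Real.exp y ^ 2 := fun y => by
    rw [← Real.exp_nat_mul]; congr 1
  rw [e1, e1, e2, e2] at h1 h2
  rw [Real.sinh_eq, Real.sinh_eq, sub_div (logDens σ uR)]
  simp only [Real.exp_neg, Real.exp_sub]
  set p := Real.exp (rapidity σ uR)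
  set q := Real.exp (rapidity σ uL)
  set m := Real.exp (logDens σ uR / (2 * a))
  set n := Real.exp (logDens σ uL / (2 * a))
  have hp : 0 < p := Real.exp_pos _
  have hq : 0 < q := Real.exp_pos _
  have hm : 0 < m := Real.exp_pos _
  have hn : 0 < n := Real.exp_pos _
  -- The product of the two light-cone relations carries the factor `(1 - s) * (1 + s)` on both
  -- sides, so the shock speed is eliminated.
  have h3 : (1 + σ) ^ 2 * ((m ^ 2 * p ^ 2 - n ^ 2 * q ^ 2) * (m ^ 2 / p ^ 2 - n ^ 2 / q ^ 2))
      = (1 - σ) ^ 2 * (m ^ 2 - n ^ 2) ^ 2 := by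
    have hne : (1 - s) * (1 + s) ≠ 0 := by
      have : 0 < (1 - s) * (1 + s) := mul_pos (by linarith) (by linarith)
      exact this.ne'
    apply mul_right_cancel₀ hne
    linear_combination (1 + σ) * (m ^ 2 / p ^ 2 - n ^ 2 / q ^ 2) * (1 + s) * h1
      + (1 - σ) * (m ^ 2 - n ^ 2) * (1 + s) * h2
  have h4 : (1 + σ) ^ 2 * ((m ^ 2 * p ^ 2 - n ^ 2 * q ^ 2) * (m ^ 2 * q ^ 2 - n ^ 2 * p ^ 2))
      = (1 - σ) ^ 2 * (m ^ 2 - n ^ 2) ^ 2 * (p ^ 2 * q ^ 2) := by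
    rw [← h3]; field_simp
  -- The product on the left of `h4` is `(m² - n²)² p² q² - m² n² (p² - q²)²`, and `(1 + σ)² - (1 -
  -- σ)² = 4σ`.
  have h5 : (1 + σ) ^ 2 * (m ^ 2 * n ^ 2 * (p ^ 2 - q ^ 2) ^ 2)
      = 4 * σ * (m ^ 2 - n ^ 2) ^ 2 * (p ^ 2 * q ^ 2) := by
    linear_combination -h4
  have h6 : m ^ 2 * n ^ 2 * (p ^ 2 - q ^ 2) ^ 2
      = 4 * a ^ 2 * (m ^ 2 - n ^ 2) ^ 2 * (p ^ 2 * q ^ 2) := by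
    have : (1 + σ) ^ 2 ≠ 0 := by positivity
    apply mul_left_cancel₀ this
    linear_combination h5 - 4 * (m ^ 2 - n ^ 2) ^ 2 * (p ^ 2 * q ^ 2) * ha2
  field_simp
  linear_combination h6

/-- The relation between the strength `x` of an elementary wave, measured by the logarithmic
density, and its strength `h`, measured by the rapidity: rarefaction waves have `x ≤ 0` and shocks
have `x > 0`. -/
def WaveRelation (a x h : ℝ) : Prop :=
  (x ≤ 0 ∧ h = x) ∨ (0 < x ∧ 0 < h ∧ Real.sinh h = 2 * a * Real.sinh (x / (2 * a)))

theorem exp_ratio_lt {σ : ℝ} (hσ : 0 < σ) (hσ1 : σ < 1) {u v : ℝ × ℝ}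
    (hu : u ∈ physical σ) (hv : v ∈ physical σ) (h : rapidity σ u < rapidity σ v) :
    (1 + vel σ u) / (1 - vel σ u) < (1 + vel σ v) / (1 - vel σ v) := by
  rw [← exp_two_mul_rapidity hσ hσ1 hu, ← exp_two_mul_rapidity hσ hσ1 hv, Real.exp_lt_exp]
  linarith

theorem logDens_lt {σ : ℝ} (hσ : 0 < σ) (hσ1 : σ < 1) {u v : ℝ × ℝ}
    (hu : u ∈ physical σ) (h : dens σ u < dens σ v) : logDens σ u < logDens σ v := by
  have hs0 := Real.sqrt_pos.2 hσ
  unfold logDens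
  have := Real.log_lt_log (dens_pos hσ hσ1 hu) h
  gcongr

theorem sub_eq_of_shock {σ c a : ℝ} (hc : 0 < c) {uL uR : ℝ × ℝ}
    (h : c • (minkFlux σ uR - minkFlux σ uL) = a • (uR - uL)) :
    minkFlux σ uR - minkFlux σ uL = (a / c) • (uR - uL) := by
  rw [div_eq_inv_mul, mul_smul, ← h, smul_smul, inv_mul_cancel₀ hc.ne', one_smul]

/-- Across a rarefaction wave the invariant identifies the two strengths and the monotone
characteristic speed fixes their sign. Across a shock the Lax condition makes the rapidity drop, and
the light-cone relation then makes the density rise, which selects the positive root in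
`shock_sinh_sq`. -/
theorem waveRelation_one {σ : ℝ} (hσ : 0 < σ) (hσ1 : σ < 1) {c : ℝ} (hc : 0 < c)
    {uL uM : ℝ × ℝ} (hL : uL ∈ physical σ) (hM : uM ∈ physical σ) {a b : ℝ} {w : ℝ → ℝ × ℝ}
    (h : IsElementaryWave σ c (charSpeed₁ σ) (invariantS σ) uL uM a b w) :
    WaveRelation (Real.sqrt σ / (1 + σ)) (logDens σ uM - logDens σ uL)
      (rapidity σ uL - rapidity σ uM) := by
  rcases h with ⟨-, hRH, h1, h2, -⟩ | ⟨h1, h2, hab, hinv, -⟩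
  · right
    have hRH' := sub_eq_of_shock hc hRH
    rw [← lt_div_iff₀' hc] at h1
    rw [← div_lt_iff₀' hc] at h2
    have hlt := (charSpeed₁_lt_iff hσ hσ1 hM hL).1 (h1.trans h2)
    have bL := charSpeed₁_bounds hσ hσ1 hL
    have bM := charSpeed₁_bounds hσ hσ1 hM
    set s := a / c
    have hvL := abs_lt.1 (abs_vel_lt_one hσ hσ1 hL)
    have hs : -1 < s := by linarith
    have hs' : s < 1 := by linarith
    have hsq := shock_sinh_sq hσ hσ1 hL hM hs hs' hRH'
    obtain ⟨hl, -⟩ := rankineHugoniot_lightcone hσ hσ1 hL hM hRH'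
    have hE := exp_ratio_lt hσ hσ1 hM hL hlt
    have hsE : 1 + s < (1 + vel σ uL) / (1 - vel σ uL) * (1 - s) := by
      rw [div_mul_eq_mul_div, lt_div_iff₀ (by linarith)]
      nlinarith
    have hEL : 0 < (1 + vel σ uL) / (1 - vel σ uL) := div_pos (by linarith) (by linarith)
    -- Otherwise the drop of `ρE`, weighted by `(1 + σ)(1 - s)`, would strictly exceed the drop of
    -- `ρ` weighted by `(1 - σ)(1 + s)`, because `EM < EL` and `1 + s < EL (1 - s)`. The light-cone
    -- relation says that the two are equal.
    have hdens : dens σ uL < dens σ uM := by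
      by_contra! hcon
      have hM0 := dens_pos hσ hσ1 hM
      set EL := (1 + vel σ uL) / (1 - vel σ uL)
      set EM := (1 + vel σ uM) / (1 - vel σ uM)
      have k1 : dens σ uM * EM < dens σ uM * EL := by gcongr
      have k2 : 0 ≤ (dens σ uL - dens σ uM) * (EL * (1 - s) - (1 + s)) :=
        mul_nonneg (by linarith) (by linarith)
      have k3 : 0 < (1 + σ) * ((dens σ uM * EL - dens σ uM * EM) * (1 - s)) :=
        mul_pos (by linarith) (mul_pos (by linarith) (by linarith))
      have k4 : 0 ≤ 2 * σ * ((dens σ uL - dens σ uM) * (EL * (1 - s))) :=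
        mul_nonneg (by linarith) (mul_nonneg (by linarith)
          (mul_nonneg hEL.le (by linarith)))
      have k5 : 0 ≤ (1 - σ) * ((dens σ uL - dens σ uM) * (EL * (1 - s) - (1 + s))) :=
        mul_nonneg (by linarith) k2
      nlinarith
    have hlog := logDens_lt hσ hσ1 hL hdens
    have hs0 := Real.sqrt_pos.2 hσ
    refine ⟨by linarith, by linarith, ?_⟩
    rw [← neg_sub, Real.sinh_neg] at hsq
    rw [neg_sq] at hsq
    refine (sq_eq_sq₀ ?_ ?_).1 hsq
    · exact (Real.sinh_nonneg_iff).2 (by linarith)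
    · have : 0 ≤ Real.sinh ((logDens σ uM - logDens σ uL) / (2 * (√σ / (1 + σ)))) :=
        Real.sinh_nonneg_iff.2 (div_nonneg (by linarith) (by positivity))
      positivity
  · left
    have hle : charSpeed₁ σ uL ≤ charSpeed₁ σ uM := by
      rw [h1, h2] at hab; exact le_of_mul_le_mul_left hab hc
    have hr : rapidity σ uL ≤ rapidity σ uM := by
      by_contra! hcon
      exact absurd ((charSpeed₁_lt_iff hσ hσ1 hM hL).2 hcon) (not_lt.2 hle)
    have hinv' : rapidity σ uM + logDens σ uM = rapidity σ uL + logDens σ uL := hinv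
    constructor <;> linarith

/-- Mirror image of `waveRelation_one`: the other light-cone component is used, and the logarithmic
density is measured from the right state, which lies ahead of a 2-wave. -/
theorem waveRelation_two {σ : ℝ} (hσ : 0 < σ) (hσ1 : σ < 1) {c : ℝ} (hc : 0 < c)
    {uM uR : ℝ × ℝ} (hM : uM ∈ physical σ) (hR : uR ∈ physical σ) {a b : ℝ} {w : ℝ → ℝ × ℝ}
    (h : IsElementaryWave σ c (charSpeed₂ σ) (invariantR σ) uM uR a b w) :
    WaveRelation (Real.sqrt σ / (1 + σ)) (logDens σ uM - logDens σ uR)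
      (rapidity σ uM - rapidity σ uR) := by
  rcases h with ⟨-, hRH, h1, h2, -⟩ | ⟨h1, h2, hab, hinv, -⟩
  · right
    have hRH' := sub_eq_of_shock hc hRH
    rw [← lt_div_iff₀' hc] at h1
    rw [← div_lt_iff₀' hc] at h2
    have hlt := (charSpeed₂_lt_iff hσ hσ1 hR hM).1 (h1.trans h2)
    have bR := charSpeed₂_bounds hσ hσ1 hR
    have bM := charSpeed₂_bounds hσ hσ1 hM
    set s := a / c
    have hvR := abs_lt.1 (abs_vel_lt_one hσ hσ1 hR)
    have hs : -1 < s := by linarith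
    have hs' : s < 1 := by linarith
    have hsq := shock_sinh_sq hσ hσ1 hM hR hs hs' hRH'
    obtain ⟨-, hl⟩ := rankineHugoniot_lightcone hσ hσ1 hM hR hRH'
    have hE := exp_ratio_lt hσ hσ1 hR hM hlt
    have hER : 0 < (1 + vel σ uR) / (1 - vel σ uR) := div_pos (by linarith) (by linarith)
    have hsE : 1 - s < (1 + s) / ((1 + vel σ uR) / (1 - vel σ uR)) := by
      rw [lt_div_iff₀ hER, ← mul_div_assoc, div_lt_iff₀ (by linarith)]
      nlinarith
    have hdens : dens σ uR < dens σ uM := by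
      by_contra! hcon
      have hM0 := dens_pos hσ hσ1 hM
      set ER := (1 + vel σ uR) / (1 - vel σ uR)
      set EM := (1 + vel σ uM) / (1 - vel σ uM)
      have k1 : dens σ uM / EM < dens σ uM / ER := by gcongr
      have k2 : 0 ≤ (dens σ uR - dens σ uM) * ((1 + s) / ER - (1 - s)) :=
        mul_nonneg (by linarith) (by linarith)
      have k3 : 0 < (1 + σ) * ((dens σ uM / ER - dens σ uM / EM) * (1 + s)) :=
        mul_pos (by linarith) (mul_pos (by linarith) (by linarith))
      have k4 : 0 ≤ 2 * σ * ((dens σ uR - dens σ uM) * ((1 + s) / ER)) :=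
        mul_nonneg (by linarith) (mul_nonneg (by linarith)
          (div_nonneg (by linarith) hER.le))
      have k5 : 0 ≤ (1 - σ) * ((dens σ uR - dens σ uM) * ((1 + s) / ER - (1 - s))) :=
        mul_nonneg (by linarith) k2
      simp only [div_eq_mul_inv] at k1 k3 k4 k5 hl
      nlinarith
    have hlog := logDens_lt hσ hσ1 hR hdens
    have hs0 := Real.sqrt_pos.2 hσ
    refine ⟨by linarith, by linarith, ?_⟩
    rw [← neg_sub, Real.sinh_neg, neg_sq, ← neg_sub (logDens σ uM), neg_div, Real.sinh_neg,
      mul_neg, neg_sq] at hsq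
    refine (sq_eq_sq₀ ?_ ?_).1 hsq
    · exact (Real.sinh_nonneg_iff).2 (by linarith)
    · have : 0 ≤ Real.sinh ((logDens σ uM - logDens σ uR) / (2 * (√σ / (1 + σ)))) :=
        Real.sinh_nonneg_iff.2 (div_nonneg (by linarith) (by positivity))
      positivity
  · left
    have hle : charSpeed₂ σ uM ≤ charSpeed₂ σ uR := by
      rw [h1, h2] at hab; exact le_of_mul_le_mul_left hab hc
    have hr : rapidity σ uM ≤ rapidity σ uR := by
      by_contra! hcon
      exact absurd ((charSpeed₂_lt_iff hσ hσ1 hR hM).2 hcon) (not_lt.2 hle)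
    have hinv' : rapidity σ uR - logDens σ uR = rapidity σ uM - logDens σ uM := hinv
    constructor <;> linarith

/-- Inside an elementary wave the wave coordinates deviate from those of the left state by no more
than they do across the whole wave. -/
theorem elementaryWave_norm_le {σ : ℝ} {c : ℝ} (hc : 0 < c) {lam inv : ℝ × ℝ → ℝ}
    (hlam : ∀ u ∈ physical σ, ∀ v ∈ physical σ, lam u < lam v ↔ rapidity σ u < rapidity σ v)
    {ε : ℝ} (hε : |ε| = 1) (hinv : ∀ u, inv u = rapidity σ u + ε * logDens σ u)
    {uL uR : ℝ × ℝ} (hL : uL ∈ physical σ) (hR : uR ∈ physical σ) {a b : ℝ} {w : ℝ → ℝ × ℝ}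
    (h : IsElementaryWave σ c lam inv uL uR a b w) :
    a ≤ b ∧ ∀ ξ ∈ Icc a b, w ξ ∈ physical σ ∧
      ‖waveCoord σ (w ξ) - waveCoord σ uL‖ ≤ ‖waveCoord σ uR - waveCoord σ uL‖ := by
  rcases h with ⟨hab, -, -, -, hw⟩ | ⟨h1, h2, hab, hi, hw⟩
  · refine ⟨hab.le, fun ξ hξ => ?_⟩
    have : ξ = a := le_antisymm (hab ▸ hξ.2) hξ.1
    subst this
    rcases hw with hw | hw <;> rw [hw]
    · exact ⟨hL, by simp⟩
    · exact ⟨hR, le_rfl⟩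
  · refine ⟨hab, fun ξ hξ => ?_⟩
    obtain ⟨hp, hs, hwi⟩ := hw ξ hξ
    refine ⟨hp, ?_⟩
    have hle : ∀ u ∈ physical σ, ∀ v ∈ physical σ, lam u ≤ lam v →
        rapidity σ u ≤ rapidity σ v := fun u hu v hv huv => by
      by_contra! hcon
      exact absurd ((hlam v hv u hu).2 hcon) (not_lt.2 huv)
    have k1 : rapidity σ uL ≤ rapidity σ (w ξ) := hle _ hL _ hp <| by
      have := hξ.1; rw [h1, ← hs] at this; exact le_of_mul_le_mul_left this hc
    have k2 : rapidity σ (w ξ) ≤ rapidity σ uR := hle _ hp _ hR <| by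
      have := hξ.2; rw [h2, ← hs] at this; exact le_of_mul_le_mul_left this hc
    rw [hinv, hinv] at hi hwi
    have e : ∀ y : ℝ, |ε * y| = |y| := fun y => by rw [abs_mul, hε, one_mul]
    -- Along a fan the invariant ties both coordinates together: they move by the same amount up to
    -- sign, so monotonicity of the rapidity controls the sup norm.
    have m1 : |logDens σ (w ξ) - logDens σ uL| = |rapidity σ (w ξ) - rapidity σ uL| := by
      rw [← e, abs_sub_comm (rapidity σ _)]; congr 1; linarith
    have m2 : |logDens σ uR - logDens σ uL| = |rapidity σ uR - rapidity σ uL| := by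
      rw [← e, abs_sub_comm (rapidity σ _)]; congr 1; linarith
    simp only [waveCoord, Prod.norm_def, Prod.mk_sub_mk, Real.norm_eq_abs, m1, m2, max_self]
    rw [abs_of_nonneg (by linarith), abs_of_nonneg (by linarith)]
    linarith

/-- Convexity of `sinh` on the half line together with `sinh 0 = 0`. -/
theorem mul_sinh_le {l x : ℝ} (hl : 0 ≤ l) (hl1 : l ≤ 1) (hx : 0 ≤ x) :
    Real.sinh (l * x) ≤ l * Real.sinh x := by
  have hconv : ConvexOn ℝ (Ici 0) Real.sinh := by
    refine MonotoneOn.convexOn_of_deriv (convex_Ici 0) Real.continuous_sinh.continuousOn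
      Real.differentiable_sinh.differentiableOn ?_
    rw [Real.deriv_sinh]
    intro a ha b hb hab
    rw [interior_Ici] at ha hb
    refine Real.cosh_le_cosh.2 ?_
    rwa [abs_of_pos ha, abs_of_pos hb]
  have := hconv.2 (x := x) (y := 0) hx (mem_Ici.2 le_rfl) hl (sub_nonneg.2 hl1) (by ring)
  simpa using this

theorem sinh_le_mul_cosh {x : ℝ} (hx : 0 ≤ x) : Real.sinh x ≤ x * Real.cosh x := by
  have hd : ∀ y : ℝ, HasDerivAt (fun y => y * Real.cosh y - Real.sinh y)
      (y * Real.sinh y) y := fun y => by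
    have := ((hasDerivAt_id y).mul (Real.hasDerivAt_cosh y)).sub (Real.hasDerivAt_sinh y)
    exact this.congr_deriv (by simp)
  have hm : MonotoneOn (fun y => y * Real.cosh y - Real.sinh y) (Ici 0) := by
    refine monotoneOn_of_deriv_nonneg (convex_Ici 0)
      (fun y _ => (hd y).continuousAt.continuousWithinAt)
      (fun y _ => (hd y).differentiableAt.differentiableWithinAt) fun y hy => ?_
    rw [interior_Ici] at hy
    rw [(hd y).deriv]
    exact mul_nonneg (le_of_lt hy) (Real.sinh_nonneg_iff.2 (le_of_lt hy))
  have := hm (mem_Ici.2 le_rfl) hx hx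
  simp at this
  linarith

/-- For shocks, `2a ≤ 1` and convexity give `sinh x ≤ 2a sinh (x / 2a) = sinh h`. This one-sided
comparison is all that locating the middle state requires. -/
theorem WaveRelation.le {a x h : ℝ} (ha : 0 < a) (ha1 : 2 * a ≤ 1) (hw : WaveRelation a x h) :
    x ≤ h := by
  rcases hw with ⟨-, rfl⟩ | ⟨hx, hh, hs⟩
  · exact le_rfl
  · rw [← Real.sinh_le_sinh, hs]
    have := mul_sinh_le (x := x / (2 * a)) (by positivity) ha1 (by positivity)
    rwa [mul_div_cancel₀ _ (by positivity)] at this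

/-- The slope of a shock curve is bounded on bounded intervals: `sinh y ≤ y cosh y` with `y = x /
2a` produces the factor `cosh (δ / 2a)`. -/
theorem WaveRelation.abs_le_mul {a x h δ : ℝ} (ha : 0 < a) (hw : WaveRelation a x h) (hδ : |x| ≤ δ) :
    |h| ≤ Real.cosh (δ / (2 * a)) * δ := by
  have h0 : 0 ≤ δ := (abs_nonneg _).trans hδ
  rcases hw with ⟨-, rfl⟩ | ⟨hx, hh, hs⟩
  · nlinarith [Real.one_le_cosh (δ / (2 * a))]
  · rw [abs_of_pos hh]
    rw [abs_of_pos hx] at hδ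
    have h1 : h ≤ Real.sinh h := Real.self_le_sinh_iff.2 hh.le
    have h2 := sinh_le_mul_cosh (x := x / (2 * a)) (by positivity)
    have h3 : Real.cosh (x / (2 * a)) ≤ Real.cosh (δ / (2 * a)) := by
      refine Real.cosh_le_cosh.2 ?_
      rw [abs_of_pos (by positivity), abs_of_nonneg (by positivity)]
      gcongr
    calc h ≤ 2 * a * Real.sinh (x / (2 * a)) := hs ▸ h1
      _ ≤ 2 * a * (x / (2 * a) * Real.cosh (x / (2 * a))) := by gcongr
      _ = Real.cosh (x / (2 * a)) * x := by field_simp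
      _ ≤ _ := by gcongr

/-- The middle state of two waves: the strengths of both are controlled by the distance of the outer
states. -/
theorem WaveRelation.middle {a x₁ h₁ x₂ h₂ : ℝ} (ha : 0 < a) (ha1 : 2 * a ≤ 1)
    (hw₁ : WaveRelation a x₁ h₁) (hw₂ : WaveRelation a x₂ h₂) :
    |x₁| ≤ |h₁ + h₂| + |x₁ - x₂| ∧ |x₂| ≤ |h₁ + h₂| + |x₁ - x₂| := by
  have l₁ := hw₁.le ha ha1
  have l₂ := hw₂.le ha ha1
  have a1 := le_abs_self (h₁ + h₂)
  have a2 := neg_abs_le (h₁ + h₂)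
  have a3 := le_abs_self (x₁ - x₂)
  have a4 := neg_abs_le (x₁ - x₂)
  -- If `x₁` and `x₂` have the same sign, `h₁` and `h₂` share it and `|x₁| + |x₂| ≤ |h₁ + h₂|`. If
  -- the signs are opposite, `|x₁| + |x₂| = |x₁ - x₂|`.
  rcases hw₁ with ⟨p₁, q₁⟩ | ⟨p₁, q₁, -⟩ <;> rcases hw₂ with ⟨p₂, q₂⟩ | ⟨p₂, q₂, -⟩ <;>
    constructor <;> rw [abs_le] <;> constructor <;> linarith

/-- In the notation of `WaveRelation`, `h₁ + h₂` and `x₁ - x₂` are, up to sign, the coordinate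
differences of the data. So both wave strengths are at most `2d` in logarithmic density and at most
`2Ld` in rapidity; two waves in a row account for the factor `4`. -/
theorem riemann_waveCoord_bound {σ : ℝ} (hσ : 0 < σ) (hσ1 : σ < 1) {c : ℝ} (hc : 0 < c)
    {uL uR : ℝ × ℝ} (hL : uL ∈ physical σ) (hR : uR ∈ physical σ) {w : ℝ → ℝ × ℝ}
    (h : IsRiemannSolution σ c uL uR w) (ξ : ℝ) :
    w ξ ∈ physical σ ∧ ‖waveCoord σ (w ξ) - waveCoord σ uL‖ ≤
      4 * Real.cosh (2 * ‖waveCoord σ uR - waveCoord σ uL‖ / (2 * (Real.sqrt σ / (1 + σ))))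
        * ‖waveCoord σ uR - waveCoord σ uL‖ := by
  obtain ⟨uM, a₁, b₁, a₂, b₂, hM, hba, hw₁, hw₂, hl, hm, hr⟩ := h
  set a := Real.sqrt σ / (1 + σ) with ha
  set d := ‖waveCoord σ uR - waveCoord σ uL‖ with hd
  have hs0 := Real.sqrt_pos.2 hσ
  have ha0 : 0 < a := by positivity
  have ha1 : 2 * a ≤ 1 := by
    rw [ha, ← mul_div_assoc, div_le_one (by positivity)]
    nlinarith [Real.sq_sqrt hσ.le, sq_nonneg (√σ - 1)]
  have r₁ := waveRelation_one hσ hσ1 hc hL hM hw₁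
  have r₂ := waveRelation_two hσ hσ1 hc hM hR hw₂
  have d1 : |rapidity σ uR - rapidity σ uL| ≤ d := norm_fst_le (waveCoord σ uR - waveCoord σ uL)
  have d2 : |logDens σ uR - logDens σ uL| ≤ d := norm_snd_le (waveCoord σ uR - waveCoord σ uL)
  obtain ⟨m₁, m₂⟩ := WaveRelation.middle ha0 ha1 r₁ r₂
  have e1 : |rapidity σ uL - rapidity σ uM + (rapidity σ uM - rapidity σ uR)| ≤ d := by
    rw [abs_sub_comm] at d1; convert d1 using 2; ring
  have e2 : |logDens σ uM - logDens σ uL - (logDens σ uM - logDens σ uR)| ≤ d := by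
    convert d2 using 2; ring
  have n₁ : |logDens σ uM - logDens σ uL| ≤ 2 * d := by linarith
  have n₂ : |logDens σ uM - logDens σ uR| ≤ 2 * d := by linarith
  have k₁ := r₁.abs_le_mul ha0 n₁
  have k₂ := r₂.abs_le_mul ha0 n₂
  set L := Real.cosh (2 * d / (2 * a))
  have hL1 : 1 ≤ L := Real.one_le_cosh _
  have hd0 : 0 ≤ d := norm_nonneg _
  have hLd : 2 * d ≤ L * (2 * d) := by nlinarith
  have s₁ : ‖waveCoord σ uM - waveCoord σ uL‖ ≤ 2 * L * d := by
    rw [Prod.norm_def]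
    refine max_le ?_ ?_
    · show |rapidity σ uM - rapidity σ uL| ≤ _
      rw [abs_sub_comm]; linarith
    · show |logDens σ uM - logDens σ uL| ≤ _
      linarith
  have s₂ : ‖waveCoord σ uR - waveCoord σ uM‖ ≤ 2 * L * d := by
    rw [Prod.norm_def]
    refine max_le ?_ ?_
    · show |rapidity σ uR - rapidity σ uM| ≤ _
      rw [abs_sub_comm]; linarith
    · show |logDens σ uR - logDens σ uM| ≤ _
      rw [abs_sub_comm]; linarith
  obtain ⟨hab₁, f₁⟩ := elementaryWave_norm_le hc (fun u hu v hv => charSpeed₁_lt_iff hσ hσ1 hu hv)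
    (ε := 1) (by simp) (fun u => by rw [one_mul]; rfl) hL hM hw₁
  obtain ⟨hab₂, f₂⟩ := elementaryWave_norm_le hc (fun u hu v hv => charSpeed₂_lt_iff hσ hσ1 hu hv)
    (ε := -1) (by simp) (fun u => by rw [neg_one_mul, ← sub_eq_add_neg]; rfl) hM hR hw₂
  have hLd0 : 0 ≤ L * d := by positivity
  rcases lt_or_ge ξ a₁ with h | h
  · rw [hl ξ h]; exact ⟨hL, by simp; positivity⟩
  rcases le_or_gt ξ b₁ with h' | h'
  · obtain ⟨p, q⟩ := f₁ ξ ⟨h, h'⟩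
    exact ⟨p, by linarith⟩
  rcases lt_or_ge ξ a₂ with h'' | h''
  · rw [hm ξ h' h'']; exact ⟨hM, by linarith⟩
  rcases le_or_gt ξ b₂ with h''' | h'''
  · obtain ⟨p, q⟩ := f₂ ξ ⟨h'', h'''⟩
    refine ⟨p, ?_⟩
    have := norm_sub_le_norm_sub_add_norm_sub (waveCoord σ (w ξ)) (waveCoord σ uM)
      (waveCoord σ uL)
    linarith
  · rw [hr ξ h''']
    exact ⟨hR, by change d ≤ _; nlinarith⟩

/-- For states in a compact set, all values of the solution of the Riemann problem lie in a compact
set of physical states, at a distance from the data that is linear in the size of the jump. -/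
theorem exists_riemann_bound {σ : ℝ} (hσ : 0 < σ) (hσ1 : σ < 1) {K : Set (ℝ × ℝ)}
    (hK : IsCompact K) (hKp : K ⊆ physical σ) :
    ∃ (D : ℝ) (K₁ : Set (ℝ × ℝ)), 0 < D ∧ IsCompact K₁ ∧ K₁ ⊆ physical σ ∧
      ∀ c > 0, ∀ uL ∈ K, ∀ uR ∈ K, ∀ w, IsRiemannSolution σ c uL uR w → ∀ ξ,
        w ξ ∈ K₁ ∧ ‖w ξ - uL‖ ≤ D * ‖uR - uL‖ := by
  obtain ⟨L, hL⟩ := exists_lipschitzOnWith_of_contDiffAt hK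
    fun u hu => contDiffAt_waveCoord hσ hσ1 (hKp hu)
  obtain ⟨R, hR⟩ := (hK.image_of_continuousOn hL.continuousOn).isBounded.exists_norm_le
  have hR' : ∀ u ∈ K, ‖waveCoord σ u‖ ≤ R := fun u hu => hR _ (mem_image_of_mem _ hu)
  set a := Real.sqrt σ / (1 + σ) with ha
  have hs0 := Real.sqrt_pos.2 hσ
  have ha0 : 0 < a := by positivity
  -- Wave coordinates of `K` have norm at most `R`, so a jump is at most `2R` and the hyperbolic
  -- cosine in `riemann_waveCoord_bound` becomes a constant.
  set Q := 4 * Real.cosh (2 * (2 * R) / (2 * a)) with hQ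
  have hQ0 : 0 < Q := by have := Real.cosh_pos (2 * (2 * R) / (2 * a)); positivity
  set R₁ := R + Q * (2 * R)
  -- The image of this ball under `ofWaveCoord` serves as `K₁`; the Lipschitz constant there carries
  -- the estimate back to conserved variables.
  obtain ⟨L', hL'⟩ := exists_lipschitzOnWith_of_contDiffAt (isCompact_closedBall (0 : ℝ × ℝ) R₁)
    fun u _ => (contDiff_ofWaveCoord σ).contDiffAt
  refine ⟨L' * (Q * L) + 1, ofWaveCoord σ '' Metric.closedBall 0 R₁, by positivity,
    (isCompact_closedBall 0 R₁).image (contDiff_ofWaveCoord σ).continuous, ?_, ?_⟩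
  · rintro _ ⟨z, -, rfl⟩
    exact ofWaveCoord_physical σ z
  intro c hc uL huL uR huR w hw ξ
  obtain ⟨hp, hb⟩ := riemann_waveCoord_bound hσ hσ1 hc (hKp huL) (hKp huR) hw ξ
  have h1 := hR' uL huL
  have h2 := hR' uR huR
  have hd : ‖waveCoord σ uR - waveCoord σ uL‖ ≤ 2 * R := by
    refine (norm_sub_le _ _).trans (by linarith)
  have hb' : ‖waveCoord σ (w ξ) - waveCoord σ uL‖ ≤ Q * ‖waveCoord σ uR - waveCoord σ uL‖ := by
    refine hb.trans ?_
    gcongr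
    rw [hQ]
    gcongr
    refine Real.cosh_le_cosh.2 ?_
    rw [abs_of_nonneg (by positivity), abs_of_nonneg]
    · gcongr
    · have : 0 ≤ R := (norm_nonneg _).trans h1
      positivity
  have hR0 : 0 ≤ R := (norm_nonneg _).trans h1
  have hw1 : waveCoord σ (w ξ) ∈ Metric.closedBall (0 : ℝ × ℝ) R₁ := by
    rw [mem_closedBall_zero_iff]
    have : ‖waveCoord σ (w ξ)‖ ≤ ‖waveCoord σ (w ξ) - waveCoord σ uL‖ + ‖waveCoord σ uL‖ := by
      simpa using norm_add_le (waveCoord σ (w ξ) - waveCoord σ uL) (waveCoord σ uL)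
    have h3 : Q * ‖waveCoord σ uR - waveCoord σ uL‖ ≤ Q * (2 * R) := by gcongr
    linarith
  have hL1 : waveCoord σ uL ∈ Metric.closedBall (0 : ℝ × ℝ) R₁ := by
    rw [mem_closedBall_zero_iff]
    have : 0 ≤ Q * (2 * R) := by positivity
    linarith
  refine ⟨⟨_, hw1, ofWaveCoord_waveCoord hσ hσ1 hp⟩, ?_⟩
  have h4 := hL'.norm_sub_le hw1 hL1
  rw [ofWaveCoord_waveCoord hσ hσ1 hp, ofWaveCoord_waveCoord hσ hσ1 (hKp huL)] at h4
  have h5 := hL.norm_sub_le huR huL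
  calc ‖w ξ - uL‖ ≤ L' * ‖waveCoord σ (w ξ) - waveCoord σ uL‖ := h4
    _ ≤ L' * (Q * (L * ‖uR - uL‖)) := by gcongr; exact hb'.trans (by gcongr)
    _ ≤ (L' * (Q * L) + 1) * ‖uR - uL‖ := by nlinarith [norm_nonneg (uR - uL)]

/-! ### The mesh -/

section Mesh

variable {rmin rmax : ℝ} {n : ℕ}

theorem meshWidth_pos (hr : rmin < rmax) (hn : 2 ≤ n) : 0 < meshWidth rmin rmax n := by
  have : (2 : ℝ) ≤ n := by exact_mod_cast hn
  exact div_pos (by linarith) (by linarith)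

theorem meshWidth_mul (hn : 2 ≤ n) : ((n : ℝ) - 1) * meshWidth rmin rmax n = rmax - rmin := by
  have : (2 : ℝ) ≤ n := by exact_mod_cast hn
  rw [meshWidth, mul_div_cancel₀]
  linarith

theorem gridPoint_one : gridPoint rmin rmax n 1 = rmin := by simp [gridPoint]

theorem gridPoint_last (hn : 2 ≤ n) : gridPoint rmin rmax n n = rmax := by
  rw [gridPoint, meshWidth_mul hn]; ring

theorem gridPoint_succ (i : ℕ) :
    gridPoint rmin rmax n (i + 1) = gridPoint rmin rmax n i + meshWidth rmin rmax n := by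
  simp only [gridPoint]; push_cast; ring

theorem gridPoint_mono (hr : rmin < rmax) (hn : 2 ≤ n) : Monotone (gridPoint rmin rmax n) :=
  monotone_nat_of_le_succ fun i => by
    rw [gridPoint_succ]; linarith [meshWidth_pos hr hn]

theorem gridPoint_mem (hr : rmin < rmax) (hn : 2 ≤ n) {i : ℕ} (hi : i ∈ Icc 1 n) :
    gridPoint rmin rmax n i ∈ Icc rmin rmax := by
  have h1 := gridPoint_mono hr hn hi.1
  have h2 := gridPoint_mono hr hn hi.2
  rw [gridPoint_one] at h1
  rw [gridPoint_last hn] at h2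
  exact ⟨h1, h2⟩

theorem halfPoint_mem (hr : rmin < rmax) (hn : 2 ≤ n) (hm : meshWidth rmin rmax n ≤ rmin)
    {i : ℕ} (hi : i ∈ Icc 1 n) : halfPoint rmin rmax n i ∈ Icc (rmin / 2) rmax := by
  have h1 := gridPoint_mem hr hn hi
  have h2 := meshWidth_pos hr hn
  rw [halfPoint]
  constructor <;> linarith [h1.1, h1.2]

theorem halfPoint_succ (i : ℕ) :
    halfPoint rmin rmax n (i + 1) = halfPoint rmin rmax n i + meshWidth rmin rmax n := by
  simp only [halfPoint, gridPoint_succ]; ring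

theorem card_mul_meshWidth_le (hr : rmin < rmax) (hn : 2 ≤ n) :
    (n : ℝ) * meshWidth rmin rmax n ≤ 2 * (rmax - rmin) := by
  have h1 := meshWidth_mul (rmin := rmin) (rmax := rmax) hn
  have h2 := meshWidth_pos hr hn
  have : (2 : ℝ) ≤ n := by exact_mod_cast hn
  nlinarith

end Mesh

/-! ### Uniform estimates on one mesh -/

section Estimates

variable {σ rmin rmax t0 tend : ℝ} {Mb Bb : ℝ → ℝ} {u₀ : ℝ → ℝ × ℝ} {A₀ B₀ : ℝ → ℝ} {n : ℕ}

/-- The bounds that the theorem assumes of each approximate solution. -/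
structure GodunovApproximation.IsBoundedBy
    (S : GodunovApproximation σ rmin rmax t0 tend Mb Bb u₀ A₀ B₀ n)
    (K : Set (ℝ × ℝ)) (C : ℝ) (V : NNReal) : Prop where
  state_mem : ∀ j, S.t j < tend → ∀ i ≤ n + 1, S.u i j ∈ K
  metric_mem : ∀ j, S.t j < tend → ∀ i ∈ Finset.Icc 1 (n + 1),
    S.A i j ∈ Icc C⁻¹ C ∧ S.B i j ∈ Icc C⁻¹ C
  variation : ∀ j, S.t j < tend → eVariationOn (fun x => S.uApp (S.t j) x) (Icc rmin rmax) ≤ V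

theorem sqrt_mul_mem {A B C : ℝ} (hC : 0 < C) (hA : A ∈ Icc C⁻¹ C) (hB : B ∈ Icc C⁻¹ C) :
    Real.sqrt (A * B) ∈ Icc C⁻¹ C := by
  have hC' := inv_pos.2 hC
  constructor
  · apply Real.le_sqrt_of_sq_le
    rw [sq]
    exact mul_le_mul hA.1 hB.1 hC'.le (hC'.le.trans hA.1)
  · exact sqrt_mul_le (hC'.le.trans hA.1) hA.2 hB.2

variable {S : GodunovApproximation σ rmin rmax t0 tend Mb Bb u₀ A₀ B₀ n} {K : Set (ℝ × ℝ)} {C : ℝ}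
  {V : NNReal}

/-- As `√(AB)` lies in `[C⁻¹, C]`, the time step and the mesh width bound each other, so that
`O(Δx)` and `O(Δt)` are interchangeable below. -/
theorem GodunovApproximation.IsBoundedBy.time_step (hS : S.IsBoundedBy K C V) (hC : 0 < C)
    (hr : rmin < rmax) {j : ℕ} (hj : S.t j < tend) :
    meshWidth rmin rmax n ≤ 2 * C * (S.t (j + 1) - S.t j) ∧
      S.t (j + 1) - S.t j ≤ C / 2 * meshWidth rmin rmax n := by
  have hm := meshWidth_pos hr S.two_le
  have hC' := inv_pos.2 hC
  rw [S.time_succ j hj, add_sub_cancel_left, timeStep]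
  constructor
  · rw [← div_le_iff₀' (by positivity)]
    refine Finset.le_inf' _ _ fun i hi => ?_
    obtain ⟨hA, hB⟩ := hS.metric_mem j hj i hi
    have h := sqrt_mul_mem hC hA hB
    have : 0 < √(S.A i j * S.B i j) := hC'.trans_le h.1
    gcongr
    exact h.2
  · have h1 : 1 ∈ Finset.Icc 1 (n + 1) := by simp
    refine (Finset.inf'_le _ h1).trans ?_
    obtain ⟨hA, hB⟩ := hS.metric_mem j hj 1 h1
    have h := sqrt_mul_mem hC hA hB
    have h0 : 0 < √(S.A 1 j * S.B 1 j) := hC'.trans_le h.1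
    rw [div_le_iff₀ (by positivity)]
    have : 1 ≤ C * √(S.A 1 j * S.B 1 j) := by
      have := mul_le_mul_of_nonneg_left h.1 hC.le
      rwa [mul_inv_cancel₀ hC.ne'] at this
    nlinarith

theorem GodunovApproximation.IsBoundedBy.time_lt (hS : S.IsBoundedBy K C V) (hC : 0 < C)
    (hr : rmin < rmax) {j : ℕ} (hj : S.t j < tend) : S.t j < S.t (j + 1) := by
  have hm := meshWidth_pos hr S.two_le
  have := (hS.time_step hC hr hj).1
  have : 0 < 2 * C * (S.t (j + 1) - S.t j) := hm.trans_le this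
  have := (pos_iff_pos_of_mul_pos this).1 (by positivity)
  linarith

theorem isODEStep_zero {A B x : ℝ} {u v : ℝ × ℝ} (h : IsODEStep σ A B x 0 u v) : v = u := by
  obtain ⟨y, h1, h2, -⟩ := h
  rw [← h1, ← h2]

/-- The point `x_i` is the left end of Riemann cell `i + 1` and lies to the left of its
discontinuity. At elapsed time zero the value there is the left state, on which the ODE has not yet
acted. -/
theorem GodunovApproximation.IsBoundedBy.uApp_gridPoint (hS : S.IsBoundedBy K C V) (hC : 0 < C)
    (hr : rmin < rmax) {j : ℕ} (hj : S.t j < tend) {i : ℕ} (hi : i ∈ Icc 1 n) :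
    S.uApp (S.t j) (gridPoint rmin rmax n i) = S.u i j := by
  have hm := meshWidth_pos hr S.two_le
  have hx := gridPoint_mem hr S.two_le hi
  obtain ⟨h, -⟩ := S.approx j hj (i + 1) (by have := hi.2; simp; omega) (S.t j) (gridPoint rmin rmax n i) le_rfl
    (hS.time_lt hC hr hj) hj le_rfl (by rw [gridPoint_succ]; linarith) hx.1 hx.2
  rw [sub_self] at h
  rw [isODEStep_zero h, riemannValue, if_pos rfl, if_pos, Nat.add_sub_cancel]
  rw [halfPoint, gridPoint_succ]
  linarith

/-- The variation is sampled at the gridpoints. The two jumps to the ghost states are not covered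
and have to be treated separately wherever they occur. -/
theorem GodunovApproximation.IsBoundedBy.sum_variation_le (hS : S.IsBoundedBy K C V) (hC : 0 < C)
    (hr : rmin < rmax) {j : ℕ} (hj : S.t j < tend) :
    ∑ i ∈ Finset.Ico 1 n, ‖S.u (i + 1) j - S.u i j‖ ≤ V := by
  have h := (eVariationOn.sum_le_of_monotoneOn_Icc (f := fun x => S.uApp (S.t j) x)
    (s := Icc rmin rmax) (m := 1) (n := n) ((gridPoint_mono hr S.two_le).monotoneOn _)
    (fun i hi => gridPoint_mem hr S.two_le hi)).trans (hS.variation j hj)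
  have h2 : ∑ i ∈ Finset.Ico 1 n, edist (S.uApp (S.t j) (gridPoint rmin rmax n (i + 1)))
      (S.uApp (S.t j) (gridPoint rmin rmax n i))
      = ENNReal.ofReal (∑ i ∈ Finset.Ico 1 n, ‖S.u (i + 1) j - S.u i j‖) := by
    rw [ENNReal.ofReal_sum_of_nonneg fun i _ => norm_nonneg _]
    refine Finset.sum_congr rfl fun i hi => ?_
    rw [Finset.mem_Ico] at hi
    rw [hS.uApp_gridPoint hC hr hj ⟨by omega, by omega⟩,
      hS.uApp_gridPoint hC hr hj ⟨by omega, by omega⟩, edist_dist, dist_eq_norm]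
  rw [h2] at h
  rwa [ENNReal.ofReal_le_iff_le_toReal (by simp), ENNReal.coe_toReal] at h

theorem riemannValue_mem {uL uR : ℝ × ℝ} {w : ℝ → ℝ × ℝ} {τ y : ℝ} {K₁ : Set (ℝ × ℝ)} {D : ℝ}
    (hD : 0 ≤ D) (hL : uL ∈ K) (hR : uR ∈ K) (h : ∀ ξ, w ξ ∈ K₁ ∧ ‖w ξ - uL‖ ≤ D * ‖uR - uL‖) :
    riemannValue uL uR w τ y ∈ K ∪ K₁ ∧
      ‖riemannValue uL uR w τ y - uR‖ ≤ (D + 1) * ‖uR - uL‖ := by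
  have h0 : 0 ≤ D * ‖uR - uL‖ := by positivity
  rw [riemannValue]
  split_ifs
  · exact ⟨Or.inl hL, by rw [norm_sub_rev]; linarith⟩
  · exact ⟨Or.inl hR, by rw [sub_self, norm_zero]; positivity⟩
  · obtain ⟨h1, h2⟩ := h (y / τ)
    refine ⟨Or.inr h1, ?_⟩
    have := norm_sub_le_norm_sub_add_norm_sub (w (y / τ)) uL uR
    rw [norm_sub_rev uL uR] at this
    linarith

/-- The two half cells use different metrics, so the fluxes of the central state do not cancel. What
remains, `(c' - c) • minkFlux`, is the discrete form of `h · ∇_A f`. -/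
theorem godunovAverage_eq (Δt Δx A B A' B' : ℝ) (uStarL uC uStarR : ℝ × ℝ) :
    godunovAverage σ Δt Δx A B A' B' uStarL uC uStarR
      = uC - (Δt / Δx) • ((flux σ A' B' uStarR - flux σ A B uStarL)
        - (Real.sqrt (A' * B') - Real.sqrt (A * B)) • minkFlux σ uC) := by
  rw [godunovAverage, sub_smul]
  change _ = uC - (Δt / Δx) • ((flux σ A' B' uStarR - flux σ A B uStarL)
    - (flux σ A' B' uC - flux σ A B uC))
  module

theorem exists_lipschitzOnWith_minkFlux (hσ : 0 < σ) (hσ1 : σ < 1) {K : Set (ℝ × ℝ)}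
    (hK : IsCompact K) (hKp : K ⊆ physical σ) : ∃ L, LipschitzOnWith L (minkFlux σ) K :=
  exists_lipschitzOnWith_of_contDiffAt hK
    fun _ hu => contDiffAt_snd.prodMk (contDiffAt_stress hσ hσ1 (hKp hu))

/-- The estimates on the Riemann and ODE steps, with a constant that does not depend on the mesh. -/
structure GodunovApproximation.StepEstimates
    (S : GodunovApproximation σ rmin rmax t0 tend Mb Bb u₀ A₀ B₀ n) (D : ℝ) : Prop where
  star_physical : ∀ j, S.t j < tend → ∀ i ∈ Icc 1 (n + 1), S.w i j 0 ∈ physical σ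
  star_norm : ∀ j, S.t j < tend → ∀ i ∈ Icc 1 (n + 1), ‖S.w i j 0‖ ≤ D
  star_sub : ∀ j, S.t j < tend → ∀ i ∈ Icc 1 (n + 1),
    ‖S.w i j 0 - S.u i j‖ ≤ D * ‖S.u i j - S.u (i - 1) j‖
  approx_sub : ∀ j, S.t j < tend → ∀ i ∈ Icc 1 (n + 1), ∀ τ x : ℝ, S.t j ≤ τ → τ < S.t (j + 1) →
    τ < tend → gridPoint rmin rmax n (i - 1) ≤ x → x < gridPoint rmin rmax n i →
    rmin ≤ x → x ≤ rmax →
    ‖S.uApp τ x - S.u i j‖ ≤ D * (‖S.u i j - S.u (i - 1) j‖ + meshWidth rmin rmax n)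
  update : ∀ j, S.t (j + 1) < tend → S.t j < tend → ∀ i ∈ Icc 1 n, ∃ q uBar : ℝ × ℝ,
    q ∈ physical σ ∧ ‖q - uBar‖ ≤ D * meshWidth rmin rmax n ∧
    ‖uBar - S.u i j‖ ≤ D * (‖S.u i j - S.u (i - 1) j‖ + ‖S.u (i + 1) j - S.u i j‖) ∧
    uBar = S.u i j - ((S.t (j + 1) - S.t j) / meshWidth rmin rmax n) •
        ((flux σ (S.A (i + 1) j) (S.B (i + 1) j) (S.w (i + 1) j 0)
            - flux σ (S.A i j) (S.B i j) (S.w i j 0))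
          - (Real.sqrt (S.A (i + 1) j * S.B (i + 1) j) - Real.sqrt (S.A i j * S.B i j))
            • minkFlux σ (S.u i j)) ∧
    ‖odeSource σ ((S.A i j + S.A (i + 1) j) / 2) ((S.B i j + S.B (i + 1) j) / 2) q
        (gridPoint rmin rmax n i)‖ ≤ D ∧
    S.u i (j + 1) = uBar + (S.t (j + 1) - S.t j) •
      odeSource σ ((S.A i j + S.A (i + 1) j) / 2) ((S.B i j + S.B (i + 1) j) / 2) q
        (gridPoint rmin rmax n i)

theorem norm_flux_sub_le {A B C : ℝ} (hC : 0 < C) (hA : A ∈ Icc C⁻¹ C) (hB : B ∈ Icc C⁻¹ C)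
    {L : NNReal} {K : Set (ℝ × ℝ)} (hL : LipschitzOnWith L (minkFlux σ) K) {u v : ℝ × ℝ}
    (hu : u ∈ K) (hv : v ∈ K) : ‖flux σ A B u - flux σ A B v‖ ≤ C * (L * ‖u - v‖) := by
  have h1 := sqrt_mul_mem hC hA hB
  rw [flux, flux, ← smul_sub, norm_smul, Real.norm_of_nonneg (Real.sqrt_nonneg _)]
  exact mul_le_mul h1.2 (hL.norm_sub_le hu hv) (norm_nonneg _) hC.le

/-- Riemann values differ from their data linearly in the jump, the Godunov average inherits this
through the Lipschitz flux, and the ODE acts for a time `O(Δx)` with a bounded right-hand side. -/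
theorem exists_stepEstimates (hσ : 0 < σ) (hσ1 : σ < 1) (hrmin : 0 < rmin) (hr : rmin < rmax)
    (hK : IsCompact K) (hKp : K ⊆ physical σ) (hC : 0 < C) (V : NNReal) :
    ∃ D h₀ : ℝ, 0 < D ∧ 0 < h₀ ∧ ∀ (n : ℕ)
      (S : GodunovApproximation σ rmin rmax t0 tend Mb Bb u₀ A₀ B₀ n), S.IsBoundedBy K C V →
      meshWidth rmin rmax n ≤ h₀ → S.StepEstimates D := by
  obtain ⟨D₁, K₁, hD₁, hK₁, hK₁p, hRP⟩ := exists_riemann_bound hσ hσ1 hK hKp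
  have hK₂c : IsCompact (K ∪ K₁) := hK.union hK₁
  obtain ⟨L, hL⟩ := exists_lipschitzOnWith_minkFlux hσ hσ1 hK₂c (union_subset hKp hK₁p)
  obtain ⟨R, hR⟩ := hK₂c.isBounded.exists_norm_le
  set P := C / 2 * C * L * (2 * (D₁ + 1)) with hP
  have hP0 : 0 ≤ P := by positivity
  -- The Godunov averages may leave `K`. They move by at most `P` times two jumps, each at most
  -- `2R`, which gives the radius on which the ODE has to be controlled.
  obtain ⟨G, hG0, hG⟩ := exists_odeStep_bound hσ hσ1 hrmin rmax hC (R + P * (2 * R + 2 * R))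
  have hGC : 0 ≤ G * (C / 2) := by positivity
  obtain ⟨D, hD, hD1, hDR, hDP, hDG, hDGC⟩ : ∃ D, 0 < D ∧ D₁ + 1 ≤ D ∧ R ≤ D ∧ P ≤ D ∧ G ≤ D ∧
      G * (C / 2) ≤ D := by
    have h1 := abs_nonneg R
    have h2 := le_abs_self R
    exact ⟨D₁ + 1 + |R| + P + G + G * (C / 2), by positivity, by linarith, by linarith,
      by linarith, by linarith, by linarith⟩
  -- A time step is at most `C / 2 * Δx`, so this threshold ensures `G * Δt ≤ 1`, as
  -- `exists_odeStep_bound` requires.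
  refine ⟨D, (G * (C / 2))⁻¹, hD, by positivity, fun n S hS hm => ?_⟩
  have hm0 := meshWidth_pos hr S.two_le
  have hRPS : ∀ j, S.t j < tend → ∀ i ∈ Icc 1 (n + 1), ∀ ξ,
      S.w i j ξ ∈ K₁ ∧ ‖S.w i j ξ - S.u (i - 1) j‖ ≤ D₁ * ‖S.u i j - S.u (i - 1) j‖ := by
    intro j hj i hi
    have hi' : i ∈ Finset.Icc 1 (n + 1) := Finset.mem_Icc.2 hi
    obtain ⟨hA, hB⟩ := hS.metric_mem j hj i hi'
    have hc : 0 < √(S.A i j * S.B i j) := (inv_pos.2 hC).trans_le (sqrt_mul_mem hC hA hB).1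
    exact hRP _ hc _ (hS.state_mem j hj _ (by have := hi.2; omega)) _
      (hS.state_mem j hj _ hi.2) _ (S.riemann_step j hj i hi')
  have hstar : ∀ j, S.t j < tend → ∀ i ∈ Icc 1 (n + 1),
      ‖S.w i j 0 - S.u i j‖ ≤ (D₁ + 1) * ‖S.u i j - S.u (i - 1) j‖ := by
    intro j hj i hi
    have h1 := (hRPS j hj i hi 0).2
    have := norm_sub_le_norm_sub_add_norm_sub (S.w i j 0) (S.u (i - 1) j) (S.u i j)
    rw [norm_sub_rev (S.u (i - 1) j)] at this
    linarith
  have hτ : ∀ j, S.t j < tend → ∀ τ, τ ≤ S.t (j + 1) - S.t j →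
      G * τ ≤ 1 ∧ G * τ ≤ G * (C / 2) * meshWidth rmin rmax n := by
    intro j hj τ h
    have h1 := (hS.time_step hC hr hj).2
    have h2 : G * τ ≤ G * (C / 2) * meshWidth rmin rmax n := by
      rw [mul_assoc]; exact mul_le_mul_of_nonneg_left (h.trans h1) hG0.le
    refine ⟨h2.trans ?_, h2⟩
    calc _ ≤ G * (C / 2) * (G * (C / 2))⁻¹ := by gcongr
      _ = 1 := mul_inv_cancel₀ (by positivity)
  have hR0 : ∀ j, S.t j < tend → 0 ≤ R := fun j hj =>
    (norm_nonneg _).trans (hR _ (Or.inl (hS.state_mem j hj 0 (by omega))))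
  refine ⟨fun j hj i hi => hK₁p (hRPS j hj i hi 0).1, fun j hj i hi => ?_, fun j hj i hi => ?_,
    fun j hj i hi τ x h1 h2 h3 h4 h5 h6 h7 => ?_, fun j hj1 hj i hi => ?_⟩
  · refine (hR _ (Or.inr (hRPS j hj i hi 0).1)).trans ?_
    linarith
  · refine (hstar j hj i hi).trans ?_
    gcongr
  · have hi' : i ∈ Finset.Icc 1 (n + 1) := Finset.mem_Icc.2 hi
    obtain ⟨hode, -⟩ := S.approx j hj i hi' τ x h1 h2 h3 h4 h5 h6 h7
    obtain ⟨hA, hB⟩ := hS.metric_mem j hj i hi'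
    obtain ⟨k1, k2⟩ := riemannValue_mem (τ := τ - S.t j) (y := x - halfPoint rmin rmax n i) hD₁.le
      (hS.state_mem j hj (i - 1) (by have := hi.2; omega)) (hS.state_mem j hj _ hi.2)
      (hRPS j hj i hi)
    obtain ⟨t1, t2⟩ := hτ j hj (τ - S.t j) (by linarith)
    have hb := hR _ k1
    have hR0' := hR0 j hj
    obtain ⟨-, k3, -⟩ := hG _ hA _ hB x ⟨h6, h7⟩ (τ - S.t j) (by linarith) t1 _ _
      (hb.trans (by nlinarith)) hode
    have := norm_sub_le_norm_sub_add_norm_sub (S.uApp τ x) (riemannValue (S.u (i - 1) j) (S.u i j)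
      (S.w i j) (τ - S.t j) (x - halfPoint rmin rmax n i)) (S.u i j)
    have e1 : (D₁ + 1) * ‖S.u i j - S.u (i - 1) j‖ ≤ D * ‖S.u i j - S.u (i - 1) j‖ := by
      gcongr
    have e2 : G * (C / 2) * meshWidth rmin rmax n ≤ D * meshWidth rmin rmax n := by
      gcongr
    linarith
  · have hi1 : i ∈ Icc 1 (n + 1) := ⟨hi.1, by have := hi.2; omega⟩
    have hi2 : i + 1 ∈ Icc 1 (n + 1) := ⟨by omega, by have := hi.2; omega⟩
    obtain ⟨hA, hB⟩ := hS.metric_mem j hj i (Finset.mem_Icc.2 hi1)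
    obtain ⟨hA', hB'⟩ := hS.metric_mem j hj (i + 1) (Finset.mem_Icc.2 hi2)
    have hx := gridPoint_mem hr S.two_le hi
    obtain ⟨ξ, hξ, q, hode, hup⟩ := S.state_update j hj1 i (Finset.mem_Icc.2 hi) _ rfl
    set uBar := godunovAverage σ (S.t (j + 1) - S.t j) (meshWidth rmin rmax n)
      (S.A i j) (S.B i j) (S.A (i + 1) j) (S.B (i + 1) j) (S.w i j 0) (S.u i j) (S.w (i + 1) j 0)
      with huBar
    have hui : S.u i j ∈ K ∪ K₁ := Or.inl (hS.state_mem j hj i hi1.2)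
    have hw1 : S.w i j 0 ∈ K ∪ K₁ := Or.inr (hRPS j hj i hi1 0).1
    have hw2 : S.w (i + 1) j 0 ∈ K ∪ K₁ := Or.inr (hRPS j hj (i + 1) hi2 0).1
    have s1 := hstar j hj i hi1
    have s2 := (hRPS j hj (i + 1) hi2 0).2
    rw [Nat.add_sub_cancel] at s2
    have f1 := norm_flux_sub_le hC hA hB hL hw1 hui
    have f2 := norm_flux_sub_le hC hA' hB' hL hw2 hui
    set d₁ := ‖S.u i j - S.u (i - 1) j‖ with hd₁
    set d₂ := ‖S.u (i + 1) j - S.u i j‖ with hd₂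
    have hd₁0 : 0 ≤ d₁ := norm_nonneg _
    have hd₂0 : 0 ≤ d₂ := norm_nonneg _
    have hbar : ‖uBar - S.u i j‖ ≤ P * (d₁ + d₂) := by
      -- Grouping by half cells compares each zero-speed flux with the flux of the central state in
      -- the same metric; no difference of metrics enters this bound.
      have e : uBar - S.u i j = -(((S.t (j + 1) - S.t j) / meshWidth rmin rmax n) •
          ((flux σ (S.A (i + 1) j) (S.B (i + 1) j) (S.w (i + 1) j 0)
            - flux σ (S.A (i + 1) j) (S.B (i + 1) j) (S.u i j))
          - (flux σ (S.A i j) (S.B i j) (S.w i j 0)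
            - flux σ (S.A i j) (S.B i j) (S.u i j)))) := by
        rw [huBar, godunovAverage]; module
      rw [e, norm_neg, norm_smul]
      have hΔ : ‖(S.t (j + 1) - S.t j) / meshWidth rmin rmax n‖ ≤ C / 2 := by
        rw [Real.norm_of_nonneg (div_nonneg (by linarith [hS.time_lt hC hr hj]) hm0.le),
          div_le_iff₀ hm0]
        exact (hS.time_step hC hr hj).2
      have hn := norm_sub_le (flux σ (S.A (i + 1) j) (S.B (i + 1) j) (S.w (i + 1) j 0)
            - flux σ (S.A (i + 1) j) (S.B (i + 1) j) (S.u i j))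
          (flux σ (S.A i j) (S.B i j) (S.w i j 0) - flux σ (S.A i j) (S.B i j) (S.u i j))
      have hn' : ‖flux σ (S.A (i + 1) j) (S.B (i + 1) j) (S.w (i + 1) j 0)
            - flux σ (S.A (i + 1) j) (S.B (i + 1) j) (S.u i j)
          - (flux σ (S.A i j) (S.B i j) (S.w i j 0) - flux σ (S.A i j) (S.B i j) (S.u i j))‖
          ≤ C * L * (2 * (D₁ + 1)) * (d₁ + d₂) := by
        have g1 : C * (L * ‖S.w i j 0 - S.u i j‖) ≤ C * (L * ((D₁ + 1) * d₁)) := by gcongr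
        have g2 : C * (L * ‖S.w (i + 1) j 0 - S.u i j‖) ≤ C * (L * (D₁ * d₂)) := by gcongr
        have g3 : 0 ≤ C * L * (D₁ + 1) * d₁ := by positivity
        have g4 : 0 ≤ C * L * D₁ * d₂ := by positivity
        have g5 : 0 ≤ C * L * d₂ := by positivity
        linarith
      calc _ ≤ C / 2 * (C * L * (2 * (D₁ + 1)) * (d₁ + d₂)) := by gcongr
        _ = _ := by rw [hP]; ring
    have hR0' := hR0 j hj
    have hd₁R : d₁ ≤ 2 * R := (norm_sub_le _ _).trans (by
      linarith [hR _ hui, hR _ (Or.inl (hS.state_mem j hj (i - 1) (by have := hi.2; omega)))])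
    have hd₂R : d₂ ≤ 2 * R := (norm_sub_le _ _).trans (by
      linarith [hR _ hui, hR _ (Or.inl (hS.state_mem j hj (i + 1) hi2.2))])
    have hbarR : ‖uBar‖ ≤ R + P * (2 * R + 2 * R) := by
      have h1 : ‖uBar‖ ≤ ‖uBar - S.u i j‖ + ‖S.u i j‖ := by
        simpa using norm_add_le (uBar - S.u i j) (S.u i j)
      have h2 := hR _ hui
      have h3 : P * (d₁ + d₂) ≤ P * (2 * R + 2 * R) := by gcongr
      linarith
    obtain ⟨t1, t2⟩ := hτ j hj (ξ - S.t j) (by linarith [hξ.2])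
    obtain ⟨k1, k2, k3⟩ := hG ((S.A i j + S.A (i + 1) j) / 2)
      ⟨by linarith [hA.1, hA'.1], by linarith [hA.2, hA'.2]⟩ ((S.B i j + S.B (i + 1) j) / 2)
      ⟨by linarith [hB.1, hB'.1], by linarith [hB.2, hB'.2]⟩ _ hx (ξ - S.t j) (by linarith [hξ.1])
      t1 _ _ hbarR hode
    refine ⟨q, uBar, k1, k2.trans (t2.trans ?_), hbar.trans ?_, godunovAverage_eq _ _ _ _ _ _ _ _ _,
      k3.trans (by linarith), hup⟩
    · gcongr
    · gcongr

end Estimates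

/-! ### Lipschitz bounds for the discrete metric -/

section MetricEstimates

variable {σ rmin rmax t0 tend : ℝ} {Mb Bb : ℝ → ℝ} {u₀ : ℝ → ℝ × ℝ} {A₀ B₀ : ℝ → ℝ} {n : ℕ}
  {S : GodunovApproximation σ rmin rmax t0 tend Mb Bb u₀ A₀ B₀ n} {K : Set (ℝ × ℝ)} {C : ℝ}
  {V : NNReal}

/-- The integrand in the exponent of the update of `B`. -/
noncomputable def exponentRate (σ A x : ℝ) (u : ℝ × ℝ) : ℝ :=
  (A⁻¹ - 1) / x + kappa * x / A * stress σ u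

/-- Two consecutive mass sums differ by one term, and `2M = (1 - A) x` turns the change of `1 / x`
into `(1 - A) / x`. This is a one-step quadrature of `A' = h⁰`, with the division at the right half
gridpoint and the density at the left one. -/
theorem GodunovApproximation.A_succ (hr : rmin < rmax) (hrmin : 0 < rmin)
    (hm : meshWidth rmin rmax n ≤ rmin) {j : ℕ} (hj : S.t (j + 1) < tend) {i : ℕ}
    (hi : i ∈ Ico 1 n) :
    S.A (i + 1) (j + 1) - S.A i (j + 1) = meshWidth rmin rmax n *
      ((1 - S.A i (j + 1)) / halfPoint rmin rmax n (i + 1)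
        - kappa * (midState (fun k => S.u k (j + 1)) i).1 * halfPoint rmin rmax n i ^ 2
          / halfPoint rmin rmax n (i + 1)) := by
  have h1 := (S.metric_update j hj i (Finset.mem_Icc.2 ⟨hi.1, hi.2.le⟩)).1
  have h2 := (S.metric_update j hj (i + 1) (Finset.mem_Icc.2 ⟨by omega, hi.2⟩)).1
  have x1 := (halfPoint_mem hr S.two_le hm (i := i) ⟨hi.1, hi.2.le⟩).1
  have x2 := (halfPoint_mem hr S.two_le hm (i := i + 1) ⟨by omega, hi.2⟩).1
  have y1 : halfPoint rmin rmax n i ≠ 0 := by linarith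
  have y2 : halfPoint rmin rmax n (i + 1) ≠ 0 := by linarith
  rw [discreteMass, Finset.sum_Ico_succ_top hi.1, ← add_assoc] at h2
  rw [discreteMass] at h1
  rw [h1, h2]
  set Q := Mb (S.t (j + 1)) + ∑ k ∈ Finset.Ico 1 i, kappa / 2 *
    ((midState (fun k => S.u k (j + 1)) k).1 * halfPoint rmin rmax n k ^ 2 * meshWidth rmin rmax n)
  have e : halfPoint rmin rmax n (i + 1) = halfPoint rmin rmax n i + meshWidth rmin rmax n :=
    halfPoint_succ i
  field_simp
  rw [e]
  ring

theorem GodunovApproximation.B_succ {j : ℕ} (hj : S.t (j + 1) < tend) {i : ℕ}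
    (hi : i ∈ Ico 1 n) :
    S.B (i + 1) (j + 1) = S.B i (j + 1) * Real.exp (meshWidth rmin rmax n *
      exponentRate σ (S.A i (j + 1)) (halfPoint rmin rmax n i)
        (midState (fun k => S.u k (j + 1)) i)) := by
  have h1 := (S.metric_update j hj i (Finset.mem_Icc.2 ⟨hi.1, hi.2.le⟩)).2
  have h2 := (S.metric_update j hj (i + 1) (Finset.mem_Icc.2 ⟨by omega, hi.2⟩)).2
  rw [discreteExponent, Finset.sum_Ico_succ_top hi.1, Real.exp_add, ← mul_assoc] at h2
  rw [discreteExponent] at h1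
  rw [h2, ← h1, exponentRate, mul_comm (meshWidth rmin rmax n)]

theorem sum_Ico_pred_le {f : ℕ → ℝ} (hf : ∀ k, 0 ≤ f k) {i n : ℕ} (hi : i ≤ n) :
    ∑ k ∈ Finset.Ico 1 i, f (k - 1) ≤ ∑ k ∈ Finset.range n, f k := by
  rw [Finset.sum_Ico_eq_sum_range]
  have : ∀ k ∈ Finset.range (i - 1), f (1 + k - 1) = f k := fun k _ => by
    rw [Nat.add_sub_cancel_left]
  rw [Finset.sum_congr rfl this]
  exact Finset.sum_le_sum_of_subset_of_nonneg
    (Finset.range_subset_range.2 (by omega)) fun k _ _ => hf k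

theorem sum_Ico_le {f : ℕ → ℝ} (hf : ∀ k, 0 ≤ f k) {i n : ℕ} (hi : i ≤ n) :
    ∑ k ∈ Finset.Ico 1 i, f k ≤ ∑ k ∈ Finset.range n, f k := by
  refine Finset.sum_le_sum_of_subset_of_nonneg (fun k hk => ?_) fun k _ _ => hf k
  rw [Finset.mem_Ico] at hk
  rw [Finset.mem_range]
  omega

/-- The total change of the states in one time step is bounded. -/
theorem GodunovApproximation.StepEstimates.sum_jump_le {D : ℝ} (hE : S.StepEstimates D)
    (hS : S.IsBoundedBy K C V) (hD : 0 < D) (hC : 0 < C) (hr : rmin < rmax) {R : ℝ}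
    (hR : ∀ u ∈ K, ‖u‖ ≤ R) {j : ℕ} (hj1 : S.t (j + 1) < tend) (hj : S.t j < tend) :
    ∑ k ∈ Finset.range n, ‖S.u k (j + 1) - S.u k j‖
      ≤ 2 * R + D * (2 * R + V + V) + D * C * (rmax - rmin) := by
  have hn := S.two_le
  have hm := meshWidth_pos hr hn
  have hjump : ∀ i i' j', S.t j' < tend → i ≤ n + 1 → i' ≤ n + 1 → ∀ j'', S.t j'' < tend →
      ‖S.u i j' - S.u i' j''‖ ≤ 2 * R := fun i i' j' h1 h2 h3 j'' h4 =>
    (norm_sub_le _ _).trans (by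
      linarith [hR _ (hS.state_mem j' h1 i h2), hR _ (hS.state_mem j'' h4 i' h3)])
  have hΔ := (hS.time_step hC hr hj).2
  have hΔ0 := hS.time_lt hC hr hj
  have hk : ∀ k ∈ Finset.Ico 1 n, ‖S.u k (j + 1) - S.u k j‖ ≤
      D * (‖S.u (k - 1 + 1) j - S.u (k - 1) j‖ + ‖S.u (k + 1) j - S.u k j‖)
        + D * (C / 2 * meshWidth rmin rmax n) := by
    intro k hk
    rw [Finset.mem_Ico] at hk
    obtain ⟨q, uBar, -, -, h3, -, h5, h6⟩ := hE.update j hj1 hj k ⟨hk.1, hk.2.le⟩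
    rw [Nat.sub_add_cancel hk.1]
    have e : S.u k (j + 1) - S.u k j = (uBar - S.u k j) + (S.t (j + 1) - S.t j) •
      odeSource σ ((S.A k j + S.A (k + 1) j) / 2) ((S.B k j + S.B (k + 1) j) / 2) q
        (gridPoint rmin rmax n k) := by rw [h6]; abel
    rw [e]
    refine (norm_add_le _ _).trans (add_le_add h3 ?_)
    rw [norm_smul, Real.norm_of_nonneg (by linarith), mul_comm D]
    exact mul_le_mul hΔ h5 (norm_nonneg _) (by positivity)
  have hV := hS.sum_variation_le hC hr hj
  set f : ℕ → ℝ := fun d => ‖S.u (d + 1) j - S.u d j‖ with hf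
  -- The shifted sum contains the jump to the ghost state, which the variation on `[rmin, rmax]`
  -- does not control; it is at most `2 * R`.
  have h1 : ∑ k ∈ Finset.Ico 1 n, f (k - 1) ≤ 2 * R + V := by
    refine (sum_Ico_pred_le (f := f) (fun k => norm_nonneg _) le_rfl).trans ?_
    rw [Finset.range_eq_Ico, Finset.sum_eq_sum_Ico_succ_bot (by omega)]
    exact add_le_add (hjump _ _ j hj (by omega) (by omega) j hj) hV
  -- The ghost state obeys no update rule, so its change in time is also bounded by `2 * R` only. A
  -- single such term does no harm, since the metric weights the sum by `Δx`.
  rw [Finset.range_eq_Ico, Finset.sum_eq_sum_Ico_succ_bot (by omega), add_assoc]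
  refine add_le_add (hjump 0 0 _ hj1 (by omega) (by omega) _ hj) ?_
  refine (Finset.sum_le_sum hk).trans ?_
  rw [Finset.sum_add_distrib, ← Finset.mul_sum, Finset.sum_add_distrib, Finset.sum_const,
    nsmul_eq_mul, Nat.card_Ico]
  refine add_le_add ?_ ?_
  · exact mul_le_mul_of_nonneg_left (add_le_add h1 hV) hD.le
  · have h2 := meshWidth_mul (rmin := rmin) (rmax := rmax) hn
    rw [Nat.cast_sub (by omega), Nat.cast_one]
    have h3 : ((n : ℝ) - 1) * (D * (C / 2 * meshWidth rmin rmax n)) = D * C / 2 * (rmax - rmin) := by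
      rw [← h2]; ring
    rw [h3]
    have : 0 ≤ D * C * (rmax - rmin) := mul_nonneg (by positivity) (by linarith)
    linarith

theorem norm_midState_sub_le (u v : ℕ → ℝ × ℝ) (k : ℕ) :
    ‖midState u k - midState v k‖ ≤ 1 / 2 * (‖u (k - 1) - v (k - 1)‖ + ‖u k - v k‖) := by
  rw [midState, midState, ← smul_sub, norm_smul]
  have : u (k - 1) + u k - (v (k - 1) + v k) = (u (k - 1) - v (k - 1)) + (u k - v k) := by abel
  rw [this]
  norm_num
  exact norm_add_le _ _

theorem sum_midState_sub_le (u v : ℕ → ℝ × ℝ) {i n : ℕ} (hi : i ≤ n) :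
    ∑ k ∈ Finset.Ico 1 i, ‖midState u k - midState v k‖ ≤ ∑ k ∈ Finset.range n, ‖u k - v k‖ := by
  refine (Finset.sum_le_sum fun k _ => norm_midState_sub_le u v k).trans ?_
  rw [← Finset.mul_sum, Finset.sum_add_distrib]
  have h1 := sum_Ico_pred_le (f := fun k => ‖u k - v k‖) (fun k => norm_nonneg _) hi
  have h2 := sum_Ico_le (f := fun k => ‖u k - v k‖) (fun k => norm_nonneg _) hi
  linarith

/-- The averages of two neighbouring states lie in a compact set of physical states. -/
theorem midState_mem {K : Set (ℝ × ℝ)} {u : ℕ → ℝ × ℝ} {k : ℕ} (h1 : u (k - 1) ∈ K)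
    (h2 : u k ∈ K) : midState u k ∈ (fun p : (ℝ × ℝ) × (ℝ × ℝ) => (1 / 2 : ℝ) • (p.1 + p.2)) ''
      (K ×ˢ K) :=
  ⟨(u (k - 1), u k), ⟨h1, h2⟩, rfl⟩

/-- The metric update evaluates the stress at averages of neighbours, which need not lie in `K`.
Convexity of the cone provides a compact set of physical states that contains them. -/
theorem midpoints_subset_physical (hσ : 0 < σ) (hσ1 : σ < 1) (hKp : K ⊆ physical σ) :
    (fun p : (ℝ × ℝ) × (ℝ × ℝ) => (1 / 2 : ℝ) • (p.1 + p.2)) '' (K ×ˢ K) ⊆ physical σ := by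
  rintro _ ⟨⟨a, b⟩, ⟨ha, hb⟩, rfl⟩
  simp only [smul_add]
  exact convex_physical hσ hσ1 (hKp ha) (hKp hb) (by norm_num) (by norm_num) (by norm_num)

theorem isCompact_midpoints (hK : IsCompact K) :
    IsCompact ((fun p : (ℝ × ℝ) × (ℝ × ℝ) => (1 / 2 : ℝ) • (p.1 + p.2)) '' (K ×ˢ K)) :=
  (hK.prod hK).image (by fun_prop)

theorem GodunovApproximation.IsBoundedBy.midState_mem (hS : S.IsBoundedBy K C V) {j : ℕ}
    (hj : S.t j < tend) {k : ℕ} (hk : k ≤ n + 1) : midState (fun k => S.u k j) k ∈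
      (fun p : (ℝ × ℝ) × (ℝ × ℝ) => (1 / 2 : ℝ) • (p.1 + p.2)) '' (K ×ˢ K) :=
  LocallyInertial.midState_mem (hS.state_mem j hj _ (by omega)) (hS.state_mem j hj _ hk)

theorem midState_norm_le {R : ℝ} (hR : ∀ u ∈ K, ‖u‖ ≤ R) {v : ℝ × ℝ}
    (hv : v ∈ (fun p : (ℝ × ℝ) × (ℝ × ℝ) => (1 / 2 : ℝ) • (p.1 + p.2)) '' (K ×ˢ K)) :
    ‖v‖ ≤ R := by
  obtain ⟨⟨a, b⟩, ⟨ha, hb⟩, rfl⟩ := hv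
  simp only [norm_smul]
  have := norm_add_le a b
  have h1 := hR a ha
  have h2 := hR b hb
  norm_num
  linarith

theorem abs_exponentRate_le (hσ : 0 < σ) (hσ1 : σ < 1) (hrmin : 0 < rmin) {A x R : ℝ} (hC : 0 < C)
    (hA : A ∈ Icc C⁻¹ C) (hx : x ∈ Icc (rmin / 2) rmax) {u : ℝ × ℝ} (hu : u ∈ physical σ)
    (hR : ‖u‖ ≤ R) :
    |exponentRate σ A x u| ≤ (C + 1) * (2 / rmin) + kappa * rmax * C * R := by
  have hC' := inv_pos.2 hC
  have hA0 : 0 < A := hC'.trans_le hA.1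
  have hx0 : 0 < x := by linarith [hx.1]
  have hAi : A⁻¹ ≤ C := by
    have := inv_anti₀ hC' hA.1
    rwa [inv_inv] at this
  have hAi0 := inv_pos.2 hA0
  have hxi : x⁻¹ ≤ 2 / rmin := by
    have := inv_anti₀ (by positivity) hx.1
    rwa [inv_div] at this
  have hs := stress_mem hσ hσ1 hu
  have hu1 : u.1 ≤ R := (le_abs_self _).trans ((norm_fst_le u).trans hR)
  have hk := kappa_pos
  refine (abs_add_le _ _).trans (add_le_add ?_ ?_)
  · rw [div_eq_mul_inv, abs_mul, abs_of_pos (inv_pos.2 hx0)]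
    refine mul_le_mul ?_ hxi (inv_pos.2 hx0).le (by linarith)
    rw [abs_le]
    constructor <;> linarith
  · rw [abs_of_nonneg (by have := hs.1; positivity), div_eq_mul_inv]
    have : 0 < rmax := hx0.trans_le hx.2
    have h2 := hx.2
    have h3 : stress σ u ≤ R := hs.2.trans hu1
    have h4 := hs.1
    gcongr

theorem abs_inv_sub_inv_le {A A' : ℝ} (hC : 0 < C) (hA : A ∈ Icc C⁻¹ C) (hA' : A' ∈ Icc C⁻¹ C) :
    |A'⁻¹ - A⁻¹| ≤ C ^ 2 * |A' - A| := by
  have hC' := inv_pos.2 hC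
  have hA0 : 0 < A := hC'.trans_le hA.1
  have hA0' : 0 < A' := hC'.trans_le hA'.1
  have hAi : A⁻¹ ≤ C := by
    have := inv_anti₀ hC' hA.1
    rwa [inv_inv] at this
  have hAi' : A'⁻¹ ≤ C := by
    have := inv_anti₀ hC' hA'.1
    rwa [inv_inv] at this
  have e : A'⁻¹ - A⁻¹ = (A'⁻¹ * A⁻¹) * (A - A') := by field_simp
  rw [e, abs_mul, abs_sub_comm A A', abs_of_pos (by positivity), sq]
  gcongr

theorem abs_exponentRate_sub_le (hσ : 0 < σ) (hσ1 : σ < 1) (hrmin : 0 < rmin) {A A' x R : ℝ}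
    (hC : 0 < C) (hA : A ∈ Icc C⁻¹ C) (hA' : A' ∈ Icc C⁻¹ C) (hx : x ∈ Icc (rmin / 2) rmax)
    {u u' : ℝ × ℝ} (hu' : u' ∈ physical σ) (hR : ‖u'‖ ≤ R)
    {L : ℝ} (hL : |stress σ u' - stress σ u| ≤ L * ‖u' - u‖) :
    |exponentRate σ A' x u' - exponentRate σ A x u| ≤
      C ^ 2 * (2 / rmin + kappa * rmax * R) * |A' - A| + kappa * rmax * C * L * ‖u' - u‖ := by
  have hC' := inv_pos.2 hC
  have hA0 : 0 < A := hC'.trans_le hA.1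
  have hx0 : 0 < x := by linarith [hx.1]
  have hAi : A⁻¹ ≤ C := by
    have := inv_anti₀ hC' hA.1
    rwa [inv_inv] at this
  have hAi0 := inv_pos.2 hA0
  have hxi : x⁻¹ ≤ 2 / rmin := by
    have := inv_anti₀ (by positivity) hx.1
    rwa [inv_div] at this
  have hxi0 := inv_pos.2 hx0
  have hs := stress_mem hσ hσ1 hu'
  have hu1 : u'.1 ≤ R := (le_abs_self _).trans ((norm_fst_le u').trans hR)
  have hk := kappa_pos
  have hd := abs_inv_sub_inv_le hC hA hA'
  -- Discrete product rule: first `A` varies at the new state, then the state varies at the old `A`.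
  have e : exponentRate σ A' x u' - exponentRate σ A x u
      = (A'⁻¹ - A⁻¹) * (x⁻¹ + kappa * x * stress σ u')
        + kappa * x * A⁻¹ * (stress σ u' - stress σ u) := by
    simp only [exponentRate, div_eq_mul_inv]; ring
  have hxm := hx.2
  have hrm : 0 < rmax := hx0.trans_le hxm
  have h4 := hs.1
  have h3 : stress σ u' ≤ R := hs.2.trans hu1
  rw [e]
  refine (abs_add_le _ _).trans (add_le_add ?_ ?_)
  · rw [abs_mul, abs_of_nonneg (a := x⁻¹ + kappa * x * stress σ u') (by positivity)]
    calc _ ≤ C ^ 2 * |A' - A| * (2 / rmin + kappa * rmax * R) := by gcongr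
      _ = _ := by ring
  · rw [abs_mul, abs_of_nonneg (a := kappa * x * A⁻¹) (by positivity)]
    calc _ ≤ kappa * rmax * C * (L * ‖u' - u‖) := by gcongr
      _ = _ := by ring

/-- The Lipschitz estimates for the metric, with a constant that does not depend on the mesh. -/
structure GodunovApproximation.MetricEstimates
    (S : GodunovApproximation σ rmin rmax t0 tend Mb Bb u₀ A₀ B₀ n) (D : ℝ) : Prop where
  space : ∀ j, S.t j < tend → ∀ i ∈ Ico 2 n,
    |S.A (i + 1) j - S.A i j| ≤ D * meshWidth rmin rmax n ∧
    |S.B (i + 1) j - S.B i j| ≤ D * meshWidth rmin rmax n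
  time : ∀ j, S.t (j + 1) < tend → S.t (j + 2) < tend → ∀ i ∈ Icc 1 n,
    t0 ≤ S.t (j + 1) → |S.A i (j + 2) - S.A i (j + 1)| ≤ D * (S.t (j + 2) - S.t (j + 1)) ∧
    |S.B i (j + 2) - S.B i (j + 1)| ≤ D * (S.t (j + 2) - S.t (j + 1))

theorem abs_sub_le_of_lipschitzOnWith {f : ℝ → ℝ} {L : NNReal} {s : Set ℝ} (hf : LipschitzOnWith L f s)
    {x y : ℝ} (hx : x ∈ s) (hy : y ∈ s) (hxy : x ≤ y) : |f y - f x| ≤ L * (y - x) := by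
  have := hf.norm_sub_le hy hx
  rwa [Real.norm_eq_abs, Real.norm_eq_abs, abs_of_nonneg (sub_nonneg.2 hxy)] at this

theorem exists_metricEstimates_aux (hσ : 0 < σ) (hσ1 : σ < 1)
    (hK : IsCompact K) (hKp : K ⊆ physical σ) : ∃ (L : NNReal) (R : ℝ), 0 ≤ R ∧
      (∀ u ∈ K, ‖u‖ ≤ R) ∧ LipschitzOnWith L (stress σ)
        ((fun p : (ℝ × ℝ) × (ℝ × ℝ) => (1 / 2 : ℝ) • (p.1 + p.2)) '' (K ×ˢ K)) := by
  obtain ⟨L, hL⟩ := exists_lipschitzOnWith_stress hσ hσ1 (isCompact_midpoints hK)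
    (midpoints_subset_physical hσ hσ1 hKp)
  obtain ⟨R, hR⟩ := hK.isBounded.exists_norm_le
  exact ⟨L, max R 0, le_max_right _ _, fun u hu => (hR u hu).trans (le_max_left _ _), hL⟩

/-- Single states may jump by `O(1)` in one time step, but the mass only sees `Δx` times the sum of
all changes. That sum is at most `U`, and `Δx ≤ 2C Δt`. -/
theorem GodunovApproximation.IsBoundedBy.A_time (hS : S.IsBoundedBy K C V) (hC : 0 < C)
    (hrmin : 0 < rmin) (hr : rmin < rmax) (hm : meshWidth rmin rmax n ≤ rmin) {L : NNReal}
    (hL : LipschitzOnWith L Mb (Icc t0 tend)) {U : ℝ} {j : ℕ} (h0 : t0 ≤ S.t (j + 1))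
    (hj : S.t (j + 1) < tend) (hj1 : S.t (j + 2) < tend)
    (hU : ∑ k ∈ Finset.range n, ‖S.u k (j + 2) - S.u k (j + 1)‖ ≤ U) {i : ℕ} (hi : i ∈ Icc 1 n) :
    |S.A i (j + 2) - S.A i (j + 1)| ≤
      4 / rmin * (L + kappa * rmax ^ 2 * C * U) * (S.t (j + 2) - S.t (j + 1)) := by
  have hn := S.two_le
  have hlt := hS.time_lt hC hr hj
  obtain ⟨hΔ, -⟩ := hS.time_step hC hr hj
  have hm0 := meshWidth_pos hr hn
  have hk := kappa_pos
  have hx := halfPoint_mem hr hn hm hi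
  have hx0 : 0 < halfPoint rmin rmax n i := by linarith [hx.1]
  have hU0 : 0 ≤ U := le_trans (Finset.sum_nonneg fun k _ => norm_nonneg _) hU
  have hrm : 0 < rmax := hrmin.trans hr
  rw [(S.metric_update j hj i (Finset.mem_Icc.2 hi)).1,
    (S.metric_update (j + 1) hj1 i (Finset.mem_Icc.2 hi)).1, discreteMass, discreteMass]
  have hMb := abs_sub_le_of_lipschitzOnWith hL (x := S.t (j + 1)) (y := S.t (j + 2)) ⟨h0, hj.le⟩
    ⟨by linarith, hj1.le⟩ hlt.le
  have hsum : |∑ k ∈ Finset.Ico 1 i, kappa / 2 * ((midState (fun k => S.u k (j + 2)) k).1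
        * halfPoint rmin rmax n k ^ 2 * meshWidth rmin rmax n)
      - ∑ k ∈ Finset.Ico 1 i, kappa / 2 * ((midState (fun k => S.u k (j + 1)) k).1
        * halfPoint rmin rmax n k ^ 2 * meshWidth rmin rmax n)|
      ≤ kappa / 2 * rmax ^ 2 * meshWidth rmin rmax n * U := by
    rw [← Finset.sum_sub_distrib]
    refine (Finset.abs_sum_le_sum_abs _ _).trans ?_
    refine le_trans (Finset.sum_le_sum fun k hk => ?_) (?_ : ∑ k ∈ Finset.Ico 1 i,
      kappa / 2 * rmax ^ 2 * meshWidth rmin rmax n * ‖midState (fun k => S.u k (j + 2)) k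
        - midState (fun k => S.u k (j + 1)) k‖ ≤ _)
    · rw [Finset.mem_Ico] at hk
      have hxk := halfPoint_mem hr hn hm (i := k) ⟨hk.1, by have := hi.2; omega⟩
      have hxk0 : 0 < halfPoint rmin rmax n k := by linarith [hxk.1]
      have e : ∀ a b : ℝ × ℝ, kappa / 2 * (a.1 * halfPoint rmin rmax n k ^ 2
          * meshWidth rmin rmax n) - kappa / 2 * (b.1 * halfPoint rmin rmax n k ^ 2
          * meshWidth rmin rmax n) = kappa / 2 * halfPoint rmin rmax n k ^ 2
          * meshWidth rmin rmax n * (a - b).1 := fun a b => by simp only [Prod.fst_sub]; ring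
      rw [e, abs_mul, abs_of_pos (by positivity)]
      have h2 := hxk.2
      gcongr
      exact norm_fst_le (_ : ℝ × ℝ)
    · rw [← Finset.mul_sum]
      gcongr
      exact (sum_midState_sub_le _ _ hi.2).trans hU
  set s₂ := ∑ k ∈ Finset.Ico 1 i, kappa / 2 * ((midState (fun k => S.u k (j + 2)) k).1
        * halfPoint rmin rmax n k ^ 2 * meshWidth rmin rmax n)
  set s₁ := ∑ k ∈ Finset.Ico 1 i, kappa / 2 * ((midState (fun k => S.u k (j + 1)) k).1
        * halfPoint rmin rmax n k ^ 2 * meshWidth rmin rmax n)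
  have hxi : (halfPoint rmin rmax n i)⁻¹ ≤ 2 / rmin := by
    have := inv_anti₀ (by positivity) hx.1
    rwa [inv_div] at this
  have e : 1 - 2 * (Mb (S.t (j + 2)) + s₂) / halfPoint rmin rmax n i
      - (1 - 2 * (Mb (S.t (j + 1)) + s₁) / halfPoint rmin rmax n i)
      = -(2 * (halfPoint rmin rmax n i)⁻¹ * ((Mb (S.t (j + 2)) - Mb (S.t (j + 1))) + (s₂ - s₁))) := by
    field_simp; ring
  change |1 - 2 * (Mb (S.t (j + 2)) + s₂) / halfPoint rmin rmax n i
      - (1 - 2 * (Mb (S.t (j + 1)) + s₁) / halfPoint rmin rmax n i)| ≤ _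
  rw [e, abs_neg, abs_mul, abs_of_pos (by positivity)]
  have hsum' : |Mb (S.t (j + 2)) - Mb (S.t (j + 1)) + (s₂ - s₁)|
      ≤ (L + kappa * rmax ^ 2 * C * U) * (S.t (j + 2) - S.t (j + 1)) := by
    refine (abs_add_le _ _).trans ?_
    rw [add_mul]
    refine add_le_add hMb (hsum.trans ?_)
    calc _ ≤ kappa / 2 * rmax ^ 2 * (2 * C * (S.t (j + 1 + 1) - S.t (j + 1))) * U := by gcongr
      _ = _ := by ring
  calc _ ≤ 2 * (2 / rmin) * ((L + kappa * rmax ^ 2 * C * U) * (S.t (j + 2) - S.t (j + 1))) := by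
        gcongr
    _ = _ := by ring

theorem GodunovApproximation.B_one {j : ℕ} (hj : S.t (j + 1) < tend) :
    S.B 1 (j + 1) = Bb (S.t (j + 1)) := by
  have := (S.metric_update j hj 1 (Finset.mem_Icc.2 ⟨le_rfl, by have := S.two_le; omega⟩)).2
  simpa [discreteExponent] using this

theorem discreteExponent_eq (u : ℕ → ℝ × ℝ) (A : ℕ → ℝ) (i : ℕ) :
    discreteExponent σ rmin rmax n u A i = ∑ k ∈ Finset.Ico 1 i,
      exponentRate σ (A k) (halfPoint rmin rmax n k) (midState u k) * meshWidth rmin rmax n := rfl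

/-- The exponent changes by `O(Δt)` for two reasons: `A` is Lipschitz in time and the number of
summands times `Δx` is bounded; and the sum of the changes of the states is bounded while `Δx ≤ 2C
Δt`. The smallness condition keeps the change of the exponent below `1`, where `|e^y - 1| ≤ 2|y|`.
-/
theorem GodunovApproximation.IsBoundedBy.B_time (hS : S.IsBoundedBy K C V) (hσ : 0 < σ)
    (hσ1 : σ < 1) (hKp : K ⊆ physical σ) (hC : 0 < C)
    (hrmin : 0 < rmin) (hr : rmin < rmax) (hm : meshWidth rmin rmax n ≤ rmin) {L LT : NNReal}
    (hL : LipschitzOnWith L Bb (Icc t0 tend)) (hLT : LipschitzOnWith LT (stress σ)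
        ((fun p : (ℝ × ℝ) × (ℝ × ℝ) => (1 / 2 : ℝ) • (p.1 + p.2)) '' (K ×ˢ K)))
    {R : ℝ} (hR0 : 0 ≤ R) (hR : ∀ u ∈ K, ‖u‖ ≤ R) {U DA : ℝ} (hDA0 : 0 ≤ DA) {j : ℕ}
    (h0 : t0 ≤ S.t (j + 1)) (hj : S.t (j + 1) < tend) (hj1 : S.t (j + 2) < tend)
    (hU : ∑ k ∈ Finset.range n, ‖S.u k (j + 2) - S.u k (j + 1)‖ ≤ U)
    (hDA : ∀ i ∈ Icc 1 n, |S.A i (j + 2) - S.A i (j + 1)| ≤ DA * (S.t (j + 2) - S.t (j + 1)))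
    {Q : ℝ} (hQ : Q = C ^ 2 * (2 / rmin + kappa * rmax * R) * (2 * (rmax - rmin) * DA)
      + kappa * rmax * C * LT * (2 * C * U))
    (hsmall : Q * (C / 2 * meshWidth rmin rmax n) ≤ 1) {i : ℕ} (hi : i ∈ Icc 1 n) :
    |S.B i (j + 2) - S.B i (j + 1)| ≤
      (L * C ^ 2 + C * (2 * Q)) * (S.t (j + 2) - S.t (j + 1)) := by
  have hn := S.two_le
  have hlt := hS.time_lt hC hr hj
  obtain ⟨hΔ, hΔ'⟩ := hS.time_step hC hr hj
  have hm0 := meshWidth_pos hr hn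
  have hk := kappa_pos
  have hC' := inv_pos.2 hC
  have hU0 : 0 ≤ U := le_trans (Finset.sum_nonneg fun k _ => norm_nonneg _) hU
  have hrm : 0 < rmax := hrmin.trans hr
  have hi' : i ∈ Finset.Icc 1 (n + 1) := Finset.mem_Icc.2 ⟨hi.1, by have := hi.2; omega⟩
  have b1 := (S.metric_update j hj i (Finset.mem_Icc.2 hi)).2
  have b2 := (S.metric_update (j + 1) hj1 i (Finset.mem_Icc.2 hi)).2
  have hBb := abs_sub_le_of_lipschitzOnWith hL (x := S.t (j + 1)) (y := S.t (j + 2)) ⟨h0, hj.le⟩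
    ⟨by linarith, hj1.le⟩ hlt.le
  set E₁ := discreteExponent σ rmin rmax n (fun k => S.u k (j + 1)) (fun k => S.A k (j + 1)) i
    with hE₁
  set E₂ := discreteExponent σ rmin rmax n (fun k => S.u k (j + 1 + 1))
    (fun k => S.A k (j + 1 + 1)) i with hE₂
  have hE : |E₂ - E₁| ≤ Q * (S.t (j + 2) - S.t (j + 1)) := by
    rw [hE₁, hE₂, discreteExponent_eq, discreteExponent_eq, ← Finset.sum_sub_distrib]
    refine (Finset.abs_sum_le_sum_abs _ _).trans ?_
    have hterm : ∀ k ∈ Finset.Ico 1 i,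
        |exponentRate σ (S.A k (j + 1 + 1)) (halfPoint rmin rmax n k)
            (midState (fun k => S.u k (j + 1 + 1)) k) * meshWidth rmin rmax n
          - exponentRate σ (S.A k (j + 1)) (halfPoint rmin rmax n k)
            (midState (fun k => S.u k (j + 1)) k) * meshWidth rmin rmax n| ≤
        C ^ 2 * (2 / rmin + kappa * rmax * R) * (DA * (S.t (j + 2) - S.t (j + 1)))
            * meshWidth rmin rmax n
          + kappa * rmax * C * LT * meshWidth rmin rmax n
            * ‖midState (fun k => S.u k (j + 2)) k - midState (fun k => S.u k (j + 1)) k‖ := by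
      intro k hk'
      rw [Finset.mem_Ico] at hk'
      have hkn : k ≤ n := by have := hi.2; omega
      have hxk := halfPoint_mem hr hn hm (i := k) ⟨hk'.1, hkn⟩
      have hkI : k ∈ Finset.Icc 1 (n + 1) := Finset.mem_Icc.2 ⟨hk'.1, by omega⟩
      have hA1 := (hS.metric_mem (j + 1) hj k hkI).1
      have hA2 := (hS.metric_mem (j + 2) hj1 k hkI).1
      have m1 := hS.midState_mem hj (k := k) (by omega)
      have m2 := hS.midState_mem hj1 (k := k) (by omega)
      have h := abs_exponentRate_sub_le hσ hσ1 hrmin hC hA1 hA2 hxk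
        (midpoints_subset_physical hσ hσ1 hKp m2) (midState_norm_le hR m2)
        (hLT.norm_sub_le m2 m1)
      rw [← sub_mul, abs_mul, abs_of_pos hm0]
      have h2 := hDA k ⟨hk'.1, hkn⟩
      calc _ ≤ (C ^ 2 * (2 / rmin + kappa * rmax * R) * (DA * (S.t (j + 2) - S.t (j + 1)))
            + kappa * rmax * C * LT * ‖midState (fun k => S.u k (j + 2)) k
              - midState (fun k => S.u k (j + 1)) k‖) * meshWidth rmin rmax n := by
            refine mul_le_mul_of_nonneg_right (h.trans ?_) hm0.le
            gcongr
        _ = _ := by ring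
    refine (Finset.sum_le_sum hterm).trans ?_
    rw [Finset.sum_add_distrib, ← Finset.mul_sum, Finset.sum_const, nsmul_eq_mul, Nat.card_Ico,
      hQ, add_mul]
    refine add_le_add ?_ ?_
    · have h1 : ((i - 1 : ℕ) : ℝ) * meshWidth rmin rmax n ≤ 2 * (rmax - rmin) := by
        refine le_trans ?_ (card_mul_meshWidth_le hr hn)
        gcongr
        have := hi.2
        omega
      have hΔ0 : 0 ≤ S.t (j + 2) - S.t (j + 1) := by linarith
      calc _ = C ^ 2 * (2 / rmin + kappa * rmax * R) * (DA * (S.t (j + 2) - S.t (j + 1)))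
            * (((i - 1 : ℕ) : ℝ) * meshWidth rmin rmax n) := by ring
        _ ≤ C ^ 2 * (2 / rmin + kappa * rmax * R) * (DA * (S.t (j + 2) - S.t (j + 1)))
            * (2 * (rmax - rmin)) := by gcongr
        _ = _ := by ring
    · have h1 := (sum_midState_sub_le (fun k => S.u k (j + 2)) (fun k => S.u k (j + 1)) hi.2).trans
        hU
      rw [← Finset.mul_sum]
      calc _ ≤ kappa * rmax * C * LT * (2 * C * (S.t (j + 1 + 1) - S.t (j + 1))) * U :=
          mul_le_mul (mul_le_mul_of_nonneg_left hΔ (by positivity)) h1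
            (Finset.sum_nonneg fun k _ => norm_nonneg _)
            (mul_nonneg (by positivity) (hm0.le.trans hΔ))
        _ = _ := by ring
  have hE1 : |E₂ - E₁| ≤ 1 := by
    refine hE.trans (le_trans ?_ hsmall)
    have hQ0 : 0 ≤ Q := by
      rw [hQ]
      have : 0 ≤ rmax - rmin := by linarith
      positivity
    exact mul_le_mul_of_nonneg_left hΔ' hQ0
  have hexp := (Real.abs_exp_sub_one_le hE1).trans (mul_le_mul_of_nonneg_left hE (by norm_num))
  have hBi1 := (hS.metric_mem (j + 1) hj i hi').2
  have hBi2 := (hS.metric_mem (j + 2) hj1 i hi').2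
  have hB12 := (hS.metric_mem (j + 2) hj1 1 (by simp)).2
  rw [S.B_one hj1] at hB12
  -- The exponential is the quotient of the values of `B` in cells `i` and `1`, both in `[C⁻¹, C]`;
  -- no bound on the exponent is needed.
  have hexp2 : Real.exp E₂ ≤ C ^ 2 := by
    have h1 : C⁻¹ * Real.exp E₂ ≤ C := by
      refine le_trans ?_ hBi2.2
      rw [b2]
      exact mul_le_mul_of_nonneg_right hB12.1 (Real.exp_pos _).le
    rw [inv_mul_le_iff₀ hC] at h1
    rwa [sq]
  have e : S.B i (j + 2) - S.B i (j + 1) = (Bb (S.t (j + 2)) - Bb (S.t (j + 1))) * Real.exp E₂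
      + S.B i (j + 1) * (Real.exp (E₂ - E₁) - 1) := by
    rw [b2, b1, Real.exp_sub]
    have := (Real.exp_pos E₁).ne'
    field_simp
    ring
  rw [e]
  refine (abs_add_le _ _).trans ?_
  rw [abs_mul, abs_mul, abs_of_pos (Real.exp_pos E₂), abs_of_pos (hC'.trans_le hBi1.1), add_mul]
  have hΔ0 : 0 ≤ S.t (j + 2) - S.t (j + 1) := by linarith
  refine add_le_add ?_ ?_
  · calc _ ≤ L * (S.t (j + 2) - S.t (j + 1)) * C ^ 2 := by gcongr
      _ = _ := by ring
  · calc _ ≤ C * (2 * (Q * (S.t (j + 2) - S.t (j + 1)))) :=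
        mul_le_mul hBi1.2 hexp (abs_nonneg _) hC.le
      _ = _ := by ring

theorem GodunovApproximation.IsBoundedBy.metric_space_succ (hS : S.IsBoundedBy K C V) (hσ : 0 < σ)
    (hσ1 : σ < 1) (hKp : K ⊆ physical σ) (hC : 0 < C)
    (hrmin : 0 < rmin) (hr : rmin < rmax) (hm : meshWidth rmin rmax n ≤ rmin)
    {R : ℝ} (hR0 : 0 ≤ R) (hR : ∀ u ∈ K, ‖u‖ ≤ R) {j : ℕ} (hj : S.t (j + 1) < tend)
    {Q : ℝ} (hQ : Q = (C + 1) * (2 / rmin) + kappa * rmax * C * R)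
    (hsmall : Q * meshWidth rmin rmax n ≤ 1) {i : ℕ} (hi : i ∈ Ico 1 n) :
    |S.A (i + 1) (j + 1) - S.A i (j + 1)| ≤
        ((C + 1) * (2 / rmin) + kappa * R * rmax ^ 2 * (2 / rmin)) * meshWidth rmin rmax n ∧
      |S.B (i + 1) (j + 1) - S.B i (j + 1)| ≤ C * (2 * Q) * meshWidth rmin rmax n := by
  have hn := S.two_le
  have hm0 := meshWidth_pos hr hn
  have hk := kappa_pos
  have hC' := inv_pos.2 hC
  have hrm : 0 < rmax := hrmin.trans hr
  have hi' : i ∈ Finset.Icc 1 (n + 1) := Finset.mem_Icc.2 ⟨hi.1, by have := hi.2; omega⟩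
  obtain ⟨hA, hB⟩ := hS.metric_mem (j + 1) hj i hi'
  have hx := halfPoint_mem hr hn hm (i := i) ⟨hi.1, hi.2.le⟩
  have hx' := halfPoint_mem hr hn hm (i := i + 1) ⟨by omega, hi.2⟩
  have hmid := hS.midState_mem hj (k := i) (by have := hi.2; omega)
  have hmp := midpoints_subset_physical hσ hσ1 hKp hmid
  have hmn := midState_norm_le hR hmid
  set v := midState (fun k => S.u k (j + 1)) i with hv
  have hx0 : 0 < halfPoint rmin rmax n i := by linarith [hx.1]
  have hx0' : 0 < halfPoint rmin rmax n (i + 1) := by linarith [hx'.1]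
  have hxi : (halfPoint rmin rmax n (i + 1))⁻¹ ≤ 2 / rmin := by
    have := inv_anti₀ (by positivity) hx'.1
    rwa [inv_div] at this
  constructor
  · rw [S.A_succ hr hrmin hm hj hi, abs_mul, abs_of_pos hm0, mul_comm (meshWidth rmin rmax n)]
    refine mul_le_mul_of_nonneg_right ((abs_sub _ _).trans (add_le_add ?_ ?_)) hm0.le
    · rw [div_eq_mul_inv, abs_mul, abs_of_pos (inv_pos.2 hx0')]
      refine mul_le_mul ?_ hxi (inv_pos.2 hx0').le (by linarith)
      rw [abs_le]
      constructor <;> linarith [hA.1, hA.2]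
    · have hv1 : |v.1| ≤ R := (norm_fst_le v).trans hmn
      rw [div_eq_mul_inv, abs_mul, abs_of_pos (inv_pos.2 hx0'), abs_mul, abs_mul,
        abs_of_pos hk, abs_of_nonneg (sq_nonneg (halfPoint rmin rmax n i)), ← hv]
      have := hx.2
      gcongr
  · rw [S.B_succ hj hi]
    have h1 := abs_exponentRate_le hσ hσ1 hrmin hC hA hx hmp hmn
    rw [← hv, ← hQ] at *
    set y := exponentRate σ (S.A i (j + 1)) (halfPoint rmin rmax n i) v
    have h2 : |meshWidth rmin rmax n * y| ≤ Q * meshWidth rmin rmax n := by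
      rw [abs_mul, abs_of_pos hm0, mul_comm]
      exact mul_le_mul_of_nonneg_right h1 hm0.le
    have h3 := Real.abs_exp_sub_one_le (h2.trans hsmall)
    have e : S.B i (j + 1) * Real.exp (meshWidth rmin rmax n * y) - S.B i (j + 1)
        = S.B i (j + 1) * (Real.exp (meshWidth rmin rmax n * y) - 1) := by ring
    rw [e, abs_mul, abs_of_pos (hC'.trans_le hB.1)]
    calc _ ≤ C * (2 * (Q * meshWidth rmin rmax n)) :=
        mul_le_mul hB.2 (h3.trans (by linarith)) (abs_nonneg _) hC.le
      _ = _ := by ring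

/-- Spatial differences come from the initial profiles at level `0` and from the update afterwards.
They start at `i = 2`, because the initial metric in the first cell is free. Time differences start
at level `1`, because the initial metric need not satisfy the update formulas. -/
theorem exists_metricEstimates (hσ : 0 < σ) (hσ1 : σ < 1) (hrmin : 0 < rmin) (hr : rmin < rmax)
    (hMb : ∃ L, LipschitzOnWith L Mb (Icc t0 tend)) (hBb : ∃ L, LipschitzOnWith L Bb (Icc t0 tend))
    (hA₀ : ∃ L, LipschitzOnWith L A₀ (Icc rmin rmax))
    (hB₀ : ∃ L, LipschitzOnWith L B₀ (Icc rmin rmax))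
    (hK : IsCompact K) (hKp : K ⊆ physical σ) (hC : 0 < C) (V : NNReal) {D : ℝ} (hD : 0 < D) :
    ∃ D' h₀ : ℝ, 0 < D' ∧ 0 < h₀ ∧ ∀ (n : ℕ)
      (S : GodunovApproximation σ rmin rmax t0 tend Mb Bb u₀ A₀ B₀ n), S.IsBoundedBy K C V →
      S.StepEstimates D → meshWidth rmin rmax n ≤ h₀ → S.MetricEstimates D' := by
  obtain ⟨LM, hLM⟩ := hMb
  obtain ⟨LB, hLB⟩ := hBb
  obtain ⟨LA0, hLA0⟩ := hA₀
  obtain ⟨LB0, hLB0⟩ := hB₀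
  obtain ⟨LT, R, hR0, hR, hLT⟩ := exists_metricEstimates_aux hσ hσ1 hK hKp
  have hk := kappa_pos
  have hrm : 0 < rmax := hrmin.trans hr
  have hrr : 0 ≤ rmax - rmin := by linarith
  obtain ⟨U, hU⟩ : ∃ U, U = 2 * R + D * (2 * R + V + V) + D * C * (rmax - rmin) := ⟨_, rfl⟩
  have hU0 : 0 ≤ U := by rw [hU]; positivity
  obtain ⟨DA, hDA⟩ : ∃ DA, DA = 4 / rmin * (LM + kappa * rmax ^ 2 * C * U) := ⟨_, rfl⟩
  have hDA0 : 0 ≤ DA := by rw [hDA]; positivity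
  obtain ⟨Q, hQ⟩ : ∃ Q, Q = C ^ 2 * (2 / rmin + kappa * rmax * R) * (2 * (rmax - rmin) * DA)
      + kappa * rmax * C * LT * (2 * C * U) := ⟨_, rfl⟩
  have hQ0 : 0 ≤ Q := by rw [hQ]; positivity
  obtain ⟨P, hP⟩ : ∃ P, P = (C + 1) * (2 / rmin) + kappa * rmax * C * R := ⟨_, rfl⟩
  have hP0 : 0 ≤ P := by rw [hP]; positivity
  obtain ⟨D', hD'0, d1, d2, d3, d4, d5, d6⟩ : ∃ D' : ℝ, 0 < D' ∧
      (C + 1) * (2 / rmin) + kappa * R * rmax ^ 2 * (2 / rmin) ≤ D' ∧ C * (2 * P) ≤ D' ∧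
      (LA0 : ℝ) ≤ D' ∧ (LB0 : ℝ) ≤ D' ∧ DA ≤ D' ∧ LB * C ^ 2 + C * (2 * Q) ≤ D' := by
    have e1 : 0 ≤ (C + 1) * (2 / rmin) + kappa * R * rmax ^ 2 * (2 / rmin) := by positivity
    have e2 : 0 ≤ C * (2 * P) := by positivity
    have e3 : (0 : ℝ) ≤ LA0 := LA0.2
    have e4 : (0 : ℝ) ≤ LB0 := LB0.2
    have e5 : 0 ≤ LB * C ^ 2 + C * (2 * Q) := by positivity
    exact ⟨1 + ((C + 1) * (2 / rmin) + kappa * R * rmax ^ 2 * (2 / rmin)) + C * (2 * P) + LA0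
      + LB0 + DA + (LB * C ^ 2 + C * (2 * Q)), by linarith, by linarith, by linarith, by linarith,
      by linarith, by linarith, by linarith⟩
  -- The three thresholds keep the half gridpoints away from zero and keep the exponents below `1`
  -- over one mesh width and over one time step.
  refine ⟨D', min rmin (min (1 / (P + 1)) (1 / (Q * (C / 2) + 1))), hD'0, by positivity,
    fun n S hS hE hm => ?_⟩
  have hm1 : meshWidth rmin rmax n ≤ rmin := hm.trans (min_le_left _ _)
  have hm2 : meshWidth rmin rmax n ≤ 1 / (P + 1) :=
    hm.trans ((min_le_right _ _).trans (min_le_left _ _))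
  have hm3 : meshWidth rmin rmax n ≤ 1 / (Q * (C / 2) + 1) :=
    hm.trans ((min_le_right _ _).trans (min_le_right _ _))
  have hn := S.two_le
  have hm0 := meshWidth_pos hr hn
  have hPm : P * meshWidth rmin rmax n ≤ 1 := by
    rw [le_div_iff₀ (by positivity)] at hm2; linarith
  have hQm : Q * (C / 2 * meshWidth rmin rmax n) ≤ 1 := by
    rw [le_div_iff₀ (by positivity)] at hm3; linarith
  refine ⟨fun j hj i hi => ?_, fun j hj hj1 i hi => ?_⟩
  · rcases j with _ | j
    · have x1 : halfPoint rmin rmax n i ∈ Icc rmin rmax := by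
        have h1 := gridPoint_mono hr hn hi.1
        rw [gridPoint_succ, gridPoint_one] at h1
        have h2 := (gridPoint_mem hr hn (i := i) ⟨by have := hi.1; omega, hi.2.le⟩).2
        rw [halfPoint]
        constructor <;> linarith
      have x2 : halfPoint rmin rmax n (i + 1) ∈ Icc rmin rmax := by
        have h2 := (gridPoint_mem hr hn (i := i + 1) ⟨by omega, hi.2⟩).2
        refine ⟨?_, by rw [halfPoint]; linarith⟩
        rw [halfPoint_succ]
        linarith [x1.1]
      obtain ⟨a1, b1⟩ := S.init_metric i (Finset.mem_Icc.2 ⟨hi.1, hi.2.le⟩)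
      obtain ⟨a2, b2⟩ := S.init_metric (i + 1) (Finset.mem_Icc.2 ⟨by have := hi.1; omega, hi.2⟩)
      have e : halfPoint rmin rmax n (i + 1) - halfPoint rmin rmax n i = meshWidth rmin rmax n := by
        rw [halfPoint_succ]; ring
      have l1 := abs_sub_le_of_lipschitzOnWith hLA0 x1 x2 (by linarith)
      have l2 := abs_sub_le_of_lipschitzOnWith hLB0 x1 x2 (by linarith)
      rw [e] at l1 l2
      rw [a1, a2, b1, b2]
      exact ⟨l1.trans (by gcongr), l2.trans (by gcongr)⟩
    · obtain ⟨l1, l2⟩ := hS.metric_space_succ hσ hσ1 hKp hC hrmin hr hm1 hR0 hR hj hP hPm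
        (i := i) ⟨by have := hi.1; omega, hi.2⟩
      exact ⟨l1.trans (by gcongr), l2.trans (by gcongr)⟩
  · intro h0
    have hsum := hE.sum_jump_le hS hD hC hr hR hj1 hj
    rw [← hU] at hsum
    have hlt := hS.time_lt hC hr hj
    have hA : ∀ i ∈ Icc 1 n, |S.A i (j + 2) - S.A i (j + 1)| ≤ DA * (S.t (j + 2) - S.t (j + 1)) :=
      fun i hi => by
        rw [hDA]
        exact hS.A_time hC hrmin hr hm1 hLM h0 hj hj1 hsum hi
    have hB := hS.B_time hσ hσ1 hKp hC hrmin hr hm1 hLB hLT hR0 hR hDA0 h0 hj hj1 hsum hA hQ hQm hi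
    have hΔ0 : 0 ≤ S.t (j + 2) - S.t (j + 1) := by linarith
    exact ⟨(hA i hi).trans (by gcongr), hB.trans (by gcongr)⟩

end MetricEstimates

/-! ### Limits of step functions -/

section StepFunctions

variable {α E ι : Type*} [NormedAddCommGroup E]

/-- The step function with value `e i` on the set `c i`, for `i` in a finite set. -/
noncomputable def stepFunction (s : Finset ι) (c : ι → Set α) (e : ι → E) (p : α) : E :=
  ∑ i ∈ s, (c i).indicator (fun _ => e i) p

theorem stepFunction_eq {s : Finset ι} {c : ι → Set α} (hd : (s : Set ι).PairwiseDisjoint c)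
    (e : ι → E) {p : α} {i : ι} (hi : i ∈ s) (hp : p ∈ c i) : stepFunction s c e p = e i := by
  rw [stepFunction, Finset.sum_eq_single i, indicator_of_mem hp]
  · intro j hj hji
    refine indicator_of_notMem (fun hpj => ?_) _
    exact (disjoint_left.1 (hd hj hi hji) hpj) hp
  · exact fun h => absurd hi h

theorem norm_stepFunction_le {s : Finset ι} {c : ι → Set α}
    (hd : (s : Set ι).PairwiseDisjoint c) {e : ι → E} {D : ℝ} (hD : 0 ≤ D)
    (he : ∀ i ∈ s, ‖e i‖ ≤ D) (p : α) : ‖stepFunction s c e p‖ ≤ D := by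
  by_cases h : ∃ i ∈ s, p ∈ c i
  · obtain ⟨i, hi, hp⟩ := h
    rw [stepFunction_eq hd e hi hp]
    exact he i hi
  · push Not at h
    rw [stepFunction, Finset.sum_eq_zero fun i hi => indicator_of_notMem (h i hi) _]
    simpa using hD

variable [MeasurableSpace α]

theorem stronglyMeasurable_stepFunction {s : Finset ι} {c : ι → Set α}
    (hc : ∀ i ∈ s, MeasurableSet (c i)) (e : ι → E) :
    StronglyMeasurable (stepFunction s c e) := by
  unfold stepFunction
  exact Finset.stronglyMeasurable_fun_sum _ fun i hi => stronglyMeasurable_const.indicator (hc i hi)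

variable [NormedSpace ℝ E]

theorem integral_stepFunction [CompleteSpace E] {μ : Measure α} [IsFiniteMeasure μ] {s : Finset ι}
    {c : ι → Set α} (hc : ∀ i ∈ s, MeasurableSet (c i)) (e : ι → E) :
    ∫ p, stepFunction s c e p ∂μ = ∑ i ∈ s, μ.real (c i) • e i := by
  unfold stepFunction
  rw [integral_finsetSum]
  · exact Finset.sum_congr rfl fun i hi => integral_indicator_const _ (hc i hi)
  · exact fun i hi => (integrable_const _).indicator (hc i hi)

/-- Bounded step functions that converge almost everywhere: the limit is measurable and bounded, and
the sums that represent the integrals converge to the integral of the limit. -/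
theorem tendsto_sum_of_step [CompleteSpace E] {μ : Measure α} [IsFiniteMeasure μ]
    {s : ℕ → Finset ι} {c : ℕ → ι → Set α}
    (hc : ∀ k, ∀ i ∈ s k, MeasurableSet (c k i)) (hd : ∀ k, (s k : Set ι).PairwiseDisjoint (c k))
    {e : ℕ → ι → E} {D : ℝ} (hD : 0 ≤ D) (he : ∀ k, ∀ i ∈ s k, ‖e k i‖ ≤ D) {f : α → E}
    (hf : ∀ᵐ p ∂μ, ∃ idx : ℕ → ι, (∀ᶠ k in atTop, idx k ∈ s k ∧ p ∈ c k (idx k)) ∧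
      Tendsto (fun k => e k (idx k)) atTop (𝓝 (f p))) :
    AEStronglyMeasurable f μ ∧
      Tendsto (fun k => ∑ i ∈ s k, μ.real (c k i) • e k i) atTop (𝓝 (∫ p, f p ∂μ)) := by
  have hlim : ∀ᵐ p ∂μ, Tendsto (fun k => stepFunction (s k) (c k) (e k) p) atTop (𝓝 (f p)) := by
    filter_upwards [hf] with p hp
    obtain ⟨idx, h1, h2⟩ := hp
    refine h2.congr' ?_
    filter_upwards [h1] with k hk
    exact (stepFunction_eq (hd k) (e k) hk.1 hk.2).symm
  have hm : ∀ k, AEStronglyMeasurable (stepFunction (s k) (c k) (e k)) μ := fun k =>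
    (stronglyMeasurable_stepFunction (hc k) (e k)).aestronglyMeasurable
  refine ⟨aestronglyMeasurable_of_tendsto_ae atTop hm hlim, ?_⟩
  have := tendsto_integral_of_dominated_convergence (fun _ => D) hm (integrable_const D)
    (fun k => Eventually.of_forall fun p => norm_stepFunction_le (hd k) hD (he k) p) hlim
  refine this.congr fun k => integral_stepFunction (hc k) (e k)

/-- Step functions whose integrals are summable tend to zero almost everywhere. -/
theorem ae_tendsto_zero_of_step {μ : Measure α} [IsFiniteMeasure μ]
    {s : ℕ → Finset ι} {c : ℕ → ι → Set α}
    (hc : ∀ k, ∀ i ∈ s k, MeasurableSet (c k i)) (hd : ∀ k, (s k : Set ι).PairwiseDisjoint (c k))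
    {e : ℕ → ι → ℝ} (he : ∀ k i, 0 ≤ e k i) {b : ℕ → ℝ} (hb : Summable b)
    (hsum : ∀ k, ∑ i ∈ s k, μ.real (c k i) * e k i ≤ b k) :
    ∀ᵐ p ∂μ, ∀ idx : ℕ → ι, (∀ᶠ k in atTop, idx k ∈ s k ∧ p ∈ c k (idx k)) →
      Tendsto (fun k => e k (idx k)) atTop (𝓝 0) := by
  have hint : ∀ k, ∫⁻ p, ENNReal.ofReal (stepFunction (s k) (c k) (e k) p) ∂μ
      ≤ ENNReal.ofReal (b k) := by
    intro k
    rw [← ofReal_integral_eq_lintegral_ofReal]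
    · refine ENNReal.ofReal_le_ofReal ?_
      rw [integral_stepFunction (hc k)]
      exact hsum k
    · unfold stepFunction
      exact integrable_finsetSum _ fun i hi => (integrable_const _).indicator (hc k i hi)
    · refine Eventually.of_forall fun p => ?_
      exact Finset.sum_nonneg fun i _ => indicator_nonneg (fun _ _ => he k i) p
  -- By Tonelli the sum of all step functions is integrable, hence finite almost everywhere, and the
  -- terms of a convergent series tend to zero. This is where summable mesh widths are needed.
  have hfin : ∫⁻ p, ∑' k, ENNReal.ofReal (stepFunction (s k) (c k) (e k) p) ∂μ ≠ ⊤ := by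
    rw [lintegral_tsum fun k => ((stronglyMeasurable_stepFunction (hc k)
      (e k)).measurable.ennreal_ofReal).aemeasurable]
    refine ne_top_of_le_ne_top ?_ (ENNReal.tsum_le_tsum hint)
    exact hb.tsum_ofReal_ne_top
  have hmeas : AEMeasurable (fun p => ∑' k, ENNReal.ofReal (stepFunction (s k) (c k) (e k) p)) μ :=
    AEMeasurable.tsum fun k => ((stronglyMeasurable_stepFunction (hc k)
      (e k)).measurable.ennreal_ofReal).aemeasurable
  filter_upwards [ae_lt_top' hmeas hfin] with p hp idx hidx
  have h := ENNReal.tendsto_atTop_zero_of_tsum_ne_top hp.ne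
  have h' := (ENNReal.tendsto_toReal ENNReal.zero_ne_top).comp h
  rw [ENNReal.toReal_zero] at h'
  refine h'.congr' ?_
  filter_upwards [hidx] with k hk
  simp only [Function.comp]
  rw [stepFunction_eq (hd k) (e k) hk.1 hk.2, ENNReal.toReal_ofReal (he k _)]

end StepFunctions

/-! ### Convergent families of approximate solutions -/

/-- A sequence of approximate solutions on meshes with summable widths, with uniform estimates, that
converges almost everywhere. -/
structure ConvergentFamily (σ rmin rmax t0 tend : ℝ) (Mb Bb : ℝ → ℝ) (u₀ : ℝ → ℝ × ℝ)
    (A₀ B₀ : ℝ → ℝ) (u : ℝ → ℝ → ℝ × ℝ) (A B : ℝ → ℝ → ℝ) where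
  hσ : 0 < σ
  hσ1 : σ < 1
  hrmin : 0 < rmin
  hr : rmin < rmax
  ht : t0 < tend
  lipMb : ∃ L, LipschitzOnWith L Mb (Icc t0 tend)
  lipBb : ∃ L, LipschitzOnWith L Bb (Icc t0 tend)
  N : ℕ → ℕ
  S : ∀ k : ℕ, GodunovApproximation σ rmin rmax t0 tend Mb Bb u₀ A₀ B₀ (N k)
  K : Set (ℝ × ℝ)
  hK : IsCompact K
  hKp : K ⊆ physical σ
  C : ℝ
  hC : 0 < C
  V : NNReal
  D : ℝ
  hD : 0 < D
  D' : ℝ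
  hD' : 0 < D'
  bounded : ∀ k, (S k).IsBoundedBy K C V
  step : ∀ k, (S k).StepEstimates D
  metric : ∀ k, (S k).MetricEstimates D'
  width_le : ∀ k, meshWidth rmin rmax (N k) ≤ rmin
  summable_width : Summable fun k => meshWidth rmin rmax (N k)
  conv : ∀ᵐ p ∂(volume.restrict (region rmin rmax t0 tend)),
    Tendsto (fun k => (S k).uApp p.1 p.2) atTop (𝓝 (u p.1 p.2)) ∧
    Tendsto (fun k => (S k).AApp p.1 p.2) atTop (𝓝 (A p.1 p.2)) ∧
    Tendsto (fun k => (S k).BApp p.1 p.2) atTop (𝓝 (B p.1 p.2))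
  conv₀ : ∀ᵐ x ∂(volume.restrict (Icc rmin rmax)),
    Tendsto (fun k => (S k).uApp t0 x) atTop (𝓝 (u₀ x))

namespace ConvergentFamily

variable {σ rmin rmax t0 tend : ℝ} {Mb Bb : ℝ → ℝ} {u₀ : ℝ → ℝ × ℝ} {A₀ B₀ : ℝ → ℝ}
  {u : ℝ → ℝ → ℝ × ℝ} {A B : ℝ → ℝ → ℝ}
  (F : ConvergentFamily σ rmin rmax t0 tend Mb Bb u₀ A₀ B₀ u A B)

/-- The mesh width. -/
noncomputable def dx (k : ℕ) : ℝ := meshWidth rmin rmax (F.N k)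

/-- The gridpoints. -/
noncomputable def X (k i : ℕ) : ℝ := gridPoint rmin rmax (F.N k) i

/-- The time levels. -/
noncomputable def T (k j : ℕ) : ℝ := (F.S k).t j

theorem two_le (k : ℕ) : 2 ≤ F.N k := (F.S k).two_le

theorem dx_pos (k : ℕ) : 0 < F.dx k := meshWidth_pos F.hr (F.two_le k)

theorem tendsto_dx : Tendsto F.dx atTop (𝓝 0) := F.summable_width.tendsto_atTop_zero

theorem X_succ (k i : ℕ) : F.X k (i + 1) = F.X k i + F.dx k := gridPoint_succ i

theorem X_pred (k : ℕ) {i : ℕ} (hi : 1 ≤ i) : F.X k (i - 1) = F.X k i - F.dx k := by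
  have := F.X_succ k (i - 1)
  rw [Nat.sub_add_cancel hi] at this
  linarith

theorem X_one (k : ℕ) : F.X k 1 = rmin := gridPoint_one

theorem X_last (k : ℕ) : F.X k (F.N k) = rmax := gridPoint_last (F.two_le k)

theorem X_mono (k : ℕ) : Monotone (F.X k) := gridPoint_mono F.hr (F.two_le k)

theorem T_zero (k : ℕ) : F.T k 0 = t0 := (F.S k).time_zero

theorem exists_last (k : ℕ) : ∃ m, tend ≤ F.T k (m + 1) := by
  obtain ⟨m, hm⟩ := (F.S k).reaches_end
  rcases m with _ | m
  · rw [(F.S k).time_zero] at hm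
    exact absurd F.ht (not_lt.2 hm)
  · exact ⟨m, hm⟩

open Classical in
/-- The index of the last time level before `tend`. -/
noncomputable def last (k : ℕ) : ℕ := Nat.find (F.exists_last k)

theorem le_T_last_succ (k : ℕ) : tend ≤ F.T k (F.last k + 1) := by
  classical
  exact Nat.find_spec (F.exists_last k)

theorem T_lt_tend {k j : ℕ} (hj : j ≤ F.last k) : F.T k j < tend := by
  classical
  rcases j with _ | j
  · rw [F.T_zero]; exact F.ht
  · exact not_le.1 (Nat.find_min (F.exists_last k) (m := j) (by unfold last at hj; omega))

theorem T_lt_succ {k j : ℕ} (hj : j ≤ F.last k) : F.T k j < F.T k (j + 1) :=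
  (F.bounded k).time_lt F.hC F.hr (F.T_lt_tend hj)

/-- Time levels are only constrained as long as the preceding one is before `tend`, whence the bound
on `j'`. -/
theorem T_mono {k j j' : ℕ} (h : j ≤ j') (hj' : j' ≤ F.last k + 1) : F.T k j ≤ F.T k j' := by
  induction j', h using Nat.le_induction with
  | base => exact le_rfl
  | succ m hm ih => exact (ih (by omega)).trans (F.T_lt_succ (by omega)).le

theorem t0_le_T {k j : ℕ} (hj : j ≤ F.last k + 1) : t0 ≤ F.T k j := by
  exact (F.T_zero k).ge.trans (F.T_mono (Nat.zero_le j) hj)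

theorem dx_le_dt {k j : ℕ} (hj : j ≤ F.last k) : F.dx k ≤ 2 * F.C * (F.T k (j + 1) - F.T k j) :=
  ((F.bounded k).time_step F.hC F.hr (F.T_lt_tend hj)).1

theorem dt_le_dx {k j : ℕ} (hj : j ≤ F.last k) : F.T k (j + 1) - F.T k j ≤ F.C / 2 * F.dx k :=
  ((F.bounded k).time_step F.hC F.hr (F.T_lt_tend hj)).2

/-- The index of the Riemann cell that contains `x`. -/
noncomputable def ix (k : ℕ) (x : ℝ) : ℕ := ⌊(x - rmin) / F.dx k⌋₊ + 2

open Classical in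
/-- The index of the time step that contains `t`. -/
noncomputable def jt (k : ℕ) (t : ℝ) : ℕ := Nat.findGreatest (fun j => F.T k j ≤ t) (F.last k)

theorem jt_le (k : ℕ) (t : ℝ) : F.jt k t ≤ F.last k := by
  classical
  exact Nat.findGreatest_le _

theorem T_jt_le (k : ℕ) {t : ℝ} (ht : t0 ≤ t) : F.T k (F.jt k t) ≤ t := by
  classical
  exact Nat.findGreatest_spec (P := fun j => F.T k j ≤ t) (Nat.zero_le _)
    (by rw [F.T_zero]; exact ht)

theorem lt_T_jt (k : ℕ) {t : ℝ} (ht : t < tend) : t < F.T k (F.jt k t + 1) := by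
  classical
  rcases (F.jt_le k t).eq_or_lt with h | h
  · rw [h]; exact ht.trans_le (F.le_T_last_succ k)
  · by_contra! hcon
    have := Nat.le_findGreatest (P := fun j => F.T k j ≤ t) (m := F.jt k t + 1) h hcon
    unfold jt at this
    omega

/-- Cell `i` is `[x_{i-1}, x_i)` and `x_1 = rmin`, so the cell that starts at `rmin` has index `2`;
this is the shift in `ix`. -/
theorem X_ix (k : ℕ) {x : ℝ} (hx : x ∈ Ico rmin rmax) :
    F.ix k x ∈ Icc 2 (F.N k) ∧ F.X k (F.ix k x - 1) ≤ x ∧ x < F.X k (F.ix k x) := by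
  have h0 := F.dx_pos k
  have hq : 0 ≤ (x - rmin) / F.dx k := div_nonneg (by linarith [hx.1]) h0.le
  have h1 := Nat.floor_le hq
  have h2 := Nat.lt_floor_add_one ((x - rmin) / F.dx k)
  rw [le_div_iff₀ h0] at h1
  rw [div_lt_iff₀ h0] at h2
  have e1 : F.X k (F.ix k x - 1) = rmin + (⌊(x - rmin) / F.dx k⌋₊ : ℝ) * F.dx k := by
    simp [X, ix, gridPoint, dx]
  have e2 : F.X k (F.ix k x) = rmin + ((⌊(x - rmin) / F.dx k⌋₊ : ℝ) + 1) * F.dx k := by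
    simp only [X, ix, gridPoint, dx]; push_cast; ring
  refine ⟨⟨by simp [ix], ?_⟩, by rw [e1]; linarith, by rw [e2]; linarith⟩
  by_contra! hcon
  have := F.X_mono k (show F.N k ≤ F.ix k x - 1 by omega)
  rw [F.X_last, e1] at this
  linarith [hx.2]

/-- The Riemann cell with index `(i, j)`. -/
def cell (k : ℕ) (q : ℕ × ℕ) : Set (ℝ × ℝ) :=
  Ico (F.T k q.2) (F.T k (q.2 + 1)) ×ˢ Ico (F.X k (q.1 - 1)) (F.X k q.1)

/-- The indices of the Riemann cells inside `[rmin, rmax)` before the last time level. -/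
noncomputable def cells (k : ℕ) : Finset (ℕ × ℕ) := Finset.Icc 2 (F.N k) ×ˢ Finset.range (F.last k)

theorem X_cell_unique {k i i' : ℕ} {x : ℝ}
    (h1 : F.X k (i - 1) ≤ x) (h2 : x < F.X k i) (h1' : F.X k (i' - 1) ≤ x)
    (h2' : x < F.X k i') : i = i' := by
  by_contra hne
  rcases Nat.lt_or_gt_of_ne hne with h | h
  · have := F.X_mono k (show i ≤ i' - 1 by omega)
    linarith
  · have := F.X_mono k (show i' ≤ i - 1 by omega)
    linarith

theorem T_cell_unique {k j j' : ℕ} {t : ℝ} (hj : j ≤ F.last k) (hj' : j' ≤ F.last k)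
    (h1 : F.T k j ≤ t) (h2 : t < F.T k (j + 1)) (h1' : F.T k j' ≤ t)
    (h2' : t < F.T k (j' + 1)) : j = j' := by
  by_contra hne
  rcases Nat.lt_or_gt_of_ne hne with h | h
  · have := F.T_mono (k := k) (show j + 1 ≤ j' by omega) (by omega)
    linarith
  · have := F.T_mono (k := k) (show j' + 1 ≤ j by omega) (by omega)
    linarith

theorem cells_disjoint (k : ℕ) : (F.cells k : Set (ℕ × ℕ)).PairwiseDisjoint (F.cell k) := by
  rintro ⟨i, j⟩ hq ⟨i', j'⟩ hq' hne
  simp only [cells, Finset.coe_product, mem_prod, Finset.mem_coe, Finset.mem_Icc,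
    Finset.mem_range] at hq hq'
  refine disjoint_left.2 fun p hp hp' => hne ?_
  have h1 := F.X_cell_unique hp.2.1 hp.2.2 hp'.2.1 hp'.2.2
  have h2 := F.T_cell_unique (by omega) (by omega) hp.1.1 hp.1.2 hp'.1.1 hp'.1.2
  simp only at h1 h2
  rw [h1, h2]

theorem measurableSet_cell (k : ℕ) (q : ℕ × ℕ) : MeasurableSet (F.cell k q) :=
  measurableSet_Ico.prod measurableSet_Ico

/-- Lebesgue measure on the region. -/
noncomputable abbrev mu (_ : ConvergentFamily σ rmin rmax t0 tend Mb Bb u₀ A₀ B₀ u A B) :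
    Measure (ℝ × ℝ) := volume.restrict (region rmin rmax t0 tend)

theorem mu_eq_prod : F.mu = (volume.restrict (Icc t0 tend)).prod (volume.restrict (Icc rmin rmax)) := by
  rw [mu, region, Measure.volume_eq_prod, Measure.prod_restrict]

instance instIsFiniteMeasure_mu : IsFiniteMeasure F.mu := by
  rw [mu_eq_prod]; infer_instance

theorem cell_subset {k : ℕ} {q : ℕ × ℕ} (hq : q ∈ F.cells k) :
    F.cell k q ⊆ region rmin rmax t0 tend := by
  simp only [cells, Finset.mem_product, Finset.mem_Icc, Finset.mem_range] at hq
  refine prod_mono ?_ ?_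
  · refine Ico_subset_Icc_self.trans (Icc_subset_Icc (F.t0_le_T (by omega)) ?_)
    exact (F.T_lt_tend (by omega)).le
  · refine Ico_subset_Icc_self.trans (Icc_subset_Icc ?_ ?_)
    · exact (F.X_one k).ge.trans (F.X_mono k (by omega))
    · exact (F.X_mono k (by omega)).trans (F.X_last k).le

theorem mu_real_cell {k : ℕ} {q : ℕ × ℕ} (hq : q ∈ F.cells k) :
    F.mu.real (F.cell k q) = (F.T k (q.2 + 1) - F.T k q.2) * F.dx k := by
  have hsub := F.cell_subset hq
  simp only [cells, Finset.mem_product, Finset.mem_Icc, Finset.mem_range] at hq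
  have h1 := F.T_lt_succ (k := k) (j := q.2) (by omega)
  have h2 := F.X_pred k (i := q.1) (by omega)
  rw [measureReal_restrict_apply (F.measurableSet_cell k q), inter_eq_left.2 hsub, cell,
    Measure.volume_eq_prod, measureReal_prod_prod, Real.volume_real_Ico_of_le h1.le,
    Real.volume_real_Ico_of_le (by rw [h2]; linarith [F.dx_pos k]), h2]
  ring

theorem tendsto_T_last : Tendsto (fun k => F.T k (F.last k)) atTop (𝓝 tend) := by
  have h : Tendsto (fun k => tend - F.C / 2 * F.dx k) atTop (𝓝 tend) := by
    simpa using (tendsto_const_nhds (x := tend)).sub (F.tendsto_dx.const_mul (F.C / 2))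
  refine tendsto_of_tendsto_of_tendsto_of_le_of_le h tendsto_const_nhds (fun k => ?_)
    (fun k => (F.T_lt_tend le_rfl).le)
  have h1 := F.dt_le_dx (k := k) (j := F.last k) le_rfl
  have h2 := F.le_T_last_succ k
  simp only
  linarith

theorem eventually_jt_lt {t : ℝ} (h0 : t0 ≤ t) (ht : t < tend) :
    ∀ᶠ k in atTop, F.jt k t < F.last k := by
  filter_upwards [F.tendsto_T_last.eventually (lt_mem_nhds ht)] with k hk
  refine lt_of_le_of_ne (F.jt_le k t) fun h => ?_
  have := F.T_jt_le k h0
  rw [h] at this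
  linarith

/-- Since steps are at most `C / 2 * Δx`, a fixed number of them reaches only `t0 + O(Δx)`. With `m
= 1` it takes a fixed time past the initial level, to which the metric update does not apply. -/
theorem eventually_le_jt (m : ℕ) {t : ℝ} (h0 : t0 < t) (ht : t < tend) :
    ∀ᶠ k in atTop, m ≤ F.jt k t := by
  have h : Tendsto (fun k => t0 + m * (F.C / 2 * F.dx k)) atTop (𝓝 t0) := by
    simpa using (tendsto_const_nhds (x := t0)).add
      ((F.tendsto_dx.const_mul (F.C / 2)).const_mul (m : ℝ))
  filter_upwards [h.eventually (gt_mem_nhds h0)] with k hk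
  by_contra! hcon
  have hb : ∀ j, j ≤ F.last k + 1 → F.T k j ≤ t0 + j * (F.C / 2 * F.dx k) := by
    intro j
    induction j with
    | zero => intro _; simp [F.T_zero]
    | succ j ih =>
      intro hj
      have h1 := ih (by omega)
      have h2 := F.dt_le_dx (k := k) (j := j) (by omega)
      push_cast
      linarith
  have h1 := F.lt_T_jt k ht
  have h2 := hb (F.jt k t + 1) (by have := F.jt_le k t; omega)
  have h3 : ((F.jt k t + 1 : ℕ) : ℝ) * (F.C / 2 * F.dx k) ≤ m * (F.C / 2 * F.dx k) := by
    have := F.dx_pos k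
    have := F.hC
    gcongr
    exact hcon
  linarith

theorem eventually_ix_lt {x : ℝ} (hx : x ∈ Ico rmin rmax) : ∀ᶠ k in atTop, F.ix k x < F.N k := by
  have h : Tendsto (fun k => rmax - F.dx k) atTop (𝓝 rmax) := by
    simpa using (tendsto_const_nhds (x := rmax)).sub F.tendsto_dx
  filter_upwards [h.eventually (lt_mem_nhds hx.2)] with k hk
  obtain ⟨h1, h2, h3⟩ := F.X_ix k hx
  refine lt_of_le_of_ne h1.2 fun h => ?_
  rw [h, F.X_pred k (by have := F.two_le k; omega), F.X_last] at h2
  linarith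

theorem eventually_mem_cell {p : ℝ × ℝ} (hp : p ∈ Ico t0 tend ×ˢ Ico rmin rmax) :
    ∀ᶠ k in atTop, (F.ix k p.2, F.jt k p.1) ∈ F.cells k ∧
      p ∈ F.cell k (F.ix k p.2, F.jt k p.1) := by
  filter_upwards [F.eventually_jt_lt hp.1.1 hp.1.2] with k hk
  obtain ⟨h1, h2, h3⟩ := F.X_ix k hp.2
  refine ⟨?_, ⟨⟨F.T_jt_le k hp.1.1, F.lt_T_jt k hp.1.2⟩, h2, h3⟩⟩
  simp only [cells, Finset.mem_product, Finset.mem_Icc, Finset.mem_range]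
  exact ⟨h1, hk⟩

theorem ae_mem_Ioo : ∀ᵐ p ∂F.mu, p ∈ Ioo t0 tend ×ˢ Ioo rmin rmax := by
  rw [mu_eq_prod, ← Measure.restrict_congr_set Ioo_ae_eq_Icc, ← Measure.restrict_congr_set
    (Ioo_ae_eq_Icc (a := rmin) (b := rmax)), Measure.prod_restrict]
  exact ae_restrict_mem (measurableSet_Ioo.prod measurableSet_Ioo)

theorem sum_dt (k : ℕ) : ∑ j ∈ Finset.range (F.last k), (F.T k (j + 1) - F.T k j)
    ≤ tend - t0 := by
  rw [Finset.sum_range_sub (F.T k), F.T_zero]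
  linarith [F.T_lt_tend (k := k) le_rfl]

theorem state_mem {k j : ℕ} (hj : j ≤ F.last k) {i : ℕ} (hi : i ≤ F.N k + 1) :
    (F.S k).u i j ∈ F.K := (F.bounded k).state_mem j (F.T_lt_tend hj) i hi

theorem A_mem {k j : ℕ} (hj : j ≤ F.last k) {i : ℕ} (hi : i ∈ Icc 1 (F.N k + 1)) :
    (F.S k).A i j ∈ Icc F.C⁻¹ F.C :=
  ((F.bounded k).metric_mem j (F.T_lt_tend hj) i (Finset.mem_Icc.2 hi)).1

theorem B_mem {k j : ℕ} (hj : j ≤ F.last k) {i : ℕ} (hi : i ∈ Icc 1 (F.N k + 1)) :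
    (F.S k).B i j ∈ Icc F.C⁻¹ F.C :=
  ((F.bounded k).metric_mem j (F.T_lt_tend hj) i (Finset.mem_Icc.2 hi)).2

theorem sum_pred_variation_le {k j : ℕ} (hj : j ≤ F.last k) :
    ∑ i ∈ Finset.Icc 2 (F.N k), ‖(F.S k).u i j - (F.S k).u (i - 1) j‖ ≤ F.V := by
  refine le_trans (le_of_eq ?_) ((F.bounded k).sum_variation_le F.hC F.hr (F.T_lt_tend hj))
  symm
  refine Finset.sum_bij (fun i _ => i + 1) ?_ ?_ ?_ ?_
  · intro i hi; simp only [Finset.mem_Ico, Finset.mem_Icc] at *; omega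
  · intro i _ i' _ h; omega
  · intro i hi
    simp only [Finset.mem_Icc] at hi
    exact ⟨i - 1, by simp only [Finset.mem_Ico]; omega, by omega⟩
  · intro i _; simp

theorem sum_succ_variation_le {k j : ℕ} (hj : j ≤ F.last k) :
    ∑ i ∈ Finset.Ico 2 (F.N k), ‖(F.S k).u (i + 1) j - (F.S k).u i j‖ ≤ F.V := by
  refine le_trans ?_ ((F.bounded k).sum_variation_le F.hC F.hr (F.T_lt_tend hj))
  refine Finset.sum_le_sum_of_subset_of_nonneg (fun i hi => ?_) fun i _ _ => norm_nonneg _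
  simp only [Finset.mem_Ico] at *
  omega

/-- The jumps between neighbouring states vanish almost everywhere in the limit. -/
theorem ae_tendsto_jump : ∀ᵐ p ∂F.mu,
    Tendsto (fun k => ‖(F.S k).u (F.ix k p.2) (F.jt k p.1)
      - (F.S k).u (F.ix k p.2 - 1) (F.jt k p.1)‖) atTop (𝓝 0) ∧
    Tendsto (fun k => ‖(F.S k).u (F.ix k p.2 + 1) (F.jt k p.1)
      - (F.S k).u (F.ix k p.2) (F.jt k p.1)‖) atTop (𝓝 0) := by
  -- With cells weighted by area, the jumps at one time level add up to at most `V * Δx * Δt`, hence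
  -- to this bound over all levels.
  have hb : Summable fun k => (tend - t0) * (F.V * F.dx k) :=
    (F.summable_width.mul_left _).mul_left _
  have h1 := ae_tendsto_zero_of_step (μ := F.mu) (s := F.cells) (c := F.cell)
    (fun k q _ => F.measurableSet_cell k q) F.cells_disjoint
    (e := fun k q => ‖(F.S k).u q.1 q.2 - (F.S k).u (q.1 - 1) q.2‖) (fun k q => norm_nonneg _) hb
    (fun k => by
      rw [Finset.sum_congr rfl fun q hq => by rw [F.mu_real_cell hq], cells,
        Finset.sum_product_right]
      refine le_trans (Finset.sum_le_sum fun j hj => ?_) (?_ : ∑ j ∈ Finset.range (F.last k),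
        (F.T k (j + 1) - F.T k j) * (F.V * F.dx k) ≤ _)
      · rw [Finset.mem_range] at hj
        have hΔ := F.T_lt_succ (k := k) (j := j) hj.le
        have hdx := F.dx_pos k
        dsimp only
        rw [← Finset.mul_sum, mul_assoc, mul_comm (F.V : ℝ)]
        have := F.sum_pred_variation_le (k := k) (j := j) hj.le
        have : 0 ≤ F.T k (j + 1) - F.T k j := by linarith
        gcongr
      · rw [← Finset.sum_mul]
        have := F.dx_pos k
        exact mul_le_mul_of_nonneg_right (F.sum_dt k) (by positivity))
  -- The last column is omitted, since its forward jump leads to a ghost state. Every fixed radius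
  -- below `rmax` eventually leaves that column.
  have h2 := ae_tendsto_zero_of_step (μ := F.mu)
    (s := fun k => Finset.Ico 2 (F.N k) ×ˢ Finset.range (F.last k)) (c := F.cell)
    (fun k q _ => F.measurableSet_cell k q) (fun k => (F.cells_disjoint k).subset (by
      intro q hq
      simp only [cells, Finset.coe_product, mem_prod, Finset.mem_coe, Finset.mem_Icc,
        Finset.mem_Ico] at *
      exact ⟨⟨hq.1.1, hq.1.2.le⟩, hq.2⟩))
    (e := fun k q => ‖(F.S k).u (q.1 + 1) q.2 - (F.S k).u q.1 q.2‖) (fun k q => norm_nonneg _) hb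
    (fun k => by
      rw [Finset.sum_congr rfl fun q hq => by
        rw [F.mu_real_cell (by
          simp only [cells, Finset.mem_product, Finset.mem_Icc, Finset.mem_Ico] at *
          exact ⟨⟨hq.1.1, hq.1.2.le⟩, hq.2⟩)], Finset.sum_product_right]
      refine le_trans (Finset.sum_le_sum fun j hj => ?_) (?_ : ∑ j ∈ Finset.range (F.last k),
        (F.T k (j + 1) - F.T k j) * (F.V * F.dx k) ≤ _)
      · rw [Finset.mem_range] at hj
        have hΔ := F.T_lt_succ (k := k) (j := j) hj.le
        have hdx := F.dx_pos k
        dsimp only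
        rw [← Finset.mul_sum, mul_assoc, mul_comm (F.V : ℝ)]
        have := F.sum_succ_variation_le (k := k) (j := j) hj.le
        have : 0 ≤ F.T k (j + 1) - F.T k j := by linarith
        gcongr
      · rw [← Finset.sum_mul]
        have := F.dx_pos k
        exact mul_le_mul_of_nonneg_right (F.sum_dt k) (by positivity))
  filter_upwards [h1, h2, F.ae_mem_Ioo] with p hp1 hp2 hp
  have hp' : p ∈ Ico t0 tend ×ˢ Ico rmin rmax :=
    ⟨Ioo_subset_Ico_self hp.1, Ioo_subset_Ico_self hp.2⟩
  refine ⟨hp1 (fun k => (F.ix k p.2, F.jt k p.1)) (F.eventually_mem_cell hp'),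
    hp2 (fun k => (F.ix k p.2, F.jt k p.1)) ?_⟩
  filter_upwards [F.eventually_mem_cell hp', F.eventually_ix_lt hp'.2] with k hk1 hk2
  refine ⟨?_, hk1.2⟩
  have := hk1.1
  simp only [cells, Finset.mem_product, Finset.mem_Icc, Finset.mem_Ico] at *
  exact ⟨⟨this.1.1, hk2⟩, this.2⟩

/-- The states and the metric on the cells converge almost everywhere. -/
theorem ae_tendsto_state : ∀ᵐ p ∂F.mu,
    Tendsto (fun k => (F.S k).u (F.ix k p.2) (F.jt k p.1)) atTop (𝓝 (u p.1 p.2)) ∧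
    Tendsto (fun k => (F.S k).A (F.ix k p.2) (F.jt k p.1)) atTop (𝓝 (A p.1 p.2)) ∧
    Tendsto (fun k => (F.S k).B (F.ix k p.2) (F.jt k p.1)) atTop (𝓝 (B p.1 p.2)) := by
  filter_upwards [F.conv, F.ae_tendsto_jump, F.ae_mem_Ioo] with p ⟨h1, h2, h3⟩ ⟨h4, _⟩ hp
  have hp' : p ∈ Ico t0 tend ×ˢ Ico rmin rmax :=
    ⟨Ioo_subset_Ico_self hp.1, Ioo_subset_Ico_self hp.2⟩
  have hidx : ∀ k, F.ix k p.2 ∈ Icc 1 (F.N k + 1) := fun k => by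
    obtain ⟨h, -⟩ := F.X_ix k hp'.2
    exact ⟨by have := h.1; omega, by have := h.2; omega⟩
  have happ := fun k => (F.S k).approx (F.jt k p.1) (F.T_lt_tend (F.jt_le k _)) (F.ix k p.2)
    (Finset.mem_Icc.2 (hidx k)) p.1 p.2 (F.T_jt_le k hp'.1.1) (F.lt_T_jt k hp'.1.2) hp'.1.2
    (F.X_ix k hp'.2).2.1 (F.X_ix k hp'.2).2.2 hp'.2.1 hp'.2.2.le
  refine ⟨?_, h2.congr fun k => (happ k).2.1, h3.congr fun k => (happ k).2.2⟩
  -- Cell state and approximate solution differ by at most a multiple of jump plus mesh width, so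
  -- the assumed convergence passes to the cell states.
  have hsub := fun k => (F.step k).approx_sub (F.jt k p.1) (F.T_lt_tend (F.jt_le k _)) (F.ix k p.2)
    (hidx k) p.1 p.2 (F.T_jt_le k hp'.1.1) (F.lt_T_jt k hp'.1.2) hp'.1.2
    (F.X_ix k hp'.2).2.1 (F.X_ix k hp'.2).2.2 hp'.2.1 hp'.2.2.le
  have hz : Tendsto (fun k => F.D * (‖(F.S k).u (F.ix k p.2) (F.jt k p.1)
      - (F.S k).u (F.ix k p.2 - 1) (F.jt k p.1)‖ + F.dx k)) atTop (𝓝 0) := by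
    simpa using (h4.add F.tendsto_dx).const_mul F.D
  have hz' := squeeze_zero_norm hsub hz
  simpa using h1.sub hz'

theorem ae_tendsto_jump_init : ∀ᵐ x ∂(volume.restrict (Icc rmin rmax)),
    Tendsto (fun k => ‖(F.S k).u (F.ix k x) 0 - (F.S k).u (F.ix k x - 1) 0‖) atTop (𝓝 0) := by
  have hb : Summable fun k => F.V * F.dx k := F.summable_width.mul_left _
  have h1 := ae_tendsto_zero_of_step (μ := volume.restrict (Icc rmin rmax))
    (s := fun k => Finset.Icc 2 (F.N k)) (c := fun k i => Ico (F.X k (i - 1)) (F.X k i))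
    (fun k i _ => measurableSet_Ico)
    (fun k i _ i' _ hne => disjoint_left.2 fun x hx hx' =>
      hne (F.X_cell_unique hx.1 hx.2 hx'.1 hx'.2))
    (e := fun k i => ‖(F.S k).u i 0 - (F.S k).u (i - 1) 0‖) (fun k q => norm_nonneg _) hb
    (fun k => by
      refine le_trans (Finset.sum_le_sum fun i hi => ?_) (?_ : ∑ i ∈ Finset.Icc 2 (F.N k),
        F.dx k * ‖(F.S k).u i 0 - (F.S k).u (i - 1) 0‖ ≤ _)
      · rw [Finset.mem_Icc] at hi
        refine mul_le_mul_of_nonneg_right ?_ (norm_nonneg _)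
        rw [measureReal_restrict_apply measurableSet_Ico]
        refine (measureReal_mono inter_subset_left measure_Ico_lt_top.ne).trans ?_
        rw [F.X_pred k (by omega), Real.volume_real_Ico_of_le (by linarith [F.dx_pos k])]
        linarith
      · rw [← Finset.mul_sum, mul_comm]
        exact mul_le_mul_of_nonneg_right (F.sum_pred_variation_le (Nat.zero_le _))
          (F.dx_pos k).le)
  filter_upwards [h1, ae_restrict_mem measurableSet_Icc,
    ae_restrict_of_ae (Measure.ae_ne volume rmax)] with x hx hxm hne
  have hx' : x ∈ Ico rmin rmax := ⟨hxm.1, lt_of_le_of_ne hxm.2 hne⟩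
  refine hx (fun k => F.ix k x) (Eventually.of_forall fun k => ?_)
  obtain ⟨h1, h2, h3⟩ := F.X_ix k hx'
  exact ⟨Finset.mem_Icc.2 h1, h2, h3⟩

theorem ae_tendsto_init : ∀ᵐ x ∂(volume.restrict (Icc rmin rmax)),
    Tendsto (fun k => (F.S k).u (F.ix k x) 0) atTop (𝓝 (u₀ x)) := by
  filter_upwards [F.conv₀, F.ae_tendsto_jump_init, ae_restrict_mem measurableSet_Icc,
    ae_restrict_of_ae (Measure.ae_ne volume rmax)] with x h1 h4 hxm hne
  have hx' : x ∈ Ico rmin rmax := ⟨hxm.1, lt_of_le_of_ne hxm.2 hne⟩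
  have hidx : ∀ k, F.ix k x ∈ Icc 1 (F.N k + 1) := fun k => by
    obtain ⟨h, -⟩ := F.X_ix k hx'
    exact ⟨by have := h.1; omega, by have := h.2; omega⟩
  have hsub := fun k => (F.step k).approx_sub 0 (F.T_lt_tend (Nat.zero_le _)) (F.ix k x)
    (hidx k) t0 x (F.T_zero k).le ((F.T_zero k).symm.trans_lt (F.T_lt_succ (Nat.zero_le _)))
    F.ht (F.X_ix k hx').2.1 (F.X_ix k hx').2.2 hx'.1 hx'.2.le
  have hz : Tendsto (fun k => F.D * (‖(F.S k).u (F.ix k x) 0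
      - (F.S k).u (F.ix k x - 1) 0‖ + F.dx k)) atTop (𝓝 0) := by
    simpa using (h4.add F.tendsto_dx).const_mul F.D
  have hz' := squeeze_zero_norm hsub hz
  simpa using h1.sub hz'

end ConvergentFamily

/-! ### Lipschitz regularity of the limit metric and convergence of Riemann sums -/

theorem abs_sub_le_of_steps {f y : ℕ → ℝ} {a b : ℕ} {D : ℝ} (hD : 0 ≤ D)
    (h : ∀ i ∈ Ico a b, |f (i + 1) - f i| ≤ D * (y (i + 1) - y i)) {i i' : ℕ}
    (hi : i ∈ Icc a b) (hi' : i' ∈ Icc a b) : |f i' - f i| ≤ D * |y i' - y i| := by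
  wlog hii : i ≤ i' generalizing i i'
  · rw [abs_sub_comm, abs_sub_comm (y i')]
    exact this hi' hi (by omega)
  have key : |f i' - f i| ≤ D * (y i' - y i) := by
    induction i', hii using Nat.le_induction with
    | base => simp
    | succ m hm ih =>
      have h1 := ih ⟨hi.1.trans hm, by have := hi'.2; omega⟩
      have h2 := h m ⟨hi.1.trans hm, by have := hi'.2; omega⟩
      calc |f (m + 1) - f i| = |(f (m + 1) - f m) + (f m - f i)| := by ring_nf
        _ ≤ |f (m + 1) - f m| + |f m - f i| := abs_add_le _ _
        _ ≤ _ := by linarith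
  exact key.trans (mul_le_mul_of_nonneg_left (le_abs_self _) hD)

/-- Two almost everywhere measurable functions on a product that agree on almost every slice agree
almost everywhere. -/
theorem ae_eq_of_ae_ae_eq {α β : Type*} [MeasurableSpace α] [MeasurableSpace β] {μ : Measure α}
    {ν : Measure β} [SFinite ν] {f g : α × β → ℝ} (hf : AEMeasurable f (μ.prod ν))
    (hg : AEMeasurable g (μ.prod ν)) (h : ∀ᵐ x ∂μ, ∀ᵐ y ∂ν, f (x, y) = g (x, y)) :
    f =ᵐ[μ.prod ν] g := by
  have h1 := Measure.ae_ae_of_ae_prod hf.ae_eq_mk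
  have h2 := Measure.ae_ae_of_ae_prod hg.ae_eq_mk
  -- For measurable representatives the set of equality is measurable, so Fubini applies in the
  -- direction from slices to the product.
  have h3 : ∀ᵐ p ∂μ.prod ν, hf.mk f p = hg.mk g p := by
    rw [Measure.ae_prod_iff_ae_ae (measurableSet_eq_fun hf.measurable_mk hg.measurable_mk)]
    filter_upwards [h, h1, h2] with x hx hx1 hx2
    filter_upwards [hx, hx1, hx2] with y hy hy1 hy2
    rw [← hy1, ← hy2, hy]
  exact hf.ae_eq_mk.trans (EventuallyEq.trans h3 hg.ae_eq_mk.symm)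

namespace ConvergentFamily

variable {σ rmin rmax t0 tend : ℝ} {Mb Bb : ℝ → ℝ} {u₀ : ℝ → ℝ × ℝ} {A₀ B₀ : ℝ → ℝ}
  {u : ℝ → ℝ → ℝ × ℝ} {A B : ℝ → ℝ → ℝ}
  (F : ConvergentFamily σ rmin rmax t0 tend Mb Bb u₀ A₀ B₀ u A B)

theorem abs_X_sub_le (k : ℕ) {x x' : ℝ} (hx : x ∈ Ico rmin rmax) (hx' : x' ∈ Ico rmin rmax) :
    |F.X k (F.ix k x') - F.X k (F.ix k x)| ≤ |x' - x| + F.dx k := by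
  obtain ⟨h1, h2, h3⟩ := F.X_ix k hx
  obtain ⟨h1', h2', h3'⟩ := F.X_ix k hx'
  rw [F.X_pred k (by have := h1.1; omega)] at h2
  rw [F.X_pred k (by have := h1'.1; omega)] at h2'
  rw [abs_le]
  have := neg_abs_le (x' - x)
  have := le_abs_self (x' - x)
  constructor <;> linarith

theorem abs_T_sub_le (k : ℕ) {t t' : ℝ} (ht : t ∈ Ico t0 tend) (ht' : t' ∈ Ico t0 tend) :
    |F.T k (F.jt k t') - F.T k (F.jt k t)| ≤ |t' - t| + F.C / 2 * F.dx k := by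
  have h2 := F.T_jt_le k ht.1
  have h3 := F.lt_T_jt k ht.2
  have h2' := F.T_jt_le k ht'.1
  have h3' := F.lt_T_jt k ht'.2
  have h4 := F.dt_le_dx (F.jt_le k t)
  have h4' := F.dt_le_dx (F.jt_le k t')
  rw [abs_le]
  have := neg_abs_le (t' - t)
  have := le_abs_self (t' - t)
  constructor <;> linarith

/-- The limit of values on the cells that are uniformly Lipschitz on the mesh is Lipschitz. -/
theorem exists_lipschitz_limit {G : ℕ → ℕ → ℕ → ℝ}
    (hval : ∀ k, ∀ j ≤ F.last k, ∀ i ∈ Icc 2 (F.N k), G k i j ∈ Icc F.C⁻¹ F.C)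
    (hsp : ∀ k, ∀ j ≤ F.last k, ∀ i ∈ Ico 2 (F.N k), |G k (i + 1) j - G k i j| ≤ F.D' * F.dx k)
    (htm : ∀ k, ∀ j ∈ Ico 1 (F.last k), ∀ i ∈ Icc 2 (F.N k),
      |G k i (j + 1) - G k i j| ≤ F.D' * (F.T k (j + 1) - F.T k j)) {g : ℝ → ℝ → ℝ}
    (hlim : ∀ᵐ p ∂F.mu, Tendsto (fun k => G k (F.ix k p.2) (F.jt k p.1)) atTop (𝓝 (g p.1 p.2))) :
    ∃ g' : ℝ → ℝ → ℝ, (∃ L, LipschitzWith L fun p : ℝ × ℝ => g' p.1 p.2) ∧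
      (∀ t x, g' t x ∈ Icc F.C⁻¹ F.C) ∧ ∀ᵐ p ∂F.mu, g' p.1 p.2 = g p.1 p.2 := by
  have hC : F.C⁻¹ ≤ F.C := by
    obtain ⟨h1, h2⟩ := F.A_mem (k := 0) (j := 0) (Nat.zero_le _) (i := 1) ⟨le_rfl, by omega⟩
    exact h1.trans h2
  -- On this set of full measure the Lipschitz bound is obtained pointwise; it is extended to the
  -- plane afterwards.
  set good : Set (ℝ × ℝ) := {p | p ∈ Ioo t0 tend ×ˢ Ioo rmin rmax ∧
    Tendsto (fun k => G k (F.ix k p.2) (F.jt k p.1)) atTop (𝓝 (g p.1 p.2))} with hgood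
  have hLip : LipschitzOnWith (Real.toNNReal (2 * F.D')) (fun p : ℝ × ℝ => g p.1 p.2) good := by
    refine LipschitzOnWith.of_dist_le' fun p hp p' hp' => ?_
    obtain ⟨⟨ht, hx⟩, hp⟩ := hp
    obtain ⟨⟨ht', hx'⟩, hp'⟩ := hp'
    have hlim1 := (hp.sub hp').abs
    -- The gridpoint and the time level of a cell approximate the point up to `O(Δx)`, which
    -- disappears in the limit. The constant `2 * D'` arises because the distance on the plane is
    -- the maximum of the two coordinate distances.
    have hlim2 : Tendsto (fun k => F.D' * (|p.2 - p'.2| + F.dx k)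
        + F.D' * (|p.1 - p'.1| + F.C / 2 * F.dx k)) atTop
        (𝓝 (F.D' * (|p.2 - p'.2| + 0) + F.D' * (|p.1 - p'.1| + F.C / 2 * 0))) :=
      ((F.tendsto_dx.const_add _).const_mul _).add
        (((F.tendsto_dx.const_mul _).const_add _).const_mul _)
    have hle := le_of_tendsto_of_tendsto hlim1 hlim2 (by
      filter_upwards [F.eventually_le_jt 1 ht.1 ht.2, F.eventually_le_jt 1 ht'.1 ht'.2]
        with k hk hk'
      have e1 := abs_sub_le_of_steps (f := fun i => G k i (F.jt k p.1)) (y := F.X k) (a := 2)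
        (b := F.N k) F.hD'.le (fun i hi => by
          have := hsp k _ (F.jt_le k p.1) i hi
          rwa [F.X_succ, add_sub_cancel_left])
        (F.X_ix k (Ioo_subset_Ico_self hx')).1 (F.X_ix k (Ioo_subset_Ico_self hx)).1
      have e2 := abs_sub_le_of_steps (f := fun j => G k (F.ix k p'.2) j) (y := F.T k) (a := 1)
        (b := F.last k) F.hD'.le (fun j hj => htm k j hj _
          (F.X_ix k (Ioo_subset_Ico_self hx')).1) ⟨hk', F.jt_le k _⟩ ⟨hk, F.jt_le k _⟩
      have e3 := F.abs_X_sub_le k (Ioo_subset_Ico_self hx') (Ioo_subset_Ico_self hx)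
      have e4 := F.abs_T_sub_le k (Ioo_subset_Ico_self ht') (Ioo_subset_Ico_self ht)
      have hD := F.hD'
      refine (abs_sub_le _ (G k (F.ix k p'.2) (F.jt k p.1)) _).trans (add_le_add ?_ ?_)
      · exact e1.trans (by gcongr)
      · exact e2.trans (by gcongr))
    rw [Real.dist_eq]
    refine hle.trans ?_
    have hD := F.hD'
    have d1 : |p.1 - p'.1| ≤ dist p p' := by rw [← Real.dist_eq]; exact le_max_left _ _
    have d2 : |p.2 - p'.2| ≤ dist p p' := by rw [← Real.dist_eq]; exact le_max_right _ _
    nlinarith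
  obtain ⟨g₁, hg₁, heq⟩ := hLip.extend_real
  -- Truncating the extension to `[C⁻¹, C]` keeps it Lipschitz, gives positivity everywhere, and
  -- changes nothing at points of convergence.
  refine ⟨fun t x => max F.C⁻¹ (min F.C (g₁ (t, x))), ⟨_, (hg₁.const_min F.C).const_max F.C⁻¹⟩,
    fun t x => ⟨le_max_left _ _, max_le hC (min_le_left _ _)⟩, ?_⟩
  filter_upwards [hlim, F.ae_mem_Ioo] with p hp hp'
  have hpg : p ∈ good := ⟨hp', hp⟩
  have hmem : g p.1 p.2 ∈ Icc F.C⁻¹ F.C := by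
    refine isClosed_Icc.mem_of_tendsto hp (Eventually.of_forall fun k => ?_)
    exact hval k _ (F.jt_le k _) _ (F.X_ix k (Ioo_subset_Ico_self hp'.2)).1
  have := heq hpg
  simp only at this
  rw [← this, min_eq_right hmem.2, max_eq_right hmem.1]

/-- The limit metric is Lipschitz after a change on a null set. -/
theorem exists_lipschitz_metric : ∃ A' B' : ℝ → ℝ → ℝ,
    (∃ L, LipschitzWith L fun p : ℝ × ℝ => A' p.1 p.2) ∧
    (∃ L, LipschitzWith L fun p : ℝ × ℝ => B' p.1 p.2) ∧
    (∀ t x, A' t x ∈ Icc F.C⁻¹ F.C) ∧ (∀ t x, B' t x ∈ Icc F.C⁻¹ F.C) ∧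
    ∀ᵐ p ∂F.mu, A' p.1 p.2 = A p.1 p.2 ∧ B' p.1 p.2 = B p.1 p.2 := by
  have hsp := fun k j (hj : j ≤ F.last k) => (F.metric k).space j (F.T_lt_tend hj)
  have htm := fun k j (hj : j ∈ Ico 1 (F.last k)) i (hi : i ∈ Icc 2 (F.N k)) => by
    have := (F.metric k).time (j - 1)
    rw [Nat.sub_add_cancel hj.1, show j - 1 + 2 = j + 1 by have := hj.1; omega] at this
    exact this (F.T_lt_tend hj.2.le) (F.T_lt_tend hj.2) i ⟨by have := hi.1; omega, hi.2⟩
      (F.t0_le_T (by have := hj.2; omega))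
  obtain ⟨A', h1, h2, h3⟩ := F.exists_lipschitz_limit (G := fun k => (F.S k).A)
    (fun k j hj i hi => F.A_mem hj ⟨by have := hi.1; omega, by have := hi.2; omega⟩)
    (fun k j hj i hi => (hsp k j hj i hi).1) (fun k j hj i hi => (htm k j hj i hi).1)
    (F.ae_tendsto_state.mono fun p hp => hp.2.1)
  obtain ⟨B', h1', h2', h3'⟩ := F.exists_lipschitz_limit (G := fun k => (F.S k).B)
    (fun k j hj i hi => F.B_mem hj ⟨by have := hi.1; omega, by have := hi.2; omega⟩)
    (fun k j hj i hi => (hsp k j hj i hi).2) (fun k j hj i hi => (htm k j hj i hi).2)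
    (F.ae_tendsto_state.mono fun p hp => hp.2.2)
  exact ⟨A', B', h1, h1', h2, h2', h3.and h3'⟩

/-- Riemann sums over the cells to the left of `x` converge to the integral. -/
theorem tendsto_sum_cells {r : ℕ → ℕ → ℝ} {Q : ℝ} (hQ : ∀ k, ∀ i ∈ Icc 1 (F.N k), |r k i| ≤ Q)
    {ρ : ℝ → ℝ} (hρ : ∀ᵐ y ∂(volume.restrict (Icc rmin rmax)),
      Tendsto (fun k => r k (F.ix k y)) atTop (𝓝 (ρ y))) {x : ℝ} (hx : x ∈ Ioo rmin rmax) :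
    Tendsto (fun k => ∑ i ∈ Finset.Ico 1 (F.ix k x), r k i * F.dx k) atTop
      (𝓝 (∫ y in rmin..x, ρ y)) := by
  have hQ0 : 0 ≤ Q := (abs_nonneg _).trans (hQ 0 1 ⟨le_rfl, by have := F.two_le 0; omega⟩)
  -- The partial sum is written as a sum over all cells with zero entries from the cell of `x`
  -- onwards. A point `y < x` lies in a strictly earlier cell once `Δx < x - y`.
  have hstep := (tendsto_sum_of_step (μ := volume.restrict (Icc rmin rmax))
    (s := fun k => Finset.Icc 2 (F.N k)) (c := fun k i => Ico (F.X k (i - 1)) (F.X k i))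
    (fun k i _ => measurableSet_Ico)
    (fun k i _ i' _ hne => disjoint_left.2 fun x hx hx' =>
      hne (F.X_cell_unique hx.1 hx.2 hx'.1 hx'.2))
    (e := fun k i => if i < F.ix k x then r k i else 0) hQ0
    (fun k i hi => by
      rw [Finset.mem_Icc] at hi
      split_ifs
      · exact hQ k i ⟨by omega, hi.2⟩
      · simpa using hQ0)
    (f := (Iio x).indicator ρ) (by
      filter_upwards [hρ, ae_restrict_mem measurableSet_Icc,
        ae_restrict_of_ae (Measure.ae_ne volume rmax), ae_restrict_of_ae (Measure.ae_ne volume x)]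
        with y hy hym hne hyx
      have hy' : y ∈ Ico rmin rmax := ⟨hym.1, lt_of_le_of_ne hym.2 hne⟩
      refine ⟨fun k => F.ix k y, Eventually.of_forall fun k => ?_, ?_⟩
      · obtain ⟨h1, h2, h3⟩ := F.X_ix k hy'
        exact ⟨Finset.mem_Icc.2 h1, h2, h3⟩
      · rcases lt_or_gt_of_ne hyx with hlt | hgt
        · rw [indicator_of_mem (by exact hlt)]
          refine hy.congr' ?_
          filter_upwards [F.tendsto_dx.eventually (gt_mem_nhds (sub_pos.2 hlt))] with k hk
          rw [if_pos]
          by_contra! hcon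
          obtain ⟨h1, h2, h3⟩ := F.X_ix k hy'
          obtain ⟨g1, g2, g3⟩ := F.X_ix k (Ioo_subset_Ico_self hx)
          rw [F.X_pred k (by have := h1.1; omega)] at h2
          have := F.X_mono k hcon
          linarith
        · rw [indicator_of_notMem (by simpa using hgt.le)]
          refine tendsto_const_nhds.congr fun k => ?_
          rw [if_neg]
          intro (hcon : F.ix k y < F.ix k x)
          obtain ⟨h1, h2, h3⟩ := F.X_ix k hy'
          obtain ⟨g1, g2, g3⟩ := F.X_ix k (Ioo_subset_Ico_self hx)
          have := F.X_mono k (show F.ix k y ≤ F.ix k x - 1 by omega)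
          linarith)).2
  have hint : ∫ y in Icc rmin rmax, (Iio x).indicator ρ y = ∫ y in rmin..x, ρ y := by
    rw [setIntegral_indicator measurableSet_Iio, intervalIntegral.integral_of_le hx.1.le,
      ← integral_Icc_eq_integral_Ioc, integral_Icc_eq_integral_Ico]
    congr 2
    ext y
    simp only [mem_inter_iff, mem_Icc, mem_Iio, mem_Ico]
    exact ⟨fun h => ⟨h.1.1, h.2⟩, fun h => ⟨⟨h.1, h.2.le.trans hx.2.le⟩, h.2⟩⟩
  rw [hint] at hstep
  -- The index `1` belongs to the cell to the left of `rmin`, outside the region; its single term is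
  -- `O(Δx)`.
  have hone : Tendsto (fun k => r k 1 * F.dx k) atTop (𝓝 0) := by
    refine squeeze_zero_norm (fun k => ?_) (by simpa using F.tendsto_dx.const_mul Q)
    rw [norm_mul, Real.norm_of_nonneg (F.dx_pos k).le]
    exact mul_le_mul_of_nonneg_right (hQ k 1 ⟨le_rfl, by have := F.two_le k; omega⟩)
      (F.dx_pos k).le
  have := hone.add hstep
  rw [zero_add] at this
  refine this.congr fun k => ?_
  obtain ⟨g1, -, -⟩ := F.X_ix k (Ioo_subset_Ico_self hx)
  rw [Finset.sum_eq_sum_Ico_succ_bot (by have := g1.1; omega)]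
  congr 1
  have hsub : Finset.Ico 2 (F.ix k x) ⊆ Finset.Icc 2 (F.N k) := fun i hi => by
    rw [Finset.mem_Ico] at hi
    rw [Finset.mem_Icc]
    have := g1.2
    omega
  rw [show (1 + 1 : ℕ) = 2 from rfl]
  symm
  refine Finset.sum_subset_zero_on_sdiff hsub (fun i hi => ?_) fun i hi => ?_
  · rw [Finset.mem_sdiff, Finset.mem_Icc, Finset.mem_Ico] at hi
    rw [if_neg (by omega), smul_zero]
  · have hi' := Finset.mem_Icc.1 (hsub hi)
    rw [Finset.mem_Ico] at hi
    rw [if_pos hi.2, smul_eq_mul, mul_comm]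
    congr 1
    have hX := F.X_pred k (i := i) (by omega)
    have h1 := F.X_mono k (show 1 ≤ i - 1 by omega)
    have h2 := F.X_mono k hi'.2
    rw [F.X_one] at h1
    rw [F.X_last] at h2
    rw [measureReal_restrict_apply measurableSet_Ico, inter_eq_left.2
      (Ico_subset_Icc_self.trans (Icc_subset_Icc h1 h2)), Real.volume_real_Ico_of_le
      (by linarith [F.dx_pos k]), hX]
    ring

end ConvergentFamily

/-! ### Measurability and continuity of the coefficients -/

section Coefficients

variable {σ : ℝ}

theorem measurable_vel : Measurable (vel σ) := by
  unfold vel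
  fun_prop

theorem measurable_dens : Measurable (dens σ) := by
  have := measurable_vel (σ := σ)
  unfold dens
  fun_prop

theorem measurable_stress : Measurable (stress σ) := by
  have := measurable_vel (σ := σ)
  have := measurable_dens (σ := σ)
  unfold stress
  fun_prop

theorem tendsto_stress (hσ : 0 < σ) (hσ1 : σ < 1) {ι : Type*} {l : Filter ι} {v : ι → ℝ × ℝ}
    {u : ℝ × ℝ} (hu : u ∈ physical σ) (hv : Tendsto v l (𝓝 u)) :
    Tendsto (fun i => stress σ (v i)) l (𝓝 (stress σ u)) :=
  ((contDiffAt_stress hσ hσ1 hu).continuousAt.tendsto).comp hv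

theorem tendsto_dens (hσ : 0 < σ) (hσ1 : σ < 1) {ι : Type*} {l : Filter ι} {v : ι → ℝ × ℝ}
    {u : ℝ × ℝ} (hu : u ∈ physical σ) (hv : Tendsto v l (𝓝 u)) :
    Tendsto (fun i => dens σ (v i)) l (𝓝 (dens σ u)) :=
  ((contDiffAt_dens hσ hσ1 hu).continuousAt.tendsto).comp hv

theorem tendsto_exponentRate (hσ : 0 < σ) (hσ1 : σ < 1) {ι : Type*} {l : Filter ι} {a x : ι → ℝ}
    {v : ι → ℝ × ℝ} {a₀ x₀ : ℝ} {u : ℝ × ℝ} (ha₀ : a₀ ≠ 0) (hx₀ : x₀ ≠ 0) (hu : u ∈ physical σ)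
    (ha : Tendsto a l (𝓝 a₀)) (hx : Tendsto x l (𝓝 x₀)) (hv : Tendsto v l (𝓝 u)) :
    Tendsto (fun i => exponentRate σ (a i) (x i) (v i)) l (𝓝 (exponentRate σ a₀ x₀ u)) := by
  have hs := tendsto_stress hσ hσ1 hu hv
  unfold exponentRate
  exact (((ha.inv₀ ha₀).sub_const 1).div hx hx₀).add
    (((hx.const_mul kappa).div ha ha₀).mul hs)

theorem tendsto_odeSource (hσ : 0 < σ) (hσ1 : σ < 1) {ι : Type*} {l : Filter ι} {a b x : ι → ℝ}
    {v : ι → ℝ × ℝ} {a₀ b₀ x₀ : ℝ} {u : ℝ × ℝ} (ha₀ : a₀ ≠ 0) (hb₀ : b₀ ≠ 0) (hx₀ : x₀ ≠ 0)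
    (hu : u ∈ physical σ) (ha : Tendsto a l (𝓝 a₀)) (hb : Tendsto b l (𝓝 b₀))
    (hx : Tendsto x l (𝓝 x₀)) (hv : Tendsto v l (𝓝 u)) :
    Tendsto (fun i => odeSource σ (a i) (b i) (v i) (x i)) l (𝓝 (odeSource σ a₀ b₀ u x₀)) := by
  have hs := tendsto_stress hσ hσ1 hu hv
  have hd := tendsto_dens hσ hσ1 hu hv
  have hv1 : Tendsto (fun i => (v i).1) l (𝓝 u.1) := (continuous_fst.tendsto u).comp hv
  have hv2 : Tendsto (fun i => (v i).2) l (𝓝 u.2) := (continuous_snd.tendsto u).comp hv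
  have hq : Tendsto (fun i => Real.sqrt (a i * b i)) l (𝓝 (Real.sqrt (a₀ * b₀))) :=
    (Real.continuous_sqrt.tendsto _).comp (ha.mul hb)
  unfold odeSource source metricRhsA metricRhsB flux minkFlux stress22
  refine Tendsto.sub (Tendsto.prodMk_nhds ?_ ?_) (Tendsto.smul ?_ ?_)
  · exact ((tendsto_const_nhds.div hx hx₀).neg.mul hq).mul hv2
  · refine (hq.const_mul _).mul ((((tendsto_const_nhds.div hx hx₀).mul hs).add
      ((((tendsto_const_nhds.div ha ha₀).sub_const 1).div hx hx₀).mul (hv1.sub hs))).add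
      (((hx.const_mul _).div ha ha₀).mul ((hv1.mul hs).sub (hv2.pow 2))) |>.sub ?_)
    exact (hx.const_mul 4).mul ((hd.const_mul σ).div (hx.pow 2) (pow_ne_zero 2 hx₀))
  · refine (Tendsto.div ?_ (ha.const_mul 2) (by simpa using ha₀)).add
      (Tendsto.div ?_ (hb.const_mul 2) (by simpa using hb₀))
    · exact ((ha.const_sub 1).div hx hx₀).sub ((hx.const_mul _).mul hv1)
    · exact (hb.div ha ha₀).mul (((ha.const_sub 1).div hx hx₀).add ((hx.const_mul _).mul hs))
  · exact hq.smul (hv2.prodMk_nhds hs)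

theorem metricRhsB_eq {A B x : ℝ} {u : ℝ × ℝ} (hA : A ≠ 0) :
    metricRhsB σ A B u x = B * exponentRate σ A x u := by
  unfold metricRhsB exponentRate
  field_simp

end Coefficients

/-! ### Limits of the quantities that enter the metric update -/

namespace ConvergentFamily

variable {σ rmin rmax t0 tend : ℝ} {Mb Bb : ℝ → ℝ} {u₀ : ℝ → ℝ × ℝ} {A₀ B₀ : ℝ → ℝ}
  {u : ℝ → ℝ → ℝ × ℝ} {A B : ℝ → ℝ → ℝ}
  (F : ConvergentFamily σ rmin rmax t0 tend Mb Bb u₀ A₀ B₀ u A B)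

theorem exists_norm_le : ∃ R, 0 ≤ R ∧ ∀ v ∈ F.K, ‖v‖ ≤ R := by
  obtain ⟨R, hR⟩ := F.hK.isBounded.exists_norm_le
  exact ⟨max R 0, le_max_right _ _, fun v hv => (hR v hv).trans (le_max_left _ _)⟩

theorem ae_state_mem : ∀ᵐ p ∂F.mu, u p.1 p.2 ∈ F.K := by
  filter_upwards [F.ae_tendsto_state, F.ae_mem_Ioo] with p hp hpI
  refine F.hK.isClosed.mem_of_tendsto hp.1 (Eventually.of_forall fun k => ?_)
  have := (F.X_ix k (Ioo_subset_Ico_self hpI.2)).1.2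
  exact F.state_mem (F.jt_le k _) (by omega)

theorem ae_init_mem : ∀ᵐ x ∂(volume.restrict (Icc rmin rmax)), u₀ x ∈ F.K := by
  filter_upwards [F.ae_tendsto_init, ae_restrict_mem measurableSet_Icc,
    ae_restrict_of_ae (Measure.ae_ne volume rmax)] with x h1 hxm hne
  refine F.hK.isClosed.mem_of_tendsto h1 (Eventually.of_forall fun k => ?_)
  have := (F.X_ix k (x := x) ⟨hxm.1, lt_of_le_of_ne hxm.2 hne⟩).1.2
  exact F.state_mem (Nat.zero_le _) (by omega)

theorem aestronglyMeasurable_state :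
    AEStronglyMeasurable (fun p : ℝ × ℝ => u p.1 p.2) F.mu := by
  obtain ⟨R, hR0, hR⟩ := F.exists_norm_le
  refine (tendsto_sum_of_step (s := F.cells) (c := F.cell) (fun k q _ => F.measurableSet_cell k q)
    F.cells_disjoint (e := fun k q => (F.S k).u q.1 q.2) hR0 (fun k q hq => ?_) ?_).1
  · simp only [cells, Finset.mem_product, Finset.mem_Icc, Finset.mem_range] at hq
    exact hR _ (F.state_mem hq.2.le (by omega))
  · filter_upwards [F.ae_tendsto_state, F.ae_mem_Ioo] with p hp hpI
    exact ⟨fun k => (F.ix k p.2, F.jt k p.1), F.eventually_mem_cell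
      ⟨Ioo_subset_Ico_self hpI.1, Ioo_subset_Ico_self hpI.2⟩, hp.1⟩

theorem tendsto_X_ix {x : ℝ} (hx : x ∈ Ico rmin rmax) :
    Tendsto (fun k => F.X k (F.ix k x)) atTop (𝓝 x) := by
  have h : Tendsto (fun k => x + F.dx k) atTop (𝓝 x) := by
    simpa using F.tendsto_dx.const_add x
  refine tendsto_of_tendsto_of_tendsto_of_le_of_le tendsto_const_nhds h (fun k => ?_) fun k => ?_
  · exact (F.X_ix k hx).2.2.le
  · obtain ⟨h1, h2, -⟩ := F.X_ix k hx
    rw [F.X_pred k (by have := h1.1; omega)] at h2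
    simp only
    linarith

theorem tendsto_T_jt {t : ℝ} (ht : t ∈ Ico t0 tend) :
    Tendsto (fun k => F.T k (F.jt k t)) atTop (𝓝 t) := by
  have h : Tendsto (fun k => t - F.C / 2 * F.dx k) atTop (𝓝 t) := by
    simpa using (F.tendsto_dx.const_mul (F.C / 2)).const_sub t
  refine tendsto_of_tendsto_of_tendsto_of_le_of_le h tendsto_const_nhds (fun k => ?_) fun k => ?_
  · have h1 := F.lt_T_jt k ht.2
    have h2 := F.dt_le_dx (F.jt_le k t)
    simp only
    linarith
  · exact F.T_jt_le k ht.1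

/-- The half gridpoints. -/
noncomputable def H (k i : ℕ) : ℝ := halfPoint rmin rmax (F.N k) i

theorem H_eq (k i : ℕ) : F.H k i = F.X k i - F.dx k / 2 := rfl

theorem H_mem {k i : ℕ} (hi : i ∈ Icc 1 (F.N k)) : F.H k i ∈ Icc (rmin / 2) rmax :=
  halfPoint_mem F.hr (F.two_le k) (F.width_le k) hi

theorem tendsto_H_ix {x : ℝ} (hx : x ∈ Ico rmin rmax) :
    Tendsto (fun k => F.H k (F.ix k x)) atTop (𝓝 x) := by
  simpa [H_eq] using (F.tendsto_X_ix hx).sub (F.tendsto_dx.div_const 2)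

/-- The average of the states on both sides of `x_{i-}`. -/
noncomputable def mid (k i j : ℕ) : ℝ × ℝ := midState (fun i => (F.S k).u i j) i

theorem mid_mem {k i j : ℕ} (hj : j ≤ F.last k) (hi : i ≤ F.N k + 1) {R : ℝ}
    (hR : ∀ v ∈ F.K, ‖v‖ ≤ R) : F.mid k i j ∈ physical σ ∧ ‖F.mid k i j‖ ≤ R := by
  have h := (F.bounded k).midState_mem (F.T_lt_tend hj) hi
  exact ⟨midpoints_subset_physical F.hσ F.hσ1 F.hKp h, midState_norm_le hR h⟩

/-- The convergence of all values on the cells that enter the update of the metric. -/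
theorem ae_tendsto_mid : ∀ᵐ p ∂F.mu,
    Tendsto (fun k => F.mid k (F.ix k p.2) (F.jt k p.1)) atTop (𝓝 (u p.1 p.2)) := by
  filter_upwards [F.ae_tendsto_state, F.ae_tendsto_jump] with p hp hj
  have h1 := hp.1.sub (tendsto_zero_iff_norm_tendsto_zero.2 hj.1)
  have h2 := (h1.add hp.1).const_smul (1 / 2 : ℝ)
  have e : (1 / 2 : ℝ) • (u p.1 p.2 - 0 + u p.1 p.2) = u p.1 p.2 := by
    rw [sub_zero, ← two_smul ℝ, smul_smul]; norm_num
  rw [e] at h2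
  refine h2.congr fun k => ?_
  rw [mid, midState, sub_sub_cancel]

end ConvergentFamily

/-! ### The metric equations in the limit -/

/-- A convergent family whose limit metric is Lipschitz and bounded. -/
structure LipschitzFamily (σ rmin rmax t0 tend : ℝ) (Mb Bb : ℝ → ℝ) (u₀ : ℝ → ℝ × ℝ)
    (A₀ B₀ : ℝ → ℝ) (u : ℝ → ℝ → ℝ × ℝ) (A B : ℝ → ℝ → ℝ)
    extends ConvergentFamily σ rmin rmax t0 tend Mb Bb u₀ A₀ B₀ u A B where
  lipA : ∃ L, LipschitzWith L fun p : ℝ × ℝ => A p.1 p.2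
  lipB : ∃ L, LipschitzWith L fun p : ℝ × ℝ => B p.1 p.2
  memA : ∀ t x, A t x ∈ Icc C⁻¹ C
  memB : ∀ t x, B t x ∈ Icc C⁻¹ C

namespace LipschitzFamily

variable {σ rmin rmax t0 tend : ℝ} {Mb Bb : ℝ → ℝ} {u₀ : ℝ → ℝ × ℝ} {A₀ B₀ : ℝ → ℝ}
  {u : ℝ → ℝ → ℝ × ℝ} {A B : ℝ → ℝ → ℝ}

theorem A_pos (F : LipschitzFamily σ rmin rmax t0 tend Mb Bb u₀ A₀ B₀ u A B)
    (t x : ℝ) : 0 < A t x := (inv_pos.2 F.hC).trans_le (F.memA t x).1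

theorem B_pos (F : LipschitzFamily σ rmin rmax t0 tend Mb Bb u₀ A₀ B₀ u A B)
    (t x : ℝ) : 0 < B t x := (inv_pos.2 F.hC).trans_le (F.memB t x).1

theorem continuous_A (F : LipschitzFamily σ rmin rmax t0 tend Mb Bb u₀ A₀ B₀ u A B) :
    Continuous fun p : ℝ × ℝ => A p.1 p.2 := F.lipA.choose_spec.continuous

theorem continuous_B (F : LipschitzFamily σ rmin rmax t0 tend Mb Bb u₀ A₀ B₀ u A B) :
    Continuous fun p : ℝ × ℝ => B p.1 p.2 := F.lipB.choose_spec.continuous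

theorem isBoundedFluidLipschitzMetric (F : LipschitzFamily σ rmin rmax t0 tend Mb Bb u₀ A₀ B₀ u A B) :
    IsBoundedFluidLipschitzMetric σ rmin rmax t0 tend u A B where
  measurable := F.aestronglyMeasurable_state
  bounded := by
    obtain ⟨R, -, hR⟩ := F.exists_norm_le
    exact ⟨R, F.ae_state_mem.mono fun p hp => hR _ hp⟩
  physical := F.ae_state_mem.mono fun p hp => F.hKp hp
  lipschitzA := F.lipA.imp fun _ h => h.lipschitzOnWith
  lipschitzB := F.lipB.imp fun _ h => h.lipschitzOnWith
  pos := fun p _ => ⟨F.A_pos _ _, F.B_pos _ _⟩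

/-- The integrated metric equations on almost every time slice. -/
theorem ae_metric_eq (F : LipschitzFamily σ rmin rmax t0 tend Mb Bb u₀ A₀ B₀ u A B) :
    ∀ᵐ t ∂(volume.restrict (Icc t0 tend)),
    (∀ᵐ y ∂(volume.restrict (Icc rmin rmax)), u t y ∈ F.K) ∧
    IntervalIntegrable (fun y => kappa / 2 * ((u t y).1 * y ^ 2)) volume rmin rmax ∧
    IntervalIntegrable (fun y => exponentRate σ (A t y) y (u t y)) volume rmin rmax ∧
    (∀ x ∈ Icc rmin rmax,
      A t x = 1 - 2 * (Mb t + ∫ y in rmin..x, kappa / 2 * ((u t y).1 * y ^ 2)) / x) ∧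
    (∀ x ∈ Icc rmin rmax,
      B t x = Bb t * Real.exp (∫ y in rmin..x, exponentRate σ (A t y) y (u t y))) := by
  obtain ⟨R, hR0, hR⟩ := F.exists_norm_le
  have hmeas := F.aestronglyMeasurable_state
  -- By Fubini, at almost every time the convergence holds at almost every radius, so Riemann sums
  -- can be taken on one time slice.
  have hae := (F.ae_tendsto_state.and F.ae_tendsto_mid).and (F.ae_state_mem.and F.ae_mem_Ioo)
  rw [F.mu_eq_prod] at hae hmeas
  filter_upwards [Measure.ae_ae_of_ae_prod hae, ae_restrict_mem measurableSet_Icc,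
    ae_restrict_of_ae (Measure.ae_ne volume t0), ae_restrict_of_ae (Measure.ae_ne volume tend),
    hmeas.prodMk_left] with t ht htm hne0 hne hut
  have htI : t ∈ Ioo t0 tend := ⟨lt_of_le_of_ne htm.1 (Ne.symm hne0), lt_of_le_of_ne htm.2 hne⟩
  have htI' := Ioo_subset_Ico_self htI
  have hK : ∀ᵐ y ∂(volume.restrict (Icc rmin rmax)), u t y ∈ F.K := ht.mono fun y hy => hy.2.1
  have hAc : Continuous fun y => A t y := F.continuous_A.comp (Continuous.prodMk_right t)
  have hBc : Continuous fun y => B t y := F.continuous_B.comp (Continuous.prodMk_right t)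
  have hint1 : IntervalIntegrable (fun y => kappa / 2 * ((u t y).1 * y ^ 2)) volume rmin rmax := by
    rw [intervalIntegrable_iff_integrableOn_Icc_of_le F.hr.le]
    refine Integrable.of_bound (C := kappa / 2 * (R * rmax ^ 2)) ?_ ?_
    · exact ((hut.fst.mul (by fun_prop)).const_mul _)
    · filter_upwards [hK, ae_restrict_mem measurableSet_Icc] with y hy hyI
      have := kappa_pos
      have hy0 : 0 ≤ y := F.hrmin.le.trans hyI.1
      rw [norm_mul, norm_mul, norm_pow, Real.norm_of_nonneg hy0, Real.norm_of_nonneg (by positivity)]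
      have := (norm_fst_le (u t y)).trans (hR _ hy)
      have := hyI.2
      gcongr
  have hint2 : IntervalIntegrable (fun y => exponentRate σ (A t y) y (u t y)) volume rmin rmax := by
    rw [intervalIntegrable_iff_integrableOn_Icc_of_le F.hr.le]
    refine Integrable.of_bound (C := (F.C + 1) * (2 / rmin) + kappa * rmax * F.C * R) ?_ ?_
    · unfold exponentRate
      have hs : AEMeasurable (fun y => stress σ (u t y)) (volume.restrict (Icc rmin rmax)) :=
        measurable_stress.comp_aemeasurable hut.aemeasurable
      have := hAc.measurable
      exact (AEMeasurable.add (by fun_prop) (AEMeasurable.mul (by fun_prop) hs)).aestronglyMeasurable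
    · filter_upwards [hK, ae_restrict_mem measurableSet_Icc] with y hy hyI
      exact abs_exponentRate_le F.hσ F.hσ1 F.hrmin F.hC (F.memA t y)
        ⟨by linarith [hyI.1, F.hrmin], hyI.2⟩ (F.hKp hy) (hR _ hy)
  have hjt := F.eventually_le_jt 1 htI.1 htI.2
  obtain ⟨LM, hLM⟩ := F.lipMb
  obtain ⟨LB, hLB⟩ := F.lipBb
  have hTt : Tendsto (fun k => F.T k (F.jt k t)) atTop (𝓝[Icc t0 tend] t) :=
    tendsto_nhdsWithin_iff.2 ⟨F.tendsto_T_jt htI', Eventually.of_forall fun k =>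
      ⟨F.t0_le_T (by have := F.jt_le k t; omega), (F.T_lt_tend (F.jt_le k t)).le⟩⟩
  have hMt : Tendsto (fun k => Mb (F.T k (F.jt k t))) atTop (𝓝 (Mb t)) :=
    (hLM.continuousOn t htm).tendsto.comp hTt
  have hBt : Tendsto (fun k => Bb (F.T k (F.jt k t))) atTop (𝓝 (Bb t)) :=
    (hLB.continuousOn t htm).tendsto.comp hTt
  have hupd := fun k (hk : 1 ≤ F.jt k t) i (hi : i ∈ Finset.Icc 1 (F.N k)) => by
    have := (F.S k).metric_update (F.jt k t - 1)
    rw [Nat.sub_add_cancel hk] at this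
    exact this (F.T_lt_tend (F.jt_le k t)) i hi
  -- At a point of convergence the two sides are limits of the two sides of the discrete update,
  -- valid as soon as the time level is at least `1`.
  have key : ∀ᵐ x ∂(volume.restrict (Icc rmin rmax)),
      A t x = 1 - 2 * (Mb t + ∫ y in rmin..x, kappa / 2 * ((u t y).1 * y ^ 2)) / x ∧
      B t x = Bb t * Real.exp (∫ y in rmin..x, exponentRate σ (A t y) y (u t y)) := by
    filter_upwards [ht] with x hx
    obtain ⟨⟨⟨-, hA, hB⟩, -⟩, -, -, hxI⟩ := hx
    have hx0 : 0 < x := F.hrmin.trans hxI.1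
    have hH := F.tendsto_H_ix (Ioo_subset_Ico_self hxI)
    have s1 := F.tendsto_sum_cells
      (r := fun k i => kappa / 2 * ((F.mid k i (F.jt k t)).1 * F.H k i ^ 2))
      (Q := kappa / 2 * (R * rmax ^ 2)) (fun k i hi => by
        have hm := F.mid_mem (F.jt_le k t) (i := i) (by have := hi.2; omega) hR
        have hHi := F.H_mem hi
        have := kappa_pos
        have := F.hrmin
        rw [← Real.norm_eq_abs, norm_mul, norm_mul, norm_pow, Real.norm_of_nonneg
          (by linarith [hHi.1] : 0 ≤ F.H k i), Real.norm_of_nonneg (by positivity)]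
        have := (norm_fst_le (F.mid k i (F.jt k t))).trans hm.2
        have := hHi.2
        have : 0 ≤ F.H k i := by linarith [hHi.1]
        gcongr)
      (ρ := fun y => kappa / 2 * ((u t y).1 * y ^ 2)) (by
        filter_upwards [ht] with y hy
        have h1 := F.tendsto_H_ix (Ioo_subset_Ico_self hy.2.2.2)
        have h2 := (continuous_fst.tendsto _).comp hy.1.2
        exact (h2.mul (h1.pow 2)).const_mul _) hxI
    have s2 := F.tendsto_sum_cells
      (r := fun k i => exponentRate σ ((F.S k).A i (F.jt k t)) (F.H k i) (F.mid k i (F.jt k t)))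
      (Q := (F.C + 1) * (2 / rmin) + kappa * rmax * F.C * R) (fun k i hi => by
        have hm := F.mid_mem (F.jt_le k t) (i := i) (by have := hi.2; omega) hR
        exact abs_exponentRate_le F.hσ F.hσ1 F.hrmin F.hC
          (F.A_mem (F.jt_le k t) ⟨hi.1, by have := hi.2; omega⟩) (F.H_mem hi) hm.1 hm.2)
      (ρ := fun y => exponentRate σ (A t y) y (u t y)) (by
        filter_upwards [ht] with y hy
        have h1 := F.tendsto_H_ix (Ioo_subset_Ico_self hy.2.2.2)
        have hy0 : 0 < y := F.hrmin.trans hy.2.2.2.1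
        exact tendsto_exponentRate F.hσ F.hσ1 (F.A_pos t y).ne' hy0.ne' (F.hKp hy.2.1)
          hy.1.1.2.1 h1 hy.1.2) hxI
    constructor
    · refine tendsto_nhds_unique hA (Tendsto.congr' ?_
        ((((hMt.add s1).const_mul 2).div hH hx0.ne').const_sub 1))
      filter_upwards [hjt] with k hk
      have hix := (F.X_ix k (Ioo_subset_Ico_self hxI)).1
      rw [(hupd k hk _ (Finset.mem_Icc.2 ⟨by have := hix.1; omega, hix.2⟩)).1, discreteMass]
      simp only [← mul_assoc]
      rfl
    · refine tendsto_nhds_unique hB (Tendsto.congr' ?_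
        (hBt.mul ((Real.continuous_exp.tendsto _).comp s2)))
      filter_upwards [hjt] with k hk
      have hix := (F.X_ix k (Ioo_subset_Ico_self hxI)).1
      rw [(hupd k hk _ (Finset.mem_Icc.2 ⟨by have := hix.1; omega, hix.2⟩)).2, discreteExponent_eq]
      rfl
  have hprim : ∀ f : ℝ → ℝ, IntervalIntegrable f volume rmin rmax →
      ContinuousOn (fun x => ∫ y in rmin..x, f y) (Icc rmin rmax) := fun f hf => by
    have := intervalIntegral.continuousOn_primitive_interval' hf (left_mem_uIcc)
    rwa [uIcc_of_le F.hr.le] at this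
  refine ⟨hK, hint1, hint2, ?_, ?_⟩
  -- Both sides are continuous in the radius, so equality almost everywhere is equality on the whole
  -- interval. In particular it holds at `rmin`, where it identifies the boundary mass.
  · refine Measure.eqOn_Icc_of_ae_eq volume F.hr.ne (key.mono fun x hx => hx.1) hAc.continuousOn ?_
    refine continuousOn_const.sub (ContinuousOn.div ?_ continuousOn_id fun x hx => ?_)
    · exact continuousOn_const.mul (continuousOn_const.add (hprim _ hint1))
    · exact (F.hrmin.trans_le hx.1).ne'
  · refine Measure.eqOn_Icc_of_ae_eq volume F.hr.ne (key.mono fun x hx => hx.2) hBc.continuousOn ?_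
    exact continuousOn_const.mul (Real.continuous_exp.comp_continuousOn (hprim _ hint2))

end LipschitzFamily

namespace LipschitzFamily

variable {σ rmin rmax t0 tend : ℝ} {Mb Bb : ℝ → ℝ} {u₀ : ℝ → ℝ × ℝ} {A₀ B₀ : ℝ → ℝ}
  {u : ℝ → ℝ → ℝ × ℝ} {A B : ℝ → ℝ → ℝ}

/-- The metric equations on almost every time slice. -/
theorem ae_ae_metric_deriv (F : LipschitzFamily σ rmin rmax t0 tend Mb Bb u₀ A₀ B₀ u A B) :
    ∀ᵐ t ∂(volume.restrict (Icc t0 tend)), ∀ᵐ x ∂(volume.restrict (Icc rmin rmax)),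
      deriv (fun y => A t y) x = metricRhsA (A t x) (u t x) x ∧
      deriv (fun y => B t y) x = metricRhsB σ (A t x) (B t x) (u t x) x := by
  filter_upwards [F.ae_metric_eq] with t ⟨_, h1, h2, hA, hB⟩
  filter_upwards [ae_restrict_mem measurableSet_Icc, ae_restrict_of_ae h1.ae_hasDerivAt_integral,
    ae_restrict_of_ae h2.ae_hasDerivAt_integral, ae_restrict_of_ae (Measure.ae_ne volume rmin),
    ae_restrict_of_ae (Measure.ae_ne volume rmax)] with x hx d1 d2 hne1 hne2
  rw [uIcc_of_le F.hr.le] at d1 d2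
  have d1' := d1 hx rmin (left_mem_Icc.2 F.hr.le)
  have d2' := d2 hx rmin (left_mem_Icc.2 F.hr.le)
  have hx0 : 0 < x := F.hrmin.trans_le hx.1
  have hnhds : Icc rmin rmax ∈ 𝓝 x :=
    Icc_mem_nhds (lt_of_le_of_ne hx.1 (Ne.symm hne1)) (lt_of_le_of_ne hx.2 hne2)
  constructor
  · have e : (fun y => A t y) =ᶠ[𝓝 x] fun y =>
        1 - 2 * (Mb t + ∫ y in rmin..y, kappa / 2 * ((u t y).1 * y ^ 2)) / y := by
      filter_upwards [hnhds] with y hy using hA y hy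
    have hd := ((((d1'.const_add (Mb t)).const_mul 2).div (hasDerivAt_id x) hx0.ne').const_sub 1)
    rw [e.deriv_eq, metricRhsA, hA x hx]
    refine hd.deriv.trans ?_
    simp only [id]
    field_simp
    ring
  · have e : (fun y => B t y) =ᶠ[𝓝 x] fun y =>
        Bb t * Real.exp (∫ y in rmin..y, exponentRate σ (A t y) y (u t y)) := by
      filter_upwards [hnhds] with y hy using hB y hy
    rw [e.deriv_eq, (d2'.exp.const_mul (Bb t)).deriv, metricRhsB_eq (F.A_pos t x).ne', hB x hx,
      mul_assoc]

/-- Partial derivatives of jointly continuous functions are jointly measurable, which turns the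
statement on almost every slice into one almost everywhere in the region. -/
theorem ae_metric_deriv (F : LipschitzFamily σ rmin rmax t0 tend Mb Bb u₀ A₀ B₀ u A B) :
    (∀ᵐ p ∂F.mu, deriv (fun x => A p.1 x) p.2 = metricRhsA (A p.1 p.2) (u p.1 p.2) p.2) ∧
    ∀ᵐ p ∂F.mu,
      deriv (fun x => B p.1 x) p.2 = metricRhsB σ (A p.1 p.2) (B p.1 p.2) (u p.1 p.2) p.2 := by
  have hu := F.aestronglyMeasurable_state.aemeasurable
  rw [F.mu_eq_prod] at hu ⊢
  have hu1 := hu.fst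
  have hs := (measurable_stress (σ := σ)).comp_aemeasurable hu
  have hA := F.continuous_A.measurable
  have hB := F.continuous_B.measurable
  have hdA : Measurable fun p : ℝ × ℝ => deriv (fun x => A p.1 x) p.2 :=
    measurable_deriv_with_param (f := A) F.continuous_A
  have hdB : Measurable fun p : ℝ × ℝ => deriv (fun x => B p.1 x) p.2 :=
    measurable_deriv_with_param (f := B) F.continuous_B
  constructor
  · refine ae_eq_of_ae_ae_eq hdA.aemeasurable ?_
      (F.ae_ae_metric_deriv.mono fun t ht => ht.mono fun x hx => hx.1)
    unfold metricRhsA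
    exact AEMeasurable.sub (by fun_prop) (AEMeasurable.mul (by fun_prop) hu1)
  · refine ae_eq_of_ae_ae_eq hdB.aemeasurable ?_
      (F.ae_ae_metric_deriv.mono fun t ht => ht.mono fun x hx => hx.2)
    unfold metricRhsB
    exact AEMeasurable.mul (by fun_prop)
      (AEMeasurable.add (by fun_prop) (AEMeasurable.mul (by fun_prop) hs))

/-- The mass at the boundary is the prescribed one. -/
theorem A_boundary (F : LipschitzFamily σ rmin rmax t0 tend Mb Bb u₀ A₀ B₀ u A B) :
    ∀ t ∈ Icc t0 tend, A t rmin = 1 - 2 * Mb t / rmin := by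
  refine Measure.eqOn_Icc_of_ae_eq volume F.ht.ne ?_ ?_ ?_
  · filter_upwards [F.ae_metric_eq] with t ⟨_, _, _, hA, _⟩
    rw [hA rmin (left_mem_Icc.2 F.hr.le), intervalIntegral.integral_same, add_zero]
  · exact (F.continuous_A.comp (Continuous.prodMk_left rmin)).continuousOn
  · obtain ⟨L, hL⟩ := F.lipMb
    exact continuousOn_const.sub ((continuousOn_const.mul hL.continuousOn).div_const _)

end LipschitzFamily

/-! ### The weak form for test functions that vanish at the boundary -/

/-- Difference quotients along short segments near a point of differentiability. -/
theorem tendsto_difference_quotient {E : Type*} [NormedAddCommGroup E] [NormedSpace ℝ E]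
    {Φ : E → ℝ} {p : E} (hΦ : DifferentiableAt ℝ Φ p) {a b : ℕ → E} {h : ℕ → ℝ} {v : E} {c : ℝ}
    (hpos : ∀ k, 0 < h k) (hlim : Tendsto h atTop (𝓝 0)) (ha : ∀ᶠ k in atTop, ‖a k - p‖ ≤ c * h k)
    (hb : ∀ k, b k = a k + h k • v) :
    Tendsto (fun k => (Φ (b k) - Φ (a k)) / h k) atTop (𝓝 (fderiv ℝ Φ p v)) := by
  have hO : (fun k => a k - p) =O[atTop] h := Asymptotics.IsBigO.of_bound c (by
    filter_upwards [ha] with k hk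
    rwa [Real.norm_of_nonneg (hpos k).le])
  have hO' : (fun k => b k - p) =O[atTop] h := by
    have h1 : (fun k => h k • v) =O[atTop] h := Asymptotics.IsBigO.of_bound ‖v‖
      (Eventually.of_forall fun k => by rw [norm_smul, mul_comm])
    refine (hO.add h1).congr_left fun k => ?_
    rw [hb]; abel
  have hap : Tendsto a atTop (𝓝 p) := by
    simpa using (hO.trans_tendsto hlim).add_const p
  have hbp : Tendsto b atTop (𝓝 p) := by
    simpa using (hO'.trans_tendsto hlim).add_const p
  have hd := hΦ.hasFDerivAt.isLittleO
  -- Differentiability at the single point `p` is enough: both end points of the segment are within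
  -- `O(h)` of `p`, so both first-order remainders are `o(h)`.
  have h1 := (hd.comp_tendsto hap).trans_isBigO hO
  have h2 := (hd.comp_tendsto hbp).trans_isBigO hO'
  have h3 := (h2.sub h1).tendsto_div_nhds_zero
  have h4 := h3.add_const (fderiv ℝ Φ p v)
  rw [zero_add] at h4
  refine h4.congr fun k => ?_
  have hk := (hpos k).ne'
  simp only [Function.comp, hb, map_sub, map_add, map_smul, smul_eq_mul]
  field_simp
  ring

/-- Summation by parts for a discrete balance law. -/
theorem discrete_weak_form {E : Type*} [AddCommGroup E] [Module ℝ E] {N J : ℕ} (hN : 1 ≤ N)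
    {U Q G : ℕ → ℕ → E} {φ : ℕ → ℕ → ℝ} {d : ℝ} {τ : ℕ → ℝ}
    (h : ∀ j < J, ∀ i ∈ Finset.Icc 2 N,
      d • U i (j + 1) = d • U i j - τ j • (Q (i + 1) j - Q i j) + τ j • G i j)
    (h1 : ∀ j, φ 1 j = 0) (hlast : ∀ j, φ N j = 0) (hJ : ∀ i, φ i J = 0) :
    ∑ i ∈ Finset.Icc 2 N, d • φ i 0 • U i 0
      + ∑ j ∈ Finset.range J, ∑ i ∈ Finset.Icc 2 N,
        (d • (φ i (j + 1) - φ i j) • U i j + τ j • (φ i (j + 1) - φ (i - 1) (j + 1)) • Q i j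
          + τ j • φ i (j + 1) • G i j) = 0 := by
  set P : ℕ → E := fun j => ∑ i ∈ Finset.Icc 2 N, d • φ i j • U i j with hP
  have key : ∀ j ∈ Finset.range J, ∑ i ∈ Finset.Icc 2 N,
        (d • (φ i (j + 1) - φ i j) • U i j + τ j • (φ i (j + 1) - φ (i - 1) (j + 1)) • Q i j
          + τ j • φ i (j + 1) • G i j) = P (j + 1) - P j := by
    intro j hj
    -- Pairing `Q i` with the preceding value of `φ` makes the sum telescope; its end terms carry
    -- `φ` at the first and last gridpoint and vanish.
    have htel : ∑ i ∈ Finset.Icc 2 N, (φ i (j + 1) • Q (i + 1) j - φ (i - 1) (j + 1) • Q i j) = 0 := by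
      have := Finset.sum_Ico_sub (fun i => φ (i - 1) (j + 1) • Q i j) (m := 2) (n := N + 1) (by omega)
      rw [Finset.Ico_add_one_right_eq_Icc] at this
      simp only [Nat.add_sub_cancel] at this
      rw [this, hlast, show (2 - 1 : ℕ) = 1 from rfl, h1, zero_smul, zero_smul, sub_zero]
    rw [hP, ← Finset.sum_sub_distrib, ← sub_eq_zero, ← Finset.sum_sub_distrib, ← smul_zero (τ j),
      ← htel, Finset.smul_sum]
    refine Finset.sum_congr rfl fun i hi => ?_
    have e := h j (Finset.mem_range.1 hj) i hi
    rw [smul_comm d (φ i (j + 1)) (U i (j + 1)), e]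
    module
  rw [Finset.sum_congr rfl key, Finset.sum_range_sub, add_sub_cancel, hP]
  simp only [hJ, zero_smul, smul_zero, Finset.sum_const_zero]

theorem abs_sqrt_mul_sub_le {A B A' B' C e : ℝ} (hC : 0 < C) (hA : A ∈ Icc C⁻¹ C)
    (hB : B ∈ Icc C⁻¹ C) (hA' : A' ∈ Icc C⁻¹ C) (hB' : B' ∈ Icc C⁻¹ C) (h1 : |A' - A| ≤ e)
    (h2 : |B' - B| ≤ e) : |Real.sqrt (A' * B') - Real.sqrt (A * B)| ≤ C ^ 2 * e := by
  have hC' := inv_pos.2 hC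
  have s := sqrt_mul_mem hC hA hB
  have s' := sqrt_mul_mem hC hA' hB'
  have hp : 0 < Real.sqrt (A' * B') + Real.sqrt (A * B) := by linarith [s.1, s'.1]
  have e1 : (Real.sqrt (A' * B') - Real.sqrt (A * B)) * (Real.sqrt (A' * B') + Real.sqrt (A * B))
      = (A' - A) * B' + A * (B' - B) := by
    have q1 := Real.mul_self_sqrt (show 0 ≤ A * B from
      mul_nonneg (hC'.le.trans hA.1) (hC'.le.trans hB.1))
    have q2 := Real.mul_self_sqrt (show 0 ≤ A' * B' from
      mul_nonneg (hC'.le.trans hA'.1) (hC'.le.trans hB'.1))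
    linear_combination q2 - q1
  have e2 : |(A' - A) * B' + A * (B' - B)| ≤ 2 * C * e := by
    refine (abs_add_le _ _).trans ?_
    rw [abs_mul, abs_mul, abs_of_pos (hC'.trans_le hA.1), abs_of_pos (hC'.trans_le hB'.1)]
    have he := (abs_nonneg _).trans h1
    have t1 := mul_le_mul h1 hB'.2 (hC'.le.trans hB'.1) he
    have t2 := mul_le_mul hA.2 h2 (abs_nonneg _) hC.le
    linarith
  rw [← e1, abs_mul, abs_of_pos hp] at e2
  have h3 : 2 * C⁻¹ ≤ Real.sqrt (A' * B') + Real.sqrt (A * B) := by linarith [s.1, s'.1]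
  have h4 : |Real.sqrt (A' * B') - Real.sqrt (A * B)| * (2 * C⁻¹) ≤ 2 * C * e :=
    (mul_le_mul_of_nonneg_left h3 (abs_nonneg _)).trans e2
  have : |Real.sqrt (A' * B') - Real.sqrt (A * B)|
      = |Real.sqrt (A' * B') - Real.sqrt (A * B)| * (2 * C⁻¹) * (C / 2) := by field_simp
  rw [this]
  calc _ ≤ 2 * C * e * (C / 2) := mul_le_mul_of_nonneg_right h4 (by positivity)
    _ = _ := by ring

/-- The limit of the difference quotients of `√(AB)`. -/
theorem tendsto_sqrt_mul_quotient {A B α β : ℝ} (hA : 0 < A) (hB : 0 < B)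
    {a b a' b' h : ℕ → ℝ} (ha : Tendsto a atTop (𝓝 A)) (hb : Tendsto b atTop (𝓝 B))
    (ha' : Tendsto a' atTop (𝓝 A)) (hb' : Tendsto b' atTop (𝓝 B))
    (hab : ∀ k, 0 < a k ∧ 0 < b k)  (hab' : ∀ᶠ k in atTop, 0 < a' k ∧ 0 < b' k)
    (h1 : Tendsto (fun k => (a' k - a k) / h k) atTop (𝓝 α))
    (h2 : Tendsto (fun k => (b' k - b k) / h k) atTop (𝓝 β)) :
    Tendsto (fun k => (Real.sqrt (a' k * b' k) - Real.sqrt (a k * b k)) / h k) atTop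
      (𝓝 ((α / (2 * A) + β / (2 * B)) * Real.sqrt (A * B))) := by
  have s : Tendsto (fun k => Real.sqrt (a k * b k)) atTop (𝓝 (Real.sqrt (A * B))) :=
    (Real.continuous_sqrt.tendsto _).comp (ha.mul hb)
  have s' : Tendsto (fun k => Real.sqrt (a' k * b' k)) atTop (𝓝 (Real.sqrt (A * B))) :=
    (Real.continuous_sqrt.tendsto _).comp (ha'.mul hb')
  have hq : 0 < Real.sqrt (A * B) := Real.sqrt_pos.2 (mul_pos hA hB)
  have hsq : Real.sqrt (A * B) ^ 2 = A * B := Real.sq_sqrt (mul_pos hA hB).le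
  have lim := ((h1.mul hb').add (ha.mul h2)).div (s'.add s) (by positivity)
  have e : (α * B + A * β) / (Real.sqrt (A * B) + Real.sqrt (A * B))
      = (α / (2 * A) + β / (2 * B)) * Real.sqrt (A * B) := by
    generalize Real.sqrt (A * B) = q at hq hsq
    field_simp
    rw [hsq]
    ring
  rw [e] at lim
  refine lim.congr' ?_
  filter_upwards [hab'] with k hk
  have q1 := Real.mul_self_sqrt (mul_pos (hab k).1 (hab k).2).le
  have q2 := Real.mul_self_sqrt (mul_pos hk.1 hk.2).le
  have p1 : 0 < Real.sqrt (a k * b k) := Real.sqrt_pos.2 (mul_pos (hab k).1 (hab k).2)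
  have p2 : 0 < Real.sqrt (a' k * b' k) := Real.sqrt_pos.2 (mul_pos hk.1 hk.2)
  rw [Pi.div_apply, div_eq_iff (by positivity), div_mul_eq_mul_div, div_mul_eq_mul_div,
    mul_div_assoc', ← add_div]
  congr 1
  linear_combination q1 - q2

/-- The limit of difference quotients of exponentials. -/
theorem tendsto_mul_exp_quotient {B β : ℝ} {b r h : ℕ → ℝ} (hb : Tendsto b atTop (𝓝 B))
    (hr : Tendsto r atTop (𝓝 β)) (hh : ∀ k, h k ≠ 0) (hlim : Tendsto h atTop (𝓝 0)) :
    Tendsto (fun k => (b k * Real.exp (h k * r k) - b k) / h k) atTop (𝓝 (B * β)) := by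
  have hd : Tendsto (fun k => (Real.exp (h k * r k) - 1) / h k) atTop (𝓝 β) := by
    have hz : Tendsto (fun k => h k * r k) atTop (𝓝 0) := by simpa using hlim.mul hr
    have ho := (Real.hasDerivAt_exp 0).isLittleO.comp_tendsto hz
    have hO : (fun k => h k * r k) =O[atTop] h := by
      simpa using (Asymptotics.isBigO_refl h atTop).mul (hr.isBigO_one ℝ)
    have h1 := (ho.trans_isBigO (k := h) (by simpa [Function.comp_def] using hO)).tendsto_div_nhds_zero
    have h2 := h1.add hr
    rw [zero_add] at h2
    refine h2.congr fun k => ?_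
    have := hh k
    simp only [Function.comp, Real.exp_zero, sub_zero, smul_eq_mul, mul_one]
    field_simp
    ring
  refine (hb.mul hd).congr fun k => ?_
  rw [mul_div_assoc', mul_sub, mul_one]

namespace ConvergentFamily

variable {σ rmin rmax t0 tend : ℝ} {Mb Bb : ℝ → ℝ} {u₀ : ℝ → ℝ × ℝ} {A₀ B₀ : ℝ → ℝ}
  {u : ℝ → ℝ → ℝ × ℝ} {A B : ℝ → ℝ → ℝ}
  (F : ConvergentFamily σ rmin rmax t0 tend Mb Bb u₀ A₀ B₀ u A B)

/-- The coordinate speed of light in the Riemann cells. -/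
noncomputable def speed (k i j : ℕ) : ℝ := Real.sqrt ((F.S k).A i j * (F.S k).B i j)

/-- The numerical flux at `x_{i-}`. -/
noncomputable def starFlux (k i j : ℕ) : ℝ × ℝ :=
  flux σ ((F.S k).A i j) ((F.S k).B i j) ((F.S k).w i j 0)

/-- The source with the averaged metric at `x_i`. -/
noncomputable def meanSource (k i j : ℕ) (v : ℝ × ℝ) : ℝ × ℝ :=
  odeSource σ (((F.S k).A i j + (F.S k).A (i + 1) j) / 2)
    (((F.S k).B i j + (F.S k).B (i + 1) j) / 2) v (F.X k i)

/-- The update of the states is a finite volume scheme. -/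
theorem exists_update : ∃ q : ℕ → ℕ → ℕ → ℝ × ℝ, ∀ k, ∀ j < F.last k, ∀ i ∈ Icc 1 (F.N k),
    q k i j ∈ physical σ ∧ ‖q k i j - (F.S k).u i j‖ ≤ F.D * F.dx k
      + F.D * (‖(F.S k).u i j - (F.S k).u (i - 1) j‖ + ‖(F.S k).u (i + 1) j - (F.S k).u i j‖) ∧
    ‖F.meanSource k i j (q k i j)‖ ≤ F.D ∧
    F.dx k • (F.S k).u i (j + 1) = F.dx k • (F.S k).u i j
      - (F.T k (j + 1) - F.T k j) • (F.starFlux k (i + 1) j - F.starFlux k i j)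
      + (F.T k (j + 1) - F.T k j) • ((F.speed k (i + 1) j - F.speed k i j)
          • minkFlux σ ((F.S k).u i j) + F.dx k • F.meanSource k i j (q k i j)) := by
  have h : ∀ k i j, ∃ q : ℝ × ℝ, j < F.last k → i ∈ Icc 1 (F.N k) →
    q ∈ physical σ ∧ ‖q - (F.S k).u i j‖ ≤ F.D * F.dx k
      + F.D * (‖(F.S k).u i j - (F.S k).u (i - 1) j‖ + ‖(F.S k).u (i + 1) j - (F.S k).u i j‖) ∧
    ‖F.meanSource k i j q‖ ≤ F.D ∧
    F.dx k • (F.S k).u i (j + 1) = F.dx k • (F.S k).u i j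
      - (F.T k (j + 1) - F.T k j) • (F.starFlux k (i + 1) j - F.starFlux k i j)
      + (F.T k (j + 1) - F.T k j) • ((F.speed k (i + 1) j - F.speed k i j)
          • minkFlux σ ((F.S k).u i j) + F.dx k • F.meanSource k i j q) := by
    intro k i j
    by_cases hij : j < F.last k ∧ i ∈ Icc 1 (F.N k)
    · obtain ⟨q, uBar, h1, h2, h3, h4, h5, h6⟩ := (F.step k).update j (F.T_lt_tend (by omega))
        (F.T_lt_tend (by omega)) i hij.2
      refine ⟨q, fun _ _ => ⟨h1, ?_, h5, ?_⟩⟩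
      · rw [show q - (F.S k).u i j = (q - uBar) + (uBar - (F.S k).u i j) by abel]
        exact (norm_add_le _ _).trans (add_le_add h2 h3)
      · have hd := (F.dx_pos k).ne'
        rw [h6, h4]
        change F.dx k • ((F.S k).u i j - ((F.T k (j + 1) - F.T k j) / F.dx k) •
          ((F.starFlux k (i + 1) j - F.starFlux k i j)
            - (F.speed k (i + 1) j - F.speed k i j) • minkFlux σ ((F.S k).u i j))
          + (F.T k (j + 1) - F.T k j) • F.meanSource k i j q) = _
        rw [smul_add, smul_sub, smul_smul, mul_div_cancel₀ _ hd]
        module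
    · exact ⟨0, fun h1 h2 => absurd ⟨h1, h2⟩ hij⟩
  choose q hq using h
  exact ⟨q, fun k j hj i hi => hq k i j hj hi⟩

theorem norm_starFlux_le {k i j : ℕ} (hj : j ≤ F.last k) (hi : i ∈ Icc 1 (F.N k + 1)) :
    ‖F.starFlux k i j‖ ≤ F.C * F.D := by
  have h1 := sqrt_mul_mem F.hC (F.A_mem hj hi) (F.B_mem hj hi)
  rw [starFlux, flux, norm_smul, Real.norm_of_nonneg (Real.sqrt_nonneg _)]
  refine mul_le_mul h1.2 ?_ (norm_nonneg _) F.hC.le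
  exact (norm_minkFlux_le F.hσ F.hσ1 ((F.step k).star_physical j (F.T_lt_tend hj) i hi)).trans
    ((F.step k).star_norm j (F.T_lt_tend hj) i hi)

theorem abs_speed_sub_le {k i j : ℕ} (hj : j ≤ F.last k) (hi : i ∈ Ico 2 (F.N k)) :
    |F.speed k (i + 1) j - F.speed k i j| ≤ F.C ^ 2 * (F.D' * F.dx k) := by
  have h := (F.metric k).space j (F.T_lt_tend hj) i hi
  have h1 : i ∈ Icc 1 (F.N k + 1) := ⟨by have := hi.1; omega, by have := hi.2; omega⟩
  have h2 : i + 1 ∈ Icc 1 (F.N k + 1) := ⟨by omega, by have := hi.2; omega⟩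
  exact abs_sqrt_mul_sub_le F.hC (F.A_mem hj h1) (F.B_mem hj h1) (F.A_mem hj h2) (F.B_mem hj h2)
    h.1 h.2

end ConvergentFamily

/-- Lipschitz test functions that vanish at the boundary and near the final time. -/
structure IsInteriorTest (rmin rmax tend : ℝ) (Φ : ℝ × ℝ → ℝ) : Prop where
  lip : ∃ L, LipschitzWith L Φ
  left : ∀ t, Φ (t, rmin) = 0
  right : ∀ t, Φ (t, rmax) = 0
  late : ∃ T < tend, ∀ t, T ≤ t → ∀ x, Φ (t, x) = 0

namespace LipschitzFamily

variable {σ rmin rmax t0 tend : ℝ} {Mb Bb : ℝ → ℝ} {u₀ : ℝ → ℝ × ℝ} {A₀ B₀ : ℝ → ℝ}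
  {u : ℝ → ℝ → ℝ × ℝ} {A B : ℝ → ℝ → ℝ}
  (F : LipschitzFamily σ rmin rmax t0 tend Mb Bb u₀ A₀ B₀ u A B)

/-- The metric values in the two cells next to a point and their difference quotients converge. -/
theorem ae_tendsto_metric_quotient
    (F : LipschitzFamily σ rmin rmax t0 tend Mb Bb u₀ A₀ B₀ u A B) : ∀ᵐ p ∂F.mu,
    Tendsto (fun k => (F.S k).A (F.ix k p.2 + 1) (F.jt k p.1)) atTop (𝓝 (A p.1 p.2)) ∧
    Tendsto (fun k => (F.S k).B (F.ix k p.2 + 1) (F.jt k p.1)) atTop (𝓝 (B p.1 p.2)) ∧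
    Tendsto (fun k => (F.speed k (F.ix k p.2 + 1) (F.jt k p.1)
        - F.speed k (F.ix k p.2) (F.jt k p.1)) / F.dx k) atTop
      (𝓝 ((metricRhsA (A p.1 p.2) (u p.1 p.2) p.2 / (2 * A p.1 p.2)
        + metricRhsB σ (A p.1 p.2) (B p.1 p.2) (u p.1 p.2) p.2 / (2 * B p.1 p.2))
          * Real.sqrt (A p.1 p.2 * B p.1 p.2))) := by
  filter_upwards [F.ae_tendsto_state, F.ae_tendsto_mid, F.ae_state_mem, F.ae_mem_Ioo]
    with p ⟨_, hA, hB⟩ hmid hK hp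
  have hx := Ioo_subset_Ico_self hp.2
  have hx0 : 0 < p.2 := F.hrmin.trans hp.2.1
  have hdx := F.tendsto_dx
  have hN := F.eventually_ix_lt hx
  have hj1 := F.eventually_le_jt 1 hp.1.1 hp.1.2
  have hi : ∀ k, F.ix k p.2 ∈ Icc 1 (F.N k + 1) ∧ F.ix k p.2 + 1 ∈ Icc 1 (F.N k + 1) := fun k => by
    have := (F.X_ix k hx).1
    exact ⟨⟨by have := this.1; omega, by have := this.2; omega⟩, by omega,
      by have := this.2; omega⟩
  have hz : Tendsto (fun k => F.D' * F.dx k) atTop (𝓝 0) := by simpa using hdx.const_mul F.D'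
  have hspace : ∀ᶠ k in atTop, |(F.S k).A (F.ix k p.2 + 1) (F.jt k p.1)
        - (F.S k).A (F.ix k p.2) (F.jt k p.1)| ≤ F.D' * F.dx k ∧
      |(F.S k).B (F.ix k p.2 + 1) (F.jt k p.1)
        - (F.S k).B (F.ix k p.2) (F.jt k p.1)| ≤ F.D' * F.dx k := by
    filter_upwards [hN] with k hk
    exact (F.metric k).space _ (F.T_lt_tend (F.jt_le k _)) _ ⟨(F.X_ix k hx).1.1, hk⟩
  have hA' : Tendsto (fun k => (F.S k).A (F.ix k p.2 + 1) (F.jt k p.1)) atTop (𝓝 (A p.1 p.2)) := by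
    have := hA.add (squeeze_zero_norm' (hspace.mono fun k hk => hk.1) hz)
    simpa using this
  have hB' : Tendsto (fun k => (F.S k).B (F.ix k p.2 + 1) (F.jt k p.1)) atTop (𝓝 (B p.1 p.2)) := by
    have := hB.add (squeeze_zero_norm' (hspace.mono fun k hk => hk.2) hz)
    simpa using this
  refine ⟨hA', hB', ?_⟩
  have hH := F.tendsto_H_ix hx
  have hH' : Tendsto (fun k => F.H k (F.ix k p.2 + 1)) atTop (𝓝 p.2) := by
    have e : ∀ k, F.H k (F.ix k p.2 + 1) = F.H k (F.ix k p.2) + F.dx k := fun k =>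
      halfPoint_succ _
    simpa [e] using hH.add hdx
  have hmid1 := (continuous_fst.tendsto _).comp hmid
  have hpos := fun k i (h : i ∈ Icc 1 (F.N k + 1)) =>
    (⟨(inv_pos.2 F.hC).trans_le (F.A_mem (F.jt_le k p.1) h).1,
      (inv_pos.2 F.hC).trans_le (F.B_mem (F.jt_le k p.1) h).1⟩ :
      0 < (F.S k).A i (F.jt k p.1) ∧ 0 < (F.S k).B i (F.jt k p.1))
  -- By the update formulas, metric differences between neighbouring cells are `Δx` times a
  -- quadrature of `h`. The quotients therefore converge to `h` itself; convergence of the metric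
  -- alone would not give this.
  refine tendsto_sqrt_mul_quotient (F.A_pos _ _) (F.B_pos _ _) hA hB hA' hB'
    (fun k => hpos k _ (hi k).1) (Eventually.of_forall fun k => hpos k _ (hi k).2) ?_ ?_
  · have lim := ((hA.const_sub 1).div hH' hx0.ne').sub
      (((hmid1.const_mul kappa).mul (hH.pow 2)).div hH' hx0.ne')
    have e : (1 - A p.1 p.2) / p.2 - kappa * (u p.1 p.2).1 * p.2 ^ 2 / p.2
        = metricRhsA (A p.1 p.2) (u p.1 p.2) p.2 := by
      rw [metricRhsA]; field_simp
    rw [e] at lim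
    refine lim.congr' ?_
    filter_upwards [hN, hj1] with k hk hk1
    have hs := (F.S k).A_succ F.hr F.hrmin (F.width_le k) (j := F.jt k p.1 - 1)
      (by rw [Nat.sub_add_cancel hk1]; exact F.T_lt_tend (F.jt_le k _)) (i := F.ix k p.2)
      ⟨by have := (hi k).1.1; omega, hk⟩
    rw [Nat.sub_add_cancel hk1] at hs
    rw [hs]
    exact (mul_div_cancel_left₀ _ (F.dx_pos k).ne').symm
  · rw [metricRhsB_eq (F.A_pos _ _).ne']
    have hr := tendsto_exponentRate F.hσ F.hσ1 (F.A_pos _ _).ne' hx0.ne' (F.hKp hK) hA hH hmid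
    refine (tendsto_mul_exp_quotient hB hr (fun k => (F.dx_pos k).ne') hdx).congr' ?_
    filter_upwards [hN, hj1] with k hk hk1
    have hs := (F.S k).B_succ (j := F.jt k p.1 - 1)
      (by rw [Nat.sub_add_cancel hk1]; exact F.T_lt_tend (F.jt_le k _)) (i := F.ix k p.2)
      ⟨by have := (hi k).1.1; omega, hk⟩
    rw [Nat.sub_add_cancel hk1] at hs
    rw [hs]
    rfl

/-- After summation by parts, the discrete balance law is the integral of a uniformly bounded step
function whose limit almost everywhere is the weak integrand. Test functions are only Lipschitz, so
that the cutoffs at the boundary and the factor `√(A/B)` in the momentum equation are admissible. -/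
theorem weakInterior_eq_zero
    (F : LipschitzFamily σ rmin rmax t0 tend Mb Bb u₀ A₀ B₀ u A B) {Φ : ℝ × ℝ → ℝ}
    (hΦ : IsInteriorTest rmin rmax tend Φ) :
    weakInterior σ rmin rmax t0 tend u₀ u A B Φ = 0 := by
  obtain ⟨q, hq⟩ := F.exists_update
  obtain ⟨R, hR0, hR⟩ := F.exists_norm_le
  obtain ⟨L, hL⟩ := hΦ.lip
  obtain ⟨T', hT', hlate⟩ := hΦ.late
  set φ : ℕ → ℕ → ℕ → ℝ := fun k i j => Φ (F.T k j, F.X k i) with hφ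
  have hφ1 : ∀ k j, φ k 1 j = 0 := fun k j => by
    simp only [hφ, F.X_one]; exact hΦ.left _
  have hφN : ∀ k j, φ k (F.N k) j = 0 := fun k j => by
    simp only [hφ, F.X_last]; exact hΦ.right _
  have hφb : ∀ k j, ∀ i ∈ Icc 1 (F.N k), |φ k i j| ≤ L * (rmax - rmin) := fun k j i hi => by
    have h := hL.dist_le_mul (F.T k j, F.X k i) (F.T k j, rmin)
    have hX : F.X k i ∈ Icc rmin rmax := gridPoint_mem F.hr (F.two_le k) hi
    rw [hΦ.left, Real.dist_0_eq_abs, Prod.dist_eq, dist_self, Real.dist_eq] at h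
    dsimp only at h
    rw [abs_of_nonneg (sub_nonneg.2 hX.1), max_eq_right (sub_nonneg.2 hX.1)] at h
    exact h.trans (mul_le_mul_of_nonneg_left (sub_le_sub_right hX.2 _) L.2)
  -- The summand of `discrete_weak_form` divided by the area of its cell.
  set e : ℕ → ℕ × ℕ → ℝ × ℝ := fun k c =>
    ((φ k c.1 (c.2 + 1) - φ k c.1 c.2) / (F.T k (c.2 + 1) - F.T k c.2)) • (F.S k).u c.1 c.2
      + ((φ k c.1 (c.2 + 1) - φ k (c.1 - 1) (c.2 + 1)) / F.dx k) • F.starFlux k c.1 c.2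
      + φ k c.1 (c.2 + 1) • (((F.speed k (c.1 + 1) c.2 - F.speed k c.1 c.2) / F.dx k)
          • minkFlux σ ((F.S k).u c.1 c.2) + F.meanSource k c.1 c.2 (q k c.1 c.2)) with he
  have hbound : ∀ k, ∀ c ∈ F.cells k, ‖e k c‖ ≤ L * R + L * (F.C * F.D)
      + L * (rmax - rmin) * (F.C ^ 2 * F.D' * R + F.D) := by
    rintro k ⟨i, j⟩ hc
    simp only [ConvergentFamily.cells, Finset.mem_product, Finset.mem_Icc, Finset.mem_range] at hc
    obtain ⟨⟨hi2, hiN⟩, hj⟩ := hc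
    have hΔ := F.T_lt_succ hj.le
    have hdx := F.dx_pos k
    have hu := hR _ (F.state_mem hj.le (i := i) (by omega))
    have hlr : 0 ≤ rmax - rmin := by linarith [F.hr]
    refine (norm_add₃_le).trans (add_le_add (add_le_add ?_ ?_) ?_)
    · rw [norm_smul]
      refine mul_le_mul ?_ hu (norm_nonneg _) L.2
      rw [norm_div, Real.norm_of_nonneg (by linarith : 0 ≤ F.T k (j + 1) - F.T k j),
        div_le_iff₀ (by linarith)]
      refine (hL.norm_sub_le _ _).trans (mul_le_mul_of_nonneg_left (le_of_eq ?_) L.2)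
      rw [Prod.mk_sub_mk, sub_self, Prod.norm_mk, norm_zero, Real.norm_of_nonneg (by linarith),
        max_eq_left (by linarith)]
    · rw [norm_smul]
      refine mul_le_mul ?_ (F.norm_starFlux_le hj.le ⟨by omega, by omega⟩) (norm_nonneg _) L.2
      rw [norm_div, Real.norm_of_nonneg hdx.le, div_le_iff₀ hdx]
      refine (hL.norm_sub_le _ _).trans (mul_le_mul_of_nonneg_left (le_of_eq ?_) L.2)
      dsimp only
      rw [Prod.mk_sub_mk, sub_self, F.X_pred k (by omega), sub_sub_cancel, Prod.norm_mk, norm_zero,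
        Real.norm_of_nonneg hdx.le, max_eq_right hdx.le]
    · rw [norm_smul]
      have hnn : 0 ≤ F.C ^ 2 * F.D' * R + F.D := by
        have := F.hD'.le; have := F.hD.le; positivity
      -- In the last column the metric jump to the cell outside the region is not controlled, but
      -- the test function vanishes at `x_N = rmax`.
      rcases hiN.eq_or_lt with rfl | hlt
      · simp only [hφN, norm_zero, zero_mul]
        exact mul_nonneg (mul_nonneg L.2 hlr) hnn
      · refine mul_le_mul (hφb k _ i ⟨by omega, by omega⟩) ((norm_add_le _ _).trans
          (add_le_add ?_ (hq k j hj i ⟨by omega, by omega⟩).2.2.1)) (norm_nonneg _)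
          (mul_nonneg L.2 hlr)
        rw [norm_smul]
        refine mul_le_mul ?_ ((norm_minkFlux_le F.hσ F.hσ1 (F.hKp
          (F.state_mem hj.le (by omega)))).trans hu) (norm_nonneg _)
          (mul_nonneg (sq_nonneg _) F.hD'.le)
        rw [norm_div, Real.norm_of_nonneg hdx.le, div_le_iff₀ hdx, mul_assoc]
        exact F.abs_speed_sub_le hj.le ⟨hi2, hlt⟩
  have hnn : 0 ≤ L * R + L * (F.C * F.D) + L * (rmax - rmin) * (F.C ^ 2 * F.D' * R + F.D) := by
    have := F.hD'.le; have := F.hD.le; have := F.hC.le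
    have hlr : 0 ≤ rmax - rmin := by linarith [F.hr]
    positivity
  -- Rademacher's theorem replaces the smoothness of the test function.
  have hdiff : ∀ᵐ p ∂F.mu, DifferentiableAt ℝ Φ p :=
    ae_restrict_of_ae hL.ae_differentiableAt
  have hinner := (tendsto_sum_of_step (μ := F.mu) (s := F.cells) (c := F.cell)
    (fun k c _ => F.measurableSet_cell k c) F.cells_disjoint hnn hbound
    (f := fun p => deriv (fun s => Φ (s, p.2)) p.1 • u p.1 p.2
        + deriv (fun y => Φ (p.1, y)) p.2 • flux σ (A p.1 p.2) (B p.1 p.2) (u p.1 p.2)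
        + Φ p • source σ (A p.1 p.2) (B p.1 p.2) (u p.1 p.2) p.2) (by
      filter_upwards [hdiff, F.ae_tendsto_state, F.ae_tendsto_jump, F.ae_tendsto_metric_quotient,
        F.ae_state_mem, F.ae_mem_Ioo] with p hd ⟨hu, hA, hB⟩ ⟨hj1, hj2⟩ ⟨hA', hB', hc⟩ hK hp
      have hp' : p ∈ Ico t0 tend ×ˢ Ico rmin rmax :=
        ⟨Ioo_subset_Ico_self hp.1, Ioo_subset_Ico_self hp.2⟩
      have hcell := F.eventually_mem_cell hp'
      refine ⟨fun k => (F.ix k p.2, F.jt k p.1), hcell, ?_⟩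
      have hx0 : 0 < p.2 := F.hrmin.trans hp.2.1
      have hphys := F.hKp hK
      have hTt := F.tendsto_T_jt hp'.1
      have hXx := F.tendsto_X_ix hp'.2
      have hdx := F.tendsto_dx
      have hΔ : Tendsto (fun k => F.T k (F.jt k p.1 + 1) - F.T k (F.jt k p.1)) atTop (𝓝 0) :=
        squeeze_zero (fun k => (sub_pos.2 (F.T_lt_succ (F.jt_le k _))).le)
          (fun k => F.dt_le_dx (F.jt_le k _)) (by simpa using hdx.const_mul (F.C / 2))
      have hT1 : Tendsto (fun k => F.T k (F.jt k p.1 + 1)) atTop (𝓝 p.1) := by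
        simpa using hTt.add hΔ
      have hC := F.hC
      have gt : deriv (fun s => Φ (s, p.2)) p.1 = fderiv ℝ Φ p (1, 0) := by
        have h1 : HasDerivAt (fun s : ℝ => (s, p.2)) ((1 : ℝ), (0 : ℝ)) p.1 :=
          (hasDerivAt_id _).prodMk (hasDerivAt_const _ _)
        exact (hd.hasFDerivAt.comp_hasDerivAt p.1 h1).deriv
      have gx : deriv (fun y => Φ (p.1, y)) p.2 = fderiv ℝ Φ p (0, 1) := by
        have h1 : HasDerivAt (fun s : ℝ => (p.1, s)) ((0 : ℝ), (1 : ℝ)) p.2 :=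
          (hasDerivAt_const _ _).prodMk (hasDerivAt_id _)
        exact (hd.hasFDerivAt.comp_hasDerivAt p.2 h1).deriv
      have l1 : Tendsto (fun k => (φ k (F.ix k p.2) (F.jt k p.1 + 1)
          - φ k (F.ix k p.2) (F.jt k p.1)) / (F.T k (F.jt k p.1 + 1) - F.T k (F.jt k p.1))) atTop
          (𝓝 (fderiv ℝ Φ p (1, 0))) := by
        refine tendsto_difference_quotient hd (c := 1 + 2 * F.C)
          (a := fun k => (F.T k (F.jt k p.1), F.X k (F.ix k p.2)))
          (b := fun k => (F.T k (F.jt k p.1 + 1), F.X k (F.ix k p.2)))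
          (fun k => sub_pos.2 (F.T_lt_succ (F.jt_le k _))) hΔ (Eventually.of_forall fun k => ?_)
          fun k => ?_
        · have h1 := F.T_jt_le k hp'.1.1
          have h2 := F.lt_T_jt k hp'.1.2
          obtain ⟨g1, g2, g3⟩ := F.X_ix k hp'.2
          rw [F.X_pred k (by have := g1.1; omega)] at g2
          have h3 := F.dx_le_dt (F.jt_le k p.1)
          have h4 : 0 ≤ F.C * (F.T k (F.jt k p.1 + 1) - F.T k (F.jt k p.1)) :=
            mul_nonneg hC.le (by linarith)
          refine max_le ?_ ?_
          · rw [Prod.fst_sub, Real.norm_eq_abs, abs_le]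
            dsimp only
            constructor <;> linarith
          · rw [Prod.snd_sub, Real.norm_eq_abs, abs_le]
            dsimp only
            constructor <;> linarith
        · simp
      have l2 : Tendsto (fun k => (φ k (F.ix k p.2) (F.jt k p.1 + 1)
          - φ k (F.ix k p.2 - 1) (F.jt k p.1 + 1)) / F.dx k) atTop
          (𝓝 (fderiv ℝ Φ p (0, 1))) := by
        refine tendsto_difference_quotient hd (c := 1 + F.C / 2)
          (a := fun k => (F.T k (F.jt k p.1 + 1), F.X k (F.ix k p.2 - 1)))
          (b := fun k => (F.T k (F.jt k p.1 + 1), F.X k (F.ix k p.2)))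
          F.dx_pos hdx (Eventually.of_forall fun k => ?_) fun k => ?_
        · have h1 := F.T_jt_le k hp'.1.1
          have h2 := F.lt_T_jt k hp'.1.2
          obtain ⟨g1, g2, g3⟩ := F.X_ix k hp'.2
          rw [F.X_pred k (by have := g1.1; omega)] at g2 ⊢
          have h3 := F.dt_le_dx (F.jt_le k p.1)
          have h4 : 0 ≤ F.C / 2 * F.dx k := mul_nonneg (by positivity) (F.dx_pos k).le
          have h5 := F.dx_pos k
          refine max_le ?_ ?_
          · rw [Prod.fst_sub, Real.norm_eq_abs, abs_le]
            dsimp only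
            constructor <;> linarith
          · rw [Prod.snd_sub, Real.norm_eq_abs, abs_le]
            dsimp only
            constructor <;> linarith
        · rw [F.X_pred k (by have := (F.X_ix k hp'.2).1.1; omega)]
          simp
      have l3 : Tendsto (fun k => φ k (F.ix k p.2) (F.jt k p.1 + 1)) atTop (𝓝 (Φ p)) :=
        (hL.continuous.tendsto p).comp (hT1.prodMk_nhds hXx)
      have hm : Tendsto (fun k => minkFlux σ ((F.S k).u (F.ix k p.2) (F.jt k p.1))) atTop
          (𝓝 (minkFlux σ (u p.1 p.2))) :=
        (continuousAt_minkFlux F.hσ F.hσ1 hphys).tendsto.comp hu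
      have hw : Tendsto (fun k => (F.S k).w (F.ix k p.2) (F.jt k p.1) 0) atTop
          (𝓝 (u p.1 p.2)) := by
        have h := squeeze_zero_norm (fun k => (F.step k).star_sub (F.jt k p.1)
          (F.T_lt_tend (F.jt_le k _)) (F.ix k p.2)
          ⟨by have := (F.X_ix k hp'.2).1.1; omega, by have := (F.X_ix k hp'.2).1.2; omega⟩)
          (by simpa using hj1.const_mul F.D)
        simpa using hu.add h
      have hsf : Tendsto (fun k => F.starFlux k (F.ix k p.2) (F.jt k p.1)) atTop
          (𝓝 (flux σ (A p.1 p.2) (B p.1 p.2) (u p.1 p.2))) :=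
        ((Real.continuous_sqrt.tendsto _).comp (hA.mul hB)).smul
          ((continuousAt_minkFlux F.hσ F.hσ1 hphys).tendsto.comp hw)
      have hqt : Tendsto (fun k => q k (F.ix k p.2) (F.jt k p.1)) atTop (𝓝 (u p.1 p.2)) := by
        have hz : Tendsto (fun k => F.D * F.dx k + F.D *
            (‖(F.S k).u (F.ix k p.2) (F.jt k p.1) - (F.S k).u (F.ix k p.2 - 1) (F.jt k p.1)‖
            + ‖(F.S k).u (F.ix k p.2 + 1) (F.jt k p.1) - (F.S k).u (F.ix k p.2) (F.jt k p.1)‖))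
            atTop (𝓝 0) := by
          simpa using (hdx.const_mul F.D).add ((hj1.add hj2).const_mul F.D)
        have h := squeeze_zero_norm' (by
          filter_upwards [F.eventually_jt_lt hp'.1.1 hp'.1.2] with k hk
          exact (hq k _ hk (F.ix k p.2) ⟨by have := (F.X_ix k hp'.2).1.1; omega,
            (F.X_ix k hp'.2).1.2⟩).2.1) hz
        simpa using hu.add h
      have hsrc : Tendsto (fun k => F.meanSource k (F.ix k p.2) (F.jt k p.1)
          (q k (F.ix k p.2) (F.jt k p.1))) atTop
          (𝓝 (odeSource σ (A p.1 p.2) (B p.1 p.2) (u p.1 p.2) p.2)) := by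
        refine tendsto_odeSource F.hσ F.hσ1 (F.A_pos _ _).ne' (F.B_pos _ _).ne' hx0.ne' hphys
          ?_ ?_ hXx hqt
        · simpa using (hA.add hA').div_const 2
        · simpa using (hB.add hB').div_const 2
      have lim := ((l1.smul hu).add (l2.smul hsf)).add (l3.smul ((hc.smul hm).add hsrc))
      rw [gt, gx]
      refine lim.congr' (Eventually.of_forall fun k => rfl) |>.trans (le_of_eq ?_)
      congr 3
      -- The limit of the metric jumps, `h · ∇_A f`, cancels the correction in `G`, and `g` is left.
      rw [odeSource, flux, smul_smul]
      abel)).2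
  have hinit := (tendsto_sum_of_step (μ := volume.restrict (Icc rmin rmax))
    (s := fun k => Finset.Icc 2 (F.N k)) (c := fun k i => Ico (F.X k (i - 1)) (F.X k i))
    (fun k i _ => measurableSet_Ico)
    (fun k i _ i' _ hne => disjoint_left.2 fun x hx hx' =>
      hne (F.X_cell_unique hx.1 hx.2 hx'.1 hx'.2))
    (e := fun k i => φ k i 0 • (F.S k).u i 0) (D := L * (rmax - rmin) * R)
    (mul_nonneg (mul_nonneg L.2 (by linarith [F.hr])) hR0)
    (fun k i hi => by
      rw [Finset.mem_Icc] at hi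
      rw [norm_smul]
      exact mul_le_mul (hφb k 0 i ⟨by omega, hi.2⟩) (hR _ (F.state_mem (Nat.zero_le _) (by omega)))
        (norm_nonneg _) (mul_nonneg L.2 (by linarith [F.hr])))
    (f := fun x => Φ (t0, x) • u₀ x) (by
      filter_upwards [F.ae_tendsto_init, ae_restrict_mem measurableSet_Icc,
        ae_restrict_of_ae (Measure.ae_ne volume rmax)] with x h1 hxm hne
      have hx' : x ∈ Ico rmin rmax := ⟨hxm.1, lt_of_le_of_ne hxm.2 hne⟩
      refine ⟨fun k => F.ix k x, Eventually.of_forall fun k => ?_, ?_⟩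
      · obtain ⟨h1, h2, h3⟩ := F.X_ix k hx'
        exact ⟨Finset.mem_Icc.2 h1, h2, h3⟩
      · refine Tendsto.smul ?_ h1
        have : ∀ k, F.T k 0 = t0 := F.T_zero
        simp only [hφ, this]
        exact (hL.continuous.tendsto (t0, x)).comp
          (tendsto_const_nhds.prodMk_nhds (F.tendsto_X_ix hx')))).2
  have hsum := hinner.add hinit
  refine tendsto_nhds_unique hsum (tendsto_const_nhds.congr' ?_)
  -- On fine meshes the last time level is later than the time after which the test function
  -- vanishes, so no terminal sum remains.
  filter_upwards [F.tendsto_T_last.eventually (lt_mem_nhds hT')] with k hk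
  have hd := discrete_weak_form (N := F.N k) (J := F.last k) (by have := F.two_le k; omega)
    (U := (F.S k).u) (Q := F.starFlux k) (φ := φ k) (d := F.dx k)
    (τ := fun j => F.T k (j + 1) - F.T k j)
    (fun j hj i hi => (hq k j hj i ⟨by have := (Finset.mem_Icc.1 hi).1; omega,
      (Finset.mem_Icc.1 hi).2⟩).2.2.2) (hφ1 k) (hφN k) (fun i => hlate _ hk.le _)
  rw [← hd, add_comm]
  congr 1
  · rw [ConvergentFamily.cells, Finset.sum_product_right]
    refine Finset.sum_congr rfl fun j hj => Finset.sum_congr rfl fun i hi => ?_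
    symm
    have hc : (i, j) ∈ F.cells k := by
      simp only [ConvergentFamily.cells, Finset.mem_product]
      exact ⟨hi, hj⟩
    have hΔ := (sub_pos.2 (F.T_lt_succ (Finset.mem_range.1 hj).le)).ne'
    have hdx := (F.dx_pos k).ne'
    rw [F.mu_real_cell hc, he]
    simp only [smul_add, smul_smul]
    refine congrArg₂ (· + ·) (congrArg₂ (· + ·) (congrArg (· • _) ?_) (congrArg (· • _) ?_))
      (congrArg₂ (· + ·) (congrArg (· • _) ?_) (congrArg (· • _) ?_)) <;> field_simp
  · refine Finset.sum_congr rfl fun i hi => ?_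
    symm
    have hi' := Finset.mem_Icc.1 hi
    have hX := F.X_pred k (i := i) (by omega)
    have h1 := F.X_mono k (show 1 ≤ i - 1 by omega)
    have h2 := F.X_mono k hi'.2
    rw [F.X_one] at h1
    rw [F.X_last] at h2
    rw [measureReal_restrict_apply measurableSet_Ico, inter_eq_left.2
      (Ico_subset_Icc_self.trans (Icc_subset_Icc h1 h2)), Real.volume_real_Ico_of_le
      (by linarith [F.dx_pos k]), hX]
    congr 1
    ring

end LipschitzFamily

/-! ### The weak form up to the boundary -/

section Source

variable {σ : ℝ}

theorem tendsto_source (hσ : 0 < σ) (hσ1 : σ < 1) {ι : Type*} {l : Filter ι} {a b x : ι → ℝ}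
    {v : ι → ℝ × ℝ} {a₀ b₀ x₀ : ℝ} {u : ℝ × ℝ} (ha₀ : a₀ ≠ 0) (hx₀ : x₀ ≠ 0)
    (hu : u ∈ physical σ) (ha : Tendsto a l (𝓝 a₀)) (hb : Tendsto b l (𝓝 b₀))
    (hx : Tendsto x l (𝓝 x₀)) (hv : Tendsto v l (𝓝 u)) :
    Tendsto (fun i => source σ (a i) (b i) (v i) (x i)) l (𝓝 (source σ a₀ b₀ u x₀)) := by
  have hs := tendsto_stress hσ hσ1 hu hv
  have hd := tendsto_dens hσ hσ1 hu hv
  have hv1 : Tendsto (fun i => (v i).1) l (𝓝 u.1) := (continuous_fst.tendsto u).comp hv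
  have hv2 : Tendsto (fun i => (v i).2) l (𝓝 u.2) := (continuous_snd.tendsto u).comp hv
  have hq : Tendsto (fun i => Real.sqrt (a i * b i)) l (𝓝 (Real.sqrt (a₀ * b₀))) :=
    (Real.continuous_sqrt.tendsto _).comp (ha.mul hb)
  unfold source stress22
  refine Tendsto.prodMk_nhds ?_ ?_
  · exact ((tendsto_const_nhds.div hx hx₀).neg.mul hq).mul hv2
  · refine (hq.const_mul _).mul ((((tendsto_const_nhds.div hx hx₀).mul hs).add
      ((((tendsto_const_nhds.div ha ha₀).sub_const 1).div hx hx₀).mul (hv1.sub hs))).add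
      (((hx.const_mul _).div ha ha₀).mul ((hv1.mul hs).sub (hv2.pow 2))) |>.sub ?_)
    exact (hx.const_mul 4).mul ((hd.const_mul σ).div (hx.pow 2) (pow_ne_zero 2 hx₀))

theorem measurable_source :
    Measurable fun q : (ℝ × ℝ) × (ℝ × ℝ) × ℝ => source σ q.1.1 q.1.2 q.2.1 q.2.2 := by
  have := measurable_stress (σ := σ)
  have := measurable_dens (σ := σ)
  unfold source stress22
  fun_prop

theorem exists_source_bound (hσ : 0 < σ) (hσ1 : σ < 1) {rmin rmax C : ℝ} (hrmin : 0 < rmin)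
    (hC : 0 < C) {K : Set (ℝ × ℝ)} (hK : IsCompact K) (hKp : K ⊆ physical σ) :
    ∃ G, ∀ A ∈ Icc C⁻¹ C, ∀ B ∈ Icc C⁻¹ C, ∀ u ∈ K, ∀ x ∈ Icc rmin rmax,
      ‖source σ A B u x‖ ≤ G := by
  have hcomp : IsCompact ((Icc C⁻¹ C ×ˢ Icc C⁻¹ C) ×ˢ K ×ˢ Icc rmin rmax) :=
    (isCompact_Icc.prod isCompact_Icc).prod (hK.prod isCompact_Icc)
  obtain ⟨G, hG⟩ := hcomp.exists_bound_of_continuousOn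
    (f := fun q : (ℝ × ℝ) × (ℝ × ℝ) × ℝ => source σ q.1.1 q.1.2 q.2.1 q.2.2) (by
      rintro q ⟨⟨hA, hB⟩, hu, hx⟩
      refine ContinuousAt.continuousWithinAt ?_
      exact tendsto_source hσ hσ1 ((inv_pos.2 hC).trans_le hA.1).ne' (hrmin.trans_le hx.1).ne'
        (hKp hu) (continuous_fst.fst.tendsto q) (continuous_fst.snd.tendsto q)
        (continuous_snd.snd.tendsto q) (continuous_snd.fst.tendsto q))
  exact ⟨G, fun A hA B hB u hu x hx => hG ((A, B), u, x) ⟨⟨hA, hB⟩, hu, hx⟩⟩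

end Source

theorem exists_lipschitzWith_mul {α : Type*} [PseudoMetricSpace α] {f g : α → ℝ} {M M' : ℝ}
    (hf : ∃ L, LipschitzWith L f) (hg : ∃ L, LipschitzWith L g) (hfM : ∀ x, |f x| ≤ M)
    (hgM : ∀ x, |g x| ≤ M') : ∃ L, LipschitzWith L fun x => f x * g x := by
  obtain ⟨Lf, hf⟩ := hf
  obtain ⟨Lg, hg⟩ := hg
  refine ⟨_, LipschitzWith.of_dist_le' (K := M * Lg + Lf * M') fun x y => ?_⟩
  have hM := (abs_nonneg _).trans (hfM x)
  have h1 := hf.dist_le_mul x y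
  have h2 := hg.dist_le_mul x y
  rw [Real.dist_eq] at h1 h2 ⊢
  have e : f x * g x - f y * g y = f x * (g x - g y) + (f x - f y) * g y := by ring
  rw [e]
  refine (abs_add_le _ _).trans ?_
  rw [abs_mul, abs_mul]
  have t1 := mul_le_mul (hfM x) h2 (abs_nonneg _) hM
  have t2 := mul_le_mul h1 (hgM y) (abs_nonneg _) (by positivity)
  linarith

/-- The support of a compactly supported function on `{t < tend}` ends before `tend`. -/
theorem exists_late {φ : ℝ × ℝ → ℝ} {tend : ℝ} (hc : HasCompactSupport φ)
    (hs : tsupport φ ⊆ {p | p.1 < tend}) : ∃ T < tend, ∀ t, T ≤ t → ∀ x, φ (t, x) = 0 := by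
  rcases (tsupport φ).eq_empty_or_nonempty with h | h
  · exact ⟨tend - 1, by linarith, fun t _ x => image_eq_zero_of_notMem_tsupport (by simp [h])⟩
  · obtain ⟨p, hp, hmax⟩ := IsCompact.exists_isMaxOn hc h continuous_fst.continuousOn
    have hpt : p.1 < tend := hs hp
    refine ⟨(p.1 + tend) / 2, by linarith, fun t ht x => image_eq_zero_of_notMem_tsupport ?_⟩
    intro hmem
    have : t ≤ p.1 := hmax hmem
    linarith

/-- A piecewise linear cutoff on `[rmin, rmax]` that equals `1` outside boundary layers of
width `δ`. -/
noncomputable def cutoff (rmin rmax δ x : ℝ) : ℝ :=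
  max 0 (min 1 (min ((x - rmin) / δ) ((rmax - x) / δ)))

theorem cutoff_mem (rmin rmax δ x : ℝ) : cutoff rmin rmax δ x ∈ Icc (0 : ℝ) 1 :=
  ⟨le_max_left _ _, max_le zero_le_one (min_le_left _ _)⟩

theorem exists_lipschitzWith_cutoff (rmin rmax δ : ℝ) :
    ∃ L, LipschitzWith L (cutoff rmin rmax δ) := by
  have h1 : LipschitzWith (Real.toNNReal |δ⁻¹|) fun x => (x - rmin) / δ :=
    LipschitzWith.of_dist_le' fun x y => by
      rw [Real.dist_eq, Real.dist_eq, ← sub_div, div_eq_inv_mul, abs_mul, sub_sub_sub_cancel_right]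
  have h2 : LipschitzWith (Real.toNNReal |δ⁻¹|) fun x => (rmax - x) / δ :=
    LipschitzWith.of_dist_le' fun x y => by
      rw [Real.dist_eq, Real.dist_eq, ← sub_div, div_eq_inv_mul, abs_mul, sub_sub_sub_cancel_left,
        abs_sub_comm]
  exact ⟨_, ((h1.min h2).const_min 1).const_max 0⟩

theorem continuous_cutoff (rmin rmax δ : ℝ) : Continuous (cutoff rmin rmax δ) :=
  (exists_lipschitzWith_cutoff rmin rmax δ).choose_spec.continuous

theorem cutoff_left {rmin rmax δ : ℝ} (hδ : 0 < δ) {x : ℝ} (h : x ≤ rmin) :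
    cutoff rmin rmax δ x = 0 := by
  refine max_eq_left ((min_le_right _ _).trans ((min_le_left _ _).trans ?_))
  exact div_nonpos_of_nonpos_of_nonneg (by linarith) hδ.le

theorem cutoff_right {rmin rmax δ : ℝ} (hδ : 0 < δ) {x : ℝ} (h : rmax ≤ x) :
    cutoff rmin rmax δ x = 0 := by
  refine max_eq_left ((min_le_right _ _).trans ((min_le_right _ _).trans ?_))
  exact div_nonpos_of_nonpos_of_nonneg (by linarith) hδ.le

theorem cutoff_middle {rmin rmax δ : ℝ} (hδ : 0 < δ) {x : ℝ} (h1 : rmin + δ ≤ x)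
    (h2 : x ≤ rmax - δ) : cutoff rmin rmax δ x = 1 := by
  rw [cutoff, min_eq_left, max_eq_right zero_le_one]
  refine le_min ?_ ?_
  · rw [le_div_iff₀ hδ]; linarith
  · rw [le_div_iff₀ hδ]; linarith

theorem cutoff_left_layer {rmin rmax δ : ℝ} (hδ : 0 < δ) (hδ' : 2 * δ < rmax - rmin) {x : ℝ}
    (h1 : rmin ≤ x) (h2 : x ≤ rmin + δ) : cutoff rmin rmax δ x = (x - rmin) / δ := by
  have e1 : (x - rmin) / δ ≤ 1 := by rw [div_le_one hδ]; linarith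
  have e2 : (x - rmin) / δ ≤ (rmax - x) / δ := by gcongr ?_ / _; linarith
  rw [cutoff, min_eq_left e2, min_eq_right e1, max_eq_right]
  exact div_nonneg (by linarith) hδ.le

theorem cutoff_right_layer {rmin rmax δ : ℝ} (hδ : 0 < δ) (hδ' : 2 * δ < rmax - rmin) {x : ℝ}
    (h1 : rmax - δ ≤ x) (h2 : x ≤ rmax) : cutoff rmin rmax δ x = (rmax - x) / δ := by
  have e1 : (rmax - x) / δ ≤ 1 := by rw [div_le_one hδ]; linarith
  have e2 : (rmax - x) / δ ≤ (x - rmin) / δ := by gcongr ?_ / _; linarith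
  rw [cutoff, min_eq_right e2, min_eq_right e1, max_eq_right]
  exact div_nonneg (by linarith) hδ.le

/-- The derivative of the cutoff away from the corners. -/
theorem hasDerivAt_cutoff {rmin rmax δ : ℝ} (hδ : 0 < δ) (hδ' : 2 * δ < rmax - rmin) {x : ℝ}
    (hx : x ∈ Ioo rmin rmax) (hl : x ≠ rmin + δ) (hr : x ≠ rmax - δ) :
    HasDerivAt (cutoff rmin rmax δ) ((Icc rmin (rmin + δ)).indicator (fun _ => δ⁻¹) x
      - (Icc (rmax - δ) rmax).indicator (fun _ => δ⁻¹) x) x := by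
  rcases lt_or_gt_of_ne hl with h1 | h1
  · rw [indicator_of_mem (by exact ⟨hx.1.le, h1.le⟩), indicator_of_notMem (fun h => by
      linarith [h.1]), sub_zero]
    have hd : HasDerivAt (fun x => (x - rmin) / δ) δ⁻¹ x := by
      simpa using ((hasDerivAt_id x).sub_const rmin).div_const δ
    refine hd.congr_of_eventuallyEq ?_
    filter_upwards [Ioo_mem_nhds hx.1 h1] with y hy
    exact cutoff_left_layer hδ hδ' hy.1.le hy.2.le
  · rcases lt_or_gt_of_ne hr with h2 | h2
    · rw [indicator_of_notMem (fun h => by linarith [h.2]), indicator_of_notMem (fun h => by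
        linarith [h.1]), sub_zero]
      refine (hasDerivAt_const x (1 : ℝ)).congr_of_eventuallyEq ?_
      filter_upwards [Ioo_mem_nhds h1 h2] with y hy
      exact cutoff_middle hδ hy.1.le hy.2.le
    · rw [indicator_of_notMem (fun h => by linarith [h.2]), indicator_of_mem
        (by exact ⟨h2.le, hx.2.le⟩), zero_sub]
      have hd : HasDerivAt (fun x => (rmax - x) / δ) (-δ⁻¹) x := by
        simpa [neg_div] using ((hasDerivAt_id x).const_sub rmax).div_const δ
      refine hd.congr_of_eventuallyEq ?_
      filter_upwards [Ioo_mem_nhds h2 hx.2] with y hy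
      exact cutoff_right_layer hδ hδ' hy.1.le hy.2.le

theorem eventually_cutoff_eq_one {rmin rmax x : ℝ} (hx : x ∈ Ioo rmin rmax) :
    ∀ᶠ δ in 𝓝[>] (0 : ℝ), cutoff rmin rmax δ x = 1 := by
  have h1 : ∀ᶠ δ in 𝓝[>] (0 : ℝ), δ < x - rmin :=
    mem_nhdsWithin_of_mem_nhds (Iio_mem_nhds (by linarith [hx.1]))
  have h2 : ∀ᶠ δ in 𝓝[>] (0 : ℝ), δ < rmax - x :=
    mem_nhdsWithin_of_mem_nhds (Iio_mem_nhds (by linarith [hx.2]))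
  filter_upwards [h1, h2, self_mem_nhdsWithin] with δ h1 h2 h0
  exact cutoff_middle h0 (by linarith) (by linarith)

namespace LipschitzFamily

variable {σ rmin rmax t0 tend : ℝ} {Mb Bb : ℝ → ℝ} {u₀ : ℝ → ℝ × ℝ} {A₀ B₀ : ℝ → ℝ}
  {u : ℝ → ℝ → ℝ × ℝ} {A B : ℝ → ℝ → ℝ}

theorem integrable_state (F : LipschitzFamily σ rmin rmax t0 tend Mb Bb u₀ A₀ B₀ u A B) :
    Integrable (fun p : ℝ × ℝ => u p.1 p.2) F.mu := by
  obtain ⟨R, -, hR⟩ := F.exists_norm_le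
  exact Integrable.of_bound F.aestronglyMeasurable_state R (F.ae_state_mem.mono fun p hp => hR _ hp)

theorem integrable_stress (F : LipschitzFamily σ rmin rmax t0 tend Mb Bb u₀ A₀ B₀ u A B) :
    Integrable (fun p : ℝ × ℝ => stress σ (u p.1 p.2)) F.mu := by
  obtain ⟨R, -, hR⟩ := F.exists_norm_le
  refine Integrable.of_bound (measurable_stress.comp_aemeasurable
    F.aestronglyMeasurable_state.aemeasurable).aestronglyMeasurable R
    (F.ae_state_mem.mono fun p hp => ?_)
  have h := (norm_minkFlux_le F.hσ F.hσ1 (F.hKp hp)).trans (hR _ hp)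
  exact (norm_snd_le (minkFlux σ (u p.1 p.2))).trans h

theorem integrable_flux (F : LipschitzFamily σ rmin rmax t0 tend Mb Bb u₀ A₀ B₀ u A B) :
    Integrable (fun p : ℝ × ℝ => flux σ (A p.1 p.2) (B p.1 p.2) (u p.1 p.2)) F.mu := by
  have hm : Integrable (fun p : ℝ × ℝ => minkFlux σ (u p.1 p.2)) F.mu :=
    F.integrable_state.snd.prodMk F.integrable_stress
  have hc : ContinuousOn (fun p : ℝ × ℝ => Real.sqrt (A p.1 p.2 * B p.1 p.2))
      (region rmin rmax t0 tend) :=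
    (Real.continuous_sqrt.comp (F.continuous_A.mul F.continuous_B)).continuousOn
  exact IntegrableOn.continuousOn_smul hm hc (isCompact_Icc.prod isCompact_Icc)

theorem integrable_source (F : LipschitzFamily σ rmin rmax t0 tend Mb Bb u₀ A₀ B₀ u A B) :
    Integrable (fun p : ℝ × ℝ => source σ (A p.1 p.2) (B p.1 p.2) (u p.1 p.2) p.2) F.mu := by
  obtain ⟨G, hG⟩ := exists_source_bound F.hσ F.hσ1 (rmax := rmax) F.hrmin F.hC F.hK F.hKp
  refine Integrable.of_bound (AEMeasurable.aestronglyMeasurable ?_) G ?_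
  · exact measurable_source.comp_aemeasurable
      ((F.continuous_A.measurable.aemeasurable.prodMk F.continuous_B.measurable.aemeasurable).prodMk
        (F.aestronglyMeasurable_state.aemeasurable.prodMk measurable_snd.aemeasurable))
  · filter_upwards [F.ae_state_mem, F.ae_mem_Ioo] with p hp hpI
    exact hG _ (F.memA _ _) _ (F.memB _ _) _ hp _ (Ioo_subset_Icc_self hpI.2)

theorem integrable_init (F : LipschitzFamily σ rmin rmax t0 tend Mb Bb u₀ A₀ B₀ u A B) :
    IntegrableOn u₀ (Icc rmin rmax) := by
  obtain ⟨R, hR0, hR⟩ := F.exists_norm_le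
  refine Integrable.of_bound ?_ R (F.ae_init_mem.mono fun p hp => hR _ hp)
  refine (tendsto_sum_of_step (s := fun k => Finset.Icc 2 (F.N k))
    (c := fun k i => Ico (F.X k (i - 1)) (F.X k i)) (fun k i _ => measurableSet_Ico)
    (fun k i _ i' _ hne => disjoint_left.2 fun x hx hx' =>
      hne (F.X_cell_unique hx.1 hx.2 hx'.1 hx'.2))
    (e := fun k i => (F.S k).u i 0) hR0 (fun k i hi => ?_) ?_).1
  · rw [Finset.mem_Icc] at hi
    exact hR _ (F.state_mem (Nat.zero_le _) (by omega))
  · filter_upwards [F.ae_tendsto_init, ae_restrict_mem measurableSet_Icc,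
        ae_restrict_of_ae (Measure.ae_ne volume rmax)] with x h1 hxm hne
    refine ⟨fun k => F.ix k x, Eventually.of_forall fun k => ?_, h1⟩
    obtain ⟨h1, h2, h3⟩ := F.X_ix k (x := x) ⟨hxm.1, lt_of_le_of_ne hxm.2 hne⟩
    exact ⟨Finset.mem_Icc.2 h1, h2, h3⟩

end LipschitzFamily

theorem continuous_deriv_fst {φ : ℝ × ℝ → ℝ} (hφ : ContDiff ℝ 1 φ) :
    Continuous fun p : ℝ × ℝ => deriv (fun s => φ (s, p.2)) p.1 := by
  have h : ∀ p : ℝ × ℝ, deriv (fun s => φ (s, p.2)) p.1 = fderiv ℝ φ p (1, 0) := fun p => by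
    have h1 : HasDerivAt (fun s : ℝ => (s, p.2)) ((1 : ℝ), (0 : ℝ)) p.1 :=
      (hasDerivAt_id _).prodMk (hasDerivAt_const _ _)
    exact (((hφ.differentiable one_ne_zero) p).hasFDerivAt.comp_hasDerivAt p.1 h1).deriv
  simp only [h]
  exact (hφ.continuous_fderiv one_ne_zero).clm_apply continuous_const

theorem hasDerivAt_snd {φ : ℝ × ℝ → ℝ} (hφ : ContDiff ℝ 1 φ) (p : ℝ × ℝ) :
    HasDerivAt (fun y => φ (p.1, y)) (fderiv ℝ φ p (0, 1)) p.2 := by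
  have h1 : HasDerivAt (fun s : ℝ => (p.1, s)) ((0 : ℝ), (1 : ℝ)) p.2 :=
    (hasDerivAt_const _ _).prodMk (hasDerivAt_id _)
  exact ((hφ.differentiable one_ne_zero) p).hasFDerivAt.comp_hasDerivAt p.2 h1

theorem continuous_deriv_snd {φ : ℝ × ℝ → ℝ} (hφ : ContDiff ℝ 1 φ) :
    Continuous fun p : ℝ × ℝ => deriv (fun y => φ (p.1, y)) p.2 := by
  simp only [fun p => (hasDerivAt_snd hφ p).deriv]
  exact (hφ.continuous_fderiv one_ne_zero).clm_apply continuous_const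

theorem isInteriorTest_mul_cutoff {φ : ℝ × ℝ → ℝ} (hφ : ContDiff ℝ ∞ φ) (hc : HasCompactSupport φ)
    {rmin rmax tend δ : ℝ} (hs : tsupport φ ⊆ {p | p.1 < tend}) (hδ : 0 < δ) :
    IsInteriorTest rmin rmax tend fun p => φ p * cutoff rmin rmax δ p.2 := by
  obtain ⟨L, hL⟩ := exists_lipschitzWith_cutoff rmin rmax δ
  obtain ⟨M, hM⟩ := hc.exists_bound_of_continuous hφ.continuous
  obtain ⟨T, hT, hlate⟩ := exists_late hc hs
  refine ⟨?_, fun t => ?_, fun t => ?_, T, hT, fun t ht x => ?_⟩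
  · refine exists_lipschitzWith_mul (M' := 1)
      (ContDiff.lipschitzWith_of_hasCompactSupport hc hφ (by simp))
      ⟨_, hL.comp LipschitzWith.prod_snd⟩ hM fun p => ?_
    have := cutoff_mem rmin rmax δ p.2
    exact (abs_of_nonneg this.1).trans_le this.2
  · simp only; rw [cutoff_left hδ le_rfl, mul_zero]
  · simp only; rw [cutoff_right hδ le_rfl, mul_zero]
  · simp only; rw [hlate t ht x, zero_mul]

namespace LipschitzFamily

variable {σ rmin rmax t0 tend : ℝ} {Mb Bb : ℝ → ℝ} {u₀ : ℝ → ℝ × ℝ} {A₀ B₀ : ℝ → ℝ}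
  {u : ℝ → ℝ → ℝ × ℝ} {A B : ℝ → ℝ → ℝ}

theorem isCompact_region (rmin rmax t0 tend : ℝ) : IsCompact (region rmin rmax t0 tend) :=
  isCompact_Icc.prod isCompact_Icc

theorem integrable_weak_integrand (F : LipschitzFamily σ rmin rmax t0 tend Mb Bb u₀ A₀ B₀ u A B)
    {φ : ℝ × ℝ → ℝ} (hφ : ContDiff ℝ ∞ φ) :
    Integrable (fun p : ℝ × ℝ => deriv (fun s => φ (s, p.2)) p.1 • u p.1 p.2
        + deriv (fun y => φ (p.1, y)) p.2 • flux σ (A p.1 p.2) (B p.1 p.2) (u p.1 p.2)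
        + φ p • source σ (A p.1 p.2) (B p.1 p.2) (u p.1 p.2) p.2) F.mu := by
  have hφ1 : ContDiff ℝ 1 φ := hφ.of_le (by exact_mod_cast le_top)
  have hc := isCompact_region rmin rmax t0 tend
  refine Integrable.add (Integrable.add ?_ ?_) ?_
  · exact IntegrableOn.continuousOn_smul F.integrable_state
      (continuous_deriv_fst hφ1).continuousOn hc
  · exact IntegrableOn.continuousOn_smul F.integrable_flux
      (continuous_deriv_snd hφ1).continuousOn hc
  · exact IntegrableOn.continuousOn_smul F.integrable_source hφ.continuous.continuousOn hc

theorem ae_snd_ne (F : LipschitzFamily σ rmin rmax t0 tend Mb Bb u₀ A₀ B₀ u A B) (a : ℝ) :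
    ∀ᵐ p ∂F.mu, p.2 ≠ a := by
  rw [F.mu_eq_prod]
  refine (Measure.quasiMeasurePreserving_snd (μ := volume.restrict (Icc t0 tend))
    (ν := volume.restrict (Icc rmin rmax))).ae (p := fun x => x ≠ a) ?_
  exact ae_restrict_of_ae (Measure.ae_ne volume a)

theorem setIntegral_layer (F : LipschitzFamily σ rmin rmax t0 tend Mb Bb u₀ A₀ B₀ u A B)
    {J : ℝ × ℝ → ℝ × ℝ} {a b : ℝ} (h1 : rmin ≤ a) (h2 : b ≤ rmax) (δ : ℝ) :
    ∫ p, (Icc a b).indicator (fun _ => δ) p.2 • J p ∂F.mu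
      = δ • ∫ p in Icc t0 tend ×ˢ Icc a b, J p := by
  have e : (fun p : ℝ × ℝ => (Icc a b).indicator (fun _ => δ) p.2 • J p)
      = (univ ×ˢ Icc a b).indicator fun p => δ • J p := by
    funext p
    by_cases hp : p.2 ∈ Icc a b
    · rw [indicator_of_mem hp, indicator_of_mem (by exact ⟨mem_univ _, hp⟩)]
    · rw [indicator_of_notMem hp, indicator_of_notMem (fun h => hp h.2), zero_smul]
  rw [e, ConvergentFamily.mu, setIntegral_indicator (MeasurableSet.univ.prod measurableSet_Icc),
    ← integral_smul]
  congr 2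
  rw [region, prod_inter_prod, inter_univ, inter_eq_right.2 (Icc_subset_Icc h1 h2)]

/-- The weak form with a cutoff at the boundary. -/
theorem weakInterior_mul_cutoff (F : LipschitzFamily σ rmin rmax t0 tend Mb Bb u₀ A₀ B₀ u A B)
    {φ : ℝ × ℝ → ℝ} (hφ : ContDiff ℝ ∞ φ) {δ : ℝ} (hδ : 0 < δ) (hδ' : 2 * δ < rmax - rmin) :
    weakInterior σ rmin rmax t0 tend u₀ u A B (fun p => φ p * cutoff rmin rmax δ p.2)
      = (∫ p, cutoff rmin rmax δ p.2 • (deriv (fun s => φ (s, p.2)) p.1 • u p.1 p.2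
          + deriv (fun y => φ (p.1, y)) p.2 • flux σ (A p.1 p.2) (B p.1 p.2) (u p.1 p.2)
          + φ p • source σ (A p.1 p.2) (B p.1 p.2) (u p.1 p.2) p.2) ∂F.mu)
        + weakBoundary σ rmin rmax t0 tend u A B φ δ
        + ∫ x in Icc rmin rmax, cutoff rmin rmax δ x • φ (t0, x) • u₀ x := by
  have hφ1 : ContDiff ℝ 1 φ := hφ.of_le (by exact_mod_cast le_top)
  have hc := isCompact_region rmin rmax t0 tend
  have hcut := continuous_cutoff rmin rmax δ
  have hJ : Integrable (fun p : ℝ × ℝ => φ p • flux σ (A p.1 p.2) (B p.1 p.2) (u p.1 p.2)) F.mu :=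
    IntegrableOn.continuousOn_smul F.integrable_flux hφ.continuous.continuousOn hc
  have hI := F.integrable_weak_integrand hφ
  have hI' : Integrable (fun p : ℝ × ℝ => cutoff rmin rmax δ p.2 •
      (deriv (fun s => φ (s, p.2)) p.1 • u p.1 p.2
          + deriv (fun y => φ (p.1, y)) p.2 • flux σ (A p.1 p.2) (B p.1 p.2) (u p.1 p.2)
          + φ p • source σ (A p.1 p.2) (B p.1 p.2) (u p.1 p.2) p.2)) F.mu :=
    IntegrableOn.continuousOn_smul hI (hcut.comp continuous_snd).continuousOn hc
  have hind : ∀ a b : ℝ, Integrable (fun p : ℝ × ℝ => (Icc a b).indicator (fun _ => δ⁻¹) p.2 •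
      φ p • flux σ (A p.1 p.2) (B p.1 p.2) (u p.1 p.2)) F.mu := fun a b => by
    refine hJ.bdd_smul (φ := fun p : ℝ × ℝ => (Icc a b).indicator (fun _ => δ⁻¹) p.2) |δ⁻¹| ?_ (Eventually.of_forall fun p => ?_)
    · exact ((measurable_const.indicator measurableSet_Icc).comp measurable_snd).aestronglyMeasurable
    · exact norm_indicator_le_norm_self _ _
  -- Away from the corners of the cutoff, the product rule adds `±δ⁻¹` times the flux term on the
  -- two layers; these are the boundary means.
  have hae : (fun p : ℝ × ℝ =>
      deriv (fun s => φ (s, p.2) * cutoff rmin rmax δ p.2) p.1 • u p.1 p.2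
        + deriv (fun y => φ (p.1, y) * cutoff rmin rmax δ y) p.2
          • flux σ (A p.1 p.2) (B p.1 p.2) (u p.1 p.2)
        + (φ p * cutoff rmin rmax δ p.2) • source σ (A p.1 p.2) (B p.1 p.2) (u p.1 p.2) p.2)
      =ᵐ[F.mu] fun p => cutoff rmin rmax δ p.2 • (deriv (fun s => φ (s, p.2)) p.1 • u p.1 p.2
          + deriv (fun y => φ (p.1, y)) p.2 • flux σ (A p.1 p.2) (B p.1 p.2) (u p.1 p.2)
          + φ p • source σ (A p.1 p.2) (B p.1 p.2) (u p.1 p.2) p.2)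
        + ((Icc rmin (rmin + δ)).indicator (fun _ => δ⁻¹) p.2 •
            φ p • flux σ (A p.1 p.2) (B p.1 p.2) (u p.1 p.2)
          - (Icc (rmax - δ) rmax).indicator (fun _ => δ⁻¹) p.2 •
            φ p • flux σ (A p.1 p.2) (B p.1 p.2) (u p.1 p.2)) := by
    filter_upwards [F.ae_mem_Ioo, F.ae_snd_ne (rmin + δ), F.ae_snd_ne (rmax - δ)] with p hp h1 h2
    have hd := (hasDerivAt_snd hφ1 p).mul (hasDerivAt_cutoff hδ hδ' hp.2 h1 h2)
    have e1 : deriv (fun y => φ (p.1, y) * cutoff rmin rmax δ y) p.2 = _ := hd.deriv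
    rw [e1, deriv_mul_const_field, (hasDerivAt_snd hφ1 p).deriv]
    module
  rw [weakInterior, weakBoundary]
  have e3 := integral_sub (hind rmin (rmin + δ)) (hind (rmax - δ) rmax)
  have e4 := integral_add hI' ((hind rmin (rmin + δ)).sub (hind (rmax - δ) rmax))
  rw [F.setIntegral_layer le_rfl (by linarith), F.setIntegral_layer (by linarith) le_rfl] at e3
  have e2 := (integral_congr_ae hae).trans (e4.trans (congrArg _ e3))
  refine congrArg₂ (· + ·) e2 (integral_congr_ae (Eventually.of_forall fun x => ?_))
  simp only
  rw [mul_comm, mul_smul]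

/-- For each small `δ` the weak form with cutoff vanishes exactly. The interior and initial parts
converge as the cutoff tends to `1`, which forces the difference of the boundary means to converge;
no trace of `u` is needed. -/
theorem balance (F : LipschitzFamily σ rmin rmax t0 tend Mb Bb u₀ A₀ B₀ u A B)
    {φ : ℝ × ℝ → ℝ} (hφ : ContDiff ℝ ∞ φ) (hc : HasCompactSupport φ)
    (hs : tsupport φ ⊆ {p | p.1 < tend}) :
    Tendsto (fun δ : ℝ => weakInterior σ rmin rmax t0 tend u₀ u A B φ
      + weakBoundary σ rmin rmax t0 tend u A B φ δ) (𝓝[>] 0) (𝓝 0) := by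
  have hI := F.integrable_weak_integrand hφ
  have hinit : IntegrableOn (fun x => φ (t0, x) • u₀ x) (Icc rmin rmax) :=
    F.integrable_init.continuousOn_smul
      (hφ.continuous.comp (Continuous.prodMk_right t0)).continuousOn isCompact_Icc
  have hnorm : ∀ (δ x : ℝ) (v : ℝ × ℝ), ‖cutoff rmin rmax δ x • v‖ ≤ ‖v‖ := fun δ x v => by
    have := cutoff_mem rmin rmax δ x
    rw [norm_smul, Real.norm_of_nonneg this.1]
    exact mul_le_of_le_one_left (norm_nonneg _) this.2
  have l1 : Tendsto (fun δ => ∫ p, cutoff rmin rmax δ p.2 •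
        (deriv (fun s => φ (s, p.2)) p.1 • u p.1 p.2
          + deriv (fun y => φ (p.1, y)) p.2 • flux σ (A p.1 p.2) (B p.1 p.2) (u p.1 p.2)
          + φ p • source σ (A p.1 p.2) (B p.1 p.2) (u p.1 p.2) p.2) ∂F.mu) (𝓝[>] 0)
      (𝓝 (∫ p, (deriv (fun s => φ (s, p.2)) p.1 • u p.1 p.2
          + deriv (fun y => φ (p.1, y)) p.2 • flux σ (A p.1 p.2) (B p.1 p.2) (u p.1 p.2)
          + φ p • source σ (A p.1 p.2) (B p.1 p.2) (u p.1 p.2) p.2) ∂F.mu)) := by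
    refine tendsto_integral_filter_of_dominated_convergence _
      (Eventually.of_forall fun δ => ?_)
      (Eventually.of_forall fun δ => Eventually.of_forall fun p => hnorm δ p.2 _) hI.norm ?_
    · exact ((continuous_cutoff rmin rmax δ).comp continuous_snd).aestronglyMeasurable.smul
        hI.aestronglyMeasurable
    · filter_upwards [F.ae_mem_Ioo] with p hp
      refine tendsto_const_nhds.congr' ?_
      filter_upwards [eventually_cutoff_eq_one hp.2] with δ hδ
      rw [hδ, one_smul]
  have l2 : Tendsto (fun δ => ∫ x in Icc rmin rmax, cutoff rmin rmax δ x • φ (t0, x) • u₀ x)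
      (𝓝[>] 0) (𝓝 (∫ x in Icc rmin rmax, φ (t0, x) • u₀ x)) := by
    refine tendsto_integral_filter_of_dominated_convergence _
      (Eventually.of_forall fun δ => ?_)
      (Eventually.of_forall fun δ => Eventually.of_forall fun p => hnorm δ p _) hinit.norm ?_
    · exact (continuous_cutoff rmin rmax δ).aestronglyMeasurable.smul hinit.aestronglyMeasurable
    · filter_upwards [ae_restrict_mem measurableSet_Icc, ae_restrict_of_ae
        (Measure.ae_ne volume rmin), ae_restrict_of_ae (Measure.ae_ne volume rmax)] with x hx h1 h2
      refine tendsto_const_nhds.congr' ?_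
      filter_upwards [eventually_cutoff_eq_one
        (⟨lt_of_le_of_ne hx.1 (Ne.symm h1), lt_of_le_of_ne hx.2 h2⟩ : x ∈ Ioo rmin rmax)] with δ hδ
      rw [hδ, one_smul]
  have l3 := (l1.add l2).const_sub (weakInterior σ rmin rmax t0 tend u₀ u A B φ)
  rw [weakInterior, sub_self] at l3
  refine l3.congr' ?_
  have hsmall : ∀ᶠ δ in 𝓝[>] (0 : ℝ), 2 * δ < rmax - rmin := by
    refine mem_nhdsWithin_of_mem_nhds ?_
    filter_upwards [Iio_mem_nhds (show (0 : ℝ) < (rmax - rmin) / 2 by linarith [F.hr])] with δ hδ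
    rw [mem_Iio] at hδ
    linarith
  filter_upwards [self_mem_nhdsWithin, hsmall] with δ h1 h2
  have e1 := F.weakInterior_mul_cutoff hφ h1 h2
  rw [F.weakInterior_eq_zero (isInteriorTest_mul_cutoff hφ hc hs h1)] at e1
  rw [weakInterior, sub_eq_add_neg]
  congr 1
  rw [neg_eq_iff_add_eq_zero, e1]
  abel

theorem isWeakSystemSolution (F : LipschitzFamily σ rmin rmax t0 tend Mb Bb u₀ A₀ B₀ u A B) :
    IsWeakSystemSolution σ rmin rmax t0 tend u₀ u A B where
  toIsBoundedFluidLipschitzMetric := F.isBoundedFluidLipschitzMetric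
  balance := fun _ h1 h2 h3 => F.balance h1 h2 h3
  metricA := F.ae_metric_deriv.1
  metricB := F.ae_metric_deriv.2

end LipschitzFamily

/-! ### Partial derivatives of Lipschitz functions -/

section PartialDerivatives

variable {f : ℝ × ℝ → ℝ} {L : NNReal}

theorem lipschitzWith_slice_fst (hf : LipschitzWith L f) (x : ℝ) :
    LipschitzWith L fun t => f (t, x) := by
  simpa [Function.comp_def] using hf.comp (LipschitzWith.prodMk_right x)

theorem lipschitzWith_slice_snd (hf : LipschitzWith L f) (t : ℝ) :
    LipschitzWith L fun x => f (t, x) := by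
  simpa [Function.comp_def] using hf.comp (LipschitzWith.prodMk_left t)

theorem measurable_deriv_fst (hf : Continuous f) :
    Measurable fun p : ℝ × ℝ => deriv (fun s => f (s, p.2)) p.1 := by
  have h : Measurable fun q : ℝ × ℝ => deriv (fun s => f (s, q.1)) q.2 :=
    measurable_deriv_with_param (f := fun x s => f (s, x)) (hf.comp continuous_swap)
  exact h.comp measurable_swap

theorem measurable_deriv_snd (hf : Continuous f) :
    Measurable fun p : ℝ × ℝ => deriv (fun y => f (p.1, y)) p.2 :=
  measurable_deriv_with_param (f := fun t y => f (t, y)) hf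

theorem abs_deriv_fst_le (hf : LipschitzWith L f) (p : ℝ × ℝ) :
    ‖deriv (fun s => f (s, p.2)) p.1‖ ≤ L :=
  norm_deriv_le_of_lipschitz (lipschitzWith_slice_fst hf p.2)

theorem abs_deriv_snd_le (hf : LipschitzWith L f) (p : ℝ × ℝ) :
    ‖deriv (fun y => f (p.1, y)) p.2‖ ≤ L :=
  norm_deriv_le_of_lipschitz (lipschitzWith_slice_snd hf p.1)

theorem ae_differentiableAt_slices (hf : LipschitzWith L f) : ∀ᵐ p : ℝ × ℝ,
    DifferentiableAt ℝ (fun s => f (s, p.2)) p.1 ∧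
      DifferentiableAt ℝ (fun y => f (p.1, y)) p.2 := by
  filter_upwards [hf.ae_differentiableAt] with p hp
  exact ⟨DifferentiableAt.comp p.1 hp (differentiableAt_id.prodMk (differentiableAt_const _)),
    DifferentiableAt.comp p.2 hp ((differentiableAt_const _).prodMk differentiableAt_id)⟩

end PartialDerivatives

namespace LipschitzFamily

variable {σ rmin rmax t0 tend : ℝ} {Mb Bb : ℝ → ℝ} {u₀ : ℝ → ℝ × ℝ} {A₀ B₀ : ℝ → ℝ}
  {u : ℝ → ℝ → ℝ × ℝ} {A B : ℝ → ℝ → ℝ}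

theorem integrable_continuous_mul (F : LipschitzFamily σ rmin rmax t0 tend Mb Bb u₀ A₀ B₀ u A B)
    {g f : ℝ × ℝ → ℝ} (hg : Continuous g) (hf : Integrable f F.mu) :
    Integrable (fun p => g p * f p) F.mu :=
  IntegrableOn.continuousOn_mul hg.continuousOn hf (isCompact_region _ _ _ _)

theorem integrable_deriv_fst_smul {E : Type*} [NormedAddCommGroup E] [NormedSpace ℝ E]
    (F : LipschitzFamily σ rmin rmax t0 tend Mb Bb u₀ A₀ B₀ u A B)
    {Φ : ℝ × ℝ → ℝ} {L : NNReal} (hΦ : LipschitzWith L Φ) {f : ℝ × ℝ → E}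
    (hf : Integrable f F.mu) :
    Integrable (fun p : ℝ × ℝ => deriv (fun s => Φ (s, p.2)) p.1 • f p) F.mu :=
  hf.bdd_smul (φ := fun p : ℝ × ℝ => deriv (fun s => Φ (s, p.2)) p.1) L
    (measurable_deriv_fst hΦ.continuous).aestronglyMeasurable
    (Eventually.of_forall fun p => abs_deriv_fst_le hΦ p)

theorem integrable_deriv_snd_smul {E : Type*} [NormedAddCommGroup E] [NormedSpace ℝ E]
    (F : LipschitzFamily σ rmin rmax t0 tend Mb Bb u₀ A₀ B₀ u A B)
    {Φ : ℝ × ℝ → ℝ} {L : NNReal} (hΦ : LipschitzWith L Φ) {f : ℝ × ℝ → E}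
    (hf : Integrable f F.mu) :
    Integrable (fun p : ℝ × ℝ => deriv (fun y => Φ (p.1, y)) p.2 • f p) F.mu :=
  hf.bdd_smul (φ := fun p : ℝ × ℝ => deriv (fun y => Φ (p.1, y)) p.2) L
    (measurable_deriv_snd hΦ.continuous).aestronglyMeasurable
    (Eventually.of_forall fun p => abs_deriv_snd_le hΦ p)

/-- The weak form for Lipschitz test functions that vanish initially. -/
theorem weak_form (F : LipschitzFamily σ rmin rmax t0 tend Mb Bb u₀ A₀ B₀ u A B)
    {Φ : ℝ × ℝ → ℝ} (hΦ : IsInteriorTest rmin rmax tend Φ) (h0 : ∀ x, Φ (t0, x) = 0) :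
    Integrable (fun p : ℝ × ℝ => deriv (fun s => Φ (s, p.2)) p.1 • u p.1 p.2
        + deriv (fun y => Φ (p.1, y)) p.2 • flux σ (A p.1 p.2) (B p.1 p.2) (u p.1 p.2)
        + Φ p • source σ (A p.1 p.2) (B p.1 p.2) (u p.1 p.2) p.2) F.mu ∧
    ∫ p, (deriv (fun s => Φ (s, p.2)) p.1 • u p.1 p.2
        + deriv (fun y => Φ (p.1, y)) p.2 • flux σ (A p.1 p.2) (B p.1 p.2) (u p.1 p.2)
        + Φ p • source σ (A p.1 p.2) (B p.1 p.2) (u p.1 p.2) p.2) ∂F.mu = 0 := by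
  obtain ⟨L, hL⟩ := hΦ.lip
  constructor
  · exact ((F.integrable_deriv_fst_smul hL F.integrable_state).add
      (F.integrable_deriv_snd_smul hL F.integrable_flux)).add
      (IntegrableOn.continuousOn_smul F.integrable_source hL.continuous.continuousOn
        (isCompact_region _ _ _ _))
  · have h := F.weakInterior_eq_zero hΦ
    rw [weakInterior] at h
    simpa only [h0, zero_smul, integral_zero, add_zero] using h

/-! ### The first-order Einstein equations -/

/-- This equation and `einstein11` are algebraic forms of `A' = h⁰` and `B' = h¹`; the condition on
the boundary mass does not enter. -/
theorem einstein00 (F : LipschitzFamily σ rmin rmax t0 tend Mb Bb u₀ A₀ B₀ u A B) :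
    ∀ᵐ p ∂F.mu, A p.1 p.2 * B p.1 p.2 / p.2 ^ 2 *
        (-p.2 * (deriv (fun r => A p.1 r) p.2 / A p.1 p.2) + 1 / A p.1 p.2 - 1)
      = kappa * B p.1 p.2 ^ 2 * ((u p.1 p.2).1 / B p.1 p.2) := by
  filter_upwards [F.ae_metric_deriv.1, F.ae_mem_Ioo] with p hp hI
  have h1 := (F.A_pos p.1 p.2).ne'
  have h2 := (F.B_pos p.1 p.2).ne'
  have h3 := (F.hrmin.trans hI.2.1).ne'
  rw [hp, metricRhsA]
  field_simp
  ring

theorem einstein11 (F : LipschitzFamily σ rmin rmax t0 tend Mb Bb u₀ A₀ B₀ u A B) :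
    ∀ᵐ p ∂F.mu, 1 / p.2 ^ 2 *
        (p.2 * (deriv (fun r => B p.1 r) p.2 / B p.1 p.2) - (1 / A p.1 p.2 - 1))
      = kappa / A p.1 p.2 ^ 2 * (A p.1 p.2 * stress σ (u p.1 p.2)) := by
  filter_upwards [F.ae_metric_deriv.2, F.ae_mem_Ioo] with p hp hI
  have h1 := (F.A_pos p.1 p.2).ne'
  have h2 := (F.B_pos p.1 p.2).ne'
  have h3 := (F.hrmin.trans hI.2.1).ne'
  rw [hp, metricRhsB]
  field_simp
  ring

/-- The mass flux defect: the left-hand side minus the right-hand side of the equation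
`∂M/∂t = -(κ/2) r² √(AB) T⁰¹_M` for the mass function `M = (1 - A) r / 2`. -/
noncomputable def massDefect (_ : LipschitzFamily σ rmin rmax t0 tend Mb Bb u₀ A₀ B₀ u A B)
    (p : ℝ × ℝ) : ℝ :=
  -(p.2 / 2) * deriv (fun s => A s p.2) p.1
    + kappa / 2 * p.2 ^ 2 * (Real.sqrt (A p.1 p.2 * B p.1 p.2) * (u p.1 p.2).2)

theorem integrable_deriv_A (F : LipschitzFamily σ rmin rmax t0 tend Mb Bb u₀ A₀ B₀ u A B) :
    Integrable (fun p : ℝ × ℝ => deriv (fun s => A s p.2) p.1) F.mu := by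
  obtain ⟨L, hL⟩ := F.lipA
  exact Integrable.of_bound (measurable_deriv_fst hL.continuous).aestronglyMeasurable L
    (Eventually.of_forall fun p => abs_deriv_fst_le hL p)

theorem continuous_sqrt_AB (F : LipschitzFamily σ rmin rmax t0 tend Mb Bb u₀ A₀ B₀ u A B) :
    Continuous fun p : ℝ × ℝ => Real.sqrt (A p.1 p.2 * B p.1 p.2) :=
  Real.continuous_sqrt.comp (F.continuous_A.mul F.continuous_B)

theorem integrable_massDefect (F : LipschitzFamily σ rmin rmax t0 tend Mb Bb u₀ A₀ B₀ u A B) :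
    Integrable F.massDefect F.mu := by
  refine Integrable.add ?_ ?_
  · exact F.integrable_continuous_mul (by fun_prop) F.integrable_deriv_A
  · exact F.integrable_continuous_mul (by fun_prop)
      (F.integrable_continuous_mul F.continuous_sqrt_AB F.integrable_state.snd)

theorem sqrt_AB_eq (F : LipschitzFamily σ rmin rmax t0 tend Mb Bb u₀ A₀ B₀ u A B) (t x : ℝ) :
    Real.sqrt (A t x * B t x) = B t x * Real.sqrt (A t x / B t x) := by
  have hB := F.B_pos t x
  rw [show A t x * B t x = B t x ^ 2 * (A t x / B t x) by field_simp,
    Real.sqrt_mul (sq_nonneg _), Real.sqrt_sq hB.le]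

/-- The first balance law tested against a product. -/
theorem integral_energy_balance (F : LipschitzFamily σ rmin rmax t0 tend Mb Bb u₀ A₀ B₀ u A B)
    {a b : ℝ → ℝ} {La Lb : NNReal} (ha : LipschitzWith La a) (hb : LipschitzWith Lb b)
    (ha1 : ∀ t, |a t| ≤ 1) (hb1 : ∀ x, |b x| ≤ 1) (ha0 : a t0 = 0)
    (hae : ∃ T < tend, ∀ t, T ≤ t → a t = 0) (hbl : b rmin = 0) (hbr : b rmax = 0) :
    ∫ p, (deriv a p.1 * (b p.2 * p.2 ^ 2 * (u p.1 p.2).1)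
      + a p.1 * (deriv b p.2 * p.2 ^ 2 * (Real.sqrt (A p.1 p.2 * B p.1 p.2) * (u p.1 p.2).2)))
      ∂F.mu = 0 := by
  -- The radius clamped to `[rmin, rmax]`, so that the weight `r²` is bounded and globally
  -- Lipschitz.
  set c : ℝ → ℝ := fun y => max rmin (min rmax y) with hc
  have hcL : LipschitzWith 1 c := (LipschitzWith.id.const_min rmax).const_max rmin
  have hcb : ∀ y, |c y| ≤ rmax := fun y => by
    have h1 : rmin ≤ c y := le_max_left _ _
    rw [abs_of_nonneg (F.hrmin.le.trans h1)]
    exact max_le F.hr.le (min_le_left _ _)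
  have hcc : ∃ L, LipschitzWith L fun y => c y * c y :=
    exists_lipschitzWith_mul ⟨_, hcL⟩ ⟨_, hcL⟩ hcb hcb
  have hccb : ∀ y, |c y * c y| ≤ rmax * rmax := fun y => by
    rw [abs_mul]
    exact mul_le_mul (hcb y) (hcb y) (abs_nonneg _) ((abs_nonneg _).trans (hcb y))
  obtain ⟨Lβ, hβ⟩ := exists_lipschitzWith_mul ⟨_, hb⟩ hcc hb1 hccb
  have hβb : ∀ y, |b y * (c y * c y)| ≤ 1 * (rmax * rmax) := fun y => by
    rw [abs_mul]
    exact mul_le_mul (hb1 y) (hccb y) (abs_nonneg _) zero_le_one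
  -- The weight `r²` is chosen so that its derivative cancels the geometric source `g⁰ = -(2/r)
  -- √(AB) T⁰¹_M`; the balance becomes a conservation law.
  have htest : IsInteriorTest rmin rmax tend fun p => a p.1 * (b p.2 * (c p.2 * c p.2)) := by
    refine ⟨exists_lipschitzWith_mul ⟨_, ha.comp LipschitzWith.prod_fst⟩
      ⟨_, hβ.comp LipschitzWith.prod_snd⟩ (fun p => ha1 p.1) (fun p => hβb p.2), fun t => ?_,
      fun t => ?_, hae.imp fun T hT => ⟨hT.1, fun t ht x => ?_⟩⟩
    · simp [hbl]
    · simp [hbr]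
    · simp [hT.2 t ht]
  obtain ⟨hint, hzero⟩ := F.weak_form htest fun x => by simp [ha0]
  have hfst := congrArg Prod.fst hzero
  rw [fst_integral hint] at hfst
  refine Eq.trans (integral_congr_ae ?_) hfst
  have hbd : ∀ᵐ p ∂F.mu, DifferentiableAt ℝ b p.2 := by
    rw [F.mu_eq_prod]
    exact (Measure.quasiMeasurePreserving_snd (μ := volume.restrict (Icc t0 tend))
      (ν := volume.restrict (Icc rmin rmax))).ae (p := fun x => DifferentiableAt ℝ b x)
      (ae_restrict_of_ae hb.ae_differentiableAt_real)
  filter_upwards [F.ae_mem_Ioo, hbd] with p hp hd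
  have hx0 : p.2 ≠ 0 := (F.hrmin.trans hp.2.1).ne'
  have hcp : ∀ y ∈ Ioo rmin rmax, c y = y := fun y hy => by
    simp only [hc]
    rw [min_eq_right hy.2.le, max_eq_right hy.1.le]
  have e1 : deriv (fun s => a s * (b p.2 * (c p.2 * c p.2))) p.1
      = deriv a p.1 * (b p.2 * (p.2 * p.2)) := by
    rw [hcp _ hp.2]
    exact deriv_mul_const_field _
  have e2 : deriv (fun y => a p.1 * (b y * (c y * c y))) p.2
      = a p.1 * (deriv b p.2 * (p.2 * p.2) + b p.2 * (1 * p.2 + p.2 * 1)) := by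
    have h1 : (fun y => a p.1 * (b y * (c y * c y))) =ᶠ[𝓝 p.2] fun y => a p.1 * (b y * (y * y)) := by
      filter_upwards [Ioo_mem_nhds hp.2.1 hp.2.2] with y hy
      rw [hcp y hy]
    rw [h1.deriv_eq]
    exact ((hd.hasDerivAt.mul ((hasDerivAt_id p.2).mul (hasDerivAt_id p.2))).const_mul _).deriv
  simp only [source, flux, minkFlux, Prod.fst_add, Prod.smul_fst, smul_eq_mul]
  rw [e1, e2, hcp _ hp.2]
  field_simp
  ring

end LipschitzFamily

/-- Integration by parts with a factor that vanishes at both ends. -/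
theorem setIntegral_mul_deriv_eq {f g : ℝ → ℝ} {a b : ℝ} (hab : a ≤ b)
    (hf : AbsolutelyContinuousOnInterval f a b) (hg : AbsolutelyContinuousOnInterval g a b)
    (ha : f a = 0) (hb : f b = 0) :
    ∫ x in Icc a b, f x * deriv g x = -∫ x in Icc a b, deriv f x * g x := by
  have h := hf.integral_mul_deriv_eq_deriv_mul hg
  rw [ha, hb, zero_mul, zero_mul, sub_zero, zero_sub, intervalIntegral.integral_of_le hab,
    intervalIntegral.integral_of_le hab] at h
  rw [integral_Icc_eq_integral_Ioc, integral_Icc_eq_integral_Ioc, h]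

/-- An integrable function whose primitive vanishes is zero almost everywhere. -/
theorem ae_eq_zero_of_forall_rat {f : ℝ → ℝ} {a b : ℝ} (hab : a ≤ b)
    (hf : IntervalIntegrable f volume a b)
    (h : ∀ q : ℚ, (q : ℝ) ∈ Ioo a b → ∫ x in a..(q : ℝ), f x = 0) :
    ∀ᵐ x ∂(volume.restrict (Icc a b)), f x = 0 := by
  have hcont : ContinuousOn (fun x => ∫ y in a..x, f y) (Ioo a b) := by
    have := intervalIntegral.continuousOn_primitive_interval' hf left_mem_uIcc
    rw [uIcc_of_le hab] at this
    exact this.mono Ioo_subset_Icc_self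
  have hzero : EqOn (fun x => ∫ y in a..x, f y) (fun _ => 0) (Ioo a b) := by
    refine EqOn.of_subset_closure (s := Ioo a b ∩ range ((↑) : ℚ → ℝ)) ?_ hcont
      continuousOn_const inter_subset_left
      (Rat.isDenseEmbedding_coe_real.dense.open_subset_closure_inter isOpen_Ioo)
    rintro _ ⟨hx, q, rfl⟩
    exact h q hx
  filter_upwards [ae_restrict_mem measurableSet_Icc, ae_restrict_of_ae hf.ae_hasDerivAt_integral,
    ae_restrict_of_ae (Measure.ae_ne volume a), ae_restrict_of_ae (Measure.ae_ne volume b)]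
    with x hx hd h1 h2
  rw [uIcc_of_le hab] at hd
  have hd' := hd hx a (left_mem_Icc.2 hab)
  have hx' : x ∈ Ioo a b := ⟨lt_of_le_of_ne hx.1 (Ne.symm h1), lt_of_le_of_ne hx.2 h2⟩
  have e : (fun x => ∫ y in a..x, f y) =ᶠ[𝓝 x] fun _ => 0 := by
    filter_upwards [Ioo_mem_nhds hx'.1 hx'.2] with y hy using hzero hy
  exact hd'.unique ((hasDerivAt_const x (0 : ℝ)).congr_of_eventuallyEq e)

theorem tendsto_mean_right {g : ℝ → ℝ} {c v : ℝ}
    (h : HasDerivAt (fun x => ∫ y in c..x, g y) v c) :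
    Tendsto (fun δ => δ⁻¹ * ∫ y in c..(c + δ), g y) (𝓝[>] 0) (𝓝 v) := by
  simpa using h.tendsto_slope_zero_right

theorem tendsto_mean_left {g : ℝ → ℝ} {a b x v : ℝ} (hg : IntervalIntegrable g volume a b)
    (hx : x ∈ Ioo a b) (h : HasDerivAt (fun x => ∫ y in a..x, g y) v x) :
    Tendsto (fun δ => δ⁻¹ * ∫ y in (x - δ)..x, g y) (𝓝[>] 0) (𝓝 v) := by
  have hneg : Tendsto (fun δ : ℝ => -δ) (𝓝[>] 0) (𝓝[<] 0) := by
    simpa using tendsto_neg_nhdsGT (a := (0 : ℝ))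
  refine (h.tendsto_slope_zero_left.comp hneg).congr' ?_
  have hsmall : ∀ᶠ δ in 𝓝[>] (0 : ℝ), δ < x - a :=
    mem_nhdsWithin_of_mem_nhds (Iio_mem_nhds (by linarith [hx.1]))
  filter_upwards [hsmall, self_mem_nhdsWithin] with δ h1 (h2 : 0 < δ)
  have hab : a ≤ b := (hx.1.trans hx.2).le
  have i1 : IntervalIntegrable g volume a (x - δ) := hg.mono_set (by
    rw [uIcc_of_le (by linarith), uIcc_of_le hab]
    exact Icc_subset_Icc le_rfl (by linarith [hx.2]))
  have i2 : IntervalIntegrable g volume (x - δ) x := hg.mono_set (by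
    rw [uIcc_of_le (by linarith), uIcc_of_le hab]
    exact Icc_subset_Icc (by linarith) hx.2.le)
  have := intervalIntegral.integral_add_adjacent_intervals i1 i2
  simp only [Function.comp, smul_eq_mul, ← sub_eq_add_neg, inv_neg]
  rw [← this]
  ring

/-! ### The mass function and its energy balance -/

namespace LipschitzFamily

variable {σ rmin rmax t0 tend : ℝ} {Mb Bb : ℝ → ℝ} {u₀ : ℝ → ℝ × ℝ} {A₀ B₀ : ℝ → ℝ}
  {u : ℝ → ℝ → ℝ × ℝ} {A B : ℝ → ℝ → ℝ}

/-- The mass function `M = (1 - A) r / 2`. -/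
noncomputable def mass (_ : LipschitzFamily σ rmin rmax t0 tend Mb Bb u₀ A₀ B₀ u A B)
    (t x : ℝ) : ℝ := (1 - A t x) * (x / 2)

theorem absolutelyContinuous_mass_snd
    (F : LipschitzFamily σ rmin rmax t0 tend Mb Bb u₀ A₀ B₀ u A B) (t a b : ℝ) :
    AbsolutelyContinuousOnInterval (F.mass t) a b := by
  obtain ⟨L, hL⟩ := F.lipA
  have h1 : LipschitzWith (0 + L) fun x => 1 - A t x :=
    (LipschitzWith.const 1).sub (lipschitzWith_slice_snd hL t)
  have h2 : LipschitzWith (Real.toNNReal (1 / 2)) fun x : ℝ => x / 2 :=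
    LipschitzWith.of_dist_le' fun x y => by
      rw [Real.dist_eq, Real.dist_eq, ← sub_div, abs_div, abs_two]; linarith
  exact (h1.lipschitzOnWith.absolutelyContinuousOnInterval).fun_mul
    (h2.lipschitzOnWith.absolutelyContinuousOnInterval)

theorem absolutelyContinuous_mass_fst
    (F : LipschitzFamily σ rmin rmax t0 tend Mb Bb u₀ A₀ B₀ u A B) (x a b : ℝ) :
    AbsolutelyContinuousOnInterval (fun t => F.mass t x) a b := by
  obtain ⟨L, hL⟩ := F.lipA
  have h1 : LipschitzWith (0 + L) fun t => 1 - A t x :=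
    (LipschitzWith.const 1).sub (lipschitzWith_slice_fst hL x)
  exact (h1.lipschitzOnWith.absolutelyContinuousOnInterval).fun_mul
    ((LipschitzWith.const (x / 2)).lipschitzOnWith.absolutelyContinuousOnInterval)

theorem deriv_mass_fst (F : LipschitzFamily σ rmin rmax t0 tend Mb Bb u₀ A₀ B₀ u A B) (t x : ℝ) :
    deriv (fun s => F.mass s x) t = -(x / 2) * deriv (fun s => A s x) t := by
  unfold mass
  rw [deriv_mul_const_field, deriv_const_sub]
  ring

theorem continuous_mass (F : LipschitzFamily σ rmin rmax t0 tend Mb Bb u₀ A₀ B₀ u A B) :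
    Continuous fun p : ℝ × ℝ => F.mass p.1 p.2 := by
  have := F.continuous_A
  unfold mass
  fun_prop

/-- The equation `∂M/∂r = (κ/2) r² T⁰⁰_M` on almost every time slice. -/
theorem ae_ae_deriv_mass (F : LipschitzFamily σ rmin rmax t0 tend Mb Bb u₀ A₀ B₀ u A B) :
    ∀ᵐ t ∂(volume.restrict (Icc t0 tend)), ∀ᵐ x ∂(volume.restrict (Icc rmin rmax)),
      deriv (F.mass t) x = kappa / 2 * (x ^ 2 * (u t x).1) := by
  obtain ⟨L, hL⟩ := F.lipA
  filter_upwards [F.ae_ae_metric_deriv] with t ht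
  filter_upwards [ht, ae_restrict_of_ae (lipschitzWith_slice_snd hL t).ae_differentiableAt_real,
    ae_restrict_mem measurableSet_Icc] with x hx hd hxI
  have hx0 : x ≠ 0 := (F.hrmin.trans_le hxI.1).ne'
  have h1 := (hd.hasDerivAt.const_sub 1).mul ((hasDerivAt_id x).div_const 2)
  have e : deriv (F.mass t) x = _ := h1.deriv
  rw [e, hx.1, metricRhsA]
  simp only [id]
  field_simp
  ring

/-- The mass defect is orthogonal to products `a(t) b'(r)`. -/
theorem integral_mul_massDefect (F : LipschitzFamily σ rmin rmax t0 tend Mb Bb u₀ A₀ B₀ u A B)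
    {a b : ℝ → ℝ} {La Lb : NNReal} (ha : LipschitzWith La a) (hb : LipschitzWith Lb b)
    (ha1 : ∀ t, |a t| ≤ 1) (hb1 : ∀ x, |b x| ≤ 1) (ha0 : a t0 = 0)
    (hae : ∃ T < tend, ∀ t, T ≤ t → a t = 0) (hbl : b rmin = 0) (hbr : b rmax = 0) :
    ∫ p, a p.1 * deriv b p.2 * F.massDefect p ∂F.mu = 0 := by
  have hat : a tend = 0 := by
    obtain ⟨T, hT, h⟩ := hae
    exact h tend hT.le
  have acA : AbsolutelyContinuousOnInterval a t0 tend :=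
    ha.lipschitzOnWith.absolutelyContinuousOnInterval
  have acB : AbsolutelyContinuousOnInterval b rmin rmax :=
    hb.lipschitzOnWith.absolutelyContinuousOnInterval
  have bddA : ∀ {f : ℝ × ℝ → ℝ}, Integrable f F.mu →
      Integrable (fun p => deriv a p.1 * f p) F.mu := fun hf =>
    hf.bdd_smul (φ := fun p : ℝ × ℝ => deriv a p.1) La
      ((measurable_deriv a).comp measurable_fst).aestronglyMeasurable
      (Eventually.of_forall fun p => norm_deriv_le_of_lipschitz ha)
  have bddB : ∀ {f : ℝ × ℝ → ℝ}, Integrable f F.mu →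
      Integrable (fun p => deriv b p.2 * f p) F.mu := fun hf =>
    hf.bdd_smul (φ := fun p : ℝ × ℝ => deriv b p.2) Lb
      ((measurable_deriv b).comp measurable_snd).aestronglyMeasurable
      (Eventually.of_forall fun p => norm_deriv_le_of_lipschitz hb)
  have hac : Continuous fun p : ℝ × ℝ => a p.1 := ha.continuous.comp continuous_fst
  have hbc : Continuous fun p : ℝ × ℝ => b p.2 := hb.continuous.comp continuous_snd
  have i1 : Integrable (fun p : ℝ × ℝ =>
      deriv a p.1 * (b p.2 * (kappa / 2 * (p.2 ^ 2 * (u p.1 p.2).1)))) F.mu :=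
    bddA (F.integrable_continuous_mul hbc ((F.integrable_continuous_mul (by fun_prop)
      F.integrable_state.fst).const_mul _))
  have iE : Integrable (fun p : ℝ × ℝ =>
      kappa / 2 * p.2 ^ 2 * (Real.sqrt (A p.1 p.2 * B p.1 p.2) * (u p.1 p.2).2)) F.mu :=
    F.integrable_continuous_mul (by fun_prop)
      (F.integrable_continuous_mul F.continuous_sqrt_AB F.integrable_state.snd)
  have iM : Integrable (fun p : ℝ × ℝ => F.mass p.1 p.2) F.mu :=
    F.continuous_mass.continuousOn.integrableOn_compact (isCompact_region _ _ _ _)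
  have i2 := bddA (bddB iM)
  have i3 : Integrable (fun p : ℝ × ℝ =>
      deriv b p.2 * (a p.1 * (-(p.2 / 2) * deriv (fun s => A s p.2) p.1))) F.mu :=
    bddB (F.integrable_continuous_mul hac
      (F.integrable_continuous_mul (by fun_prop) F.integrable_deriv_A))
  have i4 := bddB (F.integrable_continuous_mul hac iE)
  -- The energy density is `∂M/∂r`; integration by parts in `r` moves the derivative to `b`.
  have e1 : ∫ p, deriv a p.1 * (b p.2 * (kappa / 2 * (p.2 ^ 2 * (u p.1 p.2).1))) ∂F.mu
      = -∫ p, deriv a p.1 * (deriv b p.2 * F.mass p.1 p.2) ∂F.mu := by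
    rw [F.mu_eq_prod] at i1 i2 ⊢
    rw [integral_prod _ i1, integral_prod _ i2, ← integral_neg]
    refine integral_congr_ae ?_
    filter_upwards [F.ae_ae_deriv_mass] with t ht
    rw [integral_const_mul, integral_const_mul, ← mul_neg, ← setIntegral_mul_deriv_eq F.hr.le acB
      (F.absolutelyContinuous_mass_snd t _ _) hbl hbr]
    congr 1
    refine integral_congr_ae ?_
    filter_upwards [ht] with x hx
    rw [hx]
  -- Integration by parts in `t` gives the same integral from `∂M/∂t`. In the energy balance the
  -- density term can thus be replaced by one with `∂M/∂t`, and the mass defect appears.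
  have e2 : ∫ p, deriv b p.2 * (a p.1 * (-(p.2 / 2) * deriv (fun s => A s p.2) p.1)) ∂F.mu
      = -∫ p, deriv a p.1 * (deriv b p.2 * F.mass p.1 p.2) ∂F.mu := by
    rw [F.mu_eq_prod] at i3 i2 ⊢
    rw [integral_prod_symm _ i3, integral_prod_symm _ i2, ← integral_neg]
    refine integral_congr_ae (Eventually.of_forall fun x => ?_)
    simp only
    have h := setIntegral_mul_deriv_eq F.ht.le acA (F.absolutelyContinuous_mass_fst x _ _) ha0 hat
    simp only [F.deriv_mass_fst] at h
    rw [integral_const_mul, h, mul_neg, ← integral_const_mul]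
    congr 1
    refine integral_congr_ae (Eventually.of_forall fun t => ?_)
    simp only
    ring
  have hbal := F.integral_energy_balance ha hb ha1 hb1 ha0 hae hbl hbr
  have hbal2 : ∫ p, (deriv a p.1 * (b p.2 * (kappa / 2 * (p.2 ^ 2 * (u p.1 p.2).1)))
      + deriv b p.2 * (a p.1 * (kappa / 2 * p.2 ^ 2 *
        (Real.sqrt (A p.1 p.2 * B p.1 p.2) * (u p.1 p.2).2)))) ∂F.mu = 0 := by
    rw [← mul_zero (kappa / 2), ← hbal, ← integral_const_mul]
    refine integral_congr_ae (Eventually.of_forall fun p => ?_)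
    simp only
    ring
  rw [integral_add i1 i4, e1, ← e2, ← integral_add i3 i4] at hbal2
  rw [← hbal2]
  refine integral_congr_ae (Eventually.of_forall fun p => ?_)
  simp only [massDefect]
  ring

end LipschitzFamily

/-- An integrable function that is orthogonal to the derivatives of Lipschitz functions vanishing
at both ends, and whose boundary value is zero, vanishes almost everywhere. -/
theorem ae_eq_zero_of_integral_deriv_mul {w : ℝ → ℝ} {a b : ℝ} (hw : IntegrableOn w (Icc a b))
    (h : ∀ (β : ℝ → ℝ) (L : NNReal), LipschitzWith L β → (∀ x, |β x| ≤ 1) → β a = 0 → β b = 0 →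
      ∫ x in Icc a b, deriv β x * w x = 0)
    (h0 : Tendsto (fun δ => δ⁻¹ * ∫ y in a..(a + δ), w y) (𝓝[>] 0) (𝓝 0)) :
    ∀ᵐ x ∂(volume.restrict (Icc a b)), w x = 0 := by
  rcases lt_or_ge b a with hba | hab
  · simp [Icc_eq_empty (not_le.2 hba)]
  have hwi : IntervalIntegrable w volume a b :=
    (intervalIntegrable_iff_integrableOn_Icc_of_le hab).2 hw
  filter_upwards [ae_restrict_mem measurableSet_Icc, ae_restrict_of_ae hwi.ae_hasDerivAt_integral,
    ae_restrict_of_ae (Measure.ae_ne volume a), ae_restrict_of_ae (Measure.ae_ne volume b)]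
    with x hx hd h1 h2
  rw [uIcc_of_le hab] at hd
  have hx' : x ∈ Ioo a b := ⟨lt_of_le_of_ne hx.1 (Ne.symm h1), lt_of_le_of_ne hx.2 h2⟩
  -- Testing against the trapezoid between `a` and `x`, whose slopes are `±δ⁻¹`, shows that the mean
  -- of `w` over the layer at `x` equals the mean over the layer at `a`. The first tends to `w x`
  -- where the primitive has that derivative, the second to zero.
  refine tendsto_nhds_unique (tendsto_mean_left hwi hx' (hd hx a (left_mem_Icc.2 hab))) (h0.congr' ?_)
  have hsmall : ∀ᶠ δ in 𝓝[>] (0 : ℝ), δ < (x - a) / 2 :=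
    mem_nhdsWithin_of_mem_nhds (Iio_mem_nhds (by linarith [hx'.1]))
  filter_upwards [hsmall, self_mem_nhdsWithin] with δ hδ' (hδ : 0 < δ)
  obtain ⟨L, hL⟩ := exists_lipschitzWith_cutoff a x δ
  have hint := h (cutoff a x δ) L hL
    (fun y => abs_le.2 ⟨by linarith [(cutoff_mem a x δ y).1], (cutoff_mem a x δ y).2⟩)
    (cutoff_left hδ le_rfl) (cutoff_right hδ hx'.2.le)
  have hlayer : ∀ c d, a ≤ c → c ≤ d → d ≤ b →
      ∫ y in Icc a b, (Icc c d).indicator (fun y => δ⁻¹ * w y) y = δ⁻¹ * ∫ y in c..d, w y := by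
    intro c d hc hcd hd
    rw [setIntegral_indicator measurableSet_Icc,
      inter_eq_self_of_subset_right (Icc_subset_Icc hc hd), integral_const_mul,
      intervalIntegral.integral_of_le hcd, integral_Icc_eq_integral_Ioc]
  have i1 : ∀ c d, IntegrableOn (fun y => (Icc c d).indicator (fun y => δ⁻¹ * w y) y) (Icc a b) :=
    fun c d => (hw.const_mul δ⁻¹).indicator measurableSet_Icc
  rw [← hlayer a (a + δ) le_rfl (by linarith) (by linarith [hx'.2]),
    ← hlayer (x - δ) x (by linarith) (by linarith) hx'.2.le, ← sub_eq_zero,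
    ← integral_sub (i1 _ _) (i1 _ _), ← hint]
  refine integral_congr_ae ?_
  filter_upwards [ae_restrict_mem measurableSet_Icc, ae_restrict_of_ae (Measure.ae_ne volume a),
    ae_restrict_of_ae (Measure.ae_ne volume x), ae_restrict_of_ae (Measure.ae_ne volume (a + δ)),
    ae_restrict_of_ae (Measure.ae_ne volume (x - δ))] with y hy n1 n2 n3 n4
  rcases lt_or_gt_of_ne n2 with hyx | hyx
  · rw [(hasDerivAt_cutoff hδ (by linarith) ⟨lt_of_le_of_ne hy.1 (Ne.symm n1), hyx⟩ n3 n4).deriv]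
    simp only [indicator]
    split_ifs <;> ring
  · have e : cutoff a x δ =ᶠ[𝓝 y] fun _ => 0 := by
      filter_upwards [Ioi_mem_nhds hyx] with z (hz : x < z) using cutoff_right hδ hz.le
    rw [e.deriv_eq, deriv_const, zero_mul, indicator_of_notMem (fun h => by linarith [h.2]),
      indicator_of_notMem (fun h => by linarith [h.2]), sub_zero]

/-! ### Vanishing of the mass defect -/

namespace LipschitzFamily

variable {σ rmin rmax t0 tend : ℝ} {Mb Bb : ℝ → ℝ} {u₀ : ℝ → ℝ × ℝ} {A₀ B₀ : ℝ → ℝ}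
  {u : ℝ → ℝ → ℝ × ℝ} {A B : ℝ → ℝ → ℝ}

theorem integrable_slab (F : LipschitzFamily σ rmin rmax t0 tend Mb Bb u₀ A₀ B₀ u A B)
    {f : ℝ × ℝ → ℝ} (hf : Integrable f F.mu) {s₁ s₂ : ℝ} (h1 : t0 ≤ s₁) (h2 : s₂ ≤ tend) :
    Integrable f ((volume.restrict (Icc s₁ s₂)).prod (volume.restrict (Icc rmin rmax))) := by
  rw [F.mu_eq_prod, Measure.prod_restrict] at hf
  rw [Measure.prod_restrict]
  exact hf.mono_measure
    (Measure.restrict_mono (prod_mono (Icc_subset_Icc h1 h2) Subset.rfl) le_rfl)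

/-- The time integrals of the mass defect are orthogonal to derivatives. -/
theorem integral_deriv_mul_massDefect
    (F : LipschitzFamily σ rmin rmax t0 tend Mb Bb u₀ A₀ B₀ u A B) {s₁ s₂ : ℝ} (h1 : t0 ≤ s₁)
    (h2 : s₂ < tend) {b : ℝ → ℝ} {Lb : NNReal} (hb : LipschitzWith Lb b)
    (hb1 : ∀ x, |b x| ≤ 1) (hbl : b rmin = 0) (hbr : b rmax = 0) :
    ∫ x in Icc rmin rmax, deriv b x * ∫ t in Icc s₁ s₂, F.massDefect (t, x) = 0 := by
  have iW : Integrable (fun p : ℝ × ℝ => deriv b p.2 * F.massDefect p) F.mu :=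
    F.integrable_massDefect.bdd_smul (φ := fun p : ℝ × ℝ => deriv b p.2) Lb
      ((measurable_deriv b).comp measurable_snd).aestronglyMeasurable
      (Eventually.of_forall fun p => norm_deriv_le_of_lipschitz hb)
  -- Lipschitz cutoffs in time approximate the indicator of the time interval; `s₂ < tend` makes
  -- them vanish near the final time, as admissible test functions must.
  have hzero : ∀ ε > 0, ∫ p, cutoff s₁ s₂ ε p.1 * (deriv b p.2 * F.massDefect p) ∂F.mu = 0 := by
    intro ε hε
    obtain ⟨La, hLa⟩ := exists_lipschitzWith_cutoff s₁ s₂ ε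
    simp only [← mul_assoc]
    exact F.integral_mul_massDefect hLa hb
      (fun y => abs_le.2 ⟨by linarith [(cutoff_mem s₁ s₂ ε y).1], (cutoff_mem s₁ s₂ ε y).2⟩) hb1
      (cutoff_left hε h1) ⟨s₂, h2, fun t ht => cutoff_right hε ht⟩ hbl hbr
  have hlim : Tendsto (fun ε => ∫ p, cutoff s₁ s₂ ε p.1 * (deriv b p.2 * F.massDefect p) ∂F.mu)
      (𝓝[>] 0) (𝓝 (∫ p, (Ioo s₁ s₂).indicator 1 p.1 * (deriv b p.2 * F.massDefect p) ∂F.mu)) := by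
    refine tendsto_integral_filter_of_dominated_convergence
      (fun p => ‖deriv b p.2 * F.massDefect p‖) ?_ ?_ iW.norm ?_
    · refine Eventually.of_forall fun ε => ?_
      exact ((continuous_cutoff s₁ s₂ ε).comp continuous_fst).aestronglyMeasurable.mul
        iW.aestronglyMeasurable
    · refine Eventually.of_forall fun ε => Eventually.of_forall fun p => ?_
      have := cutoff_mem s₁ s₂ ε p.1
      rw [norm_mul, Real.norm_of_nonneg this.1]
      exact mul_le_of_le_one_left (norm_nonneg _) this.2
    · refine Eventually.of_forall fun p => Tendsto.mul_const _ ?_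
      by_cases hp : p.1 ∈ Ioo s₁ s₂
      · rw [indicator_of_mem hp]
        exact tendsto_const_nhds.congr' ((eventually_cutoff_eq_one hp).mono fun ε h => h.symm)
      · rw [indicator_of_notMem hp]
        refine tendsto_const_nhds.congr' ?_
        filter_upwards [self_mem_nhdsWithin] with ε (hε : 0 < ε)
        rcases le_or_gt p.1 s₁ with h | h
        · exact (cutoff_left hε h).symm
        · exact (cutoff_right hε (not_lt.1 fun h' => hp ⟨h, h'⟩)).symm
  have hz : ∫ p, (Ioo s₁ s₂).indicator 1 p.1 * (deriv b p.2 * F.massDefect p) ∂F.mu = 0 :=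
    tendsto_nhds_unique hlim (tendsto_const_nhds.congr' (by
      filter_upwards [self_mem_nhdsWithin] with ε hε using (hzero ε hε).symm))
  have iI : Integrable (fun p : ℝ × ℝ =>
      (Ioo s₁ s₂).indicator 1 p.1 * (deriv b p.2 * F.massDefect p)) F.mu := by
    refine (iW.indicator (measurable_fst (measurableSet_Ioo (a := s₁) (b := s₂)))).congr
      (Eventually.of_forall fun p => ?_)
    by_cases hp : p.1 ∈ Ioo s₁ s₂ <;> simp [indicator, hp]
  rw [F.mu_eq_prod] at hz iI
  rw [integral_prod_symm _ iI] at hz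
  rw [← hz]
  refine integral_congr_ae (Eventually.of_forall fun x => ?_)
  simp only
  have e : (fun t => (Ioo s₁ s₂).indicator 1 t * (deriv b x * F.massDefect (t, x)))
      = (Ioo s₁ s₂).indicator fun t => deriv b x * F.massDefect (t, x) := by
    funext t
    by_cases hp : t ∈ Ioo s₁ s₂ <;> simp [indicator, hp]
  rw [e, setIntegral_indicator measurableSet_Ioo,
    inter_eq_self_of_subset_right (Ioo_subset_Icc_self.trans (Icc_subset_Icc h1 h2.le)),
    integral_const_mul, integral_Icc_eq_integral_Ioo]

/-- The energy flux `√(AB) T⁰¹_M`. -/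
noncomputable def energyFlux (_ : LipschitzFamily σ rmin rmax t0 tend Mb Bb u₀ A₀ B₀ u A B)
    (p : ℝ × ℝ) : ℝ := Real.sqrt (A p.1 p.2 * B p.1 p.2) * (u p.1 p.2).2

theorem integrable_energyFlux (F : LipschitzFamily σ rmin rmax t0 tend Mb Bb u₀ A₀ B₀ u A B) :
    Integrable F.energyFlux F.mu :=
  F.integrable_continuous_mul F.continuous_sqrt_AB F.integrable_state.snd

/-- The mass is Lipschitz in time at each fixed radius, so the fundamental theorem of calculus
integrates its time derivative. -/
theorem ae_integral_massDefect (F : LipschitzFamily σ rmin rmax t0 tend Mb Bb u₀ A₀ B₀ u A B)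
    {s₁ s₂ : ℝ} (h1 : t0 ≤ s₁) (h12 : s₁ ≤ s₂) (h2 : s₂ ≤ tend) :
    ∀ᵐ x ∂(volume.restrict (Icc rmin rmax)), ∫ t in Icc s₁ s₂, F.massDefect (t, x)
      = (F.mass s₂ x - F.mass s₁ x)
        + kappa / 2 * (x ^ 2 * ∫ t in Icc s₁ s₂, F.energyFlux (t, x)) := by
  have hD : Integrable (fun p : ℝ × ℝ => -(p.2 / 2) * deriv (fun s => A s p.2) p.1) F.mu :=
    F.integrable_continuous_mul (by fun_prop) F.integrable_deriv_A
  filter_upwards [(F.integrable_slab hD h1 h2).prod_left_ae,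
    (F.integrable_slab F.integrable_energyFlux h1 h2).prod_left_ae] with x hx hx'
  have e : ∀ t, F.massDefect (t, x) = -(x / 2) * deriv (fun s => A s x) t
      + kappa / 2 * x ^ 2 * F.energyFlux (t, x) := fun t => rfl
  simp only [e]
  rw [integral_add hx (hx'.const_mul _), integral_const_mul (kappa / 2 * x ^ 2),
    ← (F.absolutelyContinuous_mass_fst x s₁ s₂).integral_deriv_eq_sub,
    intervalIntegral.integral_of_le h12, ← integral_Icc_eq_integral_Ioc, mul_assoc]
  simp only [F.deriv_mass_fst]

/-- If the boundary mass evolves consistently, then the mass defect has no boundary value at the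
inner radius. -/
theorem tendsto_mean_massDefect (F : LipschitzFamily σ rmin rmax t0 tend Mb Bb u₀ A₀ B₀ u A B)
    (hM : BoundaryMassConsistent rmin t0 tend Mb u A B) {s₁ s₂ : ℝ} (h1 : t0 ≤ s₁) (h12 : s₁ ≤ s₂)
    (h2 : s₂ ≤ tend) :
    Tendsto (fun δ => δ⁻¹ * ∫ x in rmin..(rmin + δ), ∫ t in Icc s₁ s₂, F.massDefect (t, x))
      (𝓝[>] 0) (𝓝 0) := by
  set e : ℝ → ℝ := fun x => ∫ t in Icc s₁ s₂, F.energyFlux (t, x) with he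
  have iE := F.integrable_slab F.integrable_energyFlux h1 h2
  have ie : IntegrableOn e (Icc rmin rmax) := iE.integral_prod_right
  have hmc : ∀ s, Continuous (F.mass s) := fun s =>
    F.continuous_mass.comp (Continuous.prodMk_right s)
  -- The mass is continuous and equals `Mb` at `rmin` by `A_boundary`, so the means over layers
  -- converge to the increment of `Mb`.
  have hmass : Tendsto (fun δ => δ⁻¹ * ∫ x in rmin..(rmin + δ), (F.mass s₂ x - F.mass s₁ x))
      (𝓝[>] 0) (𝓝 (Mb s₂ - Mb s₁)) := by
    have hc : Continuous fun x => F.mass s₂ x - F.mass s₁ x := (hmc s₂).sub (hmc s₁)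
    have := tendsto_mean_right (hc.integral_hasStrictDerivAt rmin rmin).hasDerivAt
    have ev : F.mass s₂ rmin - F.mass s₁ rmin = Mb s₂ - Mb s₁ := by
      rw [mass, mass, F.A_boundary s₂ ⟨h1.trans h12, h2⟩, F.A_boundary s₁ ⟨h1, h12.trans h2⟩]
      have := F.hrmin.ne'
      field_simp
      ring
    rwa [ev] at this
  have hflux := hM s₁ s₂ h1 h12 h2
  -- The hypothesis has the weight `rmin²` instead of `r²`. On the layer they differ by at most `2 *
  -- rmax * δ`, which cancels `δ⁻¹` and leaves an integral over a shrinking interval.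
  have hdiff : Tendsto (fun δ => δ⁻¹ * ∫ x in rmin..(rmin + δ), (x ^ 2 - rmin ^ 2) * e x)
      (𝓝[>] 0) (𝓝 0) := by
    have hprim : Tendsto (fun δ => 2 * rmax * ∫ x in rmin..(rmin + δ), |e x|) (𝓝[>] 0) (𝓝 0) := by
      have hc := intervalIntegral.continuousOn_primitive_interval'
        ((intervalIntegrable_iff_integrableOn_Icc_of_le F.hr.le).2 ie.norm) left_mem_uIcc
      rw [uIcc_of_le F.hr.le] at hc
      have hshift : Tendsto (fun δ => rmin + δ) (𝓝[>] (0 : ℝ)) (𝓝[Icc rmin rmax] rmin) := by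
        refine tendsto_nhdsWithin_iff.2 ⟨?_, ?_⟩
        · have : Tendsto (fun δ => rmin + δ) (𝓝 (0 : ℝ)) (𝓝 (rmin + 0)) :=
            (continuous_const_add rmin).tendsto 0
          rw [add_zero] at this
          exact this.mono_left nhdsWithin_le_nhds
        · have hs : ∀ᶠ δ in 𝓝[>] (0 : ℝ), δ < rmax - rmin :=
            mem_nhdsWithin_of_mem_nhds (Iio_mem_nhds (by linarith [F.hr]))
          filter_upwards [hs, self_mem_nhdsWithin] with δ h (h' : 0 < δ)
          exact ⟨by linarith, by linarith⟩
      have := ((hc rmin (left_mem_Icc.2 F.hr.le)).tendsto.comp hshift).const_mul (2 * rmax)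
      simpa using this
    refine squeeze_zero_norm' ?_ hprim
    have hs : ∀ᶠ δ in 𝓝[>] (0 : ℝ), δ < rmax - rmin :=
      mem_nhdsWithin_of_mem_nhds (Iio_mem_nhds (by linarith [F.hr]))
    filter_upwards [hs, self_mem_nhdsWithin] with δ h (hδ : 0 < δ)
    rw [norm_mul, norm_inv, Real.norm_of_nonneg hδ.le, inv_mul_le_iff₀ hδ,
      ← intervalIntegral.integral_const_mul, ← intervalIntegral.integral_const_mul]
    refine intervalIntegral.norm_integral_le_of_norm_le (by linarith) (Eventually.of_forall ?_) ?_
    · intro x hx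
      have hx0 : 0 < x := F.hrmin.trans hx.1
      have hs := F.hrmin
      rw [norm_mul, Real.norm_eq_abs (e x), ← mul_assoc]
      refine mul_le_mul_of_nonneg_right ?_ (abs_nonneg _)
      rw [Real.norm_of_nonneg (by nlinarith [hx.1])]
      nlinarith [hx.1, hx.2]
    · refine ((((intervalIntegrable_iff_integrableOn_Icc_of_le F.hr.le).2 ie.norm).mono_set ?_
        ).const_mul _).const_mul _
      rw [uIcc_of_le (by linarith), uIcc_of_le F.hr.le]
      exact Icc_subset_Icc le_rfl (by linarith)
  have hsum := (hmass.add (hdiff.const_mul (kappa / 2))).sub hflux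
  rw [mul_zero, add_zero, sub_self] at hsum
  refine hsum.congr' ?_
  have hs : ∀ᶠ δ in 𝓝[>] (0 : ℝ), δ < rmax - rmin :=
    mem_nhdsWithin_of_mem_nhds (Iio_mem_nhds (by linarith [F.hr]))
  filter_upwards [hs, self_mem_nhdsWithin] with δ h (hδ : 0 < δ)
  have hle : rmin ≤ rmin + δ := by linarith
  have hsub : Icc rmin (rmin + δ) ⊆ Icc rmin rmax := Icc_subset_Icc le_rfl (by linarith)
  have iδ : IntervalIntegrable e volume rmin (rmin + δ) :=
    (intervalIntegrable_iff_integrableOn_Icc_of_le hle).2 (ie.mono_set hsub)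
  have ifl : ∫ p in Icc s₁ s₂ ×ˢ Icc rmin (rmin + δ),
      Real.sqrt (A p.1 p.2 * B p.1 p.2) * (u p.1 p.2).2 = ∫ x in rmin..(rmin + δ), e x := by
    have : Integrable F.energyFlux
        ((volume.restrict (Icc s₁ s₂)).prod (volume.restrict (Icc rmin (rmin + δ)))) := by
      rw [Measure.prod_restrict] at iE ⊢
      exact iE.mono_measure (Measure.restrict_mono (prod_mono Subset.rfl hsub) le_rfl)
    rw [intervalIntegral.integral_of_le hle, ← integral_Icc_eq_integral_Ioc,
      ← integral_prod_symm _ this, Measure.prod_restrict, ← Measure.volume_eq_prod]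
    rfl
  have iq : IntervalIntegrable (fun x => (x ^ 2 - rmin ^ 2) * e x) volume rmin (rmin + δ) :=
    iδ.continuousOn_mul (by fun_prop)
  have im : IntervalIntegrable (fun x => F.mass s₂ x - F.mass s₁ x) volume rmin (rmin + δ) :=
    ((hmc s₂).sub (hmc s₁)).intervalIntegrable _ _
  have hint : ∫ x in rmin..(rmin + δ), ∫ t in Icc s₁ s₂, F.massDefect (t, x)
      = (∫ x in rmin..(rmin + δ), (F.mass s₂ x - F.mass s₁ x))
        + (kappa / 2 * (∫ x in rmin..(rmin + δ), (x ^ 2 - rmin ^ 2) * e x)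
        + kappa / 2 * rmin ^ 2 * ∫ x in rmin..(rmin + δ), e x) := by
    rw [← intervalIntegral.integral_const_mul, ← intervalIntegral.integral_const_mul,
      ← intervalIntegral.integral_add (iq.const_mul _) (iδ.const_mul _),
      ← intervalIntegral.integral_add im
        ((iq.const_mul _).add (iδ.const_mul _))]
    refine intervalIntegral.integral_congr_ae_restrict ?_
    rw [uIoc_of_le hle]
    filter_upwards [ae_restrict_of_ae_restrict_of_subset
      (Ioc_subset_Icc_self.trans hsub) (F.ae_integral_massDefect h1 h12 h2)] with x hx
    rw [hx]
    simp only [he]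
    ring
  rw [hint, ifl]
  ring

/-- The mass function evolves by the energy flux. -/
theorem ae_massDefect_eq_zero (F : LipschitzFamily σ rmin rmax t0 tend Mb Bb u₀ A₀ B₀ u A B)
    (hM : BoundaryMassConsistent rmin t0 tend Mb u A B) : ∀ᵐ p ∂F.mu, F.massDefect p = 0 := by
  have iW := F.integrable_massDefect
  -- Restricting the upper time limit to rational numbers gives one exceptional null set of radii
  -- for all of them; continuity of the primitive covers the other times.
  have hrat : ∀ᵐ x ∂(volume.restrict (Icc rmin rmax)), ∀ q : ℚ, (q : ℝ) ∈ Ioo t0 tend →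
      ∫ t in Icc t0 (q : ℝ), F.massDefect (t, x) = 0 := by
    refine ae_all_iff.2 fun q => ?_
    by_cases hq : (q : ℝ) ∈ Ioo t0 tend
    · refine (ae_eq_zero_of_integral_deriv_mul
        (F.integrable_slab iW le_rfl hq.2.le).integral_prod_right
        (fun β L hβ hβ1 hl hr => F.integral_deriv_mul_massDefect le_rfl hq.2 hβ hβ1 hl hr)
        (F.tendsto_mean_massDefect hM le_rfl hq.1.le hq.2.le)).mono fun x hx _ => hx
    · exact Eventually.of_forall fun x h => absurd h hq
  rw [F.mu_eq_prod] at iW ⊢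
  have hslices : ∀ᵐ x ∂(volume.restrict (Icc rmin rmax)),
      ∀ᵐ t ∂(volume.restrict (Icc t0 tend)), F.massDefect (t, x) = 0 := by
    filter_upwards [hrat, iW.prod_left_ae] with x hx hi
    refine ae_eq_zero_of_forall_rat F.ht.le
      ((intervalIntegrable_iff_integrableOn_Icc_of_le F.ht.le).2 hi) fun q hq => ?_
    rw [intervalIntegral.integral_of_le hq.1.le, ← integral_Icc_eq_integral_Ioc]
    exact hx q hq
  have hsw := ae_eq_of_ae_ae_eq (f := F.massDefect ∘ Prod.swap) (g := fun _ => 0)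
    iW.swap.aestronglyMeasurable.aemeasurable aemeasurable_const hslices
  exact (Measure.measurePreserving_swap.quasiMeasurePreserving.ae hsw).mono fun p hp => hp

theorem ae_deriv_A_fst (F : LipschitzFamily σ rmin rmax t0 tend Mb Bb u₀ A₀ B₀ u A B)
    (hM : BoundaryMassConsistent rmin t0 tend Mb u A B) : ∀ᵐ p ∂F.mu,
    deriv (fun s => A s p.2) p.1
      = kappa * p.2 * (Real.sqrt (A p.1 p.2 * B p.1 p.2) * (u p.1 p.2).2) := by
  filter_upwards [F.ae_massDefect_eq_zero hM, F.ae_mem_Ioo] with p hp hI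
  have h3 := (F.hrmin.trans hI.2.1).ne'
  rw [massDefect] at hp
  refine mul_left_cancel₀ (div_ne_zero h3 two_ne_zero) ?_
  linear_combination -hp

theorem einstein01 (F : LipschitzFamily σ rmin rmax t0 tend Mb Bb u₀ A₀ B₀ u A B)
    (hM : BoundaryMassConsistent rmin t0 tend Mb u A B) : ∀ᵐ p ∂F.mu,
    deriv (fun s => A s p.2) p.1 / (p.2 * A p.1 p.2)
      = kappa * (B p.1 p.2 / A p.1 p.2) *
        (Real.sqrt (A p.1 p.2 / B p.1 p.2) * (u p.1 p.2).2) := by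
  filter_upwards [F.ae_deriv_A_fst hM, F.ae_mem_Ioo] with p hp hI
  have h1 := F.A_pos p.1 p.2
  have h2 := F.B_pos p.1 p.2
  have h3 := (F.hrmin.trans hI.2.1).ne'
  rw [hp, F.sqrt_AB_eq]
  field_simp

end LipschitzFamily

/-! ### The second-order Einstein equation -/

/-- The algebra behind the second-order Einstein equation: modulo the first-order equations, its
weak integrand differs from that of the momentum balance by a spatial divergence.  Here `s` stands
for `√(A/B)`. -/
theorem einstein22_algebra {κ r s A B w₀ w₁ τ θ At Ar Bt Br φ φt φr : ℝ} (hr : r ≠ 0)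
    (hs : s ≠ 0) (hB : B ≠ 0) (hA : A = s ^ 2 * B) (hAt : At = κ * r * (B * s * w₁))
    (hAr : Ar = (1 - A) / r - κ * r * w₀) (hBr : Br = B / A * ((1 - A) / r + κ * r * τ)) :
    -(At * (φt / (r * B) - φ * Bt / (r * B ^ 2)))
      - Br * ((2 * A * Ar / (r * B) - A ^ 2 * (B + r * Br) / (r * B) ^ 2) * φ
          + A ^ 2 / (r * B) * φr)
      - A ^ 2 / (r * B) * einsteinPhi r A B At Ar Bt Br * φ - 2 * κ * r * A * θ * φ
    = -((κ * ((At * B - A * Bt) / B ^ 2 / (2 * s)) * φ + κ * s * φt) * w₁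
        + (κ * ((Ar * B - A * Br) / B ^ 2 / (2 * s)) * φ + κ * s * φr) * (B * s * τ)
        + κ * s * φ * (-(1 / 2) * (B * s) *
          (4 / r * τ + (1 / A - 1) / r * (w₀ - τ) + 2 * κ * r / A * (w₀ * τ - w₁ ^ 2)
            - 4 * r * θ)))
      - ((Ar * (1 - 2 * A) / r ^ 2 - 2 * A * (1 - A) / r ^ 3) * φ + A * (1 - A) / r ^ 2 * φr) := by
  subst hAt hAr hBr
  subst hA
  unfold einsteinPhi
  field_simp
  ring

/-- Convexity of `S` turns continuous differentiability into a Lipschitz bound. It serves to make `κ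
√(A/B)` and `A (1 - A) / r²` Lipschitz. -/
theorem exists_lipschitzWith_comp {α E : Type*} [PseudoMetricSpace α] [NormedAddCommGroup E]
    [NormedSpace ℝ E] {ψ : E → ℝ} {S : Set E} (hψ : ContDiffOn ℝ 1 ψ S) (hS : Convex ℝ S)
    (hS' : IsCompact S) {g : α → E} {L : NNReal} (hg : LipschitzWith L g) (hgS : ∀ p, g p ∈ S) :
    (∃ L', LipschitzWith L' fun p => ψ (g p)) ∧ ∃ M, ∀ p, |ψ (g p)| ≤ M := by
  obtain ⟨L', hL'⟩ := hψ.exists_lipschitzOnWith one_ne_zero hS hS'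
  obtain ⟨M, hM⟩ := hS'.exists_bound_of_continuousOn hψ.continuousOn
  refine ⟨⟨L' * L, ?_⟩, M, fun p => hM _ (hgS p)⟩
  have := hL'.comp hg.lipschitzOnWith (s := univ) fun p _ => hgS p
  exact lipschitzOnWith_univ.1 this

namespace LipschitzFamily

variable {σ rmin rmax t0 tend : ℝ} {Mb Bb : ℝ → ℝ} {u₀ : ℝ → ℝ × ℝ} {A₀ B₀ : ℝ → ℝ}
  {u : ℝ → ℝ → ℝ × ℝ} {A B : ℝ → ℝ → ℝ}

/-- The integral of a spatial divergence. -/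
theorem integral_deriv_snd_eq_zero
    (F : LipschitzFamily σ rmin rmax t0 tend Mb Bb u₀ A₀ B₀ u A B) {Ψ : ℝ × ℝ → ℝ} {L : NNReal}
    (hΨ : LipschitzWith L Ψ) (hl : ∀ t, Ψ (t, rmin) = 0) (hr : ∀ t, Ψ (t, rmax) = 0) :
    Integrable (fun p : ℝ × ℝ => deriv (fun y => Ψ (p.1, y)) p.2) F.mu ∧
      ∫ p, deriv (fun y => Ψ (p.1, y)) p.2 ∂F.mu = 0 := by
  have hc := isCompact_region rmin rmax t0 tend
  have : IsFiniteMeasure F.mu := ⟨by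
    rw [ConvergentFamily.mu, Measure.restrict_apply_univ]; exact hc.measure_lt_top⟩
  have hi : Integrable (fun p : ℝ × ℝ => deriv (fun y => Ψ (p.1, y)) p.2) F.mu :=
    Integrable.of_bound (measurable_deriv_snd hΨ.continuous).aestronglyMeasurable L
      (Eventually.of_forall fun p => abs_deriv_snd_le hΨ p)
  refine ⟨hi, ?_⟩
  rw [F.mu_eq_prod] at hi ⊢
  rw [integral_prod _ hi]
  refine integral_eq_zero_of_ae (Eventually.of_forall fun t => ?_)
  have hac : AbsolutelyContinuousOnInterval (fun y => Ψ (t, y)) rmin rmax :=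
    (lipschitzWith_slice_snd hΨ t).lipschitzOnWith.absolutelyContinuousOnInterval
  have h := hac.integral_deriv_eq_sub
  rw [hl, hr, sub_zero, intervalIntegral.integral_of_le F.hr.le,
    ← integral_Icc_eq_integral_Ioc] at h
  exact h

/-- The momentum balance is tested against `κ √(A/B) φ`, which is Lipschitz but not smooth. Once the
first-order equations are inserted, the integrand is minus that of this balance minus the radial
derivative of `A (1 - A) φ / r²`; both have integral zero. The equation for `∂A/∂t`, and with it the
consistency of the boundary mass, is essential here. -/
theorem einstein22 (F : LipschitzFamily σ rmin rmax t0 tend Mb Bb u₀ A₀ B₀ u A B)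
    (hM : BoundaryMassConsistent rmin t0 tend Mb u A B) {φ : ℝ × ℝ → ℝ} (hφ : ContDiff ℝ ∞ φ)
    (hφc : HasCompactSupport φ) (hφs : tsupport φ ⊆ Ioo t0 tend ×ˢ Ioo rmin rmax) :
    ∫ p, (-(deriv (fun s => A s p.2) p.1
            * deriv (fun s => φ (s, p.2) / (p.2 * B s p.2)) p.1)
        - deriv (fun r => B p.1 r) p.2
            * deriv (fun r => A p.1 r ^ 2 / (r * B p.1 r) * φ (p.1, r)) p.2
        - A p.1 p.2 ^ 2 / (p.2 * B p.1 p.2)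
            * einsteinPhi p.2 (A p.1 p.2) (B p.1 p.2)
                (deriv (fun s => A s p.2) p.1) (deriv (fun r => A p.1 r) p.2)
                (deriv (fun s => B s p.2) p.1) (deriv (fun r => B p.1 r) p.2) * φ p
        - 2 * kappa * p.2 * A p.1 p.2 * stress22 σ (u p.1 p.2) p.2 * φ p) ∂F.mu = 0 := by
  obtain ⟨LA, hLA⟩ := F.lipA
  obtain ⟨LB, hLB⟩ := F.lipB
  have hC := inv_pos.2 F.hC
  have hφ1 : ContDiff ℝ 1 φ := hφ.of_le (by exact_mod_cast le_top)
  have hφL : ∃ L, LipschitzWith L φ :=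
    ContDiff.lipschitzWith_of_hasCompactSupport hφc hφ (by simp)
  obtain ⟨Mφ, hMφ⟩ := hφc.exists_bound_of_continuous hφ.continuous
  have hφ0 : ∀ p : ℝ × ℝ, p ∉ Ioo t0 tend ×ˢ Ioo rmin rmax → φ p = 0 := fun p hp =>
    image_eq_zero_of_notMem_tsupport fun h => hp (hφs h)
  have hφl : ∀ t, φ (t, rmin) = 0 := fun t => hφ0 _ fun h => lt_irrefl _ h.2.1
  have hφr : ∀ t, φ (t, rmax) = 0 := fun t => hφ0 _ fun h => lt_irrefl _ h.2.2
  obtain ⟨T, hT, hlate⟩ := exists_late hφc fun p hp => (hφs hp).1.2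
  -- the test function for the momentum balance
  obtain ⟨hψL, Mψ, hMψ⟩ := exists_lipschitzWith_comp
    (ψ := fun q : ℝ × ℝ => kappa * Real.sqrt (q.1 / q.2)) (S := Icc F.C⁻¹ F.C ×ˢ Icc F.C⁻¹ F.C)
    (fun q hq => by
      have h1 : 0 < q.1 := hC.trans_le hq.1.1
      have h2 : 0 < q.2 := hC.trans_le hq.2.1
      exact (contDiffAt_const.mul ((contDiffAt_fst.div contDiffAt_snd h2.ne').sqrt
        (div_pos h1 h2).ne')).contDiffWithinAt)
    ((convex_Icc _ _).prod (convex_Icc _ _)) (isCompact_Icc.prod isCompact_Icc)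
    (hLA.prodMk hLB) fun p => ⟨F.memA p.1 p.2, F.memB p.1 p.2⟩
  have htest : IsInteriorTest rmin rmax tend fun p =>
      kappa * Real.sqrt (A p.1 p.2 / B p.1 p.2) * φ p :=
    ⟨exists_lipschitzWith_mul hψL hφL hMψ hMφ, fun t => by simp [hφl], fun t => by simp [hφr],
      T, hT, fun t ht x => by simp [hlate t ht x]⟩
  obtain ⟨hint, hzero⟩ := F.weak_form htest fun x => by
    simp [hφ0 (t0, x) fun h => lt_irrefl _ h.1.1]
  have hsnd := congrArg Prod.snd hzero
  rw [snd_integral hint] at hsnd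
  -- the divergence
  have hcL : LipschitzWith 1 fun y : ℝ => max rmin (min rmax y) :=
    (LipschitzWith.id.const_min rmax).const_max rmin
  obtain ⟨hζL, Mζ, hMζ⟩ := exists_lipschitzWith_comp
    (ψ := fun q : ℝ × ℝ => q.1 * (1 - q.1) / q.2 ^ 2) (S := Icc F.C⁻¹ F.C ×ˢ Icc rmin rmax)
    (fun q hq => by
      have h2 : 0 < q.2 := F.hrmin.trans_le hq.2.1
      have d1 : ContDiffAt ℝ 1 (fun q : ℝ × ℝ => q.1 * (1 - q.1)) q := by fun_prop
      have d2 : ContDiffAt ℝ 1 (fun q : ℝ × ℝ => q.2 ^ 2) q := by fun_prop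
      exact (d1.div d2 (pow_ne_zero 2 h2.ne')).contDiffWithinAt)
    ((convex_Icc _ _).prod (convex_Icc _ _)) (isCompact_Icc.prod isCompact_Icc)
    (hLA.prodMk (hcL.comp LipschitzWith.prod_snd)) fun p =>
      ⟨F.memA p.1 p.2, le_max_left _ _, max_le F.hr.le (min_le_left _ _)⟩
  obtain ⟨LΨ, hΨ⟩ := exists_lipschitzWith_mul hζL hφL hMζ hMφ
  obtain ⟨hdint, hdzero⟩ := F.integral_deriv_snd_eq_zero hΨ (fun t => by simp [hφl])
    fun t => by simp [hφr]
  have hw := hint.snd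
  have hsum := integral_sub hw.neg hdint
  simp only [Pi.neg_apply] at hsum
  rw [integral_neg, hsnd, hdzero, Prod.snd_zero, neg_zero, sub_zero] at hsum
  refine Eq.trans (integral_congr_ae ?_) hsum
  filter_upwards [F.ae_mem_Ioo, F.ae_deriv_A_fst hM, F.ae_metric_deriv.1, F.ae_metric_deriv.2,
    ae_restrict_of_ae (ae_differentiableAt_slices hLA),
    ae_restrict_of_ae (ae_differentiableAt_slices hLB)] with p hp hAt hAr hBr hdA hdB
  have hA := F.A_pos p.1 p.2
  have hB := F.B_pos p.1 p.2
  have hr := F.hrmin.trans hp.2.1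
  have hq : 0 < A p.1 p.2 / B p.1 p.2 := div_pos hA hB
  have hs := Real.sqrt_pos.2 hq
  have hss : A p.1 p.2 = Real.sqrt (A p.1 p.2 / B p.1 p.2) ^ 2 * B p.1 p.2 := by
    rw [Real.sq_sqrt hq.le, div_mul_cancel₀ _ hB.ne']
  have hsAB := F.sqrt_AB_eq p.1 p.2
  have dφt : DifferentiableAt ℝ (fun s => φ (s, p.2)) p.1 :=
    DifferentiableAt.comp p.1 ((hφ1.differentiable one_ne_zero) p)
      (differentiableAt_id.prodMk (differentiableAt_const _))
  have dφr : DifferentiableAt ℝ (fun y => φ (p.1, y)) p.2 :=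
    (hasDerivAt_snd hφ1 p).differentiableAt
  have e1 : deriv (fun s => φ (s, p.2) / (p.2 * B s p.2)) p.1
      = deriv (fun s => φ (s, p.2)) p.1 / (p.2 * B p.1 p.2)
        - φ p * deriv (fun s => B s p.2) p.1 / (p.2 * B p.1 p.2 ^ 2) := by
    refine (dφt.hasDerivAt.div (hdB.1.hasDerivAt.const_mul p.2) (by positivity)).deriv.trans ?_
    simp only [Prod.mk.eta]
    field_simp
  have e2 : deriv (fun r => A p.1 r ^ 2 / (r * B p.1 r) * φ (p.1, r)) p.2
      = (2 * A p.1 p.2 * deriv (fun r => A p.1 r) p.2 / (p.2 * B p.1 p.2)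
          - A p.1 p.2 ^ 2 * (B p.1 p.2 + p.2 * deriv (fun r => B p.1 r) p.2)
            / (p.2 * B p.1 p.2) ^ 2) * φ p
        + A p.1 p.2 ^ 2 / (p.2 * B p.1 p.2) * deriv (fun r => φ (p.1, r)) p.2 := by
    refine ((((hdA.2.hasDerivAt.pow 2).div ((hasDerivAt_id p.2).mul hdB.2.hasDerivAt)
      (by simp only [id, Pi.mul_apply]; positivity)).mul dφr.hasDerivAt)).deriv.trans ?_
    simp only [Pi.mul_apply, Pi.div_apply, Pi.pow_apply, Nat.cast_ofNat, Prod.mk.eta, id,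
      Nat.add_one_sub_one, pow_one, one_mul]
    field_simp
  have e3 : deriv (fun s => kappa * Real.sqrt (A s p.2 / B s p.2) * φ (s, p.2)) p.1
      = kappa * ((deriv (fun s => A s p.2) p.1 * B p.1 p.2
          - A p.1 p.2 * deriv (fun s => B s p.2) p.1) / B p.1 p.2 ^ 2
          / (2 * Real.sqrt (A p.1 p.2 / B p.1 p.2))) * φ p
        + kappa * Real.sqrt (A p.1 p.2 / B p.1 p.2) * deriv (fun s => φ (s, p.2)) p.1 :=
    ((((hdA.1.hasDerivAt.fun_div hdB.1.hasDerivAt hB.ne').sqrt hq.ne').const_mul kappa).mul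
      dφt.hasDerivAt).deriv
  have e4 : deriv (fun y => kappa * Real.sqrt (A p.1 y / B p.1 y) * φ (p.1, y)) p.2
      = kappa * ((deriv (fun r => A p.1 r) p.2 * B p.1 p.2
          - A p.1 p.2 * deriv (fun r => B p.1 r) p.2) / B p.1 p.2 ^ 2
          / (2 * Real.sqrt (A p.1 p.2 / B p.1 p.2))) * φ p
        + kappa * Real.sqrt (A p.1 p.2 / B p.1 p.2) * deriv (fun r => φ (p.1, r)) p.2 :=
    ((((hdA.2.hasDerivAt.fun_div hdB.2.hasDerivAt hB.ne').sqrt hq.ne').const_mul kappa).mul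
      dφr.hasDerivAt).deriv
  have e5 : deriv (fun y => A p.1 y * (1 - A p.1 y) / max rmin (min rmax y) ^ 2 * φ (p.1, y)) p.2
      = (deriv (fun r => A p.1 r) p.2 * (1 - 2 * A p.1 p.2) / p.2 ^ 2
          - 2 * A p.1 p.2 * (1 - A p.1 p.2) / p.2 ^ 3) * φ p
        + A p.1 p.2 * (1 - A p.1 p.2) / p.2 ^ 2 * deriv (fun r => φ (p.1, r)) p.2 := by
    have h1 : (fun y => A p.1 y * (1 - A p.1 y) / max rmin (min rmax y) ^ 2 * φ (p.1, y))
        =ᶠ[𝓝 p.2] fun y => A p.1 y * (1 - A p.1 y) / y ^ 2 * φ (p.1, y) := by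
      filter_upwards [Ioo_mem_nhds hp.2.1 hp.2.2] with y hy
      rw [min_eq_right hy.2.le, max_eq_right hy.1.le]
    rw [h1.deriv_eq]
    refine (((hdA.2.hasDerivAt.mul (hdA.2.hasDerivAt.const_sub 1)).div (hasDerivAt_pow 2 p.2)
      (by positivity)).mul dφr.hasDerivAt).deriv.trans ?_
    simp only [Pi.mul_apply, Pi.div_apply, Nat.cast_ofNat, Prod.mk.eta, Nat.add_one_sub_one,
      pow_one]
    field_simp
    ring
  have halg := einstein22_algebra (κ := kappa) (w₀ := (u p.1 p.2).1) (w₁ := (u p.1 p.2).2)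
    (τ := stress σ (u p.1 p.2)) (θ := stress22 σ (u p.1 p.2) p.2)
    (Bt := deriv (fun s => B s p.2) p.1) (φ := φ p) (φt := deriv (fun s => φ (s, p.2)) p.1)
    (φr := deriv (fun r => φ (p.1, r)) p.2) hr.ne' hs.ne' hB.ne' hss (hsAB ▸ hAt) hAr hBr
  rw [e1, e2, halg]
  simp only [Function.comp_apply, Prod.snd_add, Prod.smul_snd, smul_eq_mul, source, flux,
    minkFlux]
  rw [e3, e4, e5, hsAB]

theorem isWeakEinsteinSolution (F : LipschitzFamily σ rmin rmax t0 tend Mb Bb u₀ A₀ B₀ u A B)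
    (hM : BoundaryMassConsistent rmin t0 tend Mb u A B) :
    IsWeakEinsteinSolution σ rmin rmax t0 tend u A B where
  toIsBoundedFluidLipschitzMetric := F.isBoundedFluidLipschitzMetric
  einstein00 := F.einstein00
  einstein01 := F.einstein01 hM
  einstein11 := F.einstein11
  einstein22 := fun _ h1 h2 h3 => F.einstein22 hM h1 h2 h3

end LipschitzFamily

/-! ### Choice of a subsequence and conclusion -/

theorem tendsto_meshWidth (rmin rmax : ℝ) {N : ℕ → ℕ} (hN : Tendsto N atTop atTop) :
    Tendsto (fun k => meshWidth rmin rmax (N k)) atTop (𝓝 0) := by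
  have h : Tendsto (fun k => (N k : ℝ) - 1) atTop atTop := by
    simpa [sub_eq_add_neg] using
      tendsto_atTop_add_const_right atTop (-1 : ℝ) (tendsto_natCast_atTop_atTop.comp hN)
  exact h.const_div_atTop _

/-- The same family with the metric replaced by an almost everywhere equal Lipschitz metric. -/
theorem ConvergentFamily.exists_lipschitzFamily {σ rmin rmax t0 tend : ℝ} {Mb Bb : ℝ → ℝ}
    {u₀ : ℝ → ℝ × ℝ} {A₀ B₀ : ℝ → ℝ} {u : ℝ → ℝ → ℝ × ℝ} {A B : ℝ → ℝ → ℝ}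
    (F : ConvergentFamily σ rmin rmax t0 tend Mb Bb u₀ A₀ B₀ u A B) :
    ∃ A' B' : ℝ → ℝ → ℝ, (∀ᵐ p ∂(volume.restrict (region rmin rmax t0 tend)),
        A' p.1 p.2 = A p.1 p.2 ∧ B' p.1 p.2 = B p.1 p.2) ∧
      Nonempty (LipschitzFamily σ rmin rmax t0 tend Mb Bb u₀ A₀ B₀ u A' B') := by
  obtain ⟨A', B', hA, hB, hA', hB', h⟩ := F.exists_lipschitz_metric
  refine ⟨A', B', h, ⟨{ F with
    conv := ?_
    lipA := hA
    lipB := hB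
    memA := hA'
    memB := hB' }⟩⟩
  filter_upwards [F.conv, h] with p hp hp'
  rwa [hp'.1, hp'.2]

end LocallyInertial

theorem mainTheorem1
    (σ : ℝ) (hσ : 0 < σ) (hσ1 : σ < 1)
    (rmin rmax : ℝ) (hrmin : 0 < rmin) (hr : rmin < rmax)
    (t0 tend : ℝ) (ht : t0 < tend)
    (Mb Bb : ℝ → ℝ)
    (hMb : ∃ L, LipschitzOnWith L Mb (Set.Icc t0 tend))
    (hBb : ∃ L, LipschitzOnWith L Bb (Set.Icc t0 tend))
    (u₀ : ℝ → ℝ × ℝ) (A₀ B₀ : ℝ → ℝ)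
    (hA₀ : ∃ L, LipschitzOnWith L A₀ (Set.Icc rmin rmax))
    (hB₀ : ∃ L, LipschitzOnWith L B₀ (Set.Icc rmin rmax))
    (N : ℕ → ℕ) (hN : Filter.Tendsto N Filter.atTop Filter.atTop)
    (S : ∀ k : ℕ,
      LocallyInertial.GodunovApproximation σ rmin rmax t0 tend Mb Bb u₀ A₀ B₀ (N k))
    (K : Set (ℝ × ℝ)) (hK : IsCompact K) (hKphys : K ⊆ LocallyInertial.physical σ)
    (hKu : ∀ k j, (S k).t j < tend → ∀ i ≤ N k + 1, (S k).u i j ∈ K)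
    (C : ℝ) (hC : 0 < C)
    (hCA : ∀ k j, (S k).t j < tend → ∀ i ∈ Finset.Icc 1 (N k + 1),
      (S k).A i j ∈ Set.Icc C⁻¹ C ∧ (S k).B i j ∈ Set.Icc C⁻¹ C)
    (V : NNReal)
    (hV : ∀ k j, (S k).t j < tend →
      eVariationOn (fun x => (S k).uApp ((S k).t j) x) (Set.Icc rmin rmax) < V)
    (u : ℝ → ℝ → ℝ × ℝ) (A B : ℝ → ℝ → ℝ)
    (hconv : ∀ᵐ p ∂(MeasureTheory.volume.restrict
        (LocallyInertial.region rmin rmax t0 tend)),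
      Filter.Tendsto (fun k => (S k).uApp p.1 p.2) Filter.atTop (nhds (u p.1 p.2)) ∧
      Filter.Tendsto (fun k => (S k).AApp p.1 p.2) Filter.atTop (nhds (A p.1 p.2)) ∧
      Filter.Tendsto (fun k => (S k).BApp p.1 p.2) Filter.atTop (nhds (B p.1 p.2)))
    (hconv₀ : ∀ᵐ x ∂(MeasureTheory.volume.restrict (Set.Icc rmin rmax)),
      Filter.Tendsto (fun k => (S k).uApp t0 x) Filter.atTop (nhds (u₀ x))) :
    ∃ A' B' : ℝ → ℝ → ℝ,
      (∀ᵐ p ∂(MeasureTheory.volume.restrict (LocallyInertial.region rmin rmax t0 tend)),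
        A' p.1 p.2 = A p.1 p.2 ∧ B' p.1 p.2 = B p.1 p.2) ∧
      LocallyInertial.IsWeakSystemSolution σ rmin rmax t0 tend u₀ u A' B' ∧
      (LocallyInertial.BoundaryMassConsistent rmin t0 tend Mb u A' B' →
        LocallyInertial.IsWeakEinsteinSolution σ rmin rmax t0 tend u A' B') := by
  have hbdd : ∀ k, (S k).IsBoundedBy K C V :=
    fun k => ⟨hKu k, hCA k, fun j hj => (hV k j hj).le⟩
  obtain ⟨D, h₁, hD, hh₁, hstep⟩ := LocallyInertial.exists_stepEstimates (t0 := t0) (tend := tend) (Mb := Mb)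
    (Bb := Bb) (u₀ := u₀) (A₀ := A₀) (B₀ := B₀) hσ hσ1 hrmin hr hK hKphys hC V
  obtain ⟨D', h₂, hD', hh₂, hmetric⟩ := LocallyInertial.exists_metricEstimates (u₀ := u₀)
    hσ hσ1 hrmin hr hMb hBb hA₀ hB₀ hK hKphys hC V hD
  have hh : 0 < min (min h₁ h₂) rmin := lt_min (lt_min hh₁ hh₂) hrmin
  -- A subsequence with geometrically decaying widths makes the widths summable and puts every mesh
  -- below all thresholds. Nothing is lost, since the limits along a subsequence are the same.
  obtain ⟨ψ, hψ, hsmall⟩ := Filter.extraction_forall_of_eventually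
    (P := fun m k => LocallyInertial.meshWidth rmin rmax (N k) < min (min h₁ h₂) rmin * (1 / 2) ^ m) fun m =>
      (LocallyInertial.tendsto_meshWidth rmin rmax hN).eventually_lt_const (by positivity)
  have hle : ∀ m, LocallyInertial.meshWidth rmin rmax (N (ψ m)) ≤ min (min h₁ h₂) rmin := fun m =>
    (hsmall m).le.trans (mul_le_of_le_one_right hh.le (pow_le_one₀ (by norm_num) (by norm_num)))
  have hst : ∀ m, (S (ψ m)).StepEstimates D := fun m =>
    hstep _ _ (hbdd _) ((hle m).trans ((min_le_left _ _).trans (min_le_left _ _)))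
  have F : LocallyInertial.ConvergentFamily σ rmin rmax t0 tend Mb Bb u₀ A₀ B₀ u A B :=
    { hσ := hσ, hσ1 := hσ1, hrmin := hrmin, hr := hr, ht := ht, lipMb := hMb, lipBb := hBb
      N := fun m => N (ψ m), S := fun m => S (ψ m), K := K, hK := hK, hKp := hKphys, C := C
      hC := hC, V := V, D := D, hD := hD, D' := D', hD' := hD', bounded := fun m => hbdd _
      step := hst
      metric := fun m => hmetric _ _ (hbdd _) (hst m)
        ((hle m).trans ((min_le_left _ _).trans (min_le_right _ _)))
      width_le := fun m => (hle m).trans (min_le_right _ _)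
      summable_width := Summable.of_nonneg_of_le
        (fun m => (LocallyInertial.meshWidth_pos hr (S (ψ m)).two_le).le) (fun m => (hsmall m).le)
        (summable_geometric_two.mul_left _)
      conv := hconv.mono fun p hp => ⟨hp.1.comp hψ.tendsto_atTop, hp.2.1.comp hψ.tendsto_atTop,
        hp.2.2.comp hψ.tendsto_atTop⟩
      conv₀ := hconv₀.mono fun x hx => hx.comp hψ.tendsto_atTop }
  obtain ⟨A', B', hae, ⟨G⟩⟩ := F.exists_lipschitzFamily
  exact ⟨A', B', hae, G.isWeakSystemSolution, G.isWeakEinsteinSolution⟩
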